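/- Let $\mathfrak A$ be a commutative, not necessarily unital, locally convex algebra over $\mathbb R$ (jointly continuous multiplication), separated and sequentially complete; complex algebras are included by restriction of scalars. Let $\mathfrak A^+=\mathbb R\oplus\mathfrak A$ be its unital extension. For $\Omega$ obtained from $\mathbb N$ and finite sets by disjoint unions and products (with the obvious size $|\cdot|$), let $\mathcal K_\Omega(\mathfrak A)$ be the space of rapidly decreasing matrices: those $\Omega\times\Omega$ matrices $A$ over $\mathfrak A$ such that $p_k(A)=\sup_{n,m}\,(1+|n|)^k(1+|m|)^k\,p(A_{n,m})<\infty$ for all continuous seminorms $p$ and all $k\in\mathbb N$, topologized by the seminorms $p_k$. Put $R_0=\begin{bmatrix}0&\\&1\end{bmatrix}$ (indexed by $\{0,1\}\times\mathbb N$) and $$\mathcal G_{\mathbb N}(\mathfrak A)=\{b : b^2=b,\ b-R_0\in\mathcal K_{\{0,1\}\times\mathbb N}(\mathfrak A)\},$$ with the topology induced by $b\mapsto b-R_0\in\mathcal K_{\{0,1\}\times\mathbb N}(\mathfrak A)$; $b$ stands for the pair $\langle b,R_0\rangle$. For pairs of matrices over $\mathfrak A^+$ (with $\bar a=1-a$)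 let $\langle b,a\rangle\oplus\langle d,c\rangle=\langle b\oplus d,a\oplus c\rangle$, $\langle b,a\rangle^{\mathrm{inv}}=\langle\bar b,\bar a\rangle$, and let $\langle b,a\rangle\otimes\langle d,c\rangle$ be either one of $\langle b\otimes d+\bar b\otimes c,\;a\otimes d+\bar a\otimes c\rangle$ and $\langle b\otimes d+a\otimes\bar d,\;b\otimes c+a\otimes\bar c\rangle$ (one and the same choice throughout). Let $$\mathrm R\langle b,a\rangle=\begin{bmatrix}\bar a&a\\a&\bar a\end{bmatrix}\begin{bmatrix}b&\\&\bar a\end{bmatrix}\begin{bmatrix}\bar a&a\\a&\bar a\end{bmatrix}.$$ A relabeling map $r:\Omega\to\Omega'$ is an injective map which is an isomorphism onto its image with respect to the classes of functions of polynomial growth, such that the complement of the image is finite or, with the class of functions restricted to it, isomorphic to $\mathbb N$ with its functions of polynomial growth. The matrix $r_*A$ has the entry $A_{n,m}$ at $(r(n),r(m))$ and zeros elsewhere. Let $\theta_1:(\{0,1\}\times\mathbb N)\,\dot\cup\,(\{0,1\}\times\mathbb N)\to\mathbb N$, $\theta_2:\{0,1\}\times\mathbb N\to\mathbb N$, $\theta_3:(\{0,1\}\times\mathbb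 N)\times(\{0,1\}\times\mathbb N)\to\mathbb N$, $\theta_4:\{0\}\to\mathbb N$ be any relabeling maps. Put $$a\,\tilde+\,b=\mathrm R\,\theta_{1*}(a\oplus b),\quad \tilde-a=\mathrm R\,\theta_{2*}(a^{\mathrm{inv}}),\quad \tilde0=R_0,\quad a\,\tilde\otimes\, b=\mathrm R\,\theta_{3*}(a\otimes b),$$ and, if $\mathfrak A$ has a unit element $e$, $\tilde1=\mathrm R\,\theta_{4*}\langle e,0\rangle$ ($1\times1$ matrices). A map between subsets of locally convex spaces is called smooth if it is locally the restriction of $C^\infty$ maps, in the sense of Michal and Bastiani, between open subsets of the ambient spaces (here $\mathcal G_{\mathbb N}(\mathfrak A)$ is identified with a subset of $\mathcal K_{\{0,1\}\times\mathbb N}(\mathfrak A)$ through $b\mapsto b-R_0$). **Theorem.** (1) The operations above are well-defined on $\mathcal G_{\mathbb N}(\mathfrak A)$, continuous and smooth, and they make it a commutative topological $H$-ring, unital if $\mathfrak A$ is unital. That is, associativity, commutativity, the neutral element and the inverse element rules of $\tilde+$, associativity and commutativity of $\tilde\otimes$, both distributive laws and, if $\mathfrak A$ is unital, the neutral element rules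 of $\tilde 1$ hold up to homotopy. All these homotopies can be taken to be continuous smooth maps $\mathcal G_{\mathbb N}(\mathfrak A)^k\times[0,1]\to\mathcal G_{\mathbb N}(\mathfrak A)$. (2) For $\theta\in[0,\frac\pi2]$, $t=\sin\theta$, $s=\cos\theta$, let $\mathsf C(\theta)$ be the $\mathbb N\times\mathbb N$ matrix with row $0$ equal to $(s,ts,t^2s,\ldots)$, and with entries $-t$ at $(m+1,m)$, $t^{n-m-1}s^2$ at $(m+1,n)$ for $n>m$, and $0$ at $(m+1,n)$ for $n<m$. Then $(A,\theta)\mapsto\mathsf C(\theta)A\mathsf C(\theta)^\top$ is a well-defined continuous smooth homotopy $\mathcal K_{\mathbb N}(\mathfrak A)\times[0,\frac\pi2]\to\mathcal K_{\mathbb N}(\mathfrak A)$ through algebra endomorphisms, from the identity to $r_*$, $r(n)=n+1$. (3) There is a continuous smooth homotopy $\mathrm{Hv}:\mathcal K_{\mathbb N}(\mathfrak A)\times[0,1]\to\mathcal K_{\mathbb N}(\mathfrak A)$ through algebra endomorphisms, from the identity to $\mathrm{hv}_*$, $\mathrm{hv}(n)=2n$, such that applying it to the four blocks of $b-R_0$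 gives a continuous smooth homotopy $\mathcal G_{\mathbb N}(\mathfrak A)\times[0,1]\to\mathcal G_{\mathbb N}(\mathfrak A)$ from $b$ to the stabilized idempotent $b\oplus R_0$, where two copies of $\{0,1\}\times\mathbb N$ are placed in $\{0,1\}\times\mathbb N$ by $(i,n)\mapsto(i,2n)$ and $(i,n)\mapsto(i,2n+1)$. -/

import Mathlib

open Filter Topology

universe u v

/-! ### Index sets of polynomial growth -/

/-- An index set with a size function; the sizes only serve to describe which functions on the
index set are of polynomial growth and which matrices are rapidly decreasing. -/
class IndexSize (Ω : Type*) where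
  size : Ω → ℕ

instance IndexSize.nat : IndexSize ℕ := ⟨fun n => n⟩

instance IndexSize.fin (n : ℕ) : IndexSize (Fin n) := ⟨fun _ => 0⟩

instance IndexSize.sum (Ω Ξ : Type*) [IndexSize Ω] [IndexSize Ξ] : IndexSize (Ω ⊕ Ξ) :=
  ⟨Sum.elim IndexSize.size IndexSize.size⟩

instance IndexSize.prod (Ω Ξ : Type*) [IndexSize Ω] [IndexSize Ξ] : IndexSize (Ω × Ξ) :=
  ⟨fun x => IndexSize.size x.1 + IndexSize.size x.2⟩

/-- The set of real functions of at most polynomial growth on an index set. -/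
def polyGrowth (Ω : Type*) [IndexSize Ω] : Set (Ω → ℝ) :=
  {f | ∃ (C : ℝ) (k : ℕ), ∀ ω, |f ω| ≤ C * (1 + (IndexSize.size ω : ℝ)) ^ k}

/-- A set `S` of real functions makes `Ω` a set of polynomial growth: either `Ω` is finite and `S`
consists of all functions, or `S` is the pullback of the functions of polynomial growth on `ℕ`
along some bijection `Ω ≃ ℕ`. -/
def IsSPG {Ω : Type*} (S : Set (Ω → ℝ)) : Prop :=
  (Finite Ω ∧ S = Set.univ) ∨ ∃ q : Ω ≃ ℕ, S = {f | ∃ g ∈ polyGrowth ℕ, f = g ∘ q}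

/-- Relabeling maps: injections `r` which are isomorphisms of sets of polynomial growth onto their
image, such that the complement of the image is again a set of polynomial growth. -/
structure IsRelabeling {Ω Ω' : Type*} [IndexSize Ω] [IndexSize Ω'] (r : Ω → Ω') : Prop where
  injective : Function.Injective r
  pullback : {f : Ω → ℝ | ∃ g ∈ polyGrowth Ω', f = g ∘ r} = polyGrowth Ω
  compl : IsSPG {f : ((Set.range r)ᶜ : Set Ω') → ℝ | ∃ g ∈ polyGrowth Ω', f = fun x => g x.1}

/-! ### Matrices -/

section Matrices

variable {R : Type*} {Ω Ξ : Type*}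

/-- Multiplication of possibly infinite matrices. -/
noncomputable def mmul [NonUnitalNonAssocSemiring R] [TopologicalSpace R]
    (x y : Matrix Ω Ω R) : Matrix Ω Ω R :=
  Matrix.of fun i j => ∑' k, x i k * y k j

/-- The effect of a relabeling map `r` on matrices: the entry at `(n, m)` is moved to
`(r n, r m)`, and all the other entries of the result are `0`. -/
noncomputable def relabel [Zero R] (r : Ω → Ξ) (x : Matrix Ω Ω R) : Matrix Ξ Ξ R :=
  Matrix.of fun i j => Function.extend (Prod.map r r) (fun p => x p.1 p.2) 0 (i, j)

variable [CommRing R] [DecidableEq Ω] [DecidableEq Ξ]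

/-- The block matrix `diag (0, 1)`, indexed by `{0, 1} × Ω`. -/
def baseMat (R : Type*) [CommRing R] (Ω : Type*) [DecidableEq Ω] :
    Matrix (Fin 2 × Ω) (Fin 2 × Ω) R :=
  Matrix.diagonal fun i => if i.1 = 1 then 1 else 0

/-- The block matrix `[[1 - a, a], [a, 1 - a]]` (partial switch). -/
def swMat (a : Matrix Ω Ω R) : Matrix (Fin 2 × Ω) (Fin 2 × Ω) R :=
  Matrix.of fun i j => if i.1 = j.1 then (1 - a) i.2 j.2 else a i.2 j.2

/-- The block matrix `diag (x, y)`, indexed by `{0, 1} × Ω`. -/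
def diagMat (x y : Matrix Ω Ω R) : Matrix (Fin 2 × Ω) (Fin 2 × Ω) R :=
  Matrix.of fun i j => if i.1 = j.1 then (if i.1 = 0 then x i.2 j.2 else y i.2 j.2) else 0

/-- Pairs `⟨b, a⟩` of matrices: `b` is the leading term and `a` is the base term. -/
abbrev MatPair (Ω : Type*) (R : Type*) := Matrix Ω Ω R × Matrix Ω Ω R

/-- `⟨b, a⟩ ⊕ ⟨d, c⟩ = ⟨b ⊕ d, a ⊕ c⟩`. -/
def pairSum (x : MatPair Ω R) (y : MatPair Ξ R) : MatPair (Ω ⊕ Ξ) R :=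
  (Matrix.fromBlocks x.1 0 0 y.1, Matrix.fromBlocks x.2 0 0 y.2)

/-- `⟨b, a⟩ ↦ ⟨1 - b, 1 - a⟩`. -/
def pairInv (x : MatPair Ω R) : MatPair Ω R := (1 - x.1, 1 - x.2)

/-- The tensor product of matrices over a commutative ring (Kronecker product). -/
def kron (x : Matrix Ω Ω R) (y : Matrix Ξ Ξ R) : Matrix (Ω × Ξ) (Ω × Ξ) R :=
  Matrix.kroneckerMap (fun r s => r * s) x y

/-- The two natural product operations of pairs are indexed by `left` and `right`. -/
inductive ProductSide
  | left
  | right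

/-- The product operations
`⟨b ⊗ d + (1 - b) ⊗ c, a ⊗ d + (1 - a) ⊗ c⟩` (`left`) and
`⟨b ⊗ d + a ⊗ (1 - d), b ⊗ c + a ⊗ (1 - c)⟩` (`right`) of `⟨b, a⟩` and `⟨d, c⟩`. -/
def pairProd (side : ProductSide) (x : MatPair Ω R) (y : MatPair Ξ R) : MatPair (Ω × Ξ) R :=
  match side with
  | .left => (kron x.1 y.1 + kron (1 - x.1) y.2, kron x.2 y.1 + kron (1 - x.2) y.2)
  | .right => (kron x.1 y.1 + kron x.2 (1 - y.1), kron x.1 y.2 + kron x.2 (1 - y.2))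

/-- The pair `⟨e, 0⟩` of `1 × 1` matrices. -/
def pairOne (e : R) : MatPair (Fin 1) R := (Matrix.of fun _ _ => e, 0)

/-- The regularized matrix `sw(a) (b ⊕ (1 - a)) sw(a)` of `⟨b, a⟩`. -/
noncomputable def regMat [TopologicalSpace R] (x : MatPair Ω R) :
    Matrix (Fin 2 × Ω) (Fin 2 × Ω) R :=
  mmul (mmul (swMat x.2) (diagMat x.1 (1 - x.2))) (swMat x.2)

/-- Relabeling of both terms of a pair, followed by regularization. -/
noncomputable def regRelabel [TopologicalSpace R] (r : Ω → Ξ) (x : MatPair Ω R) :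
    Matrix (Fin 2 × Ξ) (Fin 2 × Ξ) R :=
  regMat (relabel r x.1, relabel r x.2)

end Matrices

/-! ### Rapidly decreasing matrices -/

section Rapid

variable (Ω : Type*) [IndexSize Ω] (𝔄 : Type*)

/-- The weight `((1 + |n|) (1 + |m|)) ^ k` of a matrix position `(n, m)`. -/
def posWeight {Ω : Type*} [IndexSize Ω] (k : ℕ) (x : Ω × Ω) : ℝ :=
  ((1 + (IndexSize.size x.1 : ℝ)) * (1 + (IndexSize.size x.2 : ℝ))) ^ k

theorem posWeight_nonneg {Ω : Type*} [IndexSize Ω] (k : ℕ) (x : Ω × Ω) : 0 ≤ posWeight k x := by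
  unfold posWeight; positivity

variable [AddCommGroup 𝔄] [Module ℝ 𝔄] [TopologicalSpace 𝔄]

/-- The space of rapidly decreasing matrices: `p (A n m) * ((1 + |n|) (1 + |m|)) ^ k` is bounded
for every continuous seminorm `p` and every `k`. -/
def rapidSubmodule : Submodule ℝ (Matrix Ω Ω 𝔄) where
  carrier := {A | ∀ p : Seminorm ℝ 𝔄, Continuous p → ∀ k : ℕ,
    BddAbove (Set.range fun x : Ω × Ω => posWeight k x * p (A x.1 x.2))}
  zero_mem' := by
    intro p _ k
    refine ⟨0, ?_⟩
    rintro _ ⟨x, rfl⟩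
    simp
  add_mem' := by
    intro A B hA hB p hp k
    obtain ⟨a, ha⟩ := hA p hp k
    obtain ⟨b, hb⟩ := hB p hp k
    refine ⟨a + b, ?_⟩
    rintro _ ⟨x, rfl⟩
    have h1 := ha ⟨x, rfl⟩
    have h2 := hb ⟨x, rfl⟩
    have h3 := mul_le_mul_of_nonneg_left (map_add_le_add p (A x.1 x.2) (B x.1 x.2))
      (posWeight_nonneg k x)
    simp only [Matrix.add_apply] at *
    linarith
  smul_mem' := by
    intro c A hA p hp k
    obtain ⟨a, ha⟩ := hA p hp k
    refine ⟨‖c‖ * a, ?_⟩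
    rintro _ ⟨x, rfl⟩
    have h1 := mul_le_mul_of_nonneg_left (ha ⟨x, rfl⟩) (norm_nonneg c)
    simp only [Matrix.smul_apply, map_smul_eq_mul] at *
    linarith

/-- The space of rapidly decreasing `Ω × Ω` matrices over `𝔄`.  (This is a type of its own because
its topology is not the topology of entrywise convergence.) -/
def RapidMat : Type _ := ↥(rapidSubmodule Ω 𝔄)

instance RapidMat.addCommGroup : AddCommGroup (RapidMat Ω 𝔄) :=
  inferInstanceAs (AddCommGroup ↥(rapidSubmodule Ω 𝔄))

instance RapidMat.module : Module ℝ (RapidMat Ω 𝔄) :=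
  inferInstanceAs (Module ℝ ↥(rapidSubmodule Ω 𝔄))

variable {Ω 𝔄}

/-- The underlying matrix. -/
def RapidMat.toMatrix (A : RapidMat Ω 𝔄) : Matrix Ω Ω 𝔄 := A.1

variable (Ω 𝔄)

/-- The seminorms `A ↦ sup ((1 + |n|) (1 + |m|)) ^ k * p (A n m)` on rapidly decreasing
matrices. -/
noncomputable def rapidSeminorm :
    SeminormFamily ℝ (RapidMat Ω 𝔄) ({p : Seminorm ℝ 𝔄 // Continuous p} × ℕ) := fun q =>
  Seminorm.of (fun A => ⨆ x : Ω × Ω, posWeight q.2 x * q.1.1 (A.toMatrix x.1 x.2))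
    (by
      intro A B
      refine Real.iSup_le (fun x => ?_) (add_nonneg
        (Real.iSup_nonneg fun x => mul_nonneg (posWeight_nonneg _ x) (apply_nonneg _ _))
        (Real.iSup_nonneg fun x => mul_nonneg (posWeight_nonneg _ x) (apply_nonneg _ _)))
      have h1 := le_ciSup (A.2 q.1.1 q.1.2 q.2) x
      have h2 := le_ciSup (B.2 q.1.1 q.1.2 q.2) x
      have h3 := mul_le_mul_of_nonneg_left
        (map_add_le_add q.1.1 (A.toMatrix x.1 x.2) (B.toMatrix x.1 x.2)) (posWeight_nonneg q.2 x)
      rw [mul_add] at h3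
      exact h3.trans (add_le_add h1 h2))
    (by
      intro c A
      rw [Real.mul_iSup_of_nonneg (norm_nonneg c)]
      refine iSup_congr fun x => ?_
      have : (c • A).toMatrix x.1 x.2 = c • A.toMatrix x.1 x.2 := rfl
      rw [this, map_smul_eq_mul]
      ring)

instance rapidIndex_nonempty : Nonempty ({p : Seminorm ℝ 𝔄 // Continuous p} × ℕ) :=
  ⟨(⟨0, continuous_const⟩, 0)⟩

/-- The topology induced by the seminorms `rapidSeminorm`. -/
noncomputable instance RapidMat.topology : TopologicalSpace (RapidMat Ω 𝔄) :=
  (rapidSeminorm Ω 𝔄).moduleFilterBasis.topology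

end Rapid

/-! ### The Grassmannian -/

section Grassmannian

/-- The unital extension `ℝ ⊕ 𝔄` carries the product topology. -/
instance unitizationTopology (𝔄 : Type*) [TopologicalSpace 𝔄] :
    TopologicalSpace (Unitization ℝ 𝔄) :=
  TopologicalSpace.induced (fun x => (x.fst, x.snd)) inferInstance

variable (𝔄 : Type*) [NonUnitalCommRing 𝔄] [Module ℝ 𝔄] [IsScalarTower ℝ 𝔄 𝔄]
  [SMulCommClass ℝ 𝔄 𝔄] [TopologicalSpace 𝔄]

variable {𝔄} in
/-- The matrix `diag (0, 1) + A` over the unital extension. -/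
def perturb (A : RapidMat (Fin 2 × ℕ) 𝔄) :
    Matrix (Fin 2 × ℕ) (Fin 2 × ℕ) (Unitization ℝ 𝔄) :=
  baseMat (Unitization ℝ 𝔄) ℕ + A.toMatrix.map Unitization.inr

/-- The Grassmannian: the space of idempotent matrices `b` over the unital extension, indexed by
`{0, 1} × ℕ`, which differ from `diag (0, 1)` by a rapidly decreasing matrix over `𝔄`.  Such a `b`
is recorded through the difference `A = b - diag (0, 1)`, and the topology is the one of the space
of rapidly decreasing matrices. -/
abbrev Gr : Type _ := {A : RapidMat (Fin 2 × ℕ) 𝔄 // mmul (perturb A) (perturb A) = perturb A}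

variable {𝔄}

/-- The idempotent matrix `b`. -/
def Gr.mat (b : Gr 𝔄) : Matrix (Fin 2 × ℕ) (Fin 2 × ℕ) (Unitization ℝ 𝔄) := perturb b.1

/-- The pair `⟨b, diag (0, 1)⟩`. -/
def Gr.pair (b : Gr 𝔄) : MatPair (Fin 2 × ℕ) (Unitization ℝ 𝔄) :=
  (b.mat, baseMat (Unitization ℝ 𝔄) ℕ)

/-- The decomposition of `{0, 1} × ℕ` into two copies of itself which separates even and odd
numbers. -/
def evenOdd : (Fin 2 × ℕ) ⊕ (Fin 2 × ℕ) → Fin 2 × ℕ :=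
  Sum.elim (fun x => (x.1, 2 * x.2)) (fun x => (x.1, 2 * x.2 + 1))

/-- The stabilized matrix `b ⊕ diag (0, 1)`, indexed by `{0, 1} × ℕ` through `evenOdd`. -/
noncomputable def Gr.stabMat (b : Gr 𝔄) : Matrix (Fin 2 × ℕ) (Fin 2 × ℕ) (Unitization ℝ 𝔄) :=
  relabel evenOdd (Matrix.fromBlocks b.mat 0 0 (baseMat (Unitization ℝ 𝔄) ℕ))

end Grassmannian

/-! ### Smooth maps -/

/-- `Cⁿ` maps on an open subset of a topological vector space in the sense of Michal and Bastiani: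
`f` is `C⁰` if it is continuous; `f` is `Cⁿ⁺¹` if it is continuous, all its directional derivatives
exist, and the directional derivative `(x, v) ↦ df (x, v)` is `Cⁿ`. -/
def BastianiCk {F : Type v} [AddCommGroup F] [Module ℝ F] [TopologicalSpace F] :
    (n : ℕ) → {E : Type u} → [AddCommGroup E] → [Module ℝ E] → [TopologicalSpace E] →
      Set E → (E → F) → Prop
  | 0, _, _, _, _, U, f => ContinuousOn f U
  | n + 1, E, _, _, _, U, f => ContinuousOn f U ∧ ∃ df : E × E → F,
      (∀ x ∈ U, ∀ y : E,
        Tendsto (fun t : ℝ => t⁻¹ • (f (x + t • y) - f x)) (𝓝[≠] 0) (𝓝 (df (x, y)))) ∧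
      BastianiCk n (U ×ˢ (Set.univ : Set E)) df

/-- Let `X` and `Y` be spaces which are identified with subsets of the topological vector spaces `E`
and `F` through `i` and `j`.  A map `f : X → Y` is smooth if it is locally the restriction of `C^∞`
maps from open subsets of `E` to `F`. -/
def SmoothVia {X Y : Type*} {E : Type u} {F : Type v} [AddCommGroup E] [Module ℝ E]
    [TopologicalSpace E] [AddCommGroup F] [Module ℝ F] [TopologicalSpace F]
    (i : X → E) (j : Y → F) (f : X → Y) : Prop :=
  ∀ x, ∃ U : Set E, IsOpen U ∧ i x ∈ U ∧ ∃ Φ : E → F, (∀ n, BastianiCk n U Φ) ∧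
    ∀ y, i y ∈ U → Φ (i y) = j (f y)

/-! ### Smooth homotopies and smooth topological H-rings -/

section HRing

variable {𝔄 : Type*} [NonUnitalCommRing 𝔄] [Module ℝ 𝔄] [IsScalarTower ℝ 𝔄 𝔄]
  [SMulCommClass ℝ 𝔄 𝔄] [TopologicalSpace 𝔄]

/-- Smooth (and continuous) operations with `k` variables on the Grassmannian. -/
def IsSmoothOp {k : ℕ} (f : (Fin k → Gr 𝔄) → Gr 𝔄) : Prop :=
  Continuous f ∧
    SmoothVia (fun x m => (x m).1 : (Fin k → Gr 𝔄) → (Fin k → RapidMat (Fin 2 × ℕ) 𝔄))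
      (fun b : Gr 𝔄 => b.1) f

/-- Smooth (and continuous) maps `F : 𝒢 × ⋯ × 𝒢 × [0, 1] → 𝒢`. -/
def IsSmoothHomotopy {k : ℕ} (F : (Fin k → Gr 𝔄) × Set.Icc (0 : ℝ) 1 → Gr 𝔄) : Prop :=
  Continuous F ∧
    SmoothVia (fun x => (fun m => (x.1 m).1, (x.2 : ℝ)) :
        (Fin k → Gr 𝔄) × Set.Icc (0 : ℝ) 1 → (Fin k → RapidMat (Fin 2 × ℕ) 𝔄) × ℝ)
      (fun b : Gr 𝔄 => b.1) F

/-- The maps `f, g : 𝒢 × ⋯ × 𝒢 → 𝒢` are connected by a smooth homotopy. -/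
def SmoothlyHomotopic {k : ℕ} (f g : (Fin k → Gr 𝔄) → Gr 𝔄) : Prop :=
  ∃ F : (Fin k → Gr 𝔄) × Set.Icc (0 : ℝ) 1 → Gr 𝔄, IsSmoothHomotopy F ∧
    (∀ x, F (x, ⟨0, by simp⟩) = f x) ∧ ∀ x, F (x, ⟨1, by simp⟩) = g x

/-- The given operations make the Grassmannian a commutative smooth topological H-ring
(not necessarily with a multiplicative unit): the operations are continuous and smooth, and the
identities of commutative rings hold up to smooth homotopy. -/
structure IsCommSmoothHRing (add mul : Gr 𝔄 → Gr 𝔄 → Gr 𝔄) (neg : Gr 𝔄 → Gr 𝔄) (zero : Gr 𝔄) :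
    Prop where
  smooth_add : IsSmoothOp (k := 2) fun x => add (x 0) (x 1)
  smooth_mul : IsSmoothOp (k := 2) fun x => mul (x 0) (x 1)
  smooth_neg : IsSmoothOp (k := 1) fun x => neg (x 0)
  add_assoc : SmoothlyHomotopic (k := 3)
    (fun x => add (add (x 0) (x 1)) (x 2)) (fun x => add (x 0) (add (x 1) (x 2)))
  add_comm : SmoothlyHomotopic (k := 2) (fun x => add (x 0) (x 1)) (fun x => add (x 1) (x 0))
  add_zero : SmoothlyHomotopic (k := 1) (fun x => add (x 0) zero) (fun x => x 0)
  zero_add : SmoothlyHomotopic (k := 1) (fun x => add zero (x 0)) (fun x => x 0)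
  add_neg : SmoothlyHomotopic (k := 1) (fun x => add (x 0) (neg (x 0))) (fun _ => zero)
  neg_add : SmoothlyHomotopic (k := 1) (fun x => add (neg (x 0)) (x 0)) (fun _ => zero)
  mul_assoc : SmoothlyHomotopic (k := 3)
    (fun x => mul (mul (x 0) (x 1)) (x 2)) (fun x => mul (x 0) (mul (x 1) (x 2)))
  mul_comm : SmoothlyHomotopic (k := 2) (fun x => mul (x 0) (x 1)) (fun x => mul (x 1) (x 0))
  mul_add : SmoothlyHomotopic (k := 3)
    (fun x => mul (x 0) (add (x 1) (x 2))) (fun x => add (mul (x 0) (x 1)) (mul (x 0) (x 2)))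
  add_mul : SmoothlyHomotopic (k := 3)
    (fun x => mul (add (x 0) (x 1)) (x 2)) (fun x => add (mul (x 0) (x 2)) (mul (x 1) (x 2)))

/-- The element `one` is a multiplicative unit up to smooth homotopy. -/
structure IsSmoothHUnit (mul : Gr 𝔄 → Gr 𝔄 → Gr 𝔄) (one : Gr 𝔄) : Prop where
  one_mul : SmoothlyHomotopic (k := 1) (fun x => mul one (x 0)) (fun x => x 0)
  mul_one : SmoothlyHomotopic (k := 1) (fun x => mul (x 0) one) (fun x => x 0)

/-- `T` is a smooth homotopy, parametrized by `[0, c]`, through algebra endomorphisms of the algebra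
of rapidly decreasing `ℕ × ℕ` matrices; it begins at the identity and it ends at the relabeling map
induced by `r`. -/
structure IsStabilizingHomotopy {c : ℝ} (hc : 0 ≤ c) (r : ℕ → ℕ)
    (T : RapidMat ℕ 𝔄 × Set.Icc (0 : ℝ) c → RapidMat ℕ 𝔄) : Prop where
  continuous : Continuous T
  smooth : SmoothVia (fun x => (x.1, (x.2 : ℝ)) :
    RapidMat ℕ 𝔄 × Set.Icc (0 : ℝ) c → RapidMat ℕ 𝔄 × ℝ) (fun A : RapidMat ℕ 𝔄 => A) T
  map_add : ∀ A B t, T (A + B, t) = T (A, t) + T (B, t)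
  map_smul : ∀ (a : ℝ) A t, T (a • A, t) = a • T (A, t)
  map_mul : ∀ A B D : RapidMat ℕ 𝔄, mmul A.toMatrix B.toMatrix = D.toMatrix →
    ∀ t, mmul (T (A, t)).toMatrix (T (B, t)).toMatrix = (T (D, t)).toMatrix
  start : ∀ A, T (A, ⟨0, le_rfl, hc⟩) = A
  finish : ∀ A, (T (A, ⟨c, hc, le_rfl⟩)).toMatrix = relabel r A.toMatrix

/-- The real matrix `C(θ)`: with `t = sin θ` and `s = cos θ`, its row `0` is
`s, t s, t² s, t³ s, …`, and its row `m + 1` has the entry `-t` in column `m`, followed by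
`s², t s², t² s², …`, and zeros before. -/
noncomputable def rotMat (θ : ℝ) : Matrix ℕ ℕ ℝ :=
  Matrix.of fun m n =>
    match m with
    | 0 => Real.sin θ ^ n * Real.cos θ
    | m + 1 =>
      if n < m then 0
      else if n = m then -Real.sin θ
      else Real.sin θ ^ (n - (m + 1)) * Real.cos θ ^ 2

end HRing

-- To an index set belongs the space of rapidly decreasing functions on it with values in the unital
-- extension. A continuous linear operator between such spaces is determined by its matrix
-- (`op_ext`), and products of infinite matrices become compositions (`mmul_mat`), so the argument
-- is carried out with operators. Let R₀ denote `baseOp`. A point of the Grassmannian is an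
-- idempotent R₀ + D, where D has a rapidly decreasing matrix over the algebra. Smooth dependence on
-- parameters is organized by two classes of families: `SmoothKernel` for operators like D, and
-- `SmoothMult` for operators, such as relabelings, projections and rotations, which may multiply
-- the former on either side.
--
-- The main device is a frame: finitely many embeddings J_a with left inverses J'_a, mutually
-- orthogonal, such that R₀ J_a = J_a α_a and J'_a R₀ = α_a J'_a. The assignment P ↦ R₀ + Σ J_a (P -
-- diag α)_{ab} J'_b is multiplicative and injective (`OrthFrame.lift_mul`,
-- `OrthFrame.lift_injective`). Hence idempotent matrices P of operators, with P - diag α rapidly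
-- decreasing, yield points of the Grassmannian. Two principles produce the homotopies.
--
-- Independence of the frame (`SmoothFrame.homot_of_frames`): one frame is pushed to odd positions
-- and the other to even positions, and the two frames, now orthogonal, are rotated into each other.
-- The pushing is the path `stabOp`, which turns the basis vector at ω into the one at q ω between
-- the times 1/(|ω|+2) and 1/(|ω|+1). Larger indices move first, so a target position has been
-- vacated when it is needed, and the transposed path is a left inverse at all times. The speeds
-- grow polynomially, so the path acts smoothly on rapidly decreasing matrices, even at time 0.
--
-- Equivalence of idempotents (`SmoothFrame.homot_of_mvn`): if PQP = P and QPQ = Q, then QP and PQ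
-- lead to homotopic points, by a rotation which uses free space in the zeroth block.
--
-- Regularization fits into this scheme: for the relabeled pair ⟨β, α⟩ it equals R₀ + J (β - α) J',
-- where J sends the range of 1 - α to the zeroth block and the range of α to the first block
-- (`regRelabel_mat`). For a sum, β - α consists of the differences D of the two arguments; for the
-- left product of a and b, it is the tensor product of the two differences, and α is R₀ ⊗ b + (1 -
-- R₀) ⊗ R₀. The laws of addition other than the inverse rules, and associativity, distributivity
-- and the left unit rule of multiplication, therefore only compare frames. The inverse rules
-- compare diag (b, 1 - b) with diag (R₀, 1 - R₀) by the second principle. Commutativity of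
-- multiplication, where the base terms differ, needs the exchange argument
-- `SmoothFrame.homot_of_exchange`. The right product is the left product with its arguments
-- interchanged.
--
-- For C(θ), the columns are finite and orthonormal, so conjugation is multiplicative; the entries
-- are monomials in sine and cosine of degree at most n + 1 in column n, so their derivatives grow
-- polynomially and the conjugation is smooth. Infinite stabilization is conjugation by `stabOp` for
-- n ↦ 2n, applied in each block.

universe w x

/-! ### Calculus in the sense of Michal and Bastiani -/

section Calculus

variable {E : Type u} [AddCommGroup E] [Module ℝ E] [TopologicalSpace E]
  {F : Type v} [AddCommGroup F] [Module ℝ F] [TopologicalSpace F]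
  {G : Type w} [AddCommGroup G] [Module ℝ G] [TopologicalSpace G]

/-- Hahn–Banach, applied to c • v ↦ c p(v) on the line through v. It reduces estimates of vector
valued curves to real valued ones. -/
theorem Seminorm.exists_dual_eq [PolynormableSpace ℝ G] {p : Seminorm ℝ G} (hp : Continuous p)
    (v : G) : ∃ g : G →L[ℝ] ℝ, g v = p v ∧ ∀ x, |g x| ≤ p x := by
  by_cases hv : v = 0
  · exact ⟨0, by simp [hv], fun x => by simp⟩
  · obtain ⟨g, hg, hg'⟩ := Module.Dual.exists_continuous_extension_of_le_seminorm_real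
      (Submodule.span ℝ {v}) (p v • LinearEquiv.coord ℝ G v hv) hp (by
        rintro ⟨x, hx⟩
        obtain ⟨c, rfl⟩ := Submodule.mem_span_singleton.1 hx
        have : (LinearEquiv.coord ℝ G v hv) ⟨c • v, hx⟩ = c := by
          have h := LinearEquiv.coord_apply_smul ℝ G v hv ⟨c • v, hx⟩
          exact smul_left_injective ℝ hv h
        change p v * (LinearEquiv.coord ℝ G v hv) ⟨c • v, hx⟩ ≤ p (c • v)
        rw [this, map_smul_eq_mul, Real.norm_eq_abs, mul_comm]
        exact mul_le_mul_of_nonneg_right (le_abs_self c) (apply_nonneg p v))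
    refine ⟨g, ?_, hg'⟩
    have h := hg ⟨v, Submodule.mem_span_singleton_self v⟩
    simpa [LinearEquiv.coord_self] using h

/-- The mean value inequality for curves in locally convex spaces. -/
theorem Seminorm.sub_sub_smul_le_of_slope [PolynormableSpace ℝ G] {p : Seminorm ℝ G}
    (hp : Continuous p) {h h' : ℝ → G} {z : G} {ε t : ℝ}
    (hd : ∀ s ∈ Set.uIcc 0 t, Tendsto (fun τ : ℝ => τ⁻¹ • (h (s + τ) - h s)) (𝓝[≠] 0) (𝓝 (h' s)))
    (hb : ∀ s ∈ Set.uIcc 0 t, p (h' s - z) ≤ ε) :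
    p (h t - h 0 - t • z) ≤ ε * |t| := by
  obtain ⟨g, hg, hgp⟩ := Seminorm.exists_dual_eq hp (h t - h 0 - t • z)
  have key := Convex.norm_image_sub_le_of_norm_hasDerivWithin_le (𝕜 := ℝ)
    (f := fun s => g (h s) - s * g z) (f' := fun s => g (h' s) - g z) (s := Set.uIcc 0 t) (C := ε)
    (x := 0) (y := t) (fun s hs => by
      have h1 : HasDerivAt (fun s => g (h s)) (g (h' s)) s := by
        rw [hasDerivAt_iff_tendsto_slope_zero]
        refine ((g.continuous.tendsto _).comp (hd s hs)).congr fun τ => ?_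
        simp
      have h2 : HasDerivAt (fun s : ℝ => s * g z) (g z) s := by
        simpa using (hasDerivAt_id s).mul_const (g z)
      exact (h1.sub h2).hasDerivWithinAt)
    (fun s hs => by
      rw [← map_sub, Real.norm_eq_abs]
      exact (hgp _).trans (hb s hs)) (convex_uIcc 0 t) Set.left_mem_uIcc Set.right_mem_uIcc
  rw [← hg]
  refine (le_abs_self _).trans ?_
  simp only [Real.norm_eq_abs, zero_mul, sub_zero] at key
  refine le_of_eq_of_le ?_ key
  congr 1
  rw [map_sub, map_sub, map_smul, smul_eq_mul]
  ring

theorem BastianiCk.continuousOn {n : ℕ} {U : Set E} {f : E → F} (h : BastianiCk n U f) :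
    ContinuousOn f U := by
  cases n with
  | zero => exact h
  | succ n => exact h.1

theorem BastianiCk.mono {n : ℕ} : ∀ {E : Type u} [AddCommGroup E] [Module ℝ E] [TopologicalSpace E]
    {U V : Set E} {f : E → F}, BastianiCk n U f → V ⊆ U → BastianiCk n V f := by
  induction n with
  | zero => intro E _ _ _ U V f h hV; exact ContinuousOn.mono h hV
  | succ n ih =>
    rintro E _ _ _ U V f ⟨h, df, hd, hdf⟩ hV
    exact ⟨h.mono hV, df, fun x hx => hd x (hV hx), ih hdf (Set.prod_mono hV subset_rfl)⟩

theorem BastianiCk.comp_clm {n : ℕ} : ∀ {E' : Type w} {E : Type u} [AddCommGroup E] [Module ℝ E]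
    [TopologicalSpace E] [AddCommGroup E'] [Module ℝ E'] [TopologicalSpace E']
    {U : Set E} {f : E → F}, BastianiCk n U f → ∀ L : E' →L[ℝ] E,
    BastianiCk n (L ⁻¹' U) (f ∘ L) := by
  induction n with
  | zero =>
    intro E' E _ _ _ _ _ _ U f h L
    exact ContinuousOn.comp h L.continuous.continuousOn (Set.mapsTo_preimage _ _)
  | succ n ih =>
    rintro E' E _ _ _ _ _ _ U f ⟨h, df, hd, hdf⟩ L
    refine ⟨ContinuousOn.comp h L.continuous.continuousOn (Set.mapsTo_preimage _ _),
      df ∘ (L.prodMap L), fun x hx y => ?_, (ih hdf (L.prodMap L)).mono ?_⟩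
    · simpa using hd (L x) hx (L y)
    · rintro ⟨x, y⟩ ⟨hx, -⟩
      exact ⟨hx, trivial⟩

theorem BastianiCk.clm_comp {n : ℕ} {F : Type v} [AddCommGroup F] [Module ℝ F] [TopologicalSpace F]
    (L : F →L[ℝ] G) : ∀ {E : Type u} [AddCommGroup E] [Module ℝ E] [TopologicalSpace E]
    {U : Set E} {f : E → F}, BastianiCk n U f → BastianiCk n U (L ∘ f) := by
  induction n with
  | zero => intro E _ _ _ U f h; exact L.continuous.comp_continuousOn h
  | succ n ih =>
    rintro E _ _ _ U f ⟨h, df, hd, hdf⟩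
    refine ⟨L.continuous.comp_continuousOn h, L ∘ df, fun x hx y => ?_, ih hdf⟩
    refine ((L.continuous.tendsto _).comp (hd x hx y)).congr fun t => ?_
    simp

theorem BastianiCk.prodMk {n : ℕ} : ∀ {E : Type u} [AddCommGroup E] [Module ℝ E]
    [TopologicalSpace E] {U : Set E} {f : E → F} {g : E → G}, BastianiCk n U f →
    BastianiCk n U g → BastianiCk n U (fun x => (f x, g x)) := by
  induction n with
  | zero => intro E _ _ _ U f g hf hg; exact ContinuousOn.prodMk hf hg
  | succ n ih =>
    rintro E _ _ _ U f g ⟨hf, df, hdf, hdf'⟩ ⟨hg, dg, hdg, hdg'⟩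
    exact ⟨hf.prodMk hg, _, fun x hx y => (hdf x hx y).prodMk_nhds (hdg x hx y), ih hdf' hdg'⟩

theorem BastianiCk.const {n : ℕ} (c : F) : ∀ {E : Type u} [AddCommGroup E] [Module ℝ E]
    [TopologicalSpace E] {U : Set E}, BastianiCk n U (fun _ : E => c) := by
  induction n generalizing c with
  | zero => intro E _ _ _ U; exact continuousOn_const
  | succ n ih =>
    intro E _ _ _ U
    exact ⟨continuousOn_const, fun _ => 0, fun x _ y => by simpa using tendsto_const_nhds, ih 0⟩

theorem BastianiCk.of_clm {n : ℕ} : ∀ {E : Type u} [AddCommGroup E] [Module ℝ E]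
    [TopologicalSpace E] {U : Set E} (L : E →L[ℝ] F), BastianiCk n U L := by
  induction n with
  | zero => intro E _ _ _ U L; exact L.continuous.continuousOn
  | succ n ih =>
    intro E _ _ _ U L
    refine ⟨L.continuous.continuousOn, L ∘ Prod.snd, fun x _ y => ?_,
      ih (L.comp (ContinuousLinearMap.snd ℝ E E))⟩
    refine tendsto_const_nhds.congr' ?_
    filter_upwards [self_mem_nhdsWithin] with t ht
    have ht : t ≠ 0 := ht
    simp [smul_smul, ht]

theorem BastianiCk.of_succ {n : ℕ} : ∀ {E : Type u} [AddCommGroup E] [Module ℝ E]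
    [TopologicalSpace E] {U : Set E} {f : E → F}, BastianiCk (n + 1) U f → BastianiCk n U f := by
  induction n with
  | zero => intro E _ _ _ U f h; exact h.1
  | succ n ih =>
    rintro E _ _ _ U f ⟨h, df, hd, hdf⟩
    exact ⟨h, df, hd, ih hdf⟩

/-- Directional derivatives along converging directions. -/
theorem tendsto_slope_of_tendsto [IsTopologicalAddGroup F] [ContinuousSMul ℝ F]
    [IsTopologicalAddGroup G] [PolynormableSpace ℝ G]
    {V : Set F} (hV : IsOpen V) {g : F → G} {dg : F × F → G}
    (hd : ∀ x ∈ V, ∀ y, Tendsto (fun t : ℝ => t⁻¹ • (g (x + t • y) - g x)) (𝓝[≠] 0)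
      (𝓝 (dg (x, y)))) (hdg : ContinuousOn dg (V ×ˢ Set.univ)) {x : F} (hx : x ∈ V)
    {y : F} {Y : ℝ → F} (hY : Tendsto Y (𝓝[≠] 0) (𝓝 y)) :
    Tendsto (fun t : ℝ => t⁻¹ • (g (x + t • Y t) - g x)) (𝓝[≠] 0) (𝓝 (dg (x, y))) := by
  rw [(PolynormableSpace.withSeminorms ℝ G).tendsto_nhds]
  rintro ⟨p, hp⟩ ε hε
  have hc : ContinuousAt dg (x, y) :=
    hdg.continuousAt ((hV.prod isOpen_univ).mem_nhds ⟨hx, trivial⟩)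
  have h1 : ∀ᶠ z in 𝓝 (x, y), z.1 ∈ V ∧ p (dg z - dg (x, y)) < ε / 2 := by
    refine (continuous_fst.continuousAt.eventually (hV.mem_nhds hx)).and ?_
    have h2 : Tendsto (fun z => p (dg z - dg (x, y))) (𝓝 (x, y)) (𝓝 (p (dg (x, y) - dg (x, y)))) :=
      (hp.tendsto _).comp (hc.sub tendsto_const_nhds)
    rw [sub_self, map_zero] at h2
    exact h2.eventually (gt_mem_nhds (half_pos hε))
  have h2 : Tendsto (fun z : ℝ × F => (x + z.1 • z.2, z.2)) (𝓝 (0, y)) (𝓝 (x, y)) := by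
    have : Continuous fun z : ℝ × F => (x + z.1 • z.2, z.2) := by fun_prop
    simpa using this.tendsto (0, y)
  obtain ⟨A, hA, B, hB, hAB⟩ := mem_nhds_prod_iff.1 (h2.eventually h1)
  obtain ⟨r, hr, hrA⟩ := Metric.mem_nhds_iff.1 hA
  have h3 : ∀ᶠ t in 𝓝[≠] (0 : ℝ), |t| < r := by
    filter_upwards [nhdsWithin_le_nhds (Metric.ball_mem_nhds (0 : ℝ) hr)] with t ht
    simpa using ht
  filter_upwards [h3, hY.eventually hB, self_mem_nhdsWithin] with t ht hYt ht0
  have ht0 : t ≠ 0 := ht0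
  have hs : ∀ s ∈ Set.uIcc 0 t, s ∈ A := fun s hs => hrA (by
    rw [Metric.mem_ball, dist_zero_right, Real.norm_eq_abs]
    refine lt_of_le_of_lt ?_ ht
    simpa using Set.abs_sub_left_of_mem_uIcc hs)
  -- The mean value inequality is used on a segment with the direction `Y t` held fixed. Continuity
  -- of `dg` at `(x, y)` keeps the derivative along the segment within ε / 2 of `dg (x, y)` for all
  -- small `t`.
  have key := Seminorm.sub_sub_smul_le_of_slope hp (h := fun s => g (x + s • Y t))
    (h' := fun s => dg (x + s • Y t, Y t)) (z := dg (x, y)) (ε := ε / 2) (t := t)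
    (fun s hs' => by
      refine (hd _ (hAB (Set.mk_mem_prod (hs s hs') hYt)).1 (Y t)).congr fun τ => ?_
      rw [add_smul, add_assoc])
    (fun s hs' => (hAB (Set.mk_mem_prod (hs s hs') hYt)).2.le)
  have h4 : t⁻¹ • (g (x + t • Y t) - g x) - dg (x, y) =
      t⁻¹ • (g (x + t • Y t) - g (x + (0 : ℝ) • Y t) - t • dg (x, y)) := by
    rw [smul_sub _ _ (t • dg (x, y)), smul_smul, inv_mul_cancel₀ ht0, one_smul, zero_smul, add_zero]
  rw [h4, map_smul_eq_mul, norm_inv, Real.norm_eq_abs]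
  have : 0 < |t| := abs_pos.2 ht0
  calc |t|⁻¹ * _ ≤ |t|⁻¹ * (ε / 2 * |t|) := by gcongr
    _ = ε / 2 := by field_simp
    _ < ε := half_lt_self hε

/-- The chain rule: the derivative of g ∘ f is dg composed with (x, v) ↦ (f x, df (x, v)), which is
again a composition of the same kind. The spaces vary in the induction because derivatives live on E
× E and F × F. -/
theorem BastianiCk.comp {n : ℕ} [IsTopologicalAddGroup G] [PolynormableSpace ℝ G] :
    ∀ {E : Type u} [AddCommGroup E] [Module ℝ E] [TopologicalSpace E]
    {F : Type v} [AddCommGroup F] [Module ℝ F] [TopologicalSpace F]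
    [IsTopologicalAddGroup F] [ContinuousSMul ℝ F]
    {V : Set F} {g : F → G} {U : Set E} {f : E → F},
    BastianiCk n V g → BastianiCk n U f → IsOpen V → Set.MapsTo f U V →
    BastianiCk n U (g ∘ f) := by
  induction n with
  | zero =>
    intro E _ _ _ F _ _ _ _ _ V g U f hg hf _ hUV
    exact ContinuousOn.comp hg hf hUV
  | succ n ih =>
    intro E _ _ _ F _ _ _ _ _ V g U f hg' hf' hV hUV
    obtain ⟨hg, dg, hdg, hdg'⟩ := hg'
    have hfn := hf'.of_succ
    obtain ⟨hf, df, hdf, hdf'⟩ := hf'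
    refine ⟨hg.comp hf hUV, fun z => dg (f z.1, df z), fun x hx y => ?_, ?_⟩
    -- The moving direction is the difference quotient of `f` itself, so that `f (x + t • y)` equals
    -- `f x` plus `t` times this direction.
    · refine (tendsto_slope_of_tendsto hV hdg hdg'.continuousOn (hUV hx) (hdf x hx y)).congr' ?_
      filter_upwards [self_mem_nhdsWithin] with t ht
      have ht : t ≠ 0 := ht
      simp [smul_smul, ht]
    · refine ih hdg' (f := fun z => (f z.1, df z)) (BastianiCk.prodMk ?_ hdf')
        (hV.prod isOpen_univ) (fun z hz => ⟨hUV hz.1, trivial⟩)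
      exact (hfn.comp_clm (ContinuousLinearMap.fst ℝ E E)).mono (fun z hz => hz.1)

theorem BastianiCk.add {n : ℕ} [ContinuousAdd F] {U : Set E} {f g : E → F}
    (hf : BastianiCk n U f) (hg : BastianiCk n U g) : BastianiCk n U (fun x => f x + g x) :=
  BastianiCk.clm_comp (ContinuousLinearMap.fst ℝ F F + ContinuousLinearMap.snd ℝ F F)
    (hf.prodMk hg)

/-- Continuous bilinear maps are smooth. -/
theorem BastianiCk.bilinear {n : ℕ} [IsTopologicalAddGroup E] [ContinuousSMul ℝ E]
    [IsTopologicalAddGroup F] [ContinuousSMul ℝ F] [IsTopologicalAddGroup G] [ContinuousSMul ℝ G]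
    (b : E →ₗ[ℝ] F →ₗ[ℝ] G) (hb : Continuous fun z : E × F => b z.1 z.2) :
    ∀ {D : Type x} [AddCommGroup D] [Module ℝ D] [TopologicalSpace D] {U : Set D}
    (L : D →L[ℝ] E) (M : D →L[ℝ] F) , BastianiCk n U (fun z => b (L z) (M z)) := by
  induction n with
  | zero => intro D _ _ _ U L M; exact (hb.comp (L.continuous.prodMk M.continuous)).continuousOn
  | succ n ih =>
    intro D _ _ _ U L M
    refine ⟨(hb.comp (L.continuous.prodMk M.continuous)).continuousOn,
      fun z => b (L z.1) (M z.2) + b (L z.2) (M z.1), fun x _ y => ?_, BastianiCk.add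
        (ih (L.comp (ContinuousLinearMap.fst ℝ D D)) (M.comp (ContinuousLinearMap.snd ℝ D D)))
        (ih (L.comp (ContinuousLinearMap.snd ℝ D D)) (M.comp (ContinuousLinearMap.fst ℝ D D)))⟩
    have h : Continuous fun t : ℝ => b (L x) (M y) + b (L y) (M x) + t • b (L y) (M y) := by
      fun_prop
    have h' := (h.tendsto 0).mono_left (nhdsWithin_le_nhds (s := {0}ᶜ))
    rw [zero_smul, add_zero] at h'
    refine h'.congr' ?_
    filter_upwards [self_mem_nhdsWithin] with t ht
    have ht : t ≠ 0 := ht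
    have e : b (L (x + t • y)) (M (x + t • y)) - b (L x) (M x) =
        t • (b (L x) (M y) + b (L y) (M x) + t • b (L y) (M y)) := by
      simp only [map_add, map_smul, LinearMap.add_apply, LinearMap.smul_apply, smul_add]
      abel
    rw [e, smul_smul, inv_mul_cancel₀ ht, one_smul]

/-- The derivative is the product of `deriv f ∘ L` and `L`, so induction over all smooth `f` and the
smoothness of multiplication suffice. -/
theorem BastianiCk.of_contDiff {n : ℕ} {f : ℝ → ℝ} (hf : ContDiff ℝ (⊤ : ℕ∞) f) {U : Set E}
    (L : E →L[ℝ] ℝ) : BastianiCk n U (f ∘ L) := by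
  induction n generalizing E f with
  | zero => exact (hf.continuous.comp L.continuous).continuousOn
  | succ n ih =>
    have hf' : ContDiff ℝ (⊤ : ℕ∞) (deriv f) := (contDiff_infty_iff_deriv.1 hf).2
    refine ⟨(hf.continuous.comp L.continuous).continuousOn,
      fun z => deriv f (L z.1) * L z.2, fun x _ y => ?_, ?_⟩
    · have h1 : HasDerivAt f (deriv f (L x)) (L x) :=
        ((contDiff_infty_iff_deriv.1 hf).1 (L x)).hasDerivAt
      have h2 : HasDerivAt (fun t : ℝ => L x + t * L y) (L y) 0 := by
        simpa using ((hasDerivAt_id (0 : ℝ)).mul_const (L y)).const_add (L x)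
      have h3 : HasDerivAt (fun t : ℝ => f (L x + t * L y)) (deriv f (L x) * L y) 0 := by
        refine HasDerivAt.comp (0 : ℝ) ?_ h2
        simpa using h1
      rw [hasDerivAt_iff_tendsto_slope_zero] at h3
      simpa using h3
    · refine (BastianiCk.bilinear (LinearMap.mul ℝ ℝ) continuous_mul
        (ContinuousLinearMap.fst ℝ ℝ ℝ) (ContinuousLinearMap.snd ℝ ℝ ℝ)).comp
        (V := Set.univ) (f := fun z : E × E => (deriv f (L z.1), L z.2))
        (BastianiCk.prodMk (ih hf' (L.comp (ContinuousLinearMap.fst ℝ E E)))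
          (BastianiCk.of_clm (L.comp (ContinuousLinearMap.snd ℝ E E)))) isOpen_univ
        (Set.mapsTo_univ _ _)

end Calculus

/-! ### Smooth maps between subsets of locally convex spaces -/

section SmoothVia

variable {X Y Z : Type*} {E : Type u} [AddCommGroup E] [Module ℝ E] [TopologicalSpace E]
  {F : Type v} [AddCommGroup F] [Module ℝ F] [TopologicalSpace F]
  {G : Type w} [AddCommGroup G] [Module ℝ G] [TopologicalSpace G]

/-- Maps between topological vector spaces which are `C^∞` everywhere. -/
def BastianiSmooth (f : E → F) : Prop := ∀ n, BastianiCk n Set.univ f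

theorem BastianiSmooth.of_clm (L : E →L[ℝ] F) : BastianiSmooth L := fun _ => BastianiCk.of_clm L

theorem BastianiSmooth.prodMk {f : E → F} {g : E → G} (hf : BastianiSmooth f)
    (hg : BastianiSmooth g) : BastianiSmooth fun x => (f x, g x) := fun n => (hf n).prodMk (hg n)

theorem BastianiSmooth.comp [IsTopologicalAddGroup F] [ContinuousSMul ℝ F]
    [IsTopologicalAddGroup G] [PolynormableSpace ℝ G] {g : F → G} {f : E → F}
    (hg : BastianiSmooth g) (hf : BastianiSmooth f) : BastianiSmooth (g ∘ f) :=
  fun n => (hg n).comp (hf n) isOpen_univ (Set.mapsTo_univ _ _)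

theorem BastianiSmooth.bilinear [IsTopologicalAddGroup E] [ContinuousSMul ℝ E]
    [IsTopologicalAddGroup F] [ContinuousSMul ℝ F] [IsTopologicalAddGroup G] [ContinuousSMul ℝ G]
    (b : E →ₗ[ℝ] F →ₗ[ℝ] G) (hb : Continuous fun z : E × F => b z.1 z.2) :
    BastianiSmooth fun z : E × F => b z.1 z.2 := fun _ =>
  BastianiCk.bilinear b hb (ContinuousLinearMap.fst ℝ E F) (ContinuousLinearMap.snd ℝ E F)

theorem SmoothVia.of_global {i : X → E} {j : Y → F} {f : X → Y} {Φ : E → F}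
    (hΦ : BastianiSmooth Φ) (h : ∀ x, Φ (i x) = j (f x)) : SmoothVia i j f :=
  fun _ => ⟨Set.univ, isOpen_univ, trivial, Φ, hΦ, fun y _ => h y⟩

theorem SmoothVia.comp [IsTopologicalAddGroup F] [ContinuousSMul ℝ F]
    [IsTopologicalAddGroup G] [PolynormableSpace ℝ G] {i : X → E} {j : Y → F} {k : Z → G}
    {g : Y → Z} {f : X → Y} (hg : SmoothVia j k g) (hf : SmoothVia i j f) :
    SmoothVia i k (g ∘ f) := by
  intro x
  obtain ⟨U, hU, hxU, Φ, hΦ, hΦf⟩ := hf x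
  obtain ⟨V, hV, hxV, Ψ, hΨ, hΨg⟩ := hg (f x)
  refine ⟨U ∩ Φ ⁻¹' V, (hΦ 0).continuousOn.isOpen_inter_preimage hU hV, ⟨hxU, ?_⟩, Ψ ∘ Φ,
    fun n => (hΨ n).comp ((hΦ n).mono Set.inter_subset_left) hV fun y hy => hy.2, ?_⟩
  · rwa [Set.mem_preimage, hΦf x hxU]
  · rintro y ⟨hy, hy'⟩
    rw [Function.comp_apply, hΦf y hy]
    exact hΨg _ (by rwa [Set.mem_preimage, hΦf y hy] at hy')

/-- The local ambient maps are continuous, and continuity into `Y` is tested after `j`. All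
continuity claims of the theorem follow from smoothness in this way. -/
theorem SmoothVia.continuous [TopologicalSpace X] [TopologicalSpace Y] {i : X → E} {j : Y → F}
    {f : X → Y} (hf : SmoothVia i j f) (hi : Continuous i) (hj : IsInducing j) : Continuous f := by
  rw [hj.continuous_iff, continuous_iff_continuousAt]
  intro x
  obtain ⟨U, hU, hxU, Φ, hΦ, hΦf⟩ := hf x
  have h1 : ContinuousAt (Φ ∘ i) x :=
    ((hΦ 0).continuousOn.continuousAt (hU.mem_nhds hxU)).comp hi.continuousAt
  refine h1.congr ?_
  filter_upwards [hi.continuousAt.eventually (hU.mem_nhds hxU)] with y hy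
  exact hΦf y hy

theorem SmoothVia.of_locally {i : X → E} {j : Y → F} {f : X → Y}
    (h : ∀ x, ∃ W : Set E, IsOpen W ∧ i x ∈ W ∧ ∃ g, SmoothVia i j g ∧
      ∀ y, i y ∈ W → g y = f y) : SmoothVia i j f := by
  intro x
  obtain ⟨W, hW, hxW, g, hg, hfg⟩ := h x
  obtain ⟨U, hU, hxU, Φ, hΦ, hΦg⟩ := hg x
  exact ⟨U ∩ W, hU.inter hW, ⟨hxU, hxW⟩, Φ, fun n => (hΦ n).mono Set.inter_subset_left,
    fun y hy => by rw [hΦg y hy.1, hfg y hy.2]⟩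

theorem SmoothVia.prodMk {i : X → E} {f : X → F} {g : X → G} (hf : SmoothVia i id f)
    (hg : SmoothVia i id g) : SmoothVia i id fun x => (f x, g x) := by
  intro x
  obtain ⟨U, hU, hxU, Φ, hΦ, hΦf⟩ := hf x
  obtain ⟨V, hV, hxV, Ψ, hΨ, hΨg⟩ := hg x
  exact ⟨U ∩ V, hU.inter hV, ⟨hxU, hxV⟩, fun e => (Φ e, Ψ e), fun n =>
    ((hΦ n).mono Set.inter_subset_left).prodMk ((hΨ n).mono Set.inter_subset_right),
    fun y hy => by simp [hΦf y hy.1, hΨg y hy.2]⟩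

theorem SmoothVia.const {i : X → E} {j : Y → F} (c : Y) : SmoothVia i j fun _ : X => c :=
  SmoothVia.of_global (Φ := fun _ => j c) (fun _ => BastianiCk.const _) fun _ => rfl

theorem SmoothVia.map [IsTopologicalAddGroup F] [ContinuousSMul ℝ F]
    [IsTopologicalAddGroup G] [PolynormableSpace ℝ G] {i : X → E} {f : X → F} {Φ : F → G}
    (hΦ : BastianiSmooth Φ) (hf : SmoothVia i id f) : SmoothVia i id fun x => Φ (f x) :=
  SmoothVia.comp (j := id) (k := id) (g := Φ) (SmoothVia.of_global hΦ fun _ => rfl) hf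

theorem SmoothVia.clm [IsTopologicalAddGroup F] [ContinuousSMul ℝ F]
    [IsTopologicalAddGroup G] [PolynormableSpace ℝ G] {i : X → E} {f : X → F} (L : F →L[ℝ] G)
    (hf : SmoothVia i id f) : SmoothVia i id fun x => L (f x) :=
  hf.map (BastianiSmooth.of_clm L)

theorem SmoothVia.add [IsTopologicalAddGroup F] [ContinuousSMul ℝ F] [PolynormableSpace ℝ F]
    {i : X → E} {f g : X → F} (hf : SmoothVia i id f) (hg : SmoothVia i id g) :
    SmoothVia i id fun x => f x + g x :=
  (hf.prodMk hg).clm (ContinuousLinearMap.fst ℝ F F + ContinuousLinearMap.snd ℝ F F)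

theorem SmoothVia.bilinear [IsTopologicalAddGroup F] [ContinuousSMul ℝ F]
    [IsTopologicalAddGroup G] [ContinuousSMul ℝ G]
    {H : Type x} [AddCommGroup H] [Module ℝ H] [TopologicalSpace H]
    [IsTopologicalAddGroup H] [ContinuousSMul ℝ H] [PolynormableSpace ℝ H]
    (b : F →ₗ[ℝ] G →ₗ[ℝ] H) (hb : Continuous fun z : F × G => b z.1 z.2)
    {i : X → E} {f : X → F} {g : X → G} (hf : SmoothVia i id f) (hg : SmoothVia i id g) :
    SmoothVia i id fun x => b (f x) (g x) :=
  (hf.prodMk hg).map (BastianiSmooth.bilinear b hb)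

theorem SmoothVia.smul [IsTopologicalAddGroup F] [ContinuousSMul ℝ F] [PolynormableSpace ℝ F]
    {i : X → E} {f : X → F} {c : X → ℝ} (hc : SmoothVia i id c) (hf : SmoothVia i id f) :
    SmoothVia i id fun x => c x • f x :=
  SmoothVia.bilinear (LinearMap.lsmul ℝ F) continuous_smul hc hf

theorem BastianiSmooth.of_contDiff {f : ℝ → ℝ} (hf : ContDiff ℝ (⊤ : ℕ∞) f) : BastianiSmooth f :=
  fun _ => BastianiCk.of_contDiff hf (ContinuousLinearMap.id ℝ ℝ)

/-! ### Concatenation and reversal of smooth homotopies -/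

section Homotopy

/-- The embedding of `X × [0, c]` into the ambient vector space. -/
abbrev timeEmb (i : X → E) {c : ℝ} (z : X × Set.Icc (0 : ℝ) c) : E × ℝ := (i z.1, (z.2 : ℝ))

theorem SmoothVia.time {i : X → E} {c : ℝ} {φ : ℝ → ℝ} (hφ : ContDiff ℝ (⊤ : ℕ∞) φ) :
    SmoothVia (timeEmb i (c := c)) id fun z => φ (z.2 : ℝ) :=
  (SmoothVia.of_global (j := (id : ℝ → ℝ))
    (BastianiSmooth.of_clm (ContinuousLinearMap.snd ℝ E ℝ)) fun _ => rfl).map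
    (BastianiSmooth.of_contDiff hφ)

variable [IsTopologicalAddGroup E] [ContinuousSMul ℝ E]
  [IsTopologicalAddGroup F] [PolynormableSpace ℝ F]

theorem SmoothVia.base {i : X → E} {j : Y → F} {f : X → Y} (hf : SmoothVia i j f) {c : ℝ} :
    SmoothVia (timeEmb i (c := c)) j fun z => f z.1 :=
  hf.comp (SmoothVia.of_global (BastianiSmooth.of_clm (ContinuousLinearMap.fst ℝ E ℝ))
    fun _ => rfl)

theorem SmoothVia.reparam {i : X → E} {j : Y → F} {f : X × Set.Icc (0 : ℝ) 1 → Y}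
    (hf : SmoothVia (timeEmb i) j f) {φ : ℝ → ℝ} (hφ : ContDiff ℝ (⊤ : ℕ∞) φ)
    (h : ∀ t : Set.Icc (0 : ℝ) 1, φ t ∈ Set.Icc (0 : ℝ) 1) :
    SmoothVia (timeEmb i) j fun z : X × Set.Icc (0 : ℝ) 1 => f (z.1, ⟨φ z.2, h z.2⟩) := by
  refine hf.comp (f := fun z : X × Set.Icc (0 : ℝ) 1 =>
    ((z.1, ⟨φ z.2, h z.2⟩) : X × Set.Icc (0 : ℝ) 1)) (j := timeEmb i) ?_
  refine SmoothVia.of_global (Φ := fun e : E × ℝ => (e.1, φ e.2)) ?_ fun _ => rfl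
  exact (BastianiSmooth.of_clm (ContinuousLinearMap.fst ℝ E ℝ)).prodMk
    ((BastianiSmooth.of_contDiff hφ).comp (BastianiSmooth.of_clm (ContinuousLinearMap.snd ℝ E ℝ)))

/-- After reparametrization the first homotopy has stopped by the time 1/3 and the second one does
not start before 2/3. In between, both are stationary at the common map, so switching at 1/2 does
not destroy smoothness. -/
theorem SmoothVia.glue {i : X → E} {j : Y → F} {f g : X × Set.Icc (0 : ℝ) 1 → Y}
    (hf : SmoothVia (timeEmb i) j f) (hg : SmoothVia (timeEmb i) j g)
    (hfg : ∀ x, f (x, 1) = g (x, 0)) :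
    ∃ h : X × Set.Icc (0 : ℝ) 1 → Y, SmoothVia (timeEmb i) j h ∧
      (∀ x, h (x, 0) = f (x, 0)) ∧ ∀ x, h (x, 1) = g (x, 1) := by
  have hσ : ∀ a b : ℝ, ContDiff ℝ (⊤ : ℕ∞) fun t : ℝ => Real.smoothTransition (a * t + b) :=
    fun a b => Real.smoothTransition.contDiff.comp (by fun_prop)
  have hI : ∀ a b t : ℝ, Real.smoothTransition (a * t + b) ∈ Set.Icc (0 : ℝ) 1 := fun a b t =>
    ⟨Real.smoothTransition.nonneg _, Real.smoothTransition.le_one _⟩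
  -- The new times are the smooth transition function at 3t and at 3t - 2: the former equals 1 for t
  -- ≥ 1/3, the latter equals 0 for t ≤ 2/3 and reaches 1 at t = 1.
  let f' : X × Set.Icc (0 : ℝ) 1 → Y := fun z => f (z.1, ⟨_, hI 3 0 z.2⟩)
  let g' : X × Set.Icc (0 : ℝ) 1 → Y := fun z => g (z.1, ⟨_, hI 3 (-2) z.2⟩)
  have hf' : SmoothVia (timeEmb i) j f' := hf.reparam (hσ 3 0) fun t => hI 3 0 t
  have hg' : SmoothVia (timeEmb i) j g' := hg.reparam (hσ 3 (-2)) fun t => hI 3 (-2) t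
  have hf1 : ∀ (x : X) (t : Set.Icc (0 : ℝ) 1), (1 / 3 : ℝ) ≤ t → f' (x, t) = f (x, 1) := by
    intro x t ht
    refine congrArg f (Prod.ext rfl (Subtype.ext ?_))
    exact Real.smoothTransition.one_of_one_le (by linarith)
  have hg0 : ∀ (x : X) (t : Set.Icc (0 : ℝ) 1), (t : ℝ) ≤ 2 / 3 → g' (x, t) = g (x, 0) := by
    intro x t ht
    refine congrArg g (Prod.ext rfl (Subtype.ext ?_))
    exact Real.smoothTransition.zero_of_nonpos (by linarith)
  refine ⟨fun z => if (z.2 : ℝ) ≤ 1 / 2 then f' z else g' z, SmoothVia.of_locally ?_, ?_, ?_⟩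
  · rintro ⟨x, t⟩
    by_cases ht : (t : ℝ) ≤ 1 / 2
    · refine ⟨{e | e.2 < 2 / 3}, isOpen_lt continuous_snd continuous_const, ?_, f', hf', ?_⟩
      · change (t : ℝ) < 2 / 3
        linarith
      · rintro ⟨y, s⟩ hs
        have hs : (s : ℝ) < 2 / 3 := hs
        dsimp only
        split_ifs with h
        · rfl
        · rw [hf1 y s (by linarith), hg0 y s hs.le, hfg]
    · refine ⟨{e | 1 / 3 < e.2}, isOpen_lt continuous_const continuous_snd, ?_, g', hg', ?_⟩
      · change 1 / 3 < (t : ℝ)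
        linarith
      · rintro ⟨y, s⟩ hs
        have hs : 1 / 3 < (s : ℝ) := hs
        dsimp only
        split_ifs with h
        · rw [hf1 y s hs.le, hg0 y s (by linarith), hfg]
        · rfl
  · intro x
    have : ((0 : Set.Icc (0 : ℝ) 1) : ℝ) ≤ 1 / 2 := by norm_num
    refine (if_pos this).trans (congrArg f (Prod.ext rfl (Subtype.ext ?_)))
    exact Real.smoothTransition.zero_of_nonpos (by simp)
  · intro x
    have : ¬ ((1 : Set.Icc (0 : ℝ) 1) : ℝ) ≤ 1 / 2 := by norm_num
    refine (if_neg this).trans (congrArg g (Prod.ext rfl (Subtype.ext ?_)))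
    exact Real.smoothTransition.one_of_one_le (by norm_num)

theorem SmoothVia.reverse {i : X → E} {j : Y → F} {f : X × Set.Icc (0 : ℝ) 1 → Y}
    (hf : SmoothVia (timeEmb i) j f) :
    ∃ h : X × Set.Icc (0 : ℝ) 1 → Y, SmoothVia (timeEmb i) j h ∧
      (∀ x, h (x, 0) = f (x, 1)) ∧ ∀ x, h (x, 1) = f (x, 0) := by
  have h1 : ∀ t : Set.Icc (0 : ℝ) 1, 1 - (t : ℝ) ∈ Set.Icc (0 : ℝ) 1 := fun t =>
    ⟨by linarith [t.2.2], by linarith [t.2.1]⟩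
  refine ⟨_, hf.reparam (φ := fun t => 1 - t) (by fun_prop) h1, fun x => ?_, fun x => ?_⟩
  · exact congrArg f (Prod.ext rfl (Subtype.ext (by simp)))
  · exact congrArg f (Prod.ext rfl (Subtype.ext (by simp)))

end Homotopy

end SmoothVia

/-! ### Rapidly decreasing functions -/

/-- The weight `1 + |ω|`. -/
noncomputable def wt {Ω : Type*} [IndexSize Ω] (ω : Ω) : ℝ := 1 + (IndexSize.size ω : ℝ)

section Weight

variable {Ω Ξ : Type*} [IndexSize Ω] [IndexSize Ξ]

theorem one_le_wt (ω : Ω) : 1 ≤ wt ω := by simp [wt]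

theorem wt_pos (ω : Ω) : 0 < wt ω := zero_lt_one.trans_le (one_le_wt ω)

theorem one_le_wt_pow (ω : Ω) (k : ℕ) : 1 ≤ wt ω ^ k := one_le_pow₀ (one_le_wt ω)

theorem wt_pow_le_wt_pow (ω : Ω) {k l : ℕ} (h : k ≤ l) : wt ω ^ k ≤ wt ω ^ l :=
  pow_le_pow_right₀ (one_le_wt ω) h

theorem wt_prod (ω : Ω) (ξ : Ξ) : wt (ω, ξ) = wt ω + wt ξ - 1 := by
  simp only [wt, IndexSize.size, Nat.cast_add]; ring

theorem wt_le_wt_prod_left (ω : Ω) (ξ : Ξ) : wt ω ≤ wt (ω, ξ) := by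
  rw [wt_prod]; linarith [one_le_wt ξ]

theorem wt_le_wt_prod_right (ω : Ω) (ξ : Ξ) : wt ξ ≤ wt (ω, ξ) := by
  rw [wt_prod]; linarith [one_le_wt ω]

theorem wt_prod_le (ω : Ω) (ξ : Ξ) : wt (ω, ξ) ≤ wt ω * wt ξ := by
  rw [wt_prod]; nlinarith [one_le_wt ω, one_le_wt ξ]

end Weight

/-- Index sets on which sufficiently large powers of the weight have summable inverses. -/
class TemperedIndex (Ω : Type*) [IndexSize Ω] : Prop where
  exists_summable : ∃ N : ℕ, Summable fun ω : Ω => (wt ω ^ N)⁻¹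

section TemperedIndex

variable {Ω Ξ : Type*} [IndexSize Ω] [IndexSize Ξ]

instance TemperedIndex.nat : TemperedIndex ℕ := ⟨2, by
  have h := (summable_nat_add_iff 1).2 (Real.summable_nat_pow_inv.2 one_lt_two)
  refine h.congr fun n => ?_
  simp [wt, IndexSize.size, add_comm]⟩

instance TemperedIndex.fin (n : ℕ) : TemperedIndex (Fin n) := ⟨0, (hasSum_fintype _).summable⟩

instance TemperedIndex.sum [TemperedIndex Ω] [TemperedIndex Ξ] : TemperedIndex (Ω ⊕ Ξ) := by
  obtain ⟨M, hM⟩ := TemperedIndex.exists_summable (Ω := Ω)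
  obtain ⟨N, hN⟩ := TemperedIndex.exists_summable (Ω := Ξ)
  refine ⟨M + N, Summable.sum (f := fun ω : Ω ⊕ Ξ => (wt ω ^ (M + N))⁻¹) ?_ ?_⟩
  · refine hM.of_nonneg_of_le (fun ω => ?_) fun ω => ?_
    · exact inv_nonneg.2 (pow_nonneg (wt_pos _).le _)
    · exact inv_anti₀ (pow_pos (wt_pos _) _) (wt_pow_le_wt_pow ω (Nat.le_add_right _ _))
  · refine hN.of_nonneg_of_le (fun ω => ?_) fun ω => ?_
    · exact inv_nonneg.2 (pow_nonneg (wt_pos _).le _)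
    · exact inv_anti₀ (pow_pos (wt_pos _) _) (wt_pow_le_wt_pow ω (Nat.le_add_left _ _))

instance TemperedIndex.prod [TemperedIndex Ω] [TemperedIndex Ξ] : TemperedIndex (Ω × Ξ) := by
  obtain ⟨M, hM⟩ := TemperedIndex.exists_summable (Ω := Ω)
  obtain ⟨N, hN⟩ := TemperedIndex.exists_summable (Ω := Ξ)
  refine ⟨M + N, (hM.mul_of_nonneg hN (fun ω => ?_) fun ω => ?_).of_nonneg_of_le
    (fun ω => ?_) fun ω => ?_⟩
  · exact inv_nonneg.2 (pow_nonneg (wt_pos _).le _)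
  · exact inv_nonneg.2 (pow_nonneg (wt_pos _).le _)
  · exact inv_nonneg.2 (pow_nonneg (wt_pos _).le _)
  · rw [← mul_inv, pow_add]
    refine inv_anti₀ (mul_pos (pow_pos (wt_pos _) _) (pow_pos (wt_pos _) _)) ?_
    exact mul_le_mul (pow_le_pow_left₀ (wt_pos _).le (wt_le_wt_prod_left _ _) _)
      (pow_le_pow_left₀ (wt_pos _).le (wt_le_wt_prod_right _ _) _)
      (pow_nonneg (wt_pos _).le _) (pow_nonneg (wt_pos _).le _)

theorem TemperedIndex.countable (Ω : Type*) [IndexSize Ω] [TemperedIndex Ω] : Countable Ω := by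
  obtain ⟨N, hN⟩ := TemperedIndex.exists_summable (Ω := Ω)
  have h := hN.countable_support
  rw [show Function.support (fun ω : Ω => (wt ω ^ N)⁻¹) = Set.univ from
    Set.eq_univ_of_forall fun ω => inv_ne_zero (pow_ne_zero _ (wt_pos ω).ne')] at h
  exact Set.countable_univ_iff.1 h

/-- An exponent for which the inverse weights are summable. -/
noncomputable def sumExp (Ω : Type*) [IndexSize Ω] [TemperedIndex Ω] : ℕ :=
  (TemperedIndex.exists_summable (Ω := Ω)).choose

theorem summable_inv_wt (Ω : Type*) [IndexSize Ω] [TemperedIndex Ω] :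
    Summable fun ω : Ω => (wt ω ^ sumExp Ω)⁻¹ :=
  (TemperedIndex.exists_summable (Ω := Ω)).choose_spec

/-- The sum of the inverse weights. -/
noncomputable def sumConst (Ω : Type*) [IndexSize Ω] [TemperedIndex Ω] : ℝ :=
  ∑' ω : Ω, (wt ω ^ sumExp Ω)⁻¹

theorem sumConst_nonneg (Ω : Type*) [IndexSize Ω] [TemperedIndex Ω] : 0 ≤ sumConst Ω :=
  tsum_nonneg fun _ => inv_nonneg.2 (pow_nonneg (wt_pos _).le _)

end TemperedIndex

/-- Continuous seminorms. -/
abbrev CSem (V : Type*) [AddCommGroup V] [Module ℝ V] [TopologicalSpace V] :=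
  {p : Seminorm ℝ V // Continuous p}

section RapidFun

variable (Ω : Type*) [IndexSize Ω] (V : Type*) [AddCommGroup V] [Module ℝ V] [TopologicalSpace V]

/-- Rapidly decreasing functions, as a subspace of the space of all functions. -/
def rapidFunSubmodule : Submodule ℝ (Ω → V) where
  carrier := {f | ∀ (p : CSem V) (k : ℕ), ∃ M : ℝ, ∀ ω, wt ω ^ k * p.1 (f ω) ≤ M}
  zero_mem' p k := ⟨0, fun ω => by simp⟩
  add_mem' := by
    intro f g hf hg p k
    obtain ⟨M, hM⟩ := hf p k
    obtain ⟨N, hN⟩ := hg p k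
    refine ⟨M + N, fun ω => ?_⟩
    have h := mul_le_mul_of_nonneg_left (map_add_le_add p.1 (f ω) (g ω))
      (pow_nonneg (wt_pos ω).le k)
    rw [mul_add] at h
    exact h.trans (add_le_add (hM ω) (hN ω))
  smul_mem' := by
    intro c f hf p k
    obtain ⟨M, hM⟩ := hf p k
    refine ⟨‖c‖ * M, fun ω => ?_⟩
    have h := mul_le_mul_of_nonneg_left (hM ω) (norm_nonneg c)
    rw [Pi.smul_apply, map_smul_eq_mul]
    linarith

/-- The space of rapidly decreasing functions. -/
def RapidFun : Type _ := ↥(rapidFunSubmodule Ω V)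

namespace RapidFun

instance : AddCommGroup (RapidFun Ω V) := inferInstanceAs (AddCommGroup ↥(rapidFunSubmodule Ω V))

instance : Module ℝ (RapidFun Ω V) := inferInstanceAs (Module ℝ ↥(rapidFunSubmodule Ω V))

instance : FunLike (RapidFun Ω V) Ω V := ⟨Subtype.val, Subtype.val_injective⟩

variable {Ω V}

/-- Construction of rapidly decreasing functions. -/
def mk (f : Ω → V) (h : ∀ (p : CSem V) (k : ℕ), ∃ M : ℝ, ∀ ω, wt ω ^ k * p.1 (f ω) ≤ M) :
    RapidFun Ω V := ⟨f, h⟩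

@[simp] theorem mk_apply (f : Ω → V) (h) (ω : Ω) : mk f h ω = f ω := rfl

@[ext] theorem ext {f g : RapidFun Ω V} (h : ∀ ω, f ω = g ω) : f = g := DFunLike.ext _ _ h

@[simp] theorem zero_apply (ω : Ω) : (0 : RapidFun Ω V) ω = 0 := rfl

@[simp] theorem add_apply (f g : RapidFun Ω V) (ω : Ω) : (f + g) ω = f ω + g ω := rfl

@[simp] theorem neg_apply (f : RapidFun Ω V) (ω : Ω) : (-f) ω = -f ω := rfl

@[simp] theorem sub_apply (f g : RapidFun Ω V) (ω : Ω) : (f - g) ω = f ω - g ω := rfl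

@[simp] theorem smul_apply (c : ℝ) (f : RapidFun Ω V) (ω : Ω) : (c • f) ω = c • f ω := rfl

variable (Ω) in
/-- The seminorms `f ↦ sup (1 + |ω|) ^ k * p (f ω)`. -/
noncomputable def sem (p : CSem V) (k : ℕ) : Seminorm ℝ (RapidFun Ω V) :=
  Seminorm.of (fun f => ⨆ ω : Ω, wt ω ^ k * p.1 (f ω))
    (by
      intro f g
      have hb : ∀ f : RapidFun Ω V, BddAbove (Set.range fun ω => wt ω ^ k * p.1 (f ω)) := by
        intro f
        obtain ⟨M, hM⟩ := f.2 p k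
        exact ⟨M, by rintro _ ⟨ω, rfl⟩; exact hM ω⟩
      have hn : ∀ f : RapidFun Ω V, 0 ≤ ⨆ ω : Ω, wt ω ^ k * p.1 (f ω) := fun f =>
        Real.iSup_nonneg fun ω => mul_nonneg (pow_nonneg (wt_pos ω).le k) (apply_nonneg _ _)
      refine Real.iSup_le (fun ω => ?_) (add_nonneg (hn f) (hn g))
      have h := mul_le_mul_of_nonneg_left (map_add_le_add p.1 (f ω) (g ω))
        (pow_nonneg (wt_pos ω).le k)
      rw [mul_add] at h
      exact h.trans (add_le_add (le_ciSup (hb f) ω) (le_ciSup (hb g) ω)))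
    (by
      intro c f
      rw [Real.mul_iSup_of_nonneg (norm_nonneg c)]
      refine iSup_congr fun ω => ?_
      rw [smul_apply, map_smul_eq_mul]
      ring)

theorem le_sem (p : CSem V) (k : ℕ) (f : RapidFun Ω V) (ω : Ω) :
    wt ω ^ k * p.1 (f ω) ≤ sem Ω p k f := by
  obtain ⟨M, hM⟩ := f.2 p k
  exact le_ciSup (f := fun ω => wt ω ^ k * p.1 (f ω))
    ⟨M, by rintro _ ⟨ω, rfl⟩; exact hM ω⟩ ω

theorem sem_le {p : CSem V} {k : ℕ} {f : RapidFun Ω V} {M : ℝ} (hM : 0 ≤ M)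
    (h : ∀ ω, wt ω ^ k * p.1 (f ω) ≤ M) : sem Ω p k f ≤ M :=
  Real.iSup_le h hM

theorem apply_le_sem' (p : CSem V) (k : ℕ) (f : RapidFun Ω V) (ω : Ω) :
    p.1 (f ω) ≤ sem Ω p k f :=
  (le_mul_of_one_le_left (apply_nonneg _ _) (one_le_wt_pow ω k)).trans (le_sem p k f ω)

theorem sem_mono {p q : CSem V} {k l : ℕ} (hpq : p.1 ≤ q.1) (hkl : k ≤ l) :
    sem Ω p k ≤ sem Ω q l := by
  intro f
  refine sem_le (apply_nonneg _ _) fun ω => ?_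
  exact (mul_le_mul (wt_pow_le_wt_pow ω hkl) (hpq _) (apply_nonneg _ _)
    (pow_nonneg (wt_pos ω).le _)).trans (le_sem q l f ω)

variable (Ω V) in
/-- The family of all seminorms on rapidly decreasing functions. -/
noncomputable def semFamily : SeminormFamily ℝ (RapidFun Ω V) (CSem V × ℕ) :=
  fun q => sem Ω q.1 q.2

instance : Nonempty (CSem V × ℕ) := ⟨(⟨0, continuous_const⟩, 0)⟩

noncomputable instance : TopologicalSpace (RapidFun Ω V) :=
  (semFamily Ω V).moduleFilterBasis.topology

variable (Ω V) in
theorem withSeminorms : WithSeminorms (semFamily Ω V) := ⟨rfl⟩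

instance : IsTopologicalAddGroup (RapidFun Ω V) := (withSeminorms Ω V).topologicalAddGroup

instance : ContinuousSMul ℝ (RapidFun Ω V) := (withSeminorms Ω V).continuousSMul

instance : PolynormableSpace ℝ (RapidFun Ω V) := (withSeminorms Ω V).toPolynormableSpace

theorem continuous_sem (p : CSem V) (k : ℕ) : Continuous (sem Ω p k) :=
  (withSeminorms Ω V).continuous_seminorm (p, k)

/-- Every continuous seminorm is dominated by one of the defining seminorms. -/
theorem exists_le_sem (s : CSem (RapidFun Ω V)) :
    ∃ (q : CSem V) (l : ℕ) (C : ℝ), 0 ≤ C ∧ ∀ f, s.1 f ≤ C * sem Ω q l f := by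
  obtain ⟨t, C, -, hC⟩ := Seminorm.bound_of_continuous (withSeminorms Ω V) s.1 s.2
  have hdir : ∃ (q : CSem V) (l : ℕ), t.sup (semFamily Ω V) ≤ sem Ω q l := by
    classical
    clear hC
    induction t using Finset.induction_on with
    | empty => exact ⟨⟨0, continuous_const⟩, 0, by simp⟩
    | insert a t ha ih =>
      obtain ⟨q, l, h⟩ := ih
      -- The sum of two seminorms dominates both, which makes the defining family directed.
      refine ⟨⟨q.1 + a.1.1, q.2.add a.1.2⟩, max l a.2, ?_⟩
      rw [Finset.sup_insert]
      refine sup_le (sem_mono ?_ (le_max_right _ _)) (h.trans (sem_mono ?_ (le_max_left _ _)))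
      · exact fun x => le_add_of_nonneg_left (apply_nonneg q.1 x)
      · exact fun x => le_add_of_nonneg_right (apply_nonneg a.1.1 x)
  obtain ⟨q, l, h⟩ := hdir
  refine ⟨q, l, C, C.2, fun f => (hC f).trans ?_⟩
  exact mul_le_mul_of_nonneg_left (h f) C.2

variable {Ω' : Type*} [IndexSize Ω'] {V' : Type*} [AddCommGroup V'] [Module ℝ V']
  [TopologicalSpace V']
  {Ω'' : Type*} [IndexSize Ω''] {V'' : Type*} [AddCommGroup V''] [Module ℝ V'']
  [TopologicalSpace V'']

/-- Continuity of linear maps between spaces of rapidly decreasing functions. -/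
theorem continuous_of_bound (L : RapidFun Ω V →ₗ[ℝ] RapidFun Ω' V')
    (h : ∀ (p : CSem V') (k : ℕ), ∃ (q : CSem V) (l : ℕ) (C : ℝ), ∀ f ω,
      wt ω ^ k * p.1 (L f ω) ≤ C * sem Ω q l f) : Continuous L := by
  refine (withSeminorms Ω V).continuous_of_isBounded (withSeminorms Ω' V') L ?_
  rintro ⟨p, k⟩
  obtain ⟨q, l, C, hC⟩ := h p k
  refine ⟨{(q, l)}, ⟨max C 0, le_max_right _ _⟩, fun f => ?_⟩
  rw [Finset.sup_singleton]
  have hC' : ∀ ω, wt ω ^ k * p.1 (L f ω) ≤ max C 0 * sem Ω q l f := fun ω =>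
    (hC f ω).trans (mul_le_mul_of_nonneg_right (le_max_left _ _) (apply_nonneg _ _))
  exact sem_le (mul_nonneg (le_max_right _ _) (apply_nonneg _ _)) hC'

/-- The increment splits as b(z₁ - f, z₂) + b(f, z₂ - g), and the bound of each part is a continuous
function of (z₁, z₂) which vanishes at (f, g). -/
theorem continuous_bilin_of_bound (b : RapidFun Ω V →ₗ[ℝ] RapidFun Ω' V' →ₗ[ℝ] RapidFun Ω'' V'')
    (h : ∀ (p : CSem V'') (k : ℕ), ∃ (q : CSem V) (l : ℕ) (q' : CSem V') (l' : ℕ) (C : ℝ),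
      ∀ f g ω, wt ω ^ k * p.1 (b f g ω) ≤ C * (sem Ω q l f * sem Ω' q' l' g)) :
    Continuous fun z : RapidFun Ω V × RapidFun Ω' V' => b z.1 z.2 := by
  rw [continuous_iff_continuousAt]
  rintro ⟨f, g⟩
  rw [ContinuousAt, (withSeminorms Ω'' V'').tendsto_nhds]
  rintro ⟨p, k⟩ ε hε
  obtain ⟨q, l, q', l', C, hC⟩ := h p k
  have hC' : ∀ f g, sem Ω'' p k (b f g) ≤ |C| * (sem Ω q l f * sem Ω' q' l' g) := fun f g =>
    sem_le (mul_nonneg (abs_nonneg _) (mul_nonneg (apply_nonneg _ _) (apply_nonneg _ _)))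
      fun ω => (hC f g ω).trans (mul_le_mul_of_nonneg_right (le_abs_self _)
        (mul_nonneg (apply_nonneg _ _) (apply_nonneg _ _)))
  let B : RapidFun Ω V × RapidFun Ω' V' → ℝ := fun z =>
    |C| * (sem Ω q l (z.1 - f) * sem Ω' q' l' z.2) + |C| * (sem Ω q l f * sem Ω' q' l' (z.2 - g))
  have hB : Continuous B := by
    have h1 := (continuous_sem (Ω := Ω) q l)
    have h2 := (continuous_sem (Ω := Ω') q' l')
    have h3 : Continuous fun z : RapidFun Ω V × RapidFun Ω' V' => sem Ω q l (z.1 - f) :=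
      h1.comp (continuous_fst.sub continuous_const)
    have h4 : Continuous fun z : RapidFun Ω V × RapidFun Ω' V' => sem Ω' q' l' (z.2 - g) :=
      h2.comp (continuous_snd.sub continuous_const)
    exact (continuous_const.mul (h3.mul (h2.comp continuous_snd))).add
      (continuous_const.mul (continuous_const.mul h4))
  have hB0 : B (f, g) = 0 := by simp [B]
  have h5 := hB.tendsto (f, g)
  rw [hB0] at h5
  filter_upwards [h5.eventually (gt_mem_nhds hε)] with z hz
  refine lt_of_le_of_lt ?_ hz
  have e : b z.1 z.2 - b f g = b (z.1 - f) z.2 + b f (z.2 - g) := by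
    simp only [map_sub, LinearMap.sub_apply]; abel
  change sem Ω'' p k (b z.1 z.2 - b f g) ≤ _
  rw [e]
  exact (map_add_le_add _ _ _).trans (add_le_add (hC' _ _) (hC' _ _))

/-- Evaluation at a point. -/
noncomputable def eval [PolynormableSpace ℝ V] (ω : Ω) : RapidFun Ω V →L[ℝ] V where
  toFun f := f ω
  map_add' _ _ := rfl
  map_smul' _ _ := rfl
  cont := by
    refine (PolynormableSpace.withSeminorms ℝ V).continuous_of_continuous_comp
      ({ toFun := fun f => f ω, map_add' := fun _ _ => rfl, map_smul' := fun _ _ => rfl } :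
        RapidFun Ω V →ₗ[ℝ] V) fun p => ?_
    exact Seminorm.continuous_of_le (continuous_sem p 0) fun f => apply_le_sem' p 0 f ω

@[simp] theorem eval_apply [PolynormableSpace ℝ V] (ω : Ω) (f : RapidFun Ω V) :
    eval ω f = f ω := rfl

/-- Construction of continuous linear maps from a bound. -/
noncomputable def mkCLM (T : RapidFun Ω V → Ω' → V') (hadd : ∀ f g ω, T (f + g) ω = T f ω + T g ω)
    (hsmul : ∀ (c : ℝ) f ω, T (c • f) ω = c • T f ω)
    (h : ∀ (p : CSem V') (k : ℕ), ∃ (q : CSem V) (l : ℕ) (C : ℝ), ∀ f ω,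
      wt ω ^ k * p.1 (T f ω) ≤ C * sem Ω q l f) : RapidFun Ω V →L[ℝ] RapidFun Ω' V' where
  toFun f := mk (T f) fun p k => by
    obtain ⟨q, l, C, hC⟩ := h p k
    exact ⟨_, fun ω => hC f ω⟩
  map_add' f g := ext fun ω => hadd f g ω
  map_smul' c f := ext fun ω => hsmul c f ω
  cont := continuous_of_bound
    { toFun := fun f => mk (T f) fun p k => by
        obtain ⟨q, l, C, hC⟩ := h p k
        exact ⟨_, fun ω => hC f ω⟩
      map_add' := fun f g => ext fun ω => hadd f g ω
      map_smul' := fun c f => ext fun ω => hsmul c f ω } h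

@[simp] theorem mkCLM_apply (T : RapidFun Ω V → Ω' → V') (h1) (h2) (h3) (f : RapidFun Ω V)
    (ω : Ω') : mkCLM T h1 h2 h3 f ω = T f ω := rfl

/-- Construction of bilinear maps from a bound. -/
noncomputable def mkBilin (b : RapidFun Ω V → RapidFun Ω' V' → Ω'' → V'')
    (hal : ∀ f f' g ω, b (f + f') g ω = b f g ω + b f' g ω)
    (hsl : ∀ (c : ℝ) f g ω, b (c • f) g ω = c • b f g ω)
    (har : ∀ f g g' ω, b f (g + g') ω = b f g ω + b f g' ω)
    (hsr : ∀ (c : ℝ) f g ω, b f (c • g) ω = c • b f g ω)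
    (h : ∀ (p : CSem V'') (k : ℕ), ∃ (q : CSem V) (l : ℕ) (q' : CSem V') (l' : ℕ) (C : ℝ),
      ∀ f g ω, wt ω ^ k * p.1 (b f g ω) ≤ C * (sem Ω q l f * sem Ω' q' l' g)) :
    RapidFun Ω V →ₗ[ℝ] RapidFun Ω' V' →ₗ[ℝ] RapidFun Ω'' V'' :=
  LinearMap.mk₂ ℝ (fun f g => mk (b f g) fun p k => by
    obtain ⟨q, l, q', l', C, hC⟩ := h p k
    exact ⟨_, fun ω => hC f g ω⟩)
    (fun f f' g => ext fun ω => hal f f' g ω) (fun c f g => ext fun ω => hsl c f g ω)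
    (fun f g g' => ext fun ω => har f g g' ω) (fun c f g => ext fun ω => hsr c f g ω)

@[simp] theorem mkBilin_apply (b : RapidFun Ω V → RapidFun Ω' V' → Ω'' → V'') (h1) (h2) (h3) (h4)
    (h5) (f : RapidFun Ω V) (g : RapidFun Ω' V') (ω : Ω'') :
    mkBilin b h1 h2 h3 h4 h5 f g ω = b f g ω := rfl

theorem continuous_mkBilin (b : RapidFun Ω V → RapidFun Ω' V' → Ω'' → V'') (h1) (h2) (h3) (h4)
    (h5) : Continuous fun z : RapidFun Ω V × RapidFun Ω' V' => mkBilin b h1 h2 h3 h4 h5 z.1 z.2 :=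
  continuous_bilin_of_bound _ h5

/-- Application of a continuous linear map to the values. -/
noncomputable def map (L : V →L[ℝ] V') : RapidFun Ω V →L[ℝ] RapidFun Ω V' :=
  mkCLM (fun f ω => L (f ω)) (by simp) (by simp) fun p k =>
    ⟨⟨p.1.comp L.toLinearMap, p.2.comp L.continuous⟩, k, 1, fun f ω => by
      rw [one_mul]
      exact le_sem ⟨p.1.comp L.toLinearMap, p.2.comp L.continuous⟩ k f ω⟩

@[simp] theorem map_apply (L : V →L[ℝ] V') (f : RapidFun Ω V) (ω : Ω) : map L f ω = L (f ω) := rfl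

end RapidFun

end RapidFun

/-! ### Tempered injections -/

/-- Injective maps which distort the sizes at most polynomially. -/
structure IsTempered {Ω Ω' : Type*} [IndexSize Ω] [IndexSize Ω'] (r : Ω → Ω') : Prop where
  injective : Function.Injective r
  upper : ∃ (C : ℝ) (k : ℕ), ∀ ω, wt (r ω) ≤ C * wt ω ^ k
  lower : ∃ (C : ℝ) (k : ℕ), ∀ ω, wt ω ≤ C * wt (r ω) ^ k

section IsTempered

variable {Ω Ω' Ω'' Ξ Ξ' : Type*} [IndexSize Ω] [IndexSize Ω'] [IndexSize Ω''] [IndexSize Ξ]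
  [IndexSize Ξ']

theorem exists_wt_pow_le {r : Ω → Ω'} (h : ∃ (C : ℝ) (k : ℕ), ∀ ω, wt (r ω) ≤ C * wt ω ^ k)
    (m : ℕ) : ∃ (C : ℝ) (k : ℕ), ∀ ω, wt (r ω) ^ m ≤ C * wt ω ^ k := by
  obtain ⟨C, k, h⟩ := h
  refine ⟨C ^ m, k * m, fun ω => ?_⟩
  rw [pow_mul, ← mul_pow]
  exact pow_le_pow_left₀ (wt_pos _).le (h ω) m

theorem exists_wt_pow_le' {r : Ω → Ω'} (h : ∃ (C : ℝ) (k : ℕ), ∀ ω, wt ω ≤ C * wt (r ω) ^ k)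
    (m : ℕ) : ∃ (C : ℝ) (k : ℕ), ∀ ω, wt ω ^ m ≤ C * wt (r ω) ^ k := by
  obtain ⟨C, k, h⟩ := h
  refine ⟨C ^ m, k * m, fun ω => ?_⟩
  rw [pow_mul, ← mul_pow]
  exact pow_le_pow_left₀ (wt_pos _).le (h ω) m

/-- A map is tempered if it is injective and the sizes are bounded through each other. -/
theorem IsTempered.of_le {r : Ω → Ω'} (hr : Function.Injective r) (C : ℝ)
    (h1 : ∀ ω, wt (r ω) ≤ C * wt ω) (h2 : ∀ ω, wt ω ≤ C * wt (r ω)) : IsTempered r :=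
  ⟨hr, ⟨C, 1, fun ω => by simpa using h1 ω⟩, ⟨C, 1, fun ω => by simpa using h2 ω⟩⟩

theorem IsTempered.of_eq {r : Ω → Ω'} (hr : Function.Injective r)
    (h : ∀ ω, IndexSize.size (r ω) = IndexSize.size ω) : IsTempered r :=
  .of_le hr 1 (fun ω => by simp [wt, h]) fun ω => by simp [wt, h]

theorem IsTempered.comp {s : Ω' → Ω''} {r : Ω → Ω'} (hs : IsTempered s) (hr : IsTempered r) :
    IsTempered (s ∘ r) := by
  refine ⟨hs.injective.comp hr.injective, ?_, ?_⟩
  · obtain ⟨C, k, h⟩ := hs.upper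
    obtain ⟨D, l, h'⟩ := exists_wt_pow_le hr.upper k
    refine ⟨max C 0 * D, l, fun ω => ?_⟩
    rw [mul_assoc]
    exact (h (r ω)).trans ((mul_le_mul_of_nonneg_right (le_max_left C 0)
      (pow_nonneg (wt_pos _).le _)).trans (mul_le_mul_of_nonneg_left (h' ω) (le_max_right _ _)))
  · obtain ⟨C, k, h⟩ := hr.lower
    obtain ⟨D, l, h'⟩ := exists_wt_pow_le' hs.lower k
    refine ⟨max C 0 * D, l, fun ω => ?_⟩
    rw [mul_assoc]
    exact (h ω).trans ((mul_le_mul_of_nonneg_right (le_max_left C 0)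
      (pow_nonneg (wt_pos _).le _)).trans
        (mul_le_mul_of_nonneg_left (h' (r ω)) (le_max_right _ _)))

theorem IsTempered.prodMap {r : Ω → Ω'} {s : Ξ → Ξ'} (hr : IsTempered r) (hs : IsTempered s) :
    IsTempered (Prod.map r s) := by
  refine ⟨hr.injective.prodMap hs.injective, ?_, ?_⟩
  · obtain ⟨C, k, h⟩ := hr.upper
    obtain ⟨D, l, h'⟩ := hs.upper
    refine ⟨C * D, k + l, fun ω => (wt_prod_le _ _).trans ?_⟩
    calc wt (r ω.1) * wt (s ω.2) ≤ (C * wt ω.1 ^ k) * (D * wt ω.2 ^ l) :=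
          mul_le_mul (h _) (h' _) (wt_pos _).le ((wt_pos _).le.trans (h _))
      _ = (C * D) * (wt ω.1 ^ k * wt ω.2 ^ l) := by ring
      _ ≤ (C * D) * wt ω ^ (k + l) := by
          have hC : 0 < C := pos_of_mul_pos_left ((wt_pos _).trans_le (h ω.1))
            (pow_nonneg (wt_pos _).le _)
          have hD : 0 < D := pos_of_mul_pos_left ((wt_pos _).trans_le (h' ω.2))
            (pow_nonneg (wt_pos _).le _)
          refine mul_le_mul_of_nonneg_left ?_ (mul_pos hC hD).le
          rw [pow_add]
          exact mul_le_mul (pow_le_pow_left₀ (wt_pos _).le (wt_le_wt_prod_left _ _) _)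
            (pow_le_pow_left₀ (wt_pos _).le (wt_le_wt_prod_right _ _) _)
            (pow_nonneg (wt_pos _).le _) (pow_nonneg (wt_pos _).le _)
  · obtain ⟨C, k, h⟩ := hr.lower
    obtain ⟨D, l, h'⟩ := hs.lower
    refine ⟨C * D, k + l, fun ω => (wt_prod_le ω.1 ω.2).trans ?_⟩
    calc wt ω.1 * wt ω.2 ≤ (C * wt (r ω.1) ^ k) * (D * wt (s ω.2) ^ l) :=
          mul_le_mul (h _) (h' _) (wt_pos _).le ((wt_pos _).le.trans (h _))
      _ = (C * D) * (wt (r ω.1) ^ k * wt (s ω.2) ^ l) := by ring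
      _ ≤ (C * D) * wt (Prod.map r s ω) ^ (k + l) := by
          have hC : 0 < C := pos_of_mul_pos_left ((wt_pos _).trans_le (h ω.1))
            (pow_nonneg (wt_pos _).le _)
          have hD : 0 < D := pos_of_mul_pos_left ((wt_pos _).trans_le (h' ω.2))
            (pow_nonneg (wt_pos _).le _)
          refine mul_le_mul_of_nonneg_left ?_ (mul_pos hC hD).le
          rw [pow_add]
          exact mul_le_mul (pow_le_pow_left₀ (wt_pos _).le (wt_le_wt_prod_left _ _) _)
            (pow_le_pow_left₀ (wt_pos _).le (wt_le_wt_prod_right _ _) _)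
            (pow_nonneg (wt_pos _).le _) (pow_nonneg (wt_pos _).le _)

theorem IsTempered.id : IsTempered (id : Ω → Ω) := .of_eq Function.injective_id fun _ => rfl

theorem IsTempered.inl : IsTempered (Sum.inl : Ω → Ω ⊕ Ξ) := .of_eq Sum.inl_injective fun _ => rfl

theorem IsTempered.inr : IsTempered (Sum.inr : Ξ → Ω ⊕ Ξ) := .of_eq Sum.inr_injective fun _ => rfl

theorem IsTempered.swap : IsTempered (Prod.swap : Ω × Ξ → Ξ × Ω) :=
  .of_eq Prod.swap_injective fun _ => Nat.add_comm _ _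

theorem IsTempered.assoc : IsTempered (fun z : (Ω × Ξ) × Ξ' => (z.1.1, (z.1.2, z.2))) :=
  .of_eq (Equiv.prodAssoc Ω Ξ Ξ').injective fun _ => (Nat.add_assoc _ _ _).symm

theorem IsTempered.assoc_symm : IsTempered (fun z : Ω × (Ξ × Ξ') => ((z.1, z.2.1), z.2.2)) :=
  .of_eq (Equiv.prodAssoc Ω Ξ Ξ').symm.injective fun _ => Nat.add_assoc _ _ _

theorem IsTempered.pair {n : ℕ} (i : Fin n) : IsTempered (fun ω : Ω => (i, ω)) :=
  .of_eq (Prod.mk_right_injective i) fun _ => Nat.zero_add _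

/-- The weights are themselves functions of polynomial growth: pulling back the weight of the target
bounds `wt (r ω)`, and writing the weight of the source as a pullback bounds `wt ω`. -/
theorem IsRelabeling.isTempered {r : Ω → Ω'} (hr : IsRelabeling r) : IsTempered r := by
  refine ⟨hr.injective, ?_, ?_⟩
  · have h : (fun ω => wt (r ω)) ∈ polyGrowth Ω := by
      rw [← hr.pullback]
      exact ⟨fun ω => wt ω, ⟨1, 1, fun ω => by rw [abs_of_pos (wt_pos ω), one_mul, pow_one, wt]⟩, rfl⟩
    obtain ⟨C, k, h⟩ := h
    exact ⟨C, k, fun ω => (le_abs_self _).trans (h ω)⟩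
  · have h : (fun ω : Ω => wt ω) ∈ polyGrowth Ω := ⟨1, 1, fun ω => by
      rw [abs_of_pos (wt_pos ω), one_mul, pow_one, wt]⟩
    rw [← hr.pullback] at h
    obtain ⟨g, ⟨C, k, hg⟩, h⟩ := h
    refine ⟨C, k, fun ω => ?_⟩
    rw [show wt ω = g (r ω) from congrFun h ω]
    exact (le_abs_self _).trans (hg _)

end IsTempered

set_option linter.unusedSectionVars false

/-! ### Absolutely convergent series -/

/-- Spaces in which absolutely convergent sequences are summable. -/
class AbsSummableSpace (V : Type*) [AddCommGroup V] [Module ℝ V] [TopologicalSpace V] : Prop where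
  summable_nat : ∀ f : ℕ → V, (∀ p : CSem V, Summable fun n => p.1 (f n)) → Summable f

section Summation

variable {V : Type*} [AddCommGroup V] [Module ℝ V] [TopologicalSpace V]

/-- A countable index set is injected into ℕ, and the family is extended by zero. -/
theorem AbsSummableSpace.summable [AbsSummableSpace V] {ι : Type*} [Countable ι] {f : ι → V}
    (hf : ∀ p : CSem V, Summable fun n => p.1 (f n)) : Summable f := by
  obtain ⟨e, he⟩ := Countable.exists_injective_nat ι
  have h0 : ∀ x ∉ Set.range e, Function.extend e f 0 x = 0 := fun x hx => by
    rw [Function.extend_apply' _ _ _ (by simpa using hx)]; rfl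
  have h : Summable (Function.extend e f 0) := by
    refine AbsSummableSpace.summable_nat _ fun p => ?_
    have h1 := (he.summable_iff (f := fun n => p.1 (Function.extend e f 0 n))
      (fun x hx => by rw [h0 x hx, map_zero])).1
    refine h1 ((hf p).congr fun n => ?_)
    simp [he.extend_apply]
  have h2 := (he.summable_iff h0).2 h
  refine h2.congr fun n => ?_
  simp [he.extend_apply]

theorem Seminorm.map_sum_le (p : Seminorm ℝ V) {ι : Type*} (s : Finset ι) (f : ι → V) :
    p (∑ i ∈ s, f i) ≤ ∑ i ∈ s, p (f i) :=
  Finset.le_sum_of_subadditive p (map_zero p).le (map_add_le_add p) s f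

theorem Seminorm.tsum_le {p : CSem V} {ι : Type*} {f : ι → V} {c : ι → ℝ} (hf : Summable f)
    (hc : Summable c) (h : ∀ i, p.1 (f i) ≤ c i) : p.1 (∑' i, f i) ≤ ∑' i, c i := by
  have h1 : Tendsto (fun s : Finset ι => p.1 (∑ i ∈ s, f i)) atTop (𝓝 (p.1 (∑' i, f i))) :=
    (p.2.tendsto _).comp hf.hasSum
  refine le_of_tendsto' h1 fun s => (p.1.map_sum_le s f).trans ?_
  exact (Finset.sum_le_sum fun i _ => h i).trans
    (hc.sum_le_tsum s fun i _ => (apply_nonneg _ _).trans (h i))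

/-- By joint continuity at 0, a product of two elements of some seminorm ball lies in the unit ball
of `p`; homogeneity turns this into a bilinear estimate. It is the only way in which continuity of
multiplication enters the matrix estimates. -/
theorem Seminorm.exists_mul_le {V : Type*} [NonUnitalCommRing V] [Module ℝ V]
    [IsScalarTower ℝ V V] [SMulCommClass ℝ V V] [TopologicalSpace V] [IsTopologicalRing V]
    [PolynormableSpace ℝ V] (p : CSem V) : ∃ q : CSem V, ∀ x y, p.1 (x * y) ≤ q.1 x * q.1 y := by
  have h1 : ∀ᶠ z : V × V in 𝓝 (0, 0), p.1 (z.1 * z.2) < 1 := by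
    have : Continuous fun z : V × V => p.1 (z.1 * z.2) := p.2.comp continuous_mul
    have h := this.tendsto (0, 0)
    simp only [mul_zero, map_zero] at h
    exact h.eventually (gt_mem_nhds one_pos)
  obtain ⟨A, hA, B, hB, hAB⟩ := mem_nhds_prod_iff.1 h1
  obtain ⟨s, r, hr, hs⟩ := ((PolynormableSpace.withSeminorms ℝ V).mem_nhds_iff 0 (A ∩ B)).1
    (inter_mem hA hB)
  let q0 : Seminorm ℝ V := s.sup fun p : CSem V => p.1
  have hq0 : Continuous q0 := Seminorm.continuous_finsetSup fun i _ => i.2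
  have hq : ∀ x, (Real.toNNReal r⁻¹ • q0) x = r⁻¹ * q0 x := fun x => by
    rw [_root_.smul_apply, NNReal.smul_def, Real.coe_toNNReal _ (inv_nonneg.2 hr.le), smul_eq_mul]
  refine ⟨⟨Real.toNNReal r⁻¹ • q0, hq0.const_smul (Real.toNNReal r⁻¹)⟩, ?_⟩
  have hmem : ∀ x, r⁻¹ * q0 x < 1 → x ∈ A ∩ B := fun x hx => hs (by
    rw [Seminorm.mem_ball, sub_zero]
    rwa [inv_mul_lt_iff₀ hr, mul_one] at hx)
  have key : ∀ x y (a b : ℝ), r⁻¹ * q0 x < a → r⁻¹ * q0 y < b → p.1 (x * y) ≤ a * b := by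
    intro x y a b hxa hyb
    have h0 : ∀ x, 0 ≤ r⁻¹ * q0 x := fun x => mul_nonneg (inv_nonneg.2 hr.le) (apply_nonneg _ _)
    have ha : 0 < a := (h0 x).trans_lt hxa
    have hb : 0 < b := (h0 y).trans_lt hyb
    have hsc : ∀ (x : V) (a : ℝ), 0 < a → r⁻¹ * q0 x < a → r⁻¹ * q0 (a⁻¹ • x) < 1 := by
      intro x a ha hxa
      rw [map_smul_eq_mul, norm_inv, Real.norm_of_nonneg ha.le, mul_left_comm,
        inv_mul_lt_iff₀ ha, mul_one]
      exact hxa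
    have h2 : p.1 ((a⁻¹ • x) * (b⁻¹ • y)) < 1 :=
      hAB (Set.mk_mem_prod (hmem _ (hsc x a ha hxa)).1 (hmem _ (hsc y b hb hyb)).2)
    rw [smul_mul_smul_comm, map_smul_eq_mul, ← mul_inv, norm_inv,
      Real.norm_of_nonneg (mul_pos ha hb).le, inv_mul_lt_iff₀ (mul_pos ha hb), mul_one] at h2
    exact h2.le
  intro x y
  simp only [hq]
  -- The seminorms may vanish at `x` or `y`, so the elements are scaled by slightly larger numbers,
  -- and the excess tends to 0 afterwards.
  have h3 : Tendsto (fun ε : ℝ => (r⁻¹ * q0 x + ε) * (r⁻¹ * q0 y + ε)) (𝓝[>] 0)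
      (𝓝 ((r⁻¹ * q0 x + 0) * (r⁻¹ * q0 y + 0))) := by
    have : Continuous fun ε : ℝ => (r⁻¹ * q0 x + ε) * (r⁻¹ * q0 y + ε) := by fun_prop
    exact (this.tendsto 0).mono_left nhdsWithin_le_nhds
  rw [add_zero, add_zero] at h3
  refine ge_of_tendsto h3 ?_
  filter_upwards [self_mem_nhdsWithin] with ε hε
  have hε : 0 < ε := hε
  exact key x y _ _ (by linarith) (by linarith)

variable {Ω : Type*} [IndexSize Ω] [TemperedIndex Ω]

theorem summable_of_wt_bound [AbsSummableSpace V] {f : Ω → V}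
    (h : ∀ p : CSem V, ∃ M : ℝ, ∀ ω, p.1 (f ω) ≤ M * (wt ω ^ sumExp Ω)⁻¹) : Summable f := by
  have := TemperedIndex.countable Ω
  refine AbsSummableSpace.summable fun p => ?_
  obtain ⟨M, hM⟩ := h p
  exact ((summable_inv_wt Ω).mul_left M).of_nonneg_of_le (fun _ => apply_nonneg _ _) hM

theorem Seminorm.tsum_le_of_wt_bound {f : Ω → V} (hf : Summable f) {p : CSem V} {M : ℝ}
    (h : ∀ ω, p.1 (f ω) ≤ M * (wt ω ^ sumExp Ω)⁻¹) : p.1 (∑' ω, f ω) ≤ M * sumConst Ω := by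
  rw [sumConst, ← tsum_mul_left]
  exact Seminorm.tsum_le hf ((summable_inv_wt Ω).mul_left M) h

end Summation

namespace RapidFun

/-! ### Change of indices -/

section Indices

variable {Ω Ω' Ω'' : Type*} [IndexSize Ω] [IndexSize Ω'] [IndexSize Ω''] {V : Type*}
  [AddCommGroup V] [Module ℝ V] [TopologicalSpace V]

/-- Composition with a tempered injection. -/
noncomputable def pull {r : Ω → Ω'} (hr : IsTempered r) : RapidFun Ω' V →L[ℝ] RapidFun Ω V :=
  mkCLM (fun f ω => f (r ω)) (fun _ _ _ => rfl) (fun _ _ _ => rfl) fun p k => by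
    obtain ⟨C, l, h⟩ := exists_wt_pow_le' hr.lower k
    refine ⟨p, l, max C 0, fun f ω => ?_⟩
    calc wt ω ^ k * p.1 (f (r ω)) ≤ (max C 0 * wt (r ω) ^ l) * p.1 (f (r ω)) := by
          refine mul_le_mul_of_nonneg_right ((h ω).trans ?_) (apply_nonneg _ _)
          exact mul_le_mul_of_nonneg_right (le_max_left _ _) (pow_nonneg (wt_pos _).le _)
      _ = max C 0 * (wt (r ω) ^ l * p.1 (f (r ω))) := by ring
      _ ≤ _ := mul_le_mul_of_nonneg_left (le_sem p l f _) (le_max_right _ _)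

@[simp] theorem pull_apply {r : Ω → Ω'} (hr : IsTempered r) (f : RapidFun Ω' V) (ω : Ω) :
    pull hr f ω = f (r ω) := rfl

/-- Extension by zero along a tempered injection. -/
noncomputable def rel {r : Ω → Ω'} (hr : IsTempered r) : RapidFun Ω V →L[ℝ] RapidFun Ω' V :=
  mkCLM (fun f => Function.extend r f 0)
    (fun f g ω => by
      by_cases h : ∃ a, r a = ω
      · obtain ⟨a, rfl⟩ := h
        simp [hr.injective.extend_apply]
      · simp [Function.extend_apply' _ _ _ h])
    (fun c f ω => by
      by_cases h : ∃ a, r a = ω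
      · obtain ⟨a, rfl⟩ := h
        simp [hr.injective.extend_apply]
      · simp [Function.extend_apply' _ _ _ h]) fun p k => by
    obtain ⟨C, l, h⟩ := exists_wt_pow_le hr.upper k
    refine ⟨p, l, max C 0, fun f ω => ?_⟩
    by_cases hω : ∃ a, r a = ω
    · obtain ⟨a, rfl⟩ := hω
      rw [hr.injective.extend_apply]
      calc wt (r a) ^ k * p.1 (f a) ≤ (max C 0 * wt a ^ l) * p.1 (f a) := by
            refine mul_le_mul_of_nonneg_right ((h a).trans ?_) (apply_nonneg _ _)
            exact mul_le_mul_of_nonneg_right (le_max_left _ _) (pow_nonneg (wt_pos _).le _)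
        _ = max C 0 * (wt a ^ l * p.1 (f a)) := by ring
        _ ≤ _ := mul_le_mul_of_nonneg_left (le_sem p l f _) (le_max_right _ _)
    · rw [Function.extend_apply' _ _ _ hω, Pi.zero_apply, map_zero, mul_zero]
      exact mul_nonneg (le_max_right _ _) (apply_nonneg _ _)

@[simp] theorem rel_apply {r : Ω → Ω'} (hr : IsTempered r) (f : RapidFun Ω V) (ω : Ω) :
    rel hr f (r ω) = f ω := hr.injective.extend_apply _ _ _

theorem rel_apply_eq_zero {r : Ω → Ω'} (hr : IsTempered r) (f : RapidFun Ω V) {ω : Ω'}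
    (h : ∀ a, r a ≠ ω) : rel hr f ω = 0 :=
  Function.extend_apply' _ _ _ (by rintro ⟨a, ha⟩; exact h a ha)

end Indices

/-! ### Products -/

section Products

variable {Ω Ω' Ξ Ξ' : Type*} [IndexSize Ω] [IndexSize Ω'] [IndexSize Ξ] [IndexSize Ξ'] {V : Type*}
  [NonUnitalCommRing V] [Module ℝ V] [IsScalarTower ℝ V V] [SMulCommClass ℝ V V]
  [TopologicalSpace V] [IsTopologicalRing V] [PolynormableSpace ℝ V]

/-- The exterior product `(ω, ξ) ↦ f ω * g ξ`. -/
noncomputable def ext₂ : RapidFun Ω V →ₗ[ℝ] RapidFun Ξ V →ₗ[ℝ] RapidFun (Ω × Ξ) V :=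
  mkBilin (fun f g z => f z.1 * g z.2) (by simp [add_mul])
    (fun c f g z => smul_mul_assoc c (f z.1) (g z.2)) (by simp [mul_add])
    (fun c f g z => mul_smul_comm c (f z.1) (g z.2))
    fun p k => by
      obtain ⟨q, hq⟩ := Seminorm.exists_mul_le p
      refine ⟨q, k, q, k, 1, fun f g z => ?_⟩
      calc wt z ^ k * p.1 (f z.1 * g z.2)
          ≤ (wt z.1 * wt z.2) ^ k * (q.1 (f z.1) * q.1 (g z.2)) :=
            mul_le_mul (pow_le_pow_left₀ (wt_pos _).le (wt_prod_le z.1 z.2) _) (hq _ _)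
              (apply_nonneg _ _) (pow_nonneg (mul_nonneg (wt_pos _).le (wt_pos _).le) _)
        _ = (wt z.1 ^ k * q.1 (f z.1)) * (wt z.2 ^ k * q.1 (g z.2)) := by ring
        _ ≤ sem Ω q k f * sem Ξ q k g := mul_le_mul (le_sem _ _ _ _) (le_sem _ _ _ _)
            (mul_nonneg (pow_nonneg (wt_pos _).le _) (apply_nonneg _ _)) (apply_nonneg _ _)
        _ = _ := (one_mul _).symm

@[simp] theorem ext₂_apply (f : RapidFun Ω V) (g : RapidFun Ξ V) (z : Ω × Ξ) :
    ext₂ f g z = f z.1 * g z.2 := rfl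

theorem continuous_ext₂ :
    Continuous fun z : RapidFun Ω V × RapidFun Ξ V => ext₂ z.1 z.2 :=
  continuous_mkBilin _ _ _ _ _ _

variable [TemperedIndex Ω] [AbsSummableSpace V]

/-- The weights at the outer indices come from the two factors separately. The second factor is
measured with `sumExp Ω` additional powers, which are spent on summability over the inner index. -/
theorem mul_wt_bound {p q : CSem V} (hq : ∀ x y, p.1 (x * y) ≤ q.1 x * q.1 y) {k : ℕ}
    (A : RapidFun (Ω' × Ω) V) (B : RapidFun (Ω × Ξ) V) (i : Ω') (ξ : Ξ) (ω : Ω) :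
    p.1 (A (i, ω) * B (ω, ξ)) ≤ (wt i ^ k * wt ξ ^ k)⁻¹ *
      (sem _ q k A * sem _ q (k + sumExp Ω) B) * (wt ω ^ sumExp Ω)⁻¹ := by
  have hi : 0 < wt i ^ k := pow_pos (wt_pos _) _
  have hξ : 0 < wt ξ ^ k := pow_pos (wt_pos _) _
  have hω : 0 < wt ω ^ sumExp Ω := pow_pos (wt_pos _) _
  have h1 : wt i ^ k * q.1 (A (i, ω)) ≤ sem _ q k A :=
    (mul_le_mul_of_nonneg_right (pow_le_pow_left₀ (wt_pos _).le (wt_le_wt_prod_left i ω) k)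
      (apply_nonneg _ _)).trans (le_sem q k A (i, ω))
  have h2 : (wt ξ ^ k * wt ω ^ sumExp Ω) * q.1 (B (ω, ξ)) ≤ sem _ q (k + sumExp Ω) B := by
    refine (mul_le_mul_of_nonneg_right ?_ (apply_nonneg _ _)).trans (le_sem q _ B (ω, ξ))
    rw [pow_add]
    exact mul_le_mul (pow_le_pow_left₀ (wt_pos _).le (wt_le_wt_prod_right _ _) _)
      (pow_le_pow_left₀ (wt_pos _).le (wt_le_wt_prod_left _ _) _) hω.le
      (pow_nonneg (wt_pos _).le _)
  refine (hq _ _).trans ?_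
  rw [inv_mul_eq_div, ← div_eq_mul_inv, div_div, le_div_iff₀ (by positivity)]
  calc _ = (wt i ^ k * q.1 (A (i, ω))) * ((wt ξ ^ k * wt ω ^ sumExp Ω) * q.1 (B (ω, ξ))) := by ring
    _ ≤ _ := mul_le_mul h1 h2 (by positivity) (apply_nonneg _ _)

theorem summable_mul (A : RapidFun (Ω' × Ω) V) (B : RapidFun (Ω × Ξ) V) (i : Ω') (ξ : Ξ) :
    Summable fun ω => A (i, ω) * B (ω, ξ) := by
  refine summable_of_wt_bound fun p => ?_
  obtain ⟨q, hq⟩ := Seminorm.exists_mul_le p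
  exact ⟨_, mul_wt_bound hq (k := 0) A B i ξ⟩

variable [T2Space V]

/-- The product of rectangular matrices. -/
noncomputable def kmul :
    RapidFun (Ω' × Ω) V →ₗ[ℝ] RapidFun (Ω × Ξ) V →ₗ[ℝ] RapidFun (Ω' × Ξ) V :=
  mkBilin (fun A B z => ∑' ω, A (z.1, ω) * B (ω, z.2))
    (fun A A' B z => by
      simp only [add_apply, add_mul]
      exact (summable_mul A B z.1 z.2).tsum_add (summable_mul A' B z.1 z.2))
    (fun c A B z => by
      have := (PolynormableSpace.withSeminorms ℝ V).continuousSMul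
      simp only [smul_apply, smul_mul_assoc]
      exact (summable_mul A B z.1 z.2).tsum_const_smul c)
    (fun A B B' z => by
      simp only [add_apply, mul_add]
      exact (summable_mul A B z.1 z.2).tsum_add (summable_mul A B' z.1 z.2))
    (fun c A B z => by
      have := (PolynormableSpace.withSeminorms ℝ V).continuousSMul
      simp only [smul_apply, mul_smul_comm]
      exact (summable_mul A B z.1 z.2).tsum_const_smul c) fun p k => by
      obtain ⟨q, hq⟩ := Seminorm.exists_mul_le p
      refine ⟨q, k, q, k + sumExp Ω, sumConst Ω, fun A B z => ?_⟩
      have h := Seminorm.tsum_le_of_wt_bound (summable_mul A B z.1 z.2)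
        (mul_wt_bound hq (k := k) A B z.1 z.2)
      have hi : 0 < wt z.1 ^ k := pow_pos (wt_pos _) _
      have hξ : 0 < wt z.2 ^ k := pow_pos (wt_pos _) _
      calc wt z ^ k * p.1 (∑' ω, A (z.1, ω) * B (ω, z.2))
          ≤ (wt z.1 * wt z.2) ^ k * _ :=
            mul_le_mul (pow_le_pow_left₀ (wt_pos _).le (wt_prod_le z.1 z.2) _) h
              (apply_nonneg _ _) (pow_nonneg (mul_nonneg (wt_pos _).le (wt_pos _).le) _)
        _ = _ := by rw [mul_pow]; field_simp

@[simp] theorem kmul_apply (A : RapidFun (Ω' × Ω) V) (B : RapidFun (Ω × Ξ) V) (z : Ω' × Ξ) :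
    kmul A B z = ∑' ω, A (z.1, ω) * B (ω, z.2) := rfl

theorem continuous_kmul :
    Continuous fun z : RapidFun (Ω' × Ω) V × RapidFun (Ω × Ξ) V => kmul z.1 z.2 :=
  continuous_mkBilin _ _ _ _ _ _

end Products

end RapidFun

/-! ### Scalar kernels -/

/-- Matrices of real numbers which act on rapidly decreasing functions. -/
def temperedKernel (Ω' Ω : Type*) [IndexSize Ω'] [IndexSize Ω] :
    Submodule ℝ (Ω' → Ω → ℝ) where
  carrier := {g | ∀ k : ℕ, ∃ (C : ℝ) (l : ℕ), ∀ i j, wt i ^ k * |g i j| ≤ C * wt j ^ l}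
  zero_mem' k := ⟨0, 0, fun i j => by simp⟩
  add_mem' := by
    intro g h hg hh k
    obtain ⟨C, l, hC⟩ := hg k
    obtain ⟨D, m, hD⟩ := hh k
    refine ⟨max C 0 + max D 0, l + m, fun i j => ?_⟩
    have h1 := (hC i j).trans ((mul_le_mul_of_nonneg_right (le_max_left C 0)
      (pow_nonneg (wt_pos _).le _)).trans (mul_le_mul_of_nonneg_left
        (wt_pow_le_wt_pow j (Nat.le_add_right l m)) (le_max_right C 0)))
    have h2 := (hD i j).trans ((mul_le_mul_of_nonneg_right (le_max_left D 0)
      (pow_nonneg (wt_pos _).le _)).trans (mul_le_mul_of_nonneg_left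
        (wt_pow_le_wt_pow j (Nat.le_add_left m l)) (le_max_right D 0)))
    have h3 := mul_le_mul_of_nonneg_left (abs_add_le (g i j) (h i j)) (pow_nonneg (wt_pos i).le k)
    rw [mul_add] at h3
    rw [add_mul]
    exact h3.trans (add_le_add h1 h2)
  smul_mem' := by
    intro c g hg k
    obtain ⟨C, l, hC⟩ := hg k
    refine ⟨|c| * C, l, fun i j => ?_⟩
    have := mul_le_mul_of_nonneg_left (hC i j) (abs_nonneg c)
    rw [Pi.smul_apply, Pi.smul_apply, smul_eq_mul, abs_mul]
    linarith

namespace RapidFun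

section ScalarKernel

variable {Ω Ω' Ξ : Type*} [IndexSize Ω] [IndexSize Ω'] [IndexSize Ξ] [TemperedIndex Ω] {V : Type*}
  [AddCommGroup V] [Module ℝ V] [TopologicalSpace V] [IsTopologicalAddGroup V]
  [PolynormableSpace ℝ V] [AbsSummableSpace V]

/-- The function absorbs both the growth `wt j ^ l` of the kernel and the powers `sumExp Ω` which
make the sum over `j` converge. -/
theorem smul_wt_bound {g : Ω' → Ω → ℝ} {k l : ℕ} {C : ℝ}
    (hg : ∀ i j, wt i ^ k * |g i j| ≤ C * wt j ^ l) (p : CSem V) (f : RapidFun (Ω × Ξ) V)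
    (i : Ω') (ξ : Ξ) (j : Ω) : p.1 (g i j • f (j, ξ)) ≤
      (wt i ^ k * wt ξ ^ k)⁻¹ * (C * sem _ p (k + (l + sumExp Ω)) f) * (wt j ^ sumExp Ω)⁻¹ := by
  have hi : 0 < wt i ^ k := pow_pos (wt_pos _) _
  have hξ : 0 < wt ξ ^ k := pow_pos (wt_pos _) _
  have hω : 0 < wt j ^ sumExp Ω := pow_pos (wt_pos _) _
  have hl : 0 < wt j ^ l := pow_pos (wt_pos _) _
  have hC : 0 ≤ C := nonneg_of_mul_nonneg_left
    ((mul_nonneg hi.le (abs_nonneg _)).trans (hg i j)) hl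
  have h2 : (wt ξ ^ k * (wt j ^ l * wt j ^ sumExp Ω)) * p.1 (f (j, ξ)) ≤
      sem _ p (k + (l + sumExp Ω)) f := by
    refine (mul_le_mul_of_nonneg_right ?_ (apply_nonneg _ _)).trans (le_sem p _ f (j, ξ))
    rw [pow_add, ← pow_add (wt j)]
    exact mul_le_mul (pow_le_pow_left₀ (wt_pos _).le (wt_le_wt_prod_right _ _) _)
      (pow_le_pow_left₀ (wt_pos _).le (wt_le_wt_prod_left _ _) _) (pow_nonneg (wt_pos _).le _)
      (pow_nonneg (wt_pos _).le _)
  rw [map_smul_eq_mul, Real.norm_eq_abs, inv_mul_eq_div, ← div_eq_mul_inv, div_div,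
    le_div_iff₀ (by positivity)]
  calc _ = (wt i ^ k * |g i j|) * (wt ξ ^ k * wt j ^ sumExp Ω * p.1 (f (j, ξ))) := by ring
    _ ≤ (C * wt j ^ l) * (wt ξ ^ k * wt j ^ sumExp Ω * p.1 (f (j, ξ))) :=
        mul_le_mul_of_nonneg_right (hg i j) (by positivity)
    _ = C * ((wt ξ ^ k * (wt j ^ l * wt j ^ sumExp Ω)) * p.1 (f (j, ξ))) := by ring
    _ ≤ _ := mul_le_mul_of_nonneg_left h2 hC

theorem summable_smul (g : temperedKernel Ω' Ω) (f : RapidFun (Ω × Ξ) V) (i : Ω') (ξ : Ξ) :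
    Summable fun j => g.1 i j • f (j, ξ) := by
  obtain ⟨C, l, h⟩ := g.2 0
  exact summable_of_wt_bound fun p => ⟨_, smul_wt_bound h p f i ξ⟩

theorem scal_bound {g : temperedKernel Ω' Ω} {k l : ℕ} {C : ℝ}
    (hg : ∀ i j, wt i ^ k * |g.1 i j| ≤ C * wt j ^ l) (p : CSem V) (f : RapidFun (Ω × Ξ) V)
    (z : Ω' × Ξ) : wt z ^ k * p.1 (∑' j, g.1 z.1 j • f (j, z.2)) ≤
      (C * sumConst Ω) * sem _ p (k + (l + sumExp Ω)) f := by
  have h := Seminorm.tsum_le_of_wt_bound (summable_smul g f z.1 z.2) (smul_wt_bound hg p f z.1 z.2)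
  have hi : 0 < wt z.1 ^ k := pow_pos (wt_pos _) _
  have hξ : 0 < wt z.2 ^ k := pow_pos (wt_pos _) _
  calc _ ≤ (wt z.1 * wt z.2) ^ k * _ :=
        mul_le_mul (pow_le_pow_left₀ (wt_pos _).le (wt_prod_le z.1 z.2) _) h
          (apply_nonneg _ _) (pow_nonneg (mul_nonneg (wt_pos _).le (wt_pos _).le) _)
    _ = _ := by rw [mul_pow]; field_simp

variable [T2Space V]

/-- The action of a real matrix on the first index. -/
noncomputable def scal (g : temperedKernel Ω' Ω) : RapidFun (Ω × Ξ) V →L[ℝ] RapidFun (Ω' × Ξ) V :=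
  mkCLM (fun f z => ∑' j, g.1 z.1 j • f (j, z.2))
    (fun f f' z => by
      simp only [add_apply, smul_add]
      exact (summable_smul g f z.1 z.2).tsum_add (summable_smul g f' z.1 z.2))
    (fun c f z => by
      have := (PolynormableSpace.withSeminorms ℝ V).continuousSMul
      simp only [smul_apply, smul_comm _ c]
      exact (summable_smul g f z.1 z.2).tsum_const_smul c) fun p k => by
      obtain ⟨C, l, h⟩ := g.2 k
      exact ⟨p, _, _, scal_bound h p⟩

@[simp] theorem scal_apply (g : temperedKernel Ω' Ω) (f : RapidFun (Ω × Ξ) V) (z : Ω' × Ξ) :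
    scal g f z = ∑' j, g.1 z.1 j • f (j, z.2) := rfl

theorem sem_scal_le {g : temperedKernel Ω' Ω} {k l : ℕ} {C : ℝ} (hC : 0 ≤ C)
    (hg : ∀ i j, wt i ^ k * |g.1 i j| ≤ C * wt j ^ l) (p : CSem V) (f : RapidFun (Ω × Ξ) V) :
    sem (Ω' × Ξ) p k (scal g f) ≤ (C * sumConst Ω) * sem _ p (k + (l + sumExp Ω)) f :=
  sem_le (mul_nonneg (mul_nonneg hC (sumConst_nonneg _)) (apply_nonneg _ _)) (scal_bound hg p f)

theorem scal_add (g h : temperedKernel Ω' Ω) (f : RapidFun (Ω × Ξ) V) :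
    scal (g + h) f = scal g f + scal h f := by
  ext z
  simp only [scal_apply, add_apply, Submodule.coe_add, Pi.add_apply, add_smul]
  exact (summable_smul g f z.1 z.2).tsum_add (summable_smul h f z.1 z.2)

theorem scal_smul (c : ℝ) (g : temperedKernel Ω' Ω) (f : RapidFun (Ω × Ξ) V) :
    scal (c • g) f = c • scal g f := by
  have := (PolynormableSpace.withSeminorms ℝ V).continuousSMul
  ext z
  simp only [scal_apply, smul_apply, Submodule.coe_smul, Pi.smul_apply, smul_assoc]
  exact (summable_smul g f z.1 z.2).tsum_const_smul c

theorem scal_sub (g h : temperedKernel Ω' Ω) (f : RapidFun (Ω × Ξ) V) :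
    scal (g - h) f = scal g f - scal h f := by
  rw [sub_eq_add_neg, ← neg_one_smul ℝ h, scal_add, scal_smul, neg_one_smul, sub_eq_add_neg]

end ScalarKernel

end RapidFun

/-! ### Operators between spaces of rapidly decreasing functions and their matrices -/

namespace RapidFun

section Op

variable {R : Type*} [CommRing R] [Algebra ℝ R] [TopologicalSpace R] [IsTopologicalRing R]
  [PolynormableSpace ℝ R]

section Module

variable {Ω : Type*} [IndexSize Ω]

theorem rapid_mul (c : R) (f : RapidFun Ω R) (p : CSem R) (k : ℕ) :
    ∃ M : ℝ, ∀ ω, wt ω ^ k * p.1 (c * f ω) ≤ M := by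
  obtain ⟨q, hq⟩ := Seminorm.exists_mul_le p
  refine ⟨q.1 c * sem Ω q k f, fun ω => ?_⟩
  calc wt ω ^ k * p.1 (c * f ω) ≤ wt ω ^ k * (q.1 c * q.1 (f ω)) :=
        mul_le_mul_of_nonneg_left (hq _ _) (pow_nonneg (wt_pos _).le _)
    _ = q.1 c * (wt ω ^ k * q.1 (f ω)) := by ring
    _ ≤ _ := mul_le_mul_of_nonneg_left (le_sem q k f ω) (apply_nonneg _ _)

instance : SMul R (RapidFun Ω R) := ⟨fun c f => mk (fun ω => c * f ω) (rapid_mul c f)⟩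

@[simp] theorem ring_smul_apply (c : R) (f : RapidFun Ω R) (ω : Ω) : (c • f) ω = c * f ω := rfl

instance ringModule : Module R (RapidFun Ω R) where
  one_smul f := by ext; simp
  mul_smul a b f := by ext; simp [mul_assoc]
  smul_zero c := by ext; simp
  smul_add c f g := by ext; simp [mul_add]
  add_smul a b f := by ext; simp [add_mul]
  zero_smul f := by ext; simp

open Classical in
/-- The function with value `1` at `j` and `0` elsewhere. -/
noncomputable def single (j : Ω) : RapidFun Ω R :=
  mk (fun ω => if ω = j then 1 else 0) fun p k => ⟨wt j ^ k * p.1 1, fun ω => by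
    split_ifs with h
    · rw [h]
    · rw [map_zero, mul_zero]
      exact mul_nonneg (pow_nonneg (wt_pos _).le _) (apply_nonneg _ _)⟩

@[simp] theorem single_self (j : Ω) : (single j : RapidFun Ω R) j = 1 := if_pos rfl

theorem single_ne {i j : Ω} (h : i ≠ j) : (single j : RapidFun Ω R) i = 0 := if_neg h

theorem finite_wt_le [TemperedIndex Ω] (M : ℝ) : {ω : Ω | wt ω ≤ M}.Finite := by
  have h := (summable_inv_wt Ω).tendsto_cofinite_zero
  rcases le_or_gt M 0 with hM | hM
  · convert Set.finite_empty
    ext ω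
    simpa using hM.trans_lt (wt_pos ω)
  have h1 := h.eventually (gt_mem_nhds (inv_pos.2 (pow_pos hM (sumExp Ω))))
  rw [Filter.eventually_cofinite] at h1
  refine h1.subset fun ω hω => ?_
  simp only [Set.mem_ofPred_eq, not_lt]
  exact inv_anti₀ (pow_pos (wt_pos _) _) (pow_le_pow_left₀ (wt_pos _).le hω _)

/-- Only finitely many indices have weight at most M. On the others, giving up one power of the
weight gains a factor 1/M, so the remainder is small in every seminorm. Consequently operators are
determined by their matrices. -/
theorem hasSum_single [TemperedIndex Ω] (f : RapidFun Ω R) :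
    HasSum (fun j => f j • (single j : RapidFun Ω R)) f := by
  classical
  rw [HasSum, SummationFilter.unconditional_filter, (withSeminorms Ω R).tendsto_nhds]
  rintro ⟨p, k⟩ ε hε
  obtain ⟨M, hM0, hM⟩ : ∃ M : ℝ, 0 < M ∧ sem Ω p (k + 1) f < M * ε :=
    ⟨(sem Ω p (k + 1) f + 1) / ε, by positivity, by
      rw [div_mul_cancel₀ _ hε.ne']; exact lt_add_one _⟩
  filter_upwards [eventually_ge_atTop (finite_wt_le (Ω := Ω) M).toFinset] with s hs
  have hval : ∀ ω, (∑ j ∈ s, f j • (single j : RapidFun Ω R) - f) ω = if ω ∈ s then 0 else -f ω := by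
    intro ω
    have h1 : (∑ j ∈ s, f j • (single j : RapidFun Ω R)) ω = if ω ∈ s then f ω else 0 := by
      rw [← eval_apply, map_sum]
      simp only [eval_apply, ring_smul_apply]
      rw [Finset.sum_congr rfl (fun j _ => show f j * (single j : RapidFun Ω R) ω =
        if ω = j then f j else 0 by
          by_cases h : ω = j
          · simp [h]
          · simp [h, single_ne h]), Finset.sum_ite_eq]
    rw [sub_apply, h1]
    split_ifs <;> simp
  change sem Ω p k (∑ j ∈ s, f j • (single j : RapidFun Ω R) - f) < ε
  refine lt_of_le_of_lt (sem_le (M := sem Ω p (k + 1) f / M) (by positivity) fun ω => ?_)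
    ((div_lt_iff₀ hM0).2 (by rwa [mul_comm]))
  rw [hval]
  split_ifs with h
  · rw [map_zero, mul_zero]; positivity
  · have hω : M < wt ω := by
      by_contra hω
      exact h (hs (by simpa using hω))
    rw [le_div_iff₀ hM0, map_neg_eq_map]
    refine le_trans ?_ (le_sem p (k + 1) f ω)
    rw [pow_succ, mul_right_comm]
    exact mul_le_mul_of_nonneg_right (mul_le_mul_of_nonneg_left hω.le (pow_nonneg (wt_pos _).le _))
      (apply_nonneg _ _)

end Module

variable {Ω Ω' Ω'' Ξ Ξ' : Type*} [IndexSize Ω] [IndexSize Ω'] [IndexSize Ω''] [IndexSize Ξ]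
  [IndexSize Ξ']

/-- Continuous linear maps over the ring of values. -/
noncomputable def mkOp (L : RapidFun Ω R →L[ℝ] RapidFun Ω' R)
    (h : ∀ (c : R) f ω, L (c • f) ω = c * L f ω) : RapidFun Ω R →L[R] RapidFun Ω' R where
  toFun := L
  map_add' := map_add L
  map_smul' c f := ext fun ω => h c f ω
  cont := L.continuous

@[simp] theorem mkOp_apply (L : RapidFun Ω R →L[ℝ] RapidFun Ω' R) (h) (f : RapidFun Ω R) :
    mkOp L h f = L f := rfl

theorem op_hasSum [TemperedIndex Ω] (X : RapidFun Ω R →L[R] RapidFun Ω' R) (f : RapidFun Ω R)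
    (i : Ω') : HasSum (fun j => f j * X (single j) i) (X f i) := by
  have h := ((hasSum_single f).map X X.continuous).map (eval i) (eval (V := R) i).continuous
  refine h.congr_fun fun j => ?_
  simp

theorem op_ext [TemperedIndex Ω] [T2Space R] {X Y : RapidFun Ω R →L[R] RapidFun Ω' R}
    (h : ∀ i j, X (single j) i = Y (single j) i) : X = Y := by
  ext f i
  refine (op_hasSum X f i).unique ?_
  simpa only [h] using op_hasSum Y f i

/-- The matrix of an operator. -/
noncomputable def mat (X : RapidFun Ω R →L[R] RapidFun Ω' R) : Matrix Ω' Ω R :=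
  Matrix.of fun i j => X (single j) i

@[simp] theorem mat_apply (X : RapidFun Ω R →L[R] RapidFun Ω' R) (i : Ω') (j : Ω) :
    mat X i j = X (single j) i := rfl

theorem mat_injective [TemperedIndex Ω] [T2Space R] :
    Function.Injective (mat : (RapidFun Ω R →L[R] RapidFun Ω' R) → Matrix Ω' Ω R) :=
  fun _ _ h => op_ext fun i j => congrFun (congrFun h i) j

/-- The row-by-column series is the value of `X` on the expansion of the column `Y (single j)` in
basis functions. -/
theorem mmul_mat [TemperedIndex Ω] [T2Space R] (X Y : RapidFun Ω R →L[R] RapidFun Ω R) :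
    mmul (mat X) (mat Y) = mat (X ∘L Y) := by
  ext i j
  have h := op_hasSum X (Y (single j)) i
  simp only [mmul, Matrix.of_apply, mat_apply, ContinuousLinearMap.comp_apply]
  rw [← h.tsum_eq]
  exact tsum_congr fun k => mul_comm _ _

/-- The operator of composition with a tempered injection. -/
noncomputable def pullOp {r : Ω → Ω'} (hr : IsTempered r) : RapidFun Ω' R →L[R] RapidFun Ω R :=
  mkOp (pull hr) fun _ _ _ => rfl

@[simp] theorem pullOp_apply {r : Ω → Ω'} (hr : IsTempered r) (f : RapidFun Ω' R) (ω : Ω) :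
    pullOp hr f ω = f (r ω) := rfl

/-- The operator of extension by zero along a tempered injection. -/
noncomputable def relOp {r : Ω → Ω'} (hr : IsTempered r) : RapidFun Ω R →L[R] RapidFun Ω' R :=
  mkOp (rel hr) fun c f ω => by
    by_cases h : ∃ a, r a = ω
    · obtain ⟨a, rfl⟩ := h
      simp
    · rw [rel_apply_eq_zero hr _ (by simpa using h), rel_apply_eq_zero hr _ (by simpa using h),
        mul_zero]

@[simp] theorem relOp_apply {r : Ω → Ω'} (hr : IsTempered r) (f : RapidFun Ω R) (ω : Ω) :
    relOp hr f (r ω) = f ω := rel_apply hr f ω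

theorem relOp_apply_eq_zero {r : Ω → Ω'} (hr : IsTempered r) (f : RapidFun Ω R) {ω : Ω'}
    (h : ∀ a, r a ≠ ω) : relOp hr f ω = 0 := rel_apply_eq_zero hr f h

@[simp] theorem relOp_single {r : Ω → Ω'} (hr : IsTempered r) (j : Ω) :
    relOp hr (single j : RapidFun Ω R) = single (r j) := by
  ext ω
  by_cases h : ∃ a, r a = ω
  · obtain ⟨a, rfl⟩ := h
    rw [relOp_apply]
    by_cases ha : a = j
    · simp [ha]
    · rw [single_ne ha, single_ne (hr.injective.ne ha)]
  · rw [relOp_apply_eq_zero hr _ (by simpa using h), single_ne]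
    rintro rfl
    exact h ⟨j, rfl⟩

@[simp] theorem pullOp_single {r : Ω → Ω'} (hr : IsTempered r) (j : Ω) :
    pullOp hr (single (r j) : RapidFun Ω' R) = single j := by
  ext ω
  rw [pullOp_apply]
  by_cases ha : ω = j
  · simp [ha]
  · rw [single_ne ha, single_ne (hr.injective.ne ha)]

theorem pullOp_single_eq_zero {r : Ω → Ω'} (hr : IsTempered r) {j : Ω'} (h : ∀ a, r a ≠ j) :
    pullOp hr (single j : RapidFun Ω' R) = 0 := by
  ext ω
  rw [pullOp_apply, single_ne (h ω), zero_apply]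

@[simp] theorem pullOp_relOp {r : Ω → Ω'} (hr : IsTempered r) (f : RapidFun Ω R) :
    pullOp hr (relOp hr f) = f := by
  ext ω
  simp

theorem pullOp_relOp_eq_zero {r : Ω → Ω''} {s : Ω' → Ω''} (hr : IsTempered r) (hs : IsTempered s)
    (h : ∀ a b, s b ≠ r a) (f : RapidFun Ω' R) : pullOp hr (relOp hs f) = 0 := by
  ext ω
  rw [pullOp_apply, relOp_apply_eq_zero hs _ (h ω), zero_apply]

theorem relOp_relOp {s : Ω' → Ω''} {r : Ω → Ω'} (hs : IsTempered s) (hr : IsTempered r)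
    (f : RapidFun Ω R) : relOp hs (relOp hr f) = relOp (hs.comp hr) f := by
  ext ω
  by_cases h : ∃ a, s a = ω
  · obtain ⟨a, rfl⟩ := h
    rw [relOp_apply]
    by_cases h' : ∃ b, r b = a
    · obtain ⟨b, rfl⟩ := h'
      rw [relOp_apply]
      exact (relOp_apply (hs.comp hr) f b).symm
    · rw [relOp_apply_eq_zero hr _ (by simpa using h'), relOp_apply_eq_zero]
      rintro b hb
      exact h' ⟨b, hs.injective hb⟩
  · rw [relOp_apply_eq_zero hs _ (by simpa using h), relOp_apply_eq_zero]
    rintro b rfl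
    exact h ⟨_, rfl⟩

open Classical in
/-- Restriction of functions to a subset, with values in any space. -/
noncomputable def restr {V : Type*} [AddCommGroup V] [Module ℝ V] [TopologicalSpace V]
    (s : Ω → Prop) : RapidFun Ω V →L[ℝ] RapidFun Ω V :=
  mkCLM (fun f ω => if s ω then f ω else 0) (fun f g ω => by split_ifs <;> simp)
    (fun c f ω => by split_ifs <;> simp) fun p k => ⟨p, k, 1, fun f ω => by
      rw [one_mul]
      split_ifs
      · exact le_sem p k f ω
      · rw [map_zero, mul_zero]
        exact apply_nonneg _ _⟩

open Classical in
theorem restr_apply {V : Type*} [AddCommGroup V] [Module ℝ V] [TopologicalSpace V]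
    (s : Ω → Prop) (f : RapidFun Ω V) (ω : Ω) : restr s f ω = if s ω then f ω else 0 := rfl

/-- The diagonal projection onto the functions supported by a subset. -/
noncomputable def proj (s : Ω → Prop) : RapidFun Ω R →L[R] RapidFun Ω R :=
  mkOp (restr s) fun c f ω => by simp only [restr_apply]; split_ifs <;> simp

open Classical in
theorem proj_apply (s : Ω → Prop) (f : RapidFun Ω R) (ω : Ω) :
    proj s f ω = if s ω then f ω else 0 := rfl

@[simp] theorem proj_proj (s : Ω → Prop) (f : RapidFun Ω R) : proj s (proj s f) = proj s f := by
  ext ω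
  simp only [proj_apply]
  split_ifs <;> rfl

theorem proj_relOp {s : Ω → Prop} {s' : Ω' → Prop} {r : Ω → Ω'} (hr : IsTempered r)
    (h : ∀ ω, s' (r ω) ↔ s ω) (f : RapidFun Ω R) :
    proj s' (relOp hr f) = relOp hr (proj s f) := by
  ext ω
  rw [proj_apply]
  by_cases h' : ∃ a, r a = ω
  · obtain ⟨a, rfl⟩ := h'
    simp only [relOp_apply, proj_apply]
    classical exact if_congr (h a) rfl rfl
  · rw [relOp_apply_eq_zero hr _ (by simpa using h'), relOp_apply_eq_zero hr _ (by simpa using h'),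
      ite_self]

theorem pullOp_proj {s : Ω → Prop} {s' : Ω' → Prop} {r : Ω → Ω'} (hr : IsTempered r)
    (h : ∀ ω, s' (r ω) ↔ s ω) (f : RapidFun Ω' R) :
    pullOp hr (proj s' f) = proj s (pullOp hr f) := by
  ext ω
  simp only [pullOp_apply, proj_apply]
  classical exact if_congr (h ω) rfl rfl

/-! ### Amplification -/

/-- The restriction of a function of two variables to a fixed second variable. -/
def slice {V : Type*} [AddCommGroup V] [Module ℝ V] [TopologicalSpace V]
    (f : RapidFun (Ω × Ξ) V) (ξ : Ξ) : RapidFun Ω V :=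
  mk (fun ω => f (ω, ξ)) fun p k => ⟨sem _ p k f, fun ω =>
    (mul_le_mul_of_nonneg_right (pow_le_pow_left₀ (wt_pos _).le (wt_le_wt_prod_left ω ξ) k)
      (apply_nonneg _ _)).trans (le_sem p k f (ω, ξ))⟩

@[simp] theorem slice_apply {V : Type*} [AddCommGroup V] [Module ℝ V] [TopologicalSpace V]
    (f : RapidFun (Ω × Ξ) V) (ξ : Ξ) (ω : Ω) : slice f ξ ω = f (ω, ξ) := rfl

theorem wt_sem_slice_le {V : Type*} [AddCommGroup V] [Module ℝ V] [TopologicalSpace V]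
    (f : RapidFun (Ω × Ξ) V) (ξ : Ξ) (q : CSem V) (k l : ℕ) :
    wt ξ ^ k * sem Ω q l (slice f ξ) ≤ sem _ q (k + l) f := by
  have h0 : 0 < wt ξ ^ k := pow_pos (wt_pos ξ) k
  rw [← le_inv_mul_iff₀ h0]
  refine sem_le (mul_nonneg (inv_nonneg.2 h0.le) (apply_nonneg _ _)) fun ω => ?_
  rw [le_inv_mul_iff₀ h0, slice_apply, ← mul_assoc]
  refine (mul_le_mul_of_nonneg_right ?_ (apply_nonneg _ _)).trans (le_sem q (k + l) f (ω, ξ))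
  rw [pow_add]
  exact mul_le_mul (pow_le_pow_left₀ (wt_pos _).le (wt_le_wt_prod_right _ _) _)
      (pow_le_pow_left₀ (wt_pos _).le (wt_le_wt_prod_left _ _) _) (pow_nonneg (wt_pos _).le _)
      (pow_nonneg (wt_pos _).le _)

/-- The amplification `X ⊗ 1`. -/
noncomputable def amp (X : RapidFun Ω R →L[R] RapidFun Ω' R) :
    RapidFun (Ω × Ξ) R →L[R] RapidFun (Ω' × Ξ) R :=
  mkOp (mkCLM (fun f z => X (slice f z.2) z.1)
    (fun f g z => by
      rw [show slice (f + g) z.2 = slice f z.2 + slice g z.2 from rfl, map_add, add_apply])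
    (fun c f z => by
      have e : ∀ {Ω : Type _} [IndexSize Ω] (g : RapidFun Ω R), c • g = (algebraMap ℝ R c) • g :=
        fun g => by ext ω; simp [Algebra.smul_def]
      rw [show slice (c • f) z.2 = c • slice f z.2 from rfl, e, map_smul, ring_smul_apply,
        Algebra.smul_def]) fun p k => by
      -- Continuity of `X` enters as an estimate by a single defining seminorm, whose constants are
      -- the same for all slices.
      obtain ⟨q, l, C, hC0, hC⟩ := exists_le_sem
        (⟨(sem Ω' p k).comp
          ({ toFun := X
             map_add' := map_add X
             map_smul' := fun c g => by
              have e : ∀ {Ω : Type _} [IndexSize Ω] (g : RapidFun Ω R),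
                c • g = (algebraMap ℝ R c) • g := fun g => by ext ω; simp [Algebra.smul_def]
              have e' : ∀ {Ω : Type _} [IndexSize Ω] (g : RapidFun Ω R),
                c • g = (algebraMap ℝ R c) • g := fun g => by ext ω; simp [Algebra.smul_def]
              rw [e, map_smul, ← e', RingHom.id_apply] } :
            RapidFun Ω R →ₗ[ℝ] RapidFun Ω' R), (continuous_sem p k).comp X.continuous⟩ :
          CSem (RapidFun Ω R))
      refine ⟨q, k + l, C, fun f z => ?_⟩
      have hz : 0 < wt z.2 ^ k := pow_pos (wt_pos _) k
      calc wt z ^ k * p.1 (X (slice f z.2) z.1)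
          ≤ (wt z.1 * wt z.2) ^ k * p.1 (X (slice f z.2) z.1) :=
            mul_le_mul_of_nonneg_right (pow_le_pow_left₀ (wt_pos _).le (wt_prod_le z.1 z.2) _)
              (apply_nonneg _ _)
        _ = wt z.2 ^ k * (wt z.1 ^ k * p.1 (X (slice f z.2) z.1)) := by ring
        _ ≤ wt z.2 ^ k * (C * sem Ω q l (slice f z.2)) :=
            mul_le_mul_of_nonneg_left ((le_sem p k _ _).trans (hC _)) hz.le
        _ = C * (wt z.2 ^ k * sem Ω q l (slice f z.2)) := by ring
        _ ≤ _ := mul_le_mul_of_nonneg_left (wt_sem_slice_le f z.2 q k l) hC0)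
    fun c f z => by
      rw [mkCLM_apply, mkCLM_apply, show slice (c • f) z.2 = c • slice f z.2 from rfl, map_smul,
        ring_smul_apply]

@[simp] theorem amp_apply (X : RapidFun Ω R →L[R] RapidFun Ω' R) (f : RapidFun (Ω × Ξ) R)
    (z : Ω' × Ξ) : amp X f z = X (slice f z.2) z.1 := rfl

theorem slice_single (j : Ω) (l ξ : Ξ) : slice (single (j, l) : RapidFun (Ω × Ξ) R) ξ =
    (single l : RapidFun Ξ R) ξ • (single j : RapidFun Ω R) := by
  ext ω
  rw [slice_apply, ring_smul_apply]
  by_cases h1 : ξ = l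
  · by_cases h2 : ω = j
    · simp [h1, h2]
    · rw [single_ne h2, single_ne (by simp [h2]), mul_zero]
  · rw [single_ne h1, single_ne (by simp [h1]), zero_mul]

theorem amp_single (X : RapidFun Ω R →L[R] RapidFun Ω' R) (j : Ω) (l : Ξ) (z : Ω' × Ξ) :
    amp X (single (j, l) : RapidFun (Ω × Ξ) R) z =
      (single l : RapidFun Ξ R) z.2 * X (single j) z.1 := by
  rw [amp_apply, slice_single, map_smul, ring_smul_apply]

/-- The tensor product of operators. -/
noncomputable def tens (X : RapidFun Ω R →L[R] RapidFun Ω' R) (Y : RapidFun Ξ R →L[R] RapidFun Ξ' R) :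
    RapidFun (Ω × Ξ) R →L[R] RapidFun (Ω' × Ξ') R :=
  amp X ∘L pullOp .swap ∘L amp Y ∘L pullOp .swap

theorem tens_single (X : RapidFun Ω R →L[R] RapidFun Ω' R) (Y : RapidFun Ξ R →L[R] RapidFun Ξ' R)
    (j : Ω) (l : Ξ) (z : Ω' × Ξ') : tens X Y (single (j, l) : RapidFun (Ω × Ξ) R) z =
      X (single j) z.1 * Y (single l) z.2 := by
  have h : pullOp IsTempered.swap (single (j, l) : RapidFun (Ω × Ξ) R) = single (l, j) :=
    pullOp_single IsTempered.swap (l, j)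
  simp only [tens, ContinuousLinearMap.comp_apply, h, amp_apply]
  have h' : slice (pullOp IsTempered.swap (amp Y (single (l, j) : RapidFun (Ξ × Ω) R))) z.2 =
      (Y (single l) z.2) • (single j : RapidFun Ω R) := by
    ext ω
    rw [slice_apply, pullOp_apply, ring_smul_apply]
    exact (amp_single Y l j _).trans (mul_comm _ _)
  rw [h', map_smul, ring_smul_apply, mul_comm]

section Tens

variable [TemperedIndex Ω] [TemperedIndex Ξ] [T2Space R]
  {Ξ'' : Type*} [IndexSize Ξ'']

theorem amp_comp (X : RapidFun Ω' R →L[R] RapidFun Ω'' R) (X' : RapidFun Ω R →L[R] RapidFun Ω' R) :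
    (amp (X ∘L X') : RapidFun (Ω × Ξ) R →L[R] RapidFun (Ω'' × Ξ) R) = amp X ∘L amp X' := rfl

/-- Operators which act on different variables commute: in both orders the matrix entries are the
products of the entries, and the values commute. This is what makes `tens` compatible with
composition. -/
theorem tens_eq (X : RapidFun Ω R →L[R] RapidFun Ω' R) (Y : RapidFun Ξ R →L[R] RapidFun Ξ' R) :
    tens X Y = pullOp .swap ∘L amp Y ∘L pullOp .swap ∘L amp X := by
  refine op_ext fun ⟨i, k⟩ ⟨j, l⟩ => ?_
  rw [tens_single]
  simp only [ContinuousLinearMap.comp_apply, pullOp_apply, amp_apply]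
  have h' : slice (pullOp IsTempered.swap (amp X (single (j, l) : RapidFun (Ω × Ξ) R))) i =
      (X (single j) i) • (single l : RapidFun Ξ R) := by
    ext ω
    rw [slice_apply, pullOp_apply, ring_smul_apply]
    exact (amp_single X j l _).trans (mul_comm _ _)
  exact ((congrArg (fun g => Y g k) h').trans (by rw [map_smul, ring_smul_apply])).symm

theorem tens_comp [TemperedIndex Ξ'] (X : RapidFun Ω' R →L[R] RapidFun Ω'' R) (X' : RapidFun Ω R →L[R] RapidFun Ω' R)
    (Y : RapidFun Ξ' R →L[R] RapidFun Ξ'' R) (Y' : RapidFun Ξ R →L[R] RapidFun Ξ' R) :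
    tens X Y ∘L tens X' Y' = tens (X ∘L X') (Y ∘L Y') := by
  have h : ∀ f, pullOp .swap (amp Y (pullOp .swap (amp X' f))) =
      amp X' (pullOp .swap (amp Y (pullOp .swap f))) := fun f =>
    (congrArg (fun T => T f) (tens_eq X' Y)).symm
  ext1 f
  simp only [ContinuousLinearMap.comp_apply, tens, amp_comp, h]
  rfl

@[simp] theorem tens_tens [TemperedIndex Ξ'] (X : RapidFun Ω' R →L[R] RapidFun Ω'' R)
    (X' : RapidFun Ω R →L[R] RapidFun Ω' R) (Y : RapidFun Ξ' R →L[R] RapidFun Ξ'' R)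
    (Y' : RapidFun Ξ R →L[R] RapidFun Ξ' R) (f : RapidFun (Ω × Ξ) R) :
    tens X Y (tens X' Y' f) = tens (X ∘L X') (Y ∘L Y') f := by
  rw [← tens_comp]; rfl

theorem tens_add_left (X X' : RapidFun Ω R →L[R] RapidFun Ω' R)
    (Y : RapidFun Ξ R →L[R] RapidFun Ξ' R) : tens (X + X') Y = tens X Y + tens X' Y :=
  op_ext fun ⟨i, k⟩ ⟨j, l⟩ => by
    simp only [tens_single, _root_.add_apply, add_apply, add_mul]

theorem tens_add_right (X : RapidFun Ω R →L[R] RapidFun Ω' R)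
    (Y Y' : RapidFun Ξ R →L[R] RapidFun Ξ' R) : tens X (Y + Y') = tens X Y + tens X Y' :=
  op_ext fun ⟨i, k⟩ ⟨j, l⟩ => by
    simp only [tens_single, _root_.add_apply, add_apply, mul_add]

theorem tens_sub_left (X X' : RapidFun Ω R →L[R] RapidFun Ω' R)
    (Y : RapidFun Ξ R →L[R] RapidFun Ξ' R) : tens (X - X') Y = tens X Y - tens X' Y :=
  op_ext fun ⟨i, k⟩ ⟨j, l⟩ => by
    simp only [tens_single, _root_.sub_apply, sub_apply, sub_mul]

theorem tens_sub_right (X : RapidFun Ω R →L[R] RapidFun Ω' R)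
    (Y Y' : RapidFun Ξ R →L[R] RapidFun Ξ' R) : tens X (Y - Y') = tens X Y - tens X Y' :=
  op_ext fun ⟨i, k⟩ ⟨j, l⟩ => by
    simp only [tens_single, _root_.sub_apply, sub_apply, mul_sub]

theorem tens_zero_left (Y : RapidFun Ξ R →L[R] RapidFun Ξ' R) :
    tens (0 : RapidFun Ω R →L[R] RapidFun Ω' R) Y = 0 :=
  op_ext fun ⟨i, k⟩ ⟨j, l⟩ => by
    simp only [tens_single, _root_.zero_apply, zero_apply, zero_mul]

theorem tens_zero_right (X : RapidFun Ω R →L[R] RapidFun Ω' R) :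
    tens X (0 : RapidFun Ξ R →L[R] RapidFun Ξ' R) = 0 :=
  op_ext fun ⟨i, k⟩ ⟨j, l⟩ => by
    simp only [tens_single, _root_.zero_apply, zero_apply, mul_zero]

theorem single_mul_single (i j : Ω) (k l : Ξ) :
    (single j : RapidFun Ω R) i * (single l : RapidFun Ξ R) k =
      (single (j, l) : RapidFun (Ω × Ξ) R) (i, k) := by
  have := slice_single (R := R) j l k
  rw [← slice_apply, this, ring_smul_apply, mul_comm]

theorem tens_one : tens (1 : RapidFun Ω R →L[R] RapidFun Ω R) (1 : RapidFun Ξ R →L[R] RapidFun Ξ R)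
    = 1 :=
  op_ext fun ⟨i, k⟩ ⟨j, l⟩ => by
    simp only [tens_single, one_apply_eq_self, single_mul_single]

end Tens

/-! ### Operators with rapidly decreasing matrices -/

section Kernel

theorem isTempered_fst_fin_one : IsTempered (fun z : Ω × Fin 1 => z.1) :=
  .of_eq (fun _ _ h => Prod.ext h (Subsingleton.elim _ _)) fun _ => (Nat.add_zero _).symm

theorem isTempered_mk_fin_one : IsTempered (fun ω : Ω => (ω, (0 : Fin 1))) :=
  .of_eq (fun _ _ h => congrArg Prod.fst h) fun _ => Nat.add_zero _

variable [TemperedIndex Ω] [T2Space R] [AbsSummableSpace R]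

/-- The operator with a given rapidly decreasing matrix. -/
noncomputable def kop (A : RapidFun (Ω' × Ω) R) : RapidFun Ω R →L[R] RapidFun Ω' R where
  toFun f := pull isTempered_mk_fin_one (kmul A (pull isTempered_fst_fin_one f))
  map_add' f g := by simp
  map_smul' c f := by
    ext i
    simp only [pull_apply, kmul_apply, ring_smul_apply, RingHom.id_apply]
    refine Eq.trans ?_ ((summable_mul A (pull isTempered_fst_fin_one f) i 0).tsum_mul_left c)
    exact tsum_congr fun j => mul_left_comm _ _ _
  cont := by
    refine (pull isTempered_mk_fin_one).continuous.comp (continuous_kmul.comp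
      (continuous_const.prodMk (pull isTempered_fst_fin_one).continuous))

theorem kop_apply (A : RapidFun (Ω' × Ω) R) (f : RapidFun Ω R) (i : Ω') :
    kop A f i = ∑' j, A (i, j) * f j := rfl

@[simp] theorem kop_single (A : RapidFun (Ω' × Ω) R) (i : Ω') (j : Ω) :
    kop A (single j) i = A (i, j) := by
  rw [kop_apply, tsum_eq_single j fun k hk => by rw [single_ne hk, mul_zero], single_self, mul_one]

theorem kop_add (A B : RapidFun (Ω' × Ω) R) : kop (A + B) = kop A + kop B :=
  op_ext fun i j => by simp

theorem kop_neg (A : RapidFun (Ω' × Ω) R) : kop (-A) = -kop A := op_ext fun i j => by simp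

end Kernel

end Op

end RapidFun

open RapidFun

/-! ### The unital extension -/

section Unital

variable {𝔄 : Type*} [NonUnitalCommRing 𝔄] [Module ℝ 𝔄] [IsScalarTower ℝ 𝔄 𝔄]
  [SMulCommClass ℝ 𝔄 𝔄] [TopologicalSpace 𝔄]

theorem isInducing_unitization :
    IsInducing (fun x : Unitization ℝ 𝔄 => (x.fst, x.snd)) := ⟨rfl⟩

theorem continuous_unitization_fst : Continuous (fun x : Unitization ℝ 𝔄 => x.fst) :=
  continuous_fst.comp isInducing_unitization.continuous

theorem continuous_unitization_snd : Continuous (fun x : Unitization ℝ 𝔄 => x.snd) :=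
  continuous_snd.comp isInducing_unitization.continuous

theorem continuous_unitization_rng {X : Type*} [TopologicalSpace X] {f : X → Unitization ℝ 𝔄}
    (h1 : Continuous fun x => (f x).fst) (h2 : Continuous fun x => (f x).snd) : Continuous f :=
  isInducing_unitization.continuous_iff.2 (h1.prodMk h2)

instance [IsTopologicalRing 𝔄] [ContinuousSMul ℝ 𝔄] : IsTopologicalRing (Unitization ℝ 𝔄) where
  continuous_add := continuous_unitization_rng
    ((continuous_unitization_fst.comp continuous_fst).add
      (continuous_unitization_fst.comp continuous_snd))
    ((continuous_unitization_snd.comp continuous_fst).add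
      (continuous_unitization_snd.comp continuous_snd))
  continuous_mul := by
    have a := (continuous_unitization_fst (𝔄 := 𝔄)).comp
      (continuous_fst : Continuous (Prod.fst : Unitization ℝ 𝔄 × Unitization ℝ 𝔄 → _))
    have b := (continuous_unitization_fst (𝔄 := 𝔄)).comp
      (continuous_snd : Continuous (Prod.snd : Unitization ℝ 𝔄 × Unitization ℝ 𝔄 → _))
    have c := (continuous_unitization_snd (𝔄 := 𝔄)).comp
      (continuous_fst : Continuous (Prod.fst : Unitization ℝ 𝔄 × Unitization ℝ 𝔄 → _))
    have d := (continuous_unitization_snd (𝔄 := 𝔄)).comp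
      (continuous_snd : Continuous (Prod.snd : Unitization ℝ 𝔄 × Unitization ℝ 𝔄 → _))
    exact continuous_unitization_rng (a.mul b) (((a.smul d).add (b.smul c)).add (c.mul d))
  continuous_neg := continuous_unitization_rng continuous_unitization_fst.neg
    continuous_unitization_snd.neg

instance [T2Space 𝔄] : T2Space (Unitization ℝ 𝔄) :=
  T2Space.of_injective_continuous (f := fun x : Unitization ℝ 𝔄 => (x.fst, x.snd))
    (fun _ _ h => Unitization.ext (congrArg Prod.fst h) (congrArg Prod.snd h))
    isInducing_unitization.continuous

instance [PolynormableSpace ℝ 𝔄] : PolynormableSpace ℝ (Unitization ℝ 𝔄) := by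
  have : PolynormableSpace ℝ (ℝ × 𝔄) :=
    PolynormableSpace.inf (PolynormableSpace.induced (LinearMap.fst ℝ ℝ 𝔄))
      (PolynormableSpace.induced (LinearMap.snd ℝ ℝ 𝔄))
  exact PolynormableSpace.induced
    ({ toFun := fun x => (x.fst, x.snd), map_add' := fun _ _ => rfl, map_smul' := fun _ _ => rfl } :
      Unitization ℝ 𝔄 →ₗ[ℝ] ℝ × 𝔄)

/-- The inclusion of the algebra into its unital extension. -/
def inrCLM (𝔄 : Type*) [NonUnitalCommRing 𝔄] [Module ℝ 𝔄] [IsScalarTower ℝ 𝔄 𝔄]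
    [SMulCommClass ℝ 𝔄 𝔄] [TopologicalSpace 𝔄] :
    𝔄 →L[ℝ] Unitization ℝ 𝔄 where
  toFun a := (a : Unitization ℝ 𝔄)
  map_add' a b := Unitization.inr_add ℝ a b
  map_smul' c a := Unitization.inr_smul ℝ c a
  cont := continuous_unitization_rng continuous_const continuous_id

@[simp] theorem inrCLM_apply (a : 𝔄) : inrCLM 𝔄 a = (a : Unitization ℝ 𝔄) := rfl

instance [AbsSummableSpace 𝔄] : AbsSummableSpace (Unitization ℝ 𝔄) where
  summable_nat f hf := by
    have h1 : Summable fun n => (f n).fst := by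
      have h := hf ⟨(normSeminorm ℝ ℝ).comp
        ({ toFun := fun x => x.fst, map_add' := fun _ _ => rfl, map_smul' := fun _ _ => rfl } :
          Unitization ℝ 𝔄 →ₗ[ℝ] ℝ), continuous_norm.comp continuous_unitization_fst⟩
      exact Summable.of_norm h
    have h2 : Summable fun n => (f n).snd := AbsSummableSpace.summable_nat _ fun p =>
      hf ⟨p.1.comp
        ({ toFun := fun x => x.snd, map_add' := fun _ _ => rfl, map_smul' := fun _ _ => rfl } :
          Unitization ℝ 𝔄 →ₗ[ℝ] 𝔄), p.2.comp continuous_unitization_snd⟩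
    obtain ⟨a, ha⟩ := h1
    obtain ⟨b, hb⟩ := h2
    refine ⟨Unitization.inl a + (b : Unitization ℝ 𝔄), ?_⟩
    have h3 : Continuous fun c : ℝ => (Unitization.inl c : Unitization ℝ 𝔄) :=
      continuous_unitization_rng continuous_id continuous_const
    have h4 : Continuous fun x : ℝ × 𝔄 => (Unitization.inl x.1 + (x.2 : Unitization ℝ 𝔄)) :=
      continuous_unitization_rng (by simpa using continuous_fst) (by simpa using continuous_snd)
    have h5 := (h4.tendsto (a, b)).comp (ha.prodMk hb)
    refine h5.congr fun s => ?_
    have h6 : ∀ c : Unitization ℝ 𝔄, Unitization.inl c.fst + (c.snd : Unitization ℝ 𝔄) = c :=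
      Unitization.inl_fst_add_inr_snd_eq
    have h7 := map_sum (AddMonoidHom.mk' (fun x : Unitization ℝ 𝔄 => (x.fst, x.snd))
      fun _ _ => rfl) f s
    rw [← h6 (∑ b ∈ s, f b)]
    exact congrArg (fun x : ℝ × 𝔄 => (Unitization.inl x.1 + (x.2 : Unitization ℝ 𝔄))) h7.symm

/-- Absolute convergence makes the net of all finite partial sums Cauchy. Sequential completeness
gives a limit along the initial segments, and a Cauchy net converges to the limit of such a
subsequence. -/
theorem AbsSummableSpace.of_seqComplete {V : Type*} [AddCommGroup V] [Module ℝ V] [UniformSpace V]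
    [IsUniformAddGroup V] [PolynormableSpace ℝ V]
    (h : ∀ a : ℕ → V, CauchySeq a → ∃ l, Tendsto a atTop (𝓝 l)) : AbsSummableSpace V where
  summable_nat f hf := by
    have hc : CauchySeq fun s : Finset ℕ => ∑ n ∈ s, f n := by
      rw [cauchySeq_finset_iff_sum_vanishing]
      intro e he
      obtain ⟨s, r, hr, hs⟩ := ((PolynormableSpace.withSeminorms ℝ V).mem_nhds_iff 0 e).1 he
      let q : Seminorm ℝ V := s.sup fun p : CSem V => p.1
      have hq : Continuous q := Seminorm.continuous_finsetSup fun i _ => i.2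
      obtain ⟨t, ht⟩ := summable_iff_vanishing_norm.1 (hf ⟨q, hq⟩) r hr
      refine ⟨t, fun t' ht' => hs ?_⟩
      rw [Seminorm.mem_ball, sub_zero]
      exact ((Seminorm.map_sum_le _ _ _).trans (le_abs_self _)).trans_lt (ht t' ht')
    obtain ⟨l, hl⟩ := h (fun n => ∑ i ∈ Finset.range n, f i)
      (hc.comp_tendsto Filter.tendsto_finset_range)
    exact ⟨l, tendsto_nhds_of_cauchySeq_of_subseq hc Filter.tendsto_finset_range hl⟩

end Unital

/-! ### Operators over the unital extension -/

/-- Continuous operators between spaces of rapidly decreasing functions with values in the unital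
extension. -/
abbrev Opr (𝔄 : Type*) [NonUnitalCommRing 𝔄] [Module ℝ 𝔄] [IsScalarTower ℝ 𝔄 𝔄]
    [SMulCommClass ℝ 𝔄 𝔄] [TopologicalSpace 𝔄] [IsTopologicalRing 𝔄] [ContinuousSMul ℝ 𝔄]
    [PolynormableSpace ℝ 𝔄] (Ω Ω' : Type*) [IndexSize Ω] [IndexSize Ω'] : Type _ :=
  RapidFun Ω (Unitization ℝ 𝔄) →L[Unitization ℝ 𝔄] RapidFun Ω' (Unitization ℝ 𝔄)

section Scalars

variable {R : Type*} [CommRing R] [Algebra ℝ R] [TopologicalSpace R] [IsTopologicalRing R]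
  [PolynormableSpace ℝ R] {Ω : Type*} [IndexSize Ω]

instance : SMulCommClass R ℝ (RapidFun Ω R) :=
  ⟨fun c r f => RapidFun.ext fun ω => mul_smul_comm r c (f ω)⟩

instance : IsScalarTower ℝ R (RapidFun Ω R) :=
  ⟨fun r c f => RapidFun.ext fun ω => smul_mul_assoc r c (f ω)⟩

end Scalars

section Op

variable {𝔄 : Type w} [NonUnitalCommRing 𝔄] [Module ℝ 𝔄] [IsScalarTower ℝ 𝔄 𝔄]
  [SMulCommClass ℝ 𝔄 𝔄] [TopologicalSpace 𝔄] [IsTopologicalRing 𝔄] [ContinuousSMul ℝ 𝔄]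
  [PolynormableSpace ℝ 𝔄] [T2Space 𝔄] [AbsSummableSpace 𝔄]

section Basic

variable {Ω Ω' Ω'' Ξ Ξ' : Type*} [IndexSize Ω] [IndexSize Ω'] [IndexSize Ω''] [IndexSize Ξ]
  [IndexSize Ξ'] [TemperedIndex Ω]

/-- The operator with a rapidly decreasing matrix over the algebra. -/
noncomputable def op (A : RapidFun (Ω' × Ω) 𝔄) : Opr 𝔄 Ω Ω' := kop (RapidFun.map (inrCLM 𝔄) A)

@[simp] theorem op_single (A : RapidFun (Ω' × Ω) 𝔄) (i : Ω') (j : Ω) :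
    op A (single j) i = (A (i, j) : Unitization ℝ 𝔄) := by
  simp [op]

theorem op_injective : Function.Injective (op : RapidFun (Ω' × Ω) 𝔄 → Opr 𝔄 Ω Ω') :=
  fun A B h => RapidFun.ext fun z => Unitization.inr_injective (R := ℝ) <| by
    rw [← op_single A z.1 z.2, h, op_single]

theorem op_add (A B : RapidFun (Ω' × Ω) 𝔄) : op (A + B) = op A + op B := by
  simp [op, kop_add]

theorem op_neg (A : RapidFun (Ω' × Ω) 𝔄) : op (-A) = -op A := by
  simp [op, kop_neg]

theorem op_zero : op (0 : RapidFun (Ω' × Ω) 𝔄) = 0 :=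
  op_ext fun i j => by simp

theorem op_smul (c : ℝ) (A : RapidFun (Ω' × Ω) 𝔄) : op (c • A) = c • op A :=
  op_ext fun i j => by
    rw [op_single, RapidFun.smul_apply, Unitization.inr_smul, _root_.smul_apply, RapidFun.smul_apply,
      op_single]

theorem op_comp [TemperedIndex Ξ] (A : RapidFun (Ω' × Ω) 𝔄) (B : RapidFun (Ω × Ξ) 𝔄) :
    op (kmul A B) = op A ∘L op B :=
  op_ext fun i j => by
    have h := (inrCLM 𝔄).map_tsum (summable_mul A B i j)
    rw [op_single, kmul_apply, ContinuousLinearMap.comp_apply]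
    refine h.trans ?_
    rw [show op A (op B (single j)) i = _ from kop_apply _ _ _]
    refine tsum_congr fun k => ?_
    rw [op_single]
    exact Unitization.inr_mul ℝ _ _

theorem relOp_comp_op {r : Ω' → Ω''} (hr : IsTempered r) (A : RapidFun (Ω' × Ω) 𝔄) :
    relOp hr ∘L op A = op (rel (hr.prodMap .id) A) :=
  op_ext fun i j => by
    rw [ContinuousLinearMap.comp_apply, op_single]
    by_cases h : ∃ a, r a = i
    · obtain ⟨a, rfl⟩ := h
      rw [relOp_apply, op_single]
      exact congrArg _ (rel_apply (hr.prodMap .id) A (a, j)).symm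
    · push Not at h
      rw [relOp_apply_eq_zero hr _ h, rel_apply_eq_zero, Unitization.inr_zero]
      exact fun z hz => h z.1 (congrArg Prod.fst hz)

theorem pullOp_comp_op {r : Ω'' → Ω'} (hr : IsTempered r) (A : RapidFun (Ω' × Ω) 𝔄) :
    pullOp hr ∘L op A = op (pull (hr.prodMap .id) A) :=
  op_ext fun i j => by simp

theorem op_comp_relOp [TemperedIndex Ξ] {r : Ξ → Ω} (hr : IsTempered r) (A : RapidFun (Ω' × Ω) 𝔄) :
    op A ∘L relOp hr = op (pull ((IsTempered.id (Ω := Ω')).prodMap hr) A) :=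
  op_ext fun i j => by simp

theorem op_comp_pullOp [TemperedIndex Ξ] {r : Ω → Ξ} (hr : IsTempered r) (A : RapidFun (Ω' × Ω) 𝔄) :
    op A ∘L pullOp hr = op (rel ((IsTempered.id (Ω := Ω')).prodMap hr) A) :=
  op_ext fun i j => by
    rw [ContinuousLinearMap.comp_apply, op_single]
    by_cases h : ∃ a, r a = j
    · obtain ⟨a, rfl⟩ := h
      rw [pullOp_single, op_single]
      exact congrArg _ (rel_apply ((IsTempered.id (Ω := Ω')).prodMap hr) A (i, a)).symm
    · push Not at h
      rw [pullOp_single_eq_zero hr h, rel_apply_eq_zero, Unitization.inr_zero, map_zero, RapidFun.zero_apply]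
      exact fun z hz => h z.2 (congrArg Prod.snd hz)

theorem proj_comp_op (s : Ω' → Prop) (A : RapidFun (Ω' × Ω) 𝔄) :
    proj s ∘L op A = op (restr (fun z : Ω' × Ω => s z.1) A) :=
  op_ext fun i j => by
    classical
    rw [ContinuousLinearMap.comp_apply, op_single, proj_apply, restr_apply, op_single]
    split_ifs <;> simp

theorem proj_single (s : Ω → Prop) [DecidablePred s] (j : Ω) :
    proj s (single j : RapidFun Ω (Unitization ℝ 𝔄)) = if s j then single j else 0 := by
  refine RapidFun.ext fun i => ?_
  rw [proj_apply]
  by_cases hij : i = j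
  · subst hij; split_ifs <;> simp
  · rw [single_ne hij]
    split_ifs <;> simp [single_ne hij]

theorem op_comp_proj (s : Ω → Prop) (A : RapidFun (Ω' × Ω) 𝔄) :
    op A ∘L proj s = op (restr (fun z : Ω' × Ω => s z.2) A) :=
  op_ext fun i j => by
    classical
    rw [ContinuousLinearMap.comp_apply, op_single, restr_apply, proj_single]
    split_ifs <;> simp

theorem isTempered_shuffle : IsTempered (fun z : (Ω × Ω') × (Ξ × Ξ') => ((z.1.1, z.2.1), (z.1.2, z.2.2))) :=
  .of_eq (fun a b h => by
    simp only [Prod.mk.injEq] at h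
    exact Prod.ext (Prod.ext h.1.1 h.2.1) (Prod.ext h.1.2 h.2.2))
    fun z => by simp only [IndexSize.size]; omega

theorem tens_op [TemperedIndex Ω'] [TemperedIndex Ξ] (A : RapidFun (Ω' × Ω) 𝔄) (B : RapidFun (Ξ' × Ξ) 𝔄) :
    tens (op A) (op B) = op (pull isTempered_shuffle (ext₂ A B)) :=
  op_ext fun i j => by
    rw [tens_single, op_single, op_single, op_single]
    exact (Unitization.inr_mul ℝ _ _).symm

theorem isTempered_mk_right (l : Ξ) : IsTempered (fun ω : Ω => (ω, l)) :=
  .of_le (fun _ _ h => congrArg Prod.fst h) (wt l) (fun ω => by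
    rw [mul_comm]
    exact wt_prod_le ω l) (fun ω => (wt_le_wt_prod_left ω l).trans
      (le_mul_of_one_le_left (wt_pos _).le (one_le_wt l)))

/-- The spectator row index is moved over to the columns; on the regrouped matrix, `X` acts on the
whole row index, and no amplification remains. -/
theorem amp_comp_op [TemperedIndex Ξ] (X : Opr 𝔄 Ω Ω') (A : RapidFun ((Ω × Ξ') × Ξ) 𝔄)
    (B : RapidFun (Ω' × (Ξ' × Ξ)) 𝔄) [TemperedIndex Ξ'] (h : op B = X ∘L op (pull .assoc_symm A)) :
    op (pull .assoc B) = amp X ∘L op A :=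
  op_ext fun i j => by
    rw [op_single, ContinuousLinearMap.comp_apply, amp_apply]
    have h1 : slice (op A (single j)) i.2 = op (pull .assoc_symm A) (single (i.2, j)) := by
      refine RapidFun.ext fun ω => ?_
      rw [slice_apply, op_single, op_single, pull_apply]
    rw [h1]
    have h2 := congrArg (fun Y : Opr 𝔄 (Ξ' × Ξ) Ω' => Y (single (i.2, j)) i.1) h
    rw [ContinuousLinearMap.comp_apply, op_single] at h2
    exact h2

theorem isTempered_rotate : IsTempered (fun z : (Ξ × Ξ') × Ω => (z.1.2, (z.2, z.1.1))) :=
  .of_eq (fun a b h => by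
    simp only [Prod.mk.injEq] at h
    exact Prod.ext (Prod.ext h.2.2 h.1) h.2.1)
    fun z => by simp only [IndexSize.size]; omega

theorem isTempered_rotate_symm : IsTempered (fun z : Ξ' × (Ω × Ξ) => ((z.2.2, z.1), z.2.1)) :=
  .of_eq (fun a b h => by
    simp only [Prod.mk.injEq] at h
    exact Prod.ext h.1.2 (Prod.ext h.2 h.1.1))
    fun z => by simp only [IndexSize.size]; omega

/-- The mirror image of the regrouping for left multiplication: the spectator column index is moved
over to the rows, so that only the index on which `X` acts remains as column. -/
theorem op_comp_amp [TemperedIndex Ω'] [TemperedIndex Ξ] (X : Opr 𝔄 Ω Ω')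
    (A : RapidFun (Ξ' × (Ω' × Ξ)) 𝔄) (B : RapidFun ((Ξ × Ξ') × Ω) 𝔄)
    (h : op B = op (𝔄 := 𝔄) (pull isTempered_rotate A : RapidFun ((Ξ × Ξ') × Ω') 𝔄) ∘L X) :
    op (pull isTempered_rotate_symm B) = op A ∘L amp X :=
  op_ext fun i ⟨j, l⟩ => by
    rw [op_single, ContinuousLinearMap.comp_apply, pull_apply]
    have h1 : amp X (single (j, l) : RapidFun (Ω × Ξ) (Unitization ℝ 𝔄)) =
        relOp (isTempered_mk_right l) (X (single j)) := by
      refine RapidFun.ext fun z => ?_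
      rw [amp_single]
      by_cases hz : z.2 = l
      · obtain ⟨a, b⟩ := z
        obtain rfl : b = l := hz
        rw [relOp_apply (isTempered_mk_right b) _ a, single_self, one_mul]
      · rw [single_ne hz, zero_mul, relOp_apply_eq_zero]
        exact fun a ha => hz (congrArg Prod.snd ha).symm
    have h2 := congrArg (fun Y : Opr 𝔄 Ω' Ξ' => Y (X (single j)) i) (op_comp_relOp (isTempered_mk_right l) A)
    have h3 := congrArg (fun Y : Opr 𝔄 Ω (Ξ × Ξ') => Y (single j) (l, i)) h
    rw [h1]
    refine Eq.trans ?_ h2.symm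
    exact (op_single B (l, i) j).symm.trans h3

end Basic

/-! ### Smooth families of operators -/

section Families

variable {X : Type x} {E : Type u} [AddCommGroup E] [Module ℝ E] [TopologicalSpace E] {i : X → E}
  {Ω Ω' Ω'' Ξ Ξ' : Type} [IndexSize Ω] [IndexSize Ω'] [IndexSize Ω''] [IndexSize Ξ]
  [IndexSize Ξ'] [TemperedIndex Ω] [TemperedIndex Ω'] [TemperedIndex Ω''] [TemperedIndex Ξ]
  [TemperedIndex Ξ']

/-- Smooth families of operators with rapidly decreasing matrices. -/
def SmoothKernel (i : X → E) (D : X → Opr 𝔄 Ω Ω') : Prop :=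
  ∃ δ : X → RapidFun (Ω' × Ω) 𝔄, SmoothVia i id δ ∧ ∀ x, op (δ x) = D x

namespace SmoothKernel

theorem congr {D D' : X → Opr 𝔄 Ω Ω'} (hD : SmoothKernel i D) (h : ∀ x, D x = D' x) :
    SmoothKernel i D' := funext h ▸ hD

theorem zero : SmoothKernel i (fun _ => (0 : Opr 𝔄 Ω Ω')) :=
  ⟨fun _ => 0, .const _, fun _ => op_zero⟩

theorem add {D D' : X → Opr 𝔄 Ω Ω'} (h : SmoothKernel i D) (h' : SmoothKernel i D') :
    SmoothKernel i fun x => D x + D' x := by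
  obtain ⟨δ, hδ, h⟩ := h
  obtain ⟨δ', hδ', h'⟩ := h'
  exact ⟨_, hδ.add hδ', fun x => by rw [op_add, h, h']⟩

theorem neg {D : X → Opr 𝔄 Ω Ω'} (h : SmoothKernel i D) : SmoothKernel i fun x => -D x := by
  obtain ⟨δ, hδ, h⟩ := h
  exact ⟨_, hδ.clm (-ContinuousLinearMap.id ℝ _), fun x => by
    dsimp only
    rw [← h]
    exact op_neg _⟩

theorem sub {D D' : X → Opr 𝔄 Ω Ω'} (h : SmoothKernel i D) (h' : SmoothKernel i D') :
    SmoothKernel i fun x => D x - D' x := by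
  simpa only [sub_eq_add_neg] using h.add h'.neg

theorem sum {ι : Type*} (s : Finset ι) {D : ι → X → Opr 𝔄 Ω Ω'} (h : ∀ a, SmoothKernel i (D a)) :
    SmoothKernel i fun x => ∑ a ∈ s, D a x := by
  classical
  induction s using Finset.induction_on with
  | empty => simpa using zero
  | insert a s ha ih => simpa [Finset.sum_insert ha] using (h a).add ih

theorem smul {D : X → Opr 𝔄 Ω Ω'} (h : SmoothKernel i D) {c : X → ℝ} (hc : SmoothVia i id c) :
    SmoothKernel i fun x => c x • D x := by
  obtain ⟨δ, hδ, h⟩ := h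
  exact ⟨_, hc.smul hδ, fun x => by dsimp only; rw [← h, op_smul]⟩

theorem comp {D : X → Opr 𝔄 Ω' Ω''} {D' : X → Opr 𝔄 Ω Ω'} (h : SmoothKernel i D)
    (h' : SmoothKernel i D') : SmoothKernel i fun x => D x ∘L D' x := by
  obtain ⟨δ, hδ, h⟩ := h
  obtain ⟨δ', hδ', h'⟩ := h'
  exact ⟨_, SmoothVia.bilinear kmul continuous_kmul hδ hδ', fun x => by rw [op_comp, h, h']⟩

theorem tens {D : X → Opr 𝔄 Ω Ω'} {D' : X → Opr 𝔄 Ξ Ξ'} (h : SmoothKernel i D)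
    (h' : SmoothKernel i D') : SmoothKernel i fun x => RapidFun.tens (D x) (D' x) := by
  obtain ⟨δ, hδ, h⟩ := h
  obtain ⟨δ', hδ', h'⟩ := h'
  exact ⟨_, (SmoothVia.bilinear ext₂ continuous_ext₂ hδ hδ').clm (pull isTempered_shuffle),
    fun x => by dsimp only; rw [← h, ← h', tens_op]⟩

theorem map {Y : Type*} {F : Type v} [AddCommGroup F] [Module ℝ F] [TopologicalSpace F]
    [IsTopologicalAddGroup E] [ContinuousSMul ℝ E]
    {j : Y → F} {D : X → Opr 𝔄 Ω Ω'} (h : SmoothKernel i D) {g : Y → X} (hg : SmoothVia j i g) :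
    SmoothKernel j fun y => D (g y) := by
  obtain ⟨δ, hδ, h⟩ := h
  exact ⟨_, hδ.comp hg, fun x => h _⟩

end SmoothKernel

variable [IsTopologicalAddGroup E] [ContinuousSMul ℝ E]

/-- Smooth families of operators which can be multiplied with smooth families of operators with
rapidly decreasing matrices from both sides. -/
structure SmoothMult (i : X → E) (J : X → Opr 𝔄 Ω Ω') : Prop where
  left : ∀ {Y : Type x} {F : Type u} [AddCommGroup F] [Module ℝ F] [TopologicalSpace F]
    [IsTopologicalAddGroup F] [ContinuousSMul ℝ F] {j : Y → F} {g : Y → X}, SmoothVia j i g →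
    ∀ {Ξ : Type} [IndexSize Ξ] [TemperedIndex Ξ] {D : Y → Opr 𝔄 Ξ Ω}, SmoothKernel j D →
    SmoothKernel j fun y => J (g y) ∘L D y
  right : ∀ {Y : Type x} {F : Type u} [AddCommGroup F] [Module ℝ F] [TopologicalSpace F]
    [IsTopologicalAddGroup F] [ContinuousSMul ℝ F] {j : Y → F} {g : Y → X}, SmoothVia j i g →
    ∀ {Ξ : Type} [IndexSize Ξ] [TemperedIndex Ξ] {D : Y → Opr 𝔄 Ω' Ξ}, SmoothKernel j D →
    SmoothKernel j fun y => D y ∘L J (g y)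

theorem SmoothVia.self (i : X → E) : SmoothVia i i (id : X → X) :=
  SmoothVia.of_global (BastianiSmooth.of_clm (ContinuousLinearMap.id ℝ E)) fun _ => rfl

namespace SmoothMult

/-- Immediate because substitutions are built into the definition of `SmoothMult`. It is what allows
a family to be viewed as constant in an additional time variable. -/
theorem map {Y : Type x} {F : Type u} [AddCommGroup F] [Module ℝ F] [TopologicalSpace F]
    [IsTopologicalAddGroup F] [ContinuousSMul ℝ F] [PolynormableSpace ℝ E] {j : Y → F} {g : Y → X}
    {J : X → Opr 𝔄 Ω Ω'} (hJ : SmoothMult i J) (hg : SmoothVia j i g) :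
    SmoothMult j fun y => J (g y) :=
  ⟨fun h _ _ _ _ hD => hJ.left (hg.comp h) hD, fun h _ _ _ _ hD => hJ.right (hg.comp h) hD⟩

theorem of_kernel {J : X → Opr 𝔄 Ω Ω'} (h : SmoothKernel i J) : SmoothMult i J :=
  ⟨fun hg _ _ _ _ hD => (h.map hg).comp hD, fun hg _ _ _ _ hD => hD.comp (h.map hg)⟩

theorem comp {J : X → Opr 𝔄 Ω' Ω''} {K : X → Opr 𝔄 Ω Ω'} (hJ : SmoothMult i J)
    (hK : SmoothMult i K) : SmoothMult i fun x => J x ∘L K x :=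
  ⟨fun hg _ _ _ _ hD => hJ.left hg (hK.left hg hD),
    fun hg _ _ _ _ hD => hK.right hg (hJ.right hg hD)⟩

theorem one : SmoothMult i fun _ => (1 : Opr 𝔄 Ω Ω) :=
  ⟨fun _ _ _ _ _ hD => hD, fun _ _ _ _ _ hD => hD⟩

theorem add {J K : X → Opr 𝔄 Ω Ω'} (hJ : SmoothMult i J) (hK : SmoothMult i K) :
    SmoothMult i fun x => J x + K x :=
  ⟨fun hg _ _ _ _ hD => by
    simpa only [ContinuousLinearMap.add_comp] using (hJ.left hg hD).add (hK.left hg hD),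
   fun hg _ _ _ _ hD => by
    simpa only [ContinuousLinearMap.comp_add] using (hJ.right hg hD).add (hK.right hg hD)⟩

theorem neg {J : X → Opr 𝔄 Ω Ω'} (hJ : SmoothMult i J) : SmoothMult i fun x => -J x :=
  ⟨fun hg _ _ _ _ hD => by
    simpa only [ContinuousLinearMap.neg_comp] using (hJ.left hg hD).neg,
   fun hg _ _ _ _ hD => by
    simpa only [ContinuousLinearMap.comp_neg] using (hJ.right hg hD).neg⟩

theorem sub {J K : X → Opr 𝔄 Ω Ω'} (hJ : SmoothMult i J) (hK : SmoothMult i K) :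
    SmoothMult i fun x => J x - K x := by
  simpa only [sub_eq_add_neg] using hJ.add hK.neg

theorem smul {J : X → Opr 𝔄 Ω Ω'} (hJ : SmoothMult i J) {c : X → ℝ} (hc : SmoothVia i id c) :
    SmoothMult i fun x => c x • J x :=
  ⟨fun hg _ _ _ _ hD => by
    simpa only [ContinuousLinearMap.smul_comp, Function.comp_apply] using (hJ.left hg hD).smul (hc.comp hg),
   fun hg _ _ _ _ hD => by
    simpa only [ContinuousLinearMap.comp_smul, Function.comp_apply] using (hJ.right hg hD).smul (hc.comp hg)⟩

theorem relOp {r : Ω → Ω'} (hr : IsTempered r) :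
    SmoothMult i fun _ => (RapidFun.relOp hr : Opr 𝔄 Ω Ω') :=
  ⟨fun _ _ _ _ _ ⟨_, hδ, h⟩ => ⟨_, hδ.clm (rel _), fun x => by
    dsimp only; rw [← h, relOp_comp_op]⟩,
   fun _ _ _ _ _ ⟨_, hδ, h⟩ => ⟨_, hδ.clm (pull _), fun x => by
    dsimp only; rw [← h, op_comp_relOp]⟩⟩

theorem pullOp {r : Ω' → Ω} (hr : IsTempered r) :
    SmoothMult i fun _ => (RapidFun.pullOp hr : Opr 𝔄 Ω Ω') :=
  ⟨fun _ _ _ _ _ ⟨_, hδ, h⟩ => ⟨_, hδ.clm (pull _), fun x => by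
    dsimp only; rw [← h, pullOp_comp_op]⟩,
   fun _ _ _ _ _ ⟨_, hδ, h⟩ => ⟨_, hδ.clm (rel _), fun x => by
    dsimp only; rw [← h, op_comp_pullOp]⟩⟩

theorem proj (s : Ω → Prop) : SmoothMult i fun _ => (RapidFun.proj s : Opr 𝔄 Ω Ω) :=
  ⟨fun _ _ _ _ _ ⟨_, hδ, h⟩ => ⟨_, hδ.clm (restr _), fun x => by
    dsimp only; rw [← h, proj_comp_op]⟩,
   fun _ _ _ _ _ ⟨_, hδ, h⟩ => ⟨_, hδ.clm (restr _), fun x => by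
    dsimp only; rw [← h, op_comp_proj]⟩⟩

theorem amp {J : X → Opr 𝔄 Ω Ω'} (hJ : SmoothMult i J) :
    SmoothMult i fun x => (RapidFun.amp (J x) : Opr 𝔄 (Ω × Ξ) (Ω' × Ξ)) := by
  refine ⟨fun hg _ _ _ _ ⟨δ, hδ, h⟩ => ?_, fun hg _ _ _ _ ⟨δ, hδ, h⟩ => ?_⟩
  · obtain ⟨ε, hε, h'⟩ := hJ.left hg ⟨_, hδ.clm (pull .assoc_symm), fun _ => rfl⟩
    exact ⟨_, hε.clm (pull .assoc), fun x => by dsimp only; rw [← h, amp_comp_op _ _ _ (h' x)]⟩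
  · obtain ⟨ε, hε, h'⟩ := hJ.right hg ⟨_, hδ.clm (pull isTempered_rotate), fun _ => rfl⟩
    exact ⟨_, hε.clm (pull isTempered_rotate_symm), fun x => by
      dsimp only; rw [← h, op_comp_amp _ _ _ (h' x)]⟩

theorem tens {J : X → Opr 𝔄 Ω Ω'} {K : X → Opr 𝔄 Ξ Ξ'} (hJ : SmoothMult i J)
    (hK : SmoothMult i K) : SmoothMult i fun x => RapidFun.tens (J x) (K x) :=
  hJ.amp.comp ((pullOp .swap).comp (hK.amp.comp (pullOp .swap)))

end SmoothMult

theorem SmoothKernel.sandwich {J : X → Opr 𝔄 Ω Ω'} {D : X → Opr 𝔄 Ξ Ω} {K : X → Opr 𝔄 Ξ' Ξ}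
    (hJ : SmoothMult i J) (hD : SmoothKernel i D) (hK : SmoothMult i K) :
    SmoothKernel i fun x => J x ∘L D x ∘L K x :=
  hJ.left (.self i) (hK.right (.self i) hD)

end Families

end Op

/-! ### Smooth families of scalar kernels -/

section KernelJet

variable {Ω Ω' Ξ : Type*} [IndexSize Ω] [IndexSize Ω'] [IndexSize Ξ]

/-- A sequence of families of tempered kernels, each of which is the derivative of the previous
one, with uniform bounds. -/
structure IsKernelJet (G : ℕ → ℝ → temperedKernel Ω' Ω) : Prop where
  deriv : ∀ j t i n, HasDerivAt (fun u => (G j u).1 i n) ((G (j + 1) t).1 i n) t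
  bound : ∀ j k, ∃ (C : ℝ) (l : ℕ), 0 ≤ C ∧ ∀ t i n, wt i ^ k * |(G j t).1 i n| ≤ C * wt n ^ l

theorem abs_sub_le_of_hasDerivAt {g g' : ℝ → ℝ} (h : ∀ t, HasDerivAt g (g' t) t) {M : ℝ} {t a : ℝ}
    (hM : ∀ u, |u - t| ≤ |a| → |g' u| ≤ M) : |g (t + a) - g t| ≤ M * |a| := by
  have := (convex_uIcc t (t + a)).norm_image_sub_le_of_norm_hasDerivWithin_le (f := g) (f' := g')
    (C := M) (fun u _ => (h u).hasDerivWithinAt)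
    (fun u hu => hM u (by simpa using Set.abs_sub_left_of_mem_uIcc hu))
    Set.left_mem_uIcc Set.right_mem_uIcc
  simpa using this

theorem abs_sub_sub_le_of_hasDerivAt {g g' g'' : ℝ → ℝ} (h : ∀ t, HasDerivAt g (g' t) t)
    (h' : ∀ t, HasDerivAt g' (g'' t) t) {M : ℝ} (hM : ∀ u, |g'' u| ≤ M) (t a : ℝ) :
    |g (t + a) - g t - a * g' t| ≤ M * |a| ^ 2 := by
  have h0 : 0 ≤ M := (abs_nonneg _).trans (hM 0)
  have := abs_sub_le_of_hasDerivAt (g := fun u => g u - u * g' t) (g' := fun u => g' u - g' t)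
    (fun u => (h u).sub (by simpa using (hasDerivAt_id u).mul_const (g' t))) (M := M * |a|) (t := t)
    (a := a) fun u hu => by
      have := abs_sub_le_of_hasDerivAt h' (M := M) (t := t) (a := u - t) fun u _ => hM u
      rw [add_sub_cancel] at this
      exact this.trans (mul_le_mul_of_nonneg_left hu h0)
  rw [show g (t + a) - g t - a * g' t = g (t + a) - (t + a) * g' t - (g t - t * g' t) by ring]
  exact this.trans (le_of_eq (by ring))

namespace IsKernelJet

variable {G : ℕ → ℝ → temperedKernel Ω' Ω} (hG : IsKernelJet G)
include hG

theorem shift : IsKernelJet fun j => G (j + 1) :=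
  ⟨fun j => hG.deriv (j + 1), fun j => hG.bound (j + 1)⟩

end IsKernelJet

variable [TemperedIndex Ω] {V : Type*}
  [AddCommGroup V] [Module ℝ V] [TopologicalSpace V] [IsTopologicalAddGroup V]
  [PolynormableSpace ℝ V] [AbsSummableSpace V] [T2Space V]

/-- The increment is G(u)(h - f) + (G(u) - G(t)) f. The first part is controlled by the bounds of
the kernels, uniform in time, and the second part by the mean value theorem and the bounds of the
first derivative. -/
theorem IsKernelJet.continuous_scal {G : ℕ → ℝ → temperedKernel Ω' Ω} (hG : IsKernelJet G) :
    Continuous fun z : RapidFun (Ω × Ξ) V × ℝ => scal (G 0 z.2) z.1 := by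
  rw [continuous_iff_continuousAt]
  rintro ⟨f, t⟩
  rw [ContinuousAt, (withSeminorms (Ω' × Ξ) V).tendsto_nhds]
  rintro ⟨p, k⟩ ε hε
  obtain ⟨C, l, hC0, hC⟩ := hG.bound 0 k
  obtain ⟨D, m, hD0, hD⟩ := hG.bound 1 k
  have hb1 := fun u => sem_scal_le (Ξ := Ξ) (V := V) hC0 (hC u) p
  have hb2 : ∀ u, sem (Ω' × Ξ) p k (scal (G 0 u - G 0 t) f) ≤
      (|u - t| * D * sumConst Ω) * sem _ p (k + (m + sumExp Ω)) f := fun u =>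
    sem_scal_le (mul_nonneg (abs_nonneg _) hD0) (fun i n => by
      have hi : 0 < wt i ^ k := pow_pos (wt_pos _) _
      have := abs_sub_le_of_hasDerivAt (fun t => hG.deriv 0 t i n) (M := (D * wt n ^ m) / wt i ^ k)
        (t := t) (a := u - t) fun s _ => by
          rw [le_div_iff₀ hi, mul_comm]; exact hD s i n
      rw [add_sub_cancel, div_mul_eq_mul_div, le_div_iff₀ hi] at this
      calc _ = |(G 0 u).1 i n - (G 0 t).1 i n| * wt i ^ k := mul_comm _ _
        _ ≤ _ := this
        _ = _ := by ring) p f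
  have hB : Continuous fun z : RapidFun (Ω × Ξ) V × ℝ =>
      (C * sumConst Ω) * sem _ p (k + (l + sumExp Ω)) (z.1 - f) +
        (|z.2 - t| * D * sumConst Ω) * sem _ p (k + (m + sumExp Ω)) f := by
    have h1 : Continuous fun z : RapidFun (Ω × Ξ) V × ℝ =>
        sem _ p (k + (l + sumExp Ω)) (z.1 - f) :=
      (continuous_sem _ _).comp (continuous_fst.sub continuous_const)
    fun_prop
  have h5 := hB.tendsto (f, t)
  simp only [sub_self, map_zero, abs_zero, zero_mul, mul_zero, add_zero] at h5
  filter_upwards [h5.eventually (gt_mem_nhds hε)] with z hz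
  refine lt_of_le_of_lt ?_ hz
  have e : scal (G 0 z.2) z.1 - scal (G 0 t) f =
      scal (G 0 z.2) (z.1 - f) + scal (G 0 z.2 - G 0 t) f := by
    rw [map_sub, scal_sub]; abel
  show sem _ p k (scal (G 0 z.2) z.1 - scal (G 0 t) f) ≤ _
  rw [e]
  exact (map_add_le_add _ _ _).trans (add_le_add (hb1 _ _) (hb2 _))

/-- Entrywise Taylor expansion: the uniform bounds of the second derivatives make the difference
between quotient and derivative a kernel of size O(|τ|). -/
theorem IsKernelJet.tendsto_scal {G : ℕ → ℝ → temperedKernel Ω' Ω} (hG : IsKernelJet G)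
    (f : RapidFun (Ω × Ξ) V) (t s : ℝ) :
    Tendsto (fun τ : ℝ => τ⁻¹ • (scal (G 0 (t + τ * s)) f - scal (G 0 t) f)) (𝓝[≠] 0)
      (𝓝 (s • scal (G 1 t) f)) := by
  rw [(withSeminorms (Ω' × Ξ) V).tendsto_nhds]
  rintro ⟨p, k⟩ ε hε
  obtain ⟨D, m, hD0, hD⟩ := hG.bound 2 k
  have hb : ∀ τ : ℝ, τ ≠ 0 → sem (Ω' × Ξ) p k
      (scal (τ⁻¹ • (G 0 (t + τ * s) - G 0 t) - s • G 1 t) f) ≤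
      (|τ| * s ^ 2 * D * sumConst Ω) * sem _ p (k + (m + sumExp Ω)) f := fun τ hτ =>
    sem_scal_le (mul_nonneg (by positivity) hD0) (fun i n => by
      have hi : 0 < wt i ^ k := pow_pos (wt_pos _) _
      have hτ' : 0 < |τ| := abs_pos.2 hτ
      have := abs_sub_sub_le_of_hasDerivAt (fun t => hG.deriv 0 t i n) (fun t => hG.deriv 1 t i n)
        (M := (D * wt n ^ m) / wt i ^ k) (fun s => by
          rw [le_div_iff₀ hi, mul_comm]; exact hD s i n) t (τ * s)
      rw [div_mul_eq_mul_div, le_div_iff₀ hi] at this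
      have e : (τ⁻¹ • (G 0 (t + τ * s) - G 0 t) - s • G 1 t).1 i n =
          τ⁻¹ * ((G 0 (t + τ * s)).1 i n - (G 0 t).1 i n - τ * s * (G 1 t).1 i n) := by
        have : (τ⁻¹ • (G 0 (t + τ * s) - G 0 t) - s • G 1 t).1 i n =
          τ⁻¹ * ((G 0 (t + τ * s)).1 i n - (G 0 t).1 i n) - s * (G 1 t).1 i n := rfl
        rw [this]; field_simp
      rw [e, abs_mul, abs_inv]
      calc _ = |τ|⁻¹ * (|(G 0 (t + τ * s)).1 i n - (G 0 t).1 i n - τ * s * (G 1 t).1 i n|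
            * wt i ^ k) := by ring
        _ ≤ |τ|⁻¹ * (D * wt n ^ m * |τ * s| ^ 2) := mul_le_mul_of_nonneg_left this (by positivity)
        _ = _ := by rw [abs_mul, mul_pow, sq_abs s]; field_simp) p f
  have hB : Continuous fun τ : ℝ =>
      (|τ| * s ^ 2 * D * sumConst Ω) * sem _ p (k + (m + sumExp Ω)) f := by fun_prop
  have h5 := hB.tendsto 0
  simp only [abs_zero, zero_mul] at h5
  filter_upwards [(h5.mono_left nhdsWithin_le_nhds).eventually (gt_mem_nhds hε),
    self_mem_nhdsWithin] with τ hτ hτ0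
  refine lt_of_le_of_lt ?_ hτ
  have := hb τ hτ0
  rwa [scal_sub, scal_smul, scal_smul, scal_sub] at this

/-- The derivative at (f, t) in the direction (h, s) is G₀(t) h + s G₁(t) f. Both terms are of the
same kind, for the jet and for the shifted jet, so induction applies. -/
theorem IsKernelJet.bastianiCk_scal (n : ℕ) : ∀ {G : ℕ → ℝ → temperedKernel Ω' Ω},
    IsKernelJet G → BastianiCk n Set.univ
      (fun z : RapidFun (Ω × Ξ) V × ℝ => (scal (G 0 z.2) z.1 : RapidFun (Ω' × Ξ) V)) := by
  induction n with
  | zero => intro G hG; exact hG.continuous_scal.continuousOn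
  | succ n ih =>
    intro G hG
    refine ⟨hG.continuous_scal.continuousOn, fun z => scal (G 0 z.1.2) z.2.1 +
      z.2.2 • scal (G 1 z.1.2) z.1.1, ?_, ?_⟩
    · rintro ⟨f, t⟩ - ⟨h, s⟩
      have h1 : Tendsto (fun τ : ℝ => (scal (G 0 (t + τ * s)) h : RapidFun (Ω' × Ξ) V)) (𝓝[≠] 0)
          (𝓝 (scal (G 0 t) h)) := by
        have : Continuous fun τ : ℝ => (scal (G 0 (t + τ * s)) h : RapidFun (Ω' × Ξ) V) :=
          hG.continuous_scal.comp (f := fun τ : ℝ => (h, t + τ * s)) (by fun_prop)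
        simpa using (this.tendsto 0).mono_left nhdsWithin_le_nhds
      refine (h1.add (hG.tendsto_scal f t s)).congr' ?_
      filter_upwards [self_mem_nhdsWithin] with τ hτ
      have hτ : τ ≠ 0 := hτ
      simp only [Prod.smul_mk, Prod.mk_add_mk, smul_eq_mul, map_add, map_smul, smul_sub, smul_add,
        smul_smul, inv_mul_cancel₀ hτ, one_smul]
      abel
    · let P := RapidFun (Ω × Ξ) V × ℝ
      have h1 := (ih hG).comp_clm ((((ContinuousLinearMap.fst ℝ _ ℝ).comp
        (ContinuousLinearMap.snd ℝ P P)).prod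
        ((ContinuousLinearMap.snd ℝ _ ℝ).comp (ContinuousLinearMap.fst ℝ P P))))
      have h2 := (ih hG.shift).comp_clm (ContinuousLinearMap.fst ℝ P P)
      have h3 : BastianiCk n Set.univ (fun z : P × P => z.2.2) :=
        BastianiCk.of_clm ((ContinuousLinearMap.snd ℝ _ ℝ).comp (ContinuousLinearMap.snd ℝ P P))
      have h4 := (BastianiSmooth.bilinear (LinearMap.lsmul ℝ (RapidFun (Ω' × Ξ) V))
        continuous_smul n).comp (h3.prodMk h2) isOpen_univ (Set.mapsTo_univ _ _)
      have h5 := BastianiCk.add h1 h4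
      rw [Set.univ_prod_univ]
      exact h5

theorem IsKernelJet.smooth_scal {G : ℕ → ℝ → temperedKernel Ω' Ω} (hG : IsKernelJet G) :
    BastianiSmooth
      (fun z : RapidFun (Ω × Ξ) V × ℝ => (scal (G 0 z.2) z.1 : RapidFun (Ω' × Ξ) V)) :=
  fun n => bastianiCk_scal n hG

end KernelJet

/-! ### Smooth families of diagonal operators -/

section Diag

variable {Ω : Type*} [IndexSize Ω]

/-- The diagonal kernel. -/
noncomputable def diagKernel (φ : Ω → ℝ) (h : ∃ (C : ℝ) (l : ℕ), 0 ≤ C ∧ ∀ ω, |φ ω| ≤ C * wt ω ^ l) :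
    temperedKernel Ω Ω :=
  ⟨fun i j => open Classical in if i = j then φ i else 0, fun k => by
    classical
    obtain ⟨C, l, hC, h⟩ := h
    refine ⟨C, l + k, fun i j => ?_⟩
    dsimp only
    split_ifs with hij
    · subst hij
      rw [pow_add, mul_comm, ← mul_assoc]
      exact mul_le_mul_of_nonneg_right (h i) (pow_nonneg (wt_pos _).le _)
    · simpa using mul_nonneg hC (pow_nonneg (wt_pos j).le _)⟩

theorem diagKernel_apply [DecidableEq Ω] (φ : Ω → ℝ) (h) (i j : Ω) :
    (diagKernel φ h).1 i j = if i = j then φ i else 0 := by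
  rw [diagKernel]
  dsimp only
  congr

/-- Sequences of families of functions, each of which is the derivative of the previous
one, with uniform polynomial bounds. -/
structure IsDiagJet (φ : ℕ → ℝ → Ω → ℝ) : Prop where
  deriv : ∀ j t ω, HasDerivAt (fun u => φ j u ω) (φ (j + 1) t ω) t
  bound : ∀ j, ∃ (C : ℝ) (l : ℕ), 0 ≤ C ∧ ∀ t ω, |φ j t ω| ≤ C * wt ω ^ l

theorem IsDiagJet.exists_bound {φ : ℕ → ℝ → Ω → ℝ} (h : IsDiagJet φ) (j : ℕ) (t : ℝ) :
    ∃ (C : ℝ) (l : ℕ), 0 ≤ C ∧ ∀ ω, |φ j t ω| ≤ C * wt ω ^ l := by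
  obtain ⟨C, l, h0, h⟩ := h.bound j
  exact ⟨C, l, h0, h t⟩

theorem IsDiagJet.isKernelJet {φ : ℕ → ℝ → Ω → ℝ} (h : IsDiagJet φ) :
    IsKernelJet fun j t => diagKernel (φ j t) (h.exists_bound j t) := by
  classical
  refine ⟨fun j t i n => ?_, fun j k => ?_⟩
  · simp only [diagKernel_apply]
    split_ifs
    · exact h.deriv j t i
    · exact hasDerivAt_const _ _
  · obtain ⟨C, l, hC, h⟩ := h.bound j
    refine ⟨C, l + k, hC, fun t i j => ?_⟩
    rw [diagKernel_apply]
    split_ifs with hij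
    · subst hij
      rw [pow_add, mul_comm, ← mul_assoc]
      exact mul_le_mul_of_nonneg_right (h t i) (pow_nonneg (wt_pos _).le _)
    · simpa using mul_nonneg hC (pow_nonneg (wt_pos j).le _)

theorem scal_diagKernel {Ξ : Type*} [IndexSize Ξ] [TemperedIndex Ω] {V : Type*}
    [AddCommGroup V] [Module ℝ V] [TopologicalSpace V] [IsTopologicalAddGroup V]
    [PolynormableSpace ℝ V] [AbsSummableSpace V] [T2Space V] (φ : Ω → ℝ) (h) (f : RapidFun (Ω × Ξ) V)
    (z : Ω × Ξ) : scal (diagKernel φ h) f z = φ z.1 • f z := by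
  classical
  rw [scal_apply, tsum_eq_single z.1 fun j hj => by
    rw [diagKernel_apply, if_neg hj.symm, zero_smul], diagKernel_apply, if_pos rfl]

section DiagOp

variable {R : Type*} [CommRing R] [Algebra ℝ R] [TopologicalSpace R] [IsTopologicalRing R]
  [PolynormableSpace ℝ R]

/-- Diagonal operators. -/
noncomputable def diagOp (φ : Ω → ℝ) (h : ∃ (C : ℝ) (l : ℕ), 0 ≤ C ∧ ∀ ω, |φ ω| ≤ C * wt ω ^ l) :
    RapidFun Ω R →L[R] RapidFun Ω R :=
  mkOp (mkCLM (fun f ω => φ ω • f ω) (fun f g ω => smul_add _ _ _) (fun c f ω => smul_comm _ _ _)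
    fun p k => by
      obtain ⟨C, l, hC, h⟩ := h
      refine ⟨p, k + l, C, fun f ω => ?_⟩
      rw [map_smul_eq_mul, Real.norm_eq_abs]
      have h1 := le_sem p (k + l) f ω
      have h2 : 0 ≤ p.1 (f ω) := apply_nonneg _ _
      calc _ ≤ wt ω ^ k * ((C * wt ω ^ l) * p.1 (f ω)) :=
            mul_le_mul_of_nonneg_left (mul_le_mul_of_nonneg_right (h ω) h2)
              (pow_nonneg (wt_pos ω).le k)
        _ = C * (wt ω ^ (k + l) * p.1 (f ω)) := by ring
        _ ≤ _ := mul_le_mul_of_nonneg_left h1 hC)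
    fun c f ω => (mul_smul_comm _ _ _).symm

@[simp] theorem diagOp_apply (φ : Ω → ℝ) (h) (f : RapidFun Ω R) (ω : Ω) :
    diagOp φ h f ω = φ ω • f ω := rfl

theorem diagOp_single [DecidableEq Ω] (φ : Ω → ℝ) (h) (i j : Ω) :
    diagOp φ h (single j : RapidFun Ω R) i = φ j • (single j : RapidFun Ω R) i := by
  rw [diagOp_apply]
  by_cases hij : i = j
  · rw [hij]
  · rw [single_ne hij, smul_zero, smul_zero]

end DiagOp

end Diag

section SmoothDiag

variable {𝔄 : Type w} [NonUnitalCommRing 𝔄] [Module ℝ 𝔄] [IsScalarTower ℝ 𝔄 𝔄]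
  [SMulCommClass ℝ 𝔄 𝔄] [TopologicalSpace 𝔄] [IsTopologicalRing 𝔄] [ContinuousSMul ℝ 𝔄]
  [PolynormableSpace ℝ 𝔄] [T2Space 𝔄] [AbsSummableSpace 𝔄]
  {X : Type x} {E : Type u} [AddCommGroup E] [Module ℝ E] [TopologicalSpace E]
  [IsTopologicalAddGroup E] [ContinuousSMul ℝ E] {i : X → E}
  {Ω Ξ : Type} [IndexSize Ω] [TemperedIndex Ω] [IndexSize Ξ] [TemperedIndex Ξ]

theorem diagOp_comp_op (φ : Ω → ℝ) (h) (A : RapidFun (Ω × Ξ) 𝔄) :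
    diagOp φ h ∘L op A = op (scal (diagKernel φ h) A) :=
  op_ext fun a b => by
    rw [ContinuousLinearMap.comp_apply, diagOp_apply, op_single, op_single, scal_diagKernel,
      Unitization.inr_smul]

theorem op_comp_diagOp (φ : Ω → ℝ) (h) (A : RapidFun (Ξ × Ω) 𝔄) :
    op A ∘L diagOp φ h = op (pull .swap (scal (diagKernel φ h) (pull .swap A))) :=
  op_ext fun a b => by
    classical
    have h1 : diagOp φ h (single b : RapidFun Ω (Unitization ℝ 𝔄)) = φ b • single b :=
      RapidFun.ext fun c => diagOp_single φ h c b
    have h2 : op A (φ b • single b : RapidFun Ω (Unitization ℝ 𝔄)) = φ b • op A (single b) :=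
      (op A).map_smul_of_tower _ _
    rw [ContinuousLinearMap.comp_apply, h1, h2, RapidFun.smul_apply, op_single, op_single,
      pull_apply, scal_diagKernel, pull_apply, Unitization.inr_smul]
    rfl

theorem SmoothMult.diagOp {φ : ℕ → ℝ → Ω → ℝ} (hφ : IsDiagJet φ) {c : X → ℝ}
    (hc : SmoothVia i id c) :
    SmoothMult i fun x => (_root_.diagOp (φ 0 (c x)) (hφ.exists_bound 0 (c x)) : Opr 𝔄 Ω Ω) := by
  refine ⟨fun hg _ _ _ _ ⟨δ, hδ, h⟩ => ?_, fun hg _ _ _ _ ⟨δ, hδ, h⟩ => ?_⟩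
  · refine ⟨_, (hδ.prodMk (hc.comp hg)).map hφ.isKernelJet.smooth_scal, fun x => ?_⟩
    dsimp only; rw [← h, diagOp_comp_op]; rfl
  · refine ⟨_, (((hδ.clm (pull .swap)).prodMk (hc.comp hg)).map hφ.isKernelJet.smooth_scal).clm (pull .swap),
      fun x => ?_⟩
    dsimp only; rw [← h, op_comp_diagOp]; rfl

end SmoothDiag

/-! ### Transition functions -/

section Transition

/-- Compactness bounds the derivatives on [0, 1], and outside of it the function is locally
constant; the two constant values only matter for j = 0. -/
theorem exists_iteratedDeriv_bound {ψ : ℝ → ℝ} (h : ContDiff ℝ (⊤ : ℕ∞) ψ)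
    (h0 : ∀ u ≤ 0, ψ u = ψ 0) (h1 : ∀ u, 1 ≤ u → ψ u = ψ 1) (j : ℕ) :
    ∃ C, 0 ≤ C ∧ ∀ u, |iteratedDeriv j ψ u| ≤ C := by
  have hc : Continuous (iteratedDeriv j ψ) := h.continuous_iteratedDeriv j (by exact_mod_cast le_top)
  obtain ⟨C, hC⟩ := isCompact_Icc.exists_bound_of_continuousOn (s := Set.Icc (0 : ℝ) 1)
    hc.continuousOn
  have hconst : ∀ c u : ℝ, |iteratedDeriv j (fun _ : ℝ => c) u| ≤ |c| := fun c u => by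
    rw [iteratedDeriv_const]
    split_ifs
    · exact le_rfl
    · simp
  refine ⟨|C| + |ψ 0| + |ψ 1|, by positivity, fun u => ?_⟩
  rcases lt_or_ge u 0 with hu | hu
  · have : ψ =ᶠ[𝓝 u] fun _ => ψ 0 := by
      filter_upwards [gt_mem_nhds hu] with v hv
      exact h0 v hv.le
    rw [this.iteratedDeriv_eq]
    have := hconst (ψ 0) u
    have := abs_nonneg C
    have := abs_nonneg (ψ 1)
    linarith
  rcases lt_or_ge 1 u with hu1 | hu1
  · have : ψ =ᶠ[𝓝 u] fun _ => ψ 1 := by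
      filter_upwards [lt_mem_nhds hu1] with v hv
      exact h1 v hv.le
    rw [this.iteratedDeriv_eq]
    have := hconst (ψ 1) u
    have := abs_nonneg C
    have := abs_nonneg (ψ 0)
    linarith
  · have := hC u ⟨hu, hu1⟩
    rw [Real.norm_eq_abs] at this
    have := le_abs_self C
    have := abs_nonneg (ψ 0)
    have := abs_nonneg (ψ 1)
    linarith

/-- Jets of functions which arise from a single function by affine substitutions of polynomial
growth. -/
theorem isDiagJet_affine {Ω : Type*} [IndexSize Ω] {ψ : ℝ → ℝ} (h : ContDiff ℝ (⊤ : ℕ∞) ψ)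
    (h0 : ∀ u ≤ 0, ψ u = ψ 0) (h1 : ∀ u, 1 ≤ u → ψ u = ψ 1) (a b : Ω → ℝ) {m : ℕ} {A : ℝ}
    (ha : ∀ ω, |a ω| ≤ A * wt ω ^ m) :
    IsDiagJet fun j t ω => a ω ^ j * iteratedDeriv j ψ (a ω * t - b ω) := by
  refine ⟨fun j t ω => ?_, fun j => ?_⟩
  · have hd : DifferentiableAt ℝ (iteratedDeriv j ψ) (a ω * t - b ω) :=
      (h.differentiable_iteratedDeriv j (by exact_mod_cast WithTop.coe_lt_top j)) _
    have h2 := hd.hasDerivAt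
    rw [← iteratedDeriv_succ] at h2
    have h3 : HasDerivAt (fun t => a ω * t - b ω) (a ω) t := by
      simpa using ((hasDerivAt_id t).const_mul (a ω)).sub_const (b ω)
    have h4 := (h2.comp t h3).const_mul (a ω ^ j)
    refine h4.congr_deriv ?_
    ring
  · obtain ⟨C, hC0, hC⟩ := exists_iteratedDeriv_bound h h0 h1 j
    refine ⟨|A| ^ j * C, m * j, by positivity, fun t ω => ?_⟩
    have h2 : |a ω| ≤ |A| * wt ω ^ m :=
      (ha ω).trans (mul_le_mul_of_nonneg_right (le_abs_self A) (pow_nonneg (wt_pos ω).le m))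
    rw [abs_mul, abs_pow]
    calc _ ≤ (|A| * wt ω ^ m) ^ j * C := mul_le_mul (pow_le_pow_left₀ (abs_nonneg _) h2 j) (hC _)
          (abs_nonneg _) (by have := wt_pos ω; positivity)
      _ = _ := by rw [mul_pow, ← pow_mul]; ring

end Transition

/-! ### Rapidly decreasing matrices as rapidly decreasing functions -/

section RapidMat

variable {Ω : Type*} [IndexSize Ω] {𝔄 : Type*} [AddCommGroup 𝔄] [Module ℝ 𝔄] [TopologicalSpace 𝔄]

theorem posWeight_eq (k : ℕ) (z : Ω × Ω) : posWeight k z = (wt z.1 * wt z.2) ^ k := rfl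

/-- The product of the weights of the two indices lies between the weight of the pair and its
square. Therefore rapidly decreasing matrices form the same topological vector space as rapidly
decreasing functions on pairs. -/
theorem posWeight_le (k : ℕ) (z : Ω × Ω) : posWeight k z ≤ wt z ^ (2 * k) := by
  rw [posWeight_eq, pow_mul, sq]
  exact pow_le_pow_left₀ (mul_pos (wt_pos _) (wt_pos _)).le (mul_le_mul (wt_le_wt_prod_left _ _)
    (wt_le_wt_prod_right _ _) (wt_pos _).le (wt_pos _).le) k

theorem wt_pow_le_posWeight (k : ℕ) (z : Ω × Ω) : wt z ^ k ≤ posWeight k z :=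
  pow_le_pow_left₀ (wt_pos _).le (wt_prod_le z.1 z.2) k

namespace RapidMat

variable (Ω 𝔄) in
theorem withSeminorms : WithSeminorms (rapidSeminorm Ω 𝔄) := ⟨rfl⟩

instance : IsTopologicalAddGroup (RapidMat Ω 𝔄) := (withSeminorms Ω 𝔄).topologicalAddGroup

instance : ContinuousSMul ℝ (RapidMat Ω 𝔄) := (withSeminorms Ω 𝔄).continuousSMul

instance : PolynormableSpace ℝ (RapidMat Ω 𝔄) := (withSeminorms Ω 𝔄).toPolynormableSpace

theorem le_rapidSeminorm (q : CSem 𝔄 × ℕ) (A : RapidMat Ω 𝔄) (z : Ω × Ω) :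
    posWeight q.2 z * q.1.1 (A.toMatrix z.1 z.2) ≤ rapidSeminorm Ω 𝔄 q A :=
  le_ciSup (A.2 q.1.1 q.1.2 q.2) z

theorem rapidSeminorm_le {q : CSem 𝔄 × ℕ} {A : RapidMat Ω 𝔄} {M : ℝ} (hM : 0 ≤ M)
    (h : ∀ z : Ω × Ω, posWeight q.2 z * q.1.1 (A.toMatrix z.1 z.2) ≤ M) :
    rapidSeminorm Ω 𝔄 q A ≤ M :=
  Real.iSup_le h hM

/-- Matrices and functions of two variables. -/
def toFunLinear : RapidMat Ω 𝔄 ≃ₗ[ℝ] RapidFun (Ω × Ω) 𝔄 where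
  toFun A := RapidFun.mk (fun z => A.toMatrix z.1 z.2) fun p k => by
    obtain ⟨M, hM⟩ := A.2 p.1 p.2 k
    exact ⟨M, fun z => (mul_le_mul_of_nonneg_right (wt_pow_le_posWeight k z)
      (apply_nonneg _ _)).trans (hM ⟨z, rfl⟩)⟩
  invFun f := ⟨Matrix.of fun i j => f (i, j), fun p hp k => ⟨sem _ ⟨p, hp⟩ (2 * k) f, by
    rintro _ ⟨z, rfl⟩
    exact (mul_le_mul_of_nonneg_right (posWeight_le k z) (apply_nonneg _ _)).trans
      (le_sem (⟨p, hp⟩ : CSem 𝔄) (2 * k) f z)⟩⟩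
  map_add' _ _ := rfl
  map_smul' _ _ := rfl
  left_inv _ := rfl
  right_inv _ := rfl

/-- Matrices and functions of two variables. -/
def toFunL : RapidMat Ω 𝔄 ≃L[ℝ] RapidFun (Ω × Ω) 𝔄 where
  toLinearEquiv := toFunLinear
  continuous_toFun := by
    refine (withSeminorms Ω 𝔄).continuous_of_isBounded (RapidFun.withSeminorms (Ω × Ω) 𝔄)
      toFunLinear.toLinearMap ?_
    intro q
    refine ⟨{q}, 1, fun A => ?_⟩
    rw [Finset.sup_singleton, one_smul]
    exact sem_le (apply_nonneg _ _) fun z => (mul_le_mul_of_nonneg_right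
      (wt_pow_le_posWeight q.2 z) (apply_nonneg _ _)).trans (le_rapidSeminorm q A z)
  continuous_invFun := by
    refine (RapidFun.withSeminorms (Ω × Ω) 𝔄).continuous_of_isBounded (withSeminorms Ω 𝔄)
      toFunLinear.symm.toLinearMap ?_
    intro q
    refine ⟨{(q.1, 2 * q.2)}, 1, fun f => ?_⟩
    rw [Finset.sup_singleton, one_smul]
    exact rapidSeminorm_le (apply_nonneg _ _) fun z => (mul_le_mul_of_nonneg_right
      (posWeight_le q.2 z) (apply_nonneg _ _)).trans (le_sem q.1 (2 * q.2) f z)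

@[simp] theorem toFunL_apply (A : RapidMat Ω 𝔄) (z : Ω × Ω) :
    toFunL A z = A.toMatrix z.1 z.2 := rfl

@[simp] theorem toMatrix_toFunL_symm (f : RapidFun (Ω × Ω) 𝔄) (i j : Ω) :
    (toFunL.symm f).toMatrix i j = f (i, j) := rfl

end RapidMat

end RapidMat

/-! ### The Grassmannian in terms of operators -/

section Gr

variable {𝔄 : Type w} [NonUnitalCommRing 𝔄] [Module ℝ 𝔄] [IsScalarTower ℝ 𝔄 𝔄]
  [SMulCommClass ℝ 𝔄 𝔄] [TopologicalSpace 𝔄] [IsTopologicalRing 𝔄] [ContinuousSMul ℝ 𝔄]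
  [PolynormableSpace ℝ 𝔄] [T2Space 𝔄] [AbsSummableSpace 𝔄]

variable (𝔄) in
/-- The operator `diag (0, 1)`. -/
noncomputable def baseOp : Opr 𝔄 (Fin 2 × ℕ) (Fin 2 × ℕ) := proj fun z => z.1 = 1

theorem baseOp_mul_baseOp : baseOp 𝔄 * baseOp 𝔄 = baseOp 𝔄 :=
  ContinuousLinearMap.ext fun f => proj_proj _ f

theorem mat_baseOp : RapidFun.mat (baseOp 𝔄) = baseMat (Unitization ℝ 𝔄) ℕ := by
  ext1 i j
  rw [mat_apply, baseOp, proj_single, baseMat, Matrix.diagonal_apply]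
  by_cases hij : i = j
  · subst hij
    rw [if_pos rfl]
    split_ifs <;> simp
  · rw [if_neg hij]
    split_ifs
    · exact single_ne hij
    · rfl

theorem mat_baseOp_add (A : RapidMat (Fin 2 × ℕ) 𝔄) :
    RapidFun.mat (baseOp 𝔄 + op (RapidMat.toFunL A)) = perturb A := by
  rw [perturb, ← mat_baseOp]
  ext1 i j
  rw [mat_apply, Matrix.add_apply, mat_apply, _root_.add_apply, RapidFun.add_apply, op_single]
  rfl

namespace Gr

/-- The operator of `b - diag (0, 1)`. -/
noncomputable def dop (b : Gr 𝔄) : Opr 𝔄 (Fin 2 × ℕ) (Fin 2 × ℕ) := op (RapidMat.toFunL b.1)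

theorem mat_eq (b : Gr 𝔄) : b.mat = RapidFun.mat (baseOp 𝔄 + b.dop) := (mat_baseOp_add b.1).symm

theorem dop_injective : Function.Injective (dop : Gr 𝔄 → _) := fun _ _ h =>
  Subtype.ext (RapidMat.toFunL.injective (op_injective h))

/-- The operator of `b`. -/
noncomputable def top (b : Gr 𝔄) : Opr 𝔄 (Fin 2 × ℕ) (Fin 2 × ℕ) := baseOp 𝔄 + b.dop

/-- Matrix products correspond to compositions and the matrix determines the operator, so
idempotency carries over. -/
theorem top_mul_top (b : Gr 𝔄) : b.top * b.top = b.top := by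
  refine mat_injective ?_
  have := b.2
  rw [← mat_baseOp_add, mmul_mat] at this
  exact this

/-- The way back from operators to the Grassmannian: the smooth kernel of `D` is the difference to
R₀ which records the point. -/
theorem exists_of_smoothKernel {X : Type*} {E : Type u} [AddCommGroup E] [Module ℝ E]
    [TopologicalSpace E] {i : X → E} {D : X → Opr 𝔄 (Fin 2 × ℕ) (Fin 2 × ℕ)}
    (hD : SmoothKernel i D) (h : ∀ x, (baseOp 𝔄 + D x) * (baseOp 𝔄 + D x) = baseOp 𝔄 + D x) :
    ∃ f : X → Gr 𝔄, SmoothVia i (fun b : Gr 𝔄 => b.1) f ∧ ∀ x, (f x).dop = D x := by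
  obtain ⟨δ, hδ, hδD⟩ := hD
  refine ⟨fun x => ⟨RapidMat.toFunL.symm (δ x), ?_⟩, ?_, fun x => ?_⟩
  · rw [← mat_baseOp_add, mmul_mat, RapidMat.toFunL.apply_symm_apply, hδD]
    exact congrArg _ (h x)
  · exact hδ.clm (ContinuousLinearEquiv.toContinuousLinearMap RapidMat.toFunL.symm)
  · rw [dop, RapidMat.toFunL.apply_symm_apply, hδD]

end Gr

variable {X : Type x} {E : Type u} [AddCommGroup E] [Module ℝ E] [TopologicalSpace E]
  {i : X → E}

theorem SmoothVia.dop {f : X → Gr 𝔄} (hf : SmoothVia i (fun b : Gr 𝔄 => b.1) f) :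
    SmoothKernel i fun x => (f x).dop :=
  ⟨fun x => RapidMat.toFunL (f x).1, SmoothVia.clm (i := i)
    (ContinuousLinearEquiv.toContinuousLinearMap RapidMat.toFunL) hf, fun _ => rfl⟩

theorem SmoothMult.baseOp [IsTopologicalAddGroup E] [ContinuousSMul ℝ E] : SmoothMult i fun _ => _root_.baseOp 𝔄 := SmoothMult.proj _

theorem SmoothVia.top [IsTopologicalAddGroup E] [ContinuousSMul ℝ E] {f : X → Gr 𝔄} (hf : SmoothVia i (fun b : Gr 𝔄 => b.1) f) :
    SmoothMult i fun x => (f x).top :=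
  SmoothMult.baseOp.add (.of_kernel hf.dop)

/-! ### Homotopies -/

/-- Smooth homotopies between maps into the Grassmannian. -/
def Homot (i : X → E) (f g : X → Gr 𝔄) : Prop :=
  ∃ h : X × Set.Icc (0 : ℝ) 1 → Gr 𝔄, SmoothVia (timeEmb i) (fun b : Gr 𝔄 => b.1) h ∧
    (∀ x, h (x, 0) = f x) ∧ ∀ x, h (x, 1) = g x

namespace Homot

variable [IsTopologicalAddGroup E] [ContinuousSMul ℝ E]

theorem symm {f g : X → Gr 𝔄} (h : Homot i f g) : Homot i g f := by
  obtain ⟨k, hk, h0, h1⟩ := h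
  obtain ⟨k', hk', h0', h1'⟩ := hk.reverse
  exact ⟨k', hk', fun x => (h0' x).trans (h1 x), fun x => (h1' x).trans (h0 x)⟩

theorem trans {f g h : X → Gr 𝔄} (hfg : Homot i f g) (hgh : Homot i g h) : Homot i f h := by
  obtain ⟨k, hk, h0, h1⟩ := hfg
  obtain ⟨l, hl, h2, h3⟩ := hgh
  obtain ⟨m, hm, h4, h5⟩ := hk.glue hl fun x => (h1 x).trans (h2 x).symm
  exact ⟨m, hm, fun x => (h4 x).trans (h0 x), fun x => (h5 x).trans (h3 x)⟩

end Homot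

end Gr

/-! ### Passage to smooth operations and homotopies of several variables -/

section Ops

variable {𝔄 : Type w} [NonUnitalCommRing 𝔄] [Module ℝ 𝔄] [IsScalarTower ℝ 𝔄 𝔄]
  [SMulCommClass ℝ 𝔄 𝔄] [TopologicalSpace 𝔄]

/-- The embedding of the set of tuples in the Grassmannian. -/
abbrev tupleEmb (𝔄 : Type w) [NonUnitalCommRing 𝔄] [Module ℝ 𝔄] [IsScalarTower ℝ 𝔄 𝔄]
    [SMulCommClass ℝ 𝔄 𝔄] [TopologicalSpace 𝔄] (k : ℕ) (x : Fin k → Gr 𝔄) :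
    Fin k → RapidMat (Fin 2 × ℕ) 𝔄 := fun m => (x m).1

theorem continuous_tupleEmb (k : ℕ) : Continuous (tupleEmb 𝔄 k) :=
  continuous_pi fun m => continuous_subtype_val.comp (continuous_apply m)

theorem IsSmoothOp.of_smoothVia {k : ℕ} {f : (Fin k → Gr 𝔄) → Gr 𝔄}
    (h : SmoothVia (tupleEmb 𝔄 k) (fun b : Gr 𝔄 => b.1) f) : IsSmoothOp f :=
  ⟨h.continuous (continuous_tupleEmb k) .subtypeVal, h⟩

theorem SmoothVia.isSmoothHomotopy {k : ℕ} {F : (Fin k → Gr 𝔄) × Set.Icc (0 : ℝ) 1 → Gr 𝔄}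
    (h : SmoothVia (timeEmb (tupleEmb 𝔄 k)) (fun b : Gr 𝔄 => b.1) F) : IsSmoothHomotopy F :=
  ⟨h.continuous (((continuous_tupleEmb k).comp continuous_fst).prodMk
    (continuous_subtype_val.comp continuous_snd)) .subtypeVal, h⟩

theorem Homot.smoothlyHomotopic {k : ℕ} {f g : (Fin k → Gr 𝔄) → Gr 𝔄}
    (h : Homot (tupleEmb 𝔄 k) f g) : SmoothlyHomotopic f g := by
  obtain ⟨F, hF, h0, h1⟩ := h
  exact ⟨F, hF.isSmoothHomotopy, h0, h1⟩

end Ops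

/-! ### Stabilizing paths of isometries -/

section Stab

variable {Ω : Type} [IndexSize Ω]

/-- The speed of the rotation of a basis vector to its image under the map `q`. -/
noncomputable def stabRate (q : Ω → Ω) (ω : Ω) : ℝ := open Classical in
  if q ω = ω then 0 else ((IndexSize.size ω : ℝ) + 1) * ((IndexSize.size ω : ℝ) + 2)

/-- The delay of the rotation of a basis vector to its image under the map `q`. -/
noncomputable def stabShift (q : Ω → Ω) (ω : Ω) : ℝ := open Classical in
  if q ω = ω then 0 else (IndexSize.size ω : ℝ) + 1

/-- The angle of the rotation of a basis vector, divided by `π / 2`. -/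
noncomputable def stabAngle (q : Ω → Ω) (t : ℝ) (ω : Ω) : ℝ :=
  Real.smoothTransition (stabRate q ω * t - stabShift q ω)

theorem abs_stabRate_le (q : Ω → Ω) (ω : Ω) : |stabRate q ω| ≤ 2 * wt ω ^ 2 := by
  unfold stabRate wt
  split_ifs
  · simp only [abs_zero]; positivity
  · rw [abs_of_nonneg (by positivity)]
    have : (0 : ℝ) ≤ IndexSize.size ω := Nat.cast_nonneg _
    nlinarith

theorem stabAngle_zero (q : Ω → Ω) (ω : Ω) : stabAngle q 0 ω = 0 := by
  refine Real.smoothTransition.zero_of_nonpos ?_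
  unfold stabShift
  split_ifs
  · simp
  · rw [mul_zero, zero_sub]
    exact neg_nonpos.2 (by positivity)

theorem stabAngle_of_eq {q : Ω → Ω} {ω : Ω} (h : q ω = ω) (t : ℝ) : stabAngle q t ω = 0 :=
  Real.smoothTransition.zero_of_nonpos (by simp [stabRate, stabShift, h])

theorem stabAngle_one {q : Ω → Ω} {ω : Ω} (h : q ω ≠ ω) : stabAngle q 1 ω = 1 := by
  refine Real.smoothTransition.one_of_one_le ?_
  rw [stabRate, stabShift, if_neg h, if_neg h]
  have : (0 : ℝ) ≤ IndexSize.size ω := Nat.cast_nonneg _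
  nlinarith

/-- An index of size n which is not fixed turns only between the times 1/(n + 2) and 1/(n + 1).
Since `q` enlarges the size of such an index, the window of `q ω` has closed when the window of `ω`
opens. -/
theorem stabAngle_eq_zero_or {q : Ω → Ω} (hq : Function.Injective q)
    (hinc : ∀ ω, q ω = ω ∨ IndexSize.size ω < IndexSize.size (q ω)) (t : ℝ) (ω : Ω) :
    stabAngle q t ω = 0 ∨ stabAngle q t (q ω) = 1 := by
  by_cases h : q ω = ω
  · exact Or.inl (stabAngle_of_eq h t)
  have h' : q (q ω) ≠ q ω := fun e => h (hq e)
  have hlt : (IndexSize.size ω : ℝ) + 1 ≤ IndexSize.size (q ω) := by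
    exact_mod_cast (hinc ω).resolve_left h
  have h0 : (0 : ℝ) ≤ IndexSize.size ω := Nat.cast_nonneg _
  rcases le_or_gt (((IndexSize.size ω : ℝ) + 2) * t) 1 with ht | ht
  · refine Or.inl (Real.smoothTransition.zero_of_nonpos ?_)
    rw [stabRate, stabShift, if_neg h, if_neg h]
    nlinarith
  · refine Or.inr (Real.smoothTransition.one_of_one_le ?_)
    rw [stabRate, stabShift, if_neg h', if_neg h']
    have ht0 : 0 < t := by
      by_contra hc
      nlinarith
    have h3 : 1 < ((IndexSize.size (q ω) : ℝ) + 1) * t := by nlinarith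
    nlinarith

/-- The smooth profiles of the rotations. -/
noncomputable def rotProfile (f : ℝ → ℝ) (u : ℝ) : ℝ := f (Real.pi / 2 * Real.smoothTransition u)

/-- All angles come from one profile by affine changes of time whose rates are at most quadratic in
the weight. Hence every time derivative grows polynomially in ω, uniformly in t, and the
accumulation of the windows at t = 0 is harmless. -/
theorem isDiagJet_rotProfile {f : ℝ → ℝ} (hf : ContDiff ℝ (⊤ : ℕ∞) f) (q : Ω → Ω) :
    IsDiagJet fun j t ω =>
      stabRate q ω ^ j * iteratedDeriv j (rotProfile f) (stabRate q ω * t - stabShift q ω) := by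
  refine isDiagJet_affine (hf.comp (contDiff_const.mul Real.smoothTransition.contDiff))
    (fun u hu => ?_) (fun u hu => ?_) _ _ (abs_stabRate_le q)
  · simp only [Function.comp_apply, Real.smoothTransition.zero_of_nonpos hu,
      Real.smoothTransition.zero]
  · simp only [Function.comp_apply, Real.smoothTransition.one_of_one_le hu,
      Real.smoothTransition.one]

theorem rotProfile_jet_zero (f : ℝ → ℝ) (q : Ω → Ω) (t : ℝ) (ω : Ω) :
    stabRate q ω ^ 0 * iteratedDeriv 0 (rotProfile f) (stabRate q ω * t - stabShift q ω) =
      f (Real.pi / 2 * stabAngle q t ω) := by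
  rw [pow_zero, one_mul, iteratedDeriv_zero, rotProfile, stabAngle]

variable {R : Type*} [CommRing R] [Algebra ℝ R] [TopologicalSpace R] [IsTopologicalRing R]
  [PolynormableSpace ℝ R]

/-- The diagonal part of the rotations. -/
noncomputable def stabDiag (R : Type*) [CommRing R] [Algebra ℝ R] [TopologicalSpace R]
    [IsTopologicalRing R] [PolynormableSpace ℝ R] {f : ℝ → ℝ} (hf : ContDiff ℝ (⊤ : ℕ∞) f)
    (q : Ω → Ω) (t : ℝ) : RapidFun Ω R →L[R] RapidFun Ω R :=
  diagOp _ ((isDiagJet_rotProfile hf q).exists_bound 0 t)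

theorem stabDiag_apply {f : ℝ → ℝ} (hf : ContDiff ℝ (⊤ : ℕ∞) f)
    (q : Ω → Ω) (t : ℝ) (g : RapidFun Ω R) (ω : Ω) :
    stabDiag R hf q t g ω = f (Real.pi / 2 * stabAngle q t ω) • g ω := by
  rw [stabDiag, diagOp_apply, rotProfile_jet_zero]

/-- A path of isometries from the identity to the relabeling by `q`. -/
noncomputable def stabOp {q : Ω → Ω} (hq : IsTempered q) (t : ℝ) :
    RapidFun Ω R →L[R] RapidFun Ω R :=
  stabDiag R Real.contDiff_cos q t + relOp hq ∘L stabDiag R Real.contDiff_sin q t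

/-- The transposed operators of `stabOp`. -/
noncomputable def stabOpT {q : Ω → Ω} (hq : IsTempered q) (t : ℝ) :
    RapidFun Ω R →L[R] RapidFun Ω R :=
  stabDiag R Real.contDiff_cos q t + stabDiag R Real.contDiff_sin q t ∘L pullOp hq

section

variable {q : Ω → Ω} (hq : IsTempered q)

theorem stabOp_apply (t : ℝ) (f : RapidFun Ω R) (ω : Ω) :
    stabOp hq t f ω = Real.cos (Real.pi / 2 * stabAngle q t ω) • f ω +
      relOp hq (stabDiag R Real.contDiff_sin q t f) ω := by
  rw [stabOp, _root_.add_apply, RapidFun.add_apply, stabDiag_apply]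
  rfl

theorem stabOpT_apply (t : ℝ) (f : RapidFun Ω R) (ω : Ω) :
    stabOpT hq t f ω = Real.cos (Real.pi / 2 * stabAngle q t ω) • f ω +
      Real.sin (Real.pi / 2 * stabAngle q t ω) • f (q ω) := by
  rw [stabOpT, _root_.add_apply, RapidFun.add_apply, stabDiag_apply,
    ContinuousLinearMap.comp_apply, stabDiag_apply, pullOp_apply]

theorem stabOp_zero : (stabOp hq 0 : RapidFun Ω R →L[R] RapidFun Ω R) = 1 :=
  ContinuousLinearMap.ext fun f => RapidFun.ext fun ω => by
    have h : stabDiag R Real.contDiff_sin q 0 f = 0 := RapidFun.ext fun ω => by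
      rw [stabDiag_apply, stabAngle_zero]; simp
    rw [stabOp_apply, h, stabAngle_zero]
    simp

theorem stabOpT_zero : (stabOpT hq 0 : RapidFun Ω R →L[R] RapidFun Ω R) = 1 :=
  ContinuousLinearMap.ext fun f => RapidFun.ext fun ω => by
    rw [stabOpT_apply, stabAngle_zero]
    simp

theorem stabOp_one : (stabOp hq 1 : RapidFun Ω R →L[R] RapidFun Ω R) = relOp hq :=
  ContinuousLinearMap.ext fun f => RapidFun.ext fun ω => by
    rw [stabOp_apply]
    by_cases h : ∃ a, q a = ω
    · obtain ⟨a, rfl⟩ := h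
      rw [relOp_apply, relOp_apply, stabDiag_apply]
      by_cases h' : q a = a
      · rw [h', stabAngle_of_eq h']; simp
      · have h2 : q (q a) ≠ q a := fun e => h' (hq.injective e)
        rw [stabAngle_one h', stabAngle_one h2]; simp
    -- A point outside the range of `q` is not a fixed point, so it has been turned completely and
    -- its cosine vanishes.
    · push Not at h
      rw [relOp_apply_eq_zero hq _ h, relOp_apply_eq_zero hq _ h, stabAngle_one (h ω)]
      simp

theorem stabOpT_one : (stabOpT hq 1 : RapidFun Ω R →L[R] RapidFun Ω R) = pullOp hq :=
  ContinuousLinearMap.ext fun f => RapidFun.ext fun ω => by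
    rw [stabOpT_apply, pullOp_apply]
    by_cases h' : q ω = ω
    · rw [h', stabAngle_of_eq h']; simp
    · rw [stabAngle_one h']; simp

/-- The only possible interference is between the part of ω which has arrived at `q ω` and the part
of `q ω` which is still there. By `stabAngle_eq_zero_or` one of them vanishes at each time, and cos²
+ sin² = 1 remains. -/
theorem stabOpT_comp_stabOp
    (hinc : ∀ ω, q ω = ω ∨ IndexSize.size ω < IndexSize.size (q ω)) (t : ℝ) :
    stabOpT hq t ∘L stabOp hq t = (1 : RapidFun Ω R →L[R] RapidFun Ω R) :=
  ContinuousLinearMap.ext fun f => RapidFun.ext fun ω => by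
    have h1 : Real.cos (Real.pi / 2 * stabAngle q t ω) •
        relOp hq (stabDiag R Real.contDiff_sin q t f) ω = 0 := by
      by_cases h : ∃ a, q a = ω
      · obtain ⟨a, rfl⟩ := h
        rw [relOp_apply, stabDiag_apply]
        rcases stabAngle_eq_zero_or hq.injective hinc t a with h | h <;> rw [h] <;> simp
      · push Not at h
        rw [relOp_apply_eq_zero hq _ h, smul_zero]
    have h2 : Real.sin (Real.pi / 2 * stabAngle q t ω) •
        Real.cos (Real.pi / 2 * stabAngle q t (q ω)) • f (q ω) = 0 := by
      rcases stabAngle_eq_zero_or hq.injective hinc t ω with h | h <;> rw [h] <;> simp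
    rw [ContinuousLinearMap.comp_apply, stabOpT_apply, stabOp_apply, stabOp_apply, relOp_apply,
      stabDiag_apply, smul_add, smul_add, h1, h2, add_zero, zero_add, smul_smul, smul_smul,
      ← add_smul, ← sq, ← sq, Real.cos_sq_add_sin_sq, one_smul]
    rfl

theorem proj_comp_stabOp {s : Ω → Prop} (hs : ∀ ω, s (q ω) ↔ s ω) (t : ℝ) :
    proj s ∘L stabOp hq t = (stabOp hq t ∘L proj s : RapidFun Ω R →L[R] RapidFun Ω R) := by
  classical
  have hd : ∀ {f : ℝ → ℝ} (hf : ContDiff ℝ (⊤ : ℕ∞) f),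
      proj s ∘L stabDiag R hf q t = stabDiag R hf q t ∘L proj s := fun hf =>
    ContinuousLinearMap.ext fun f => RapidFun.ext fun ω => by
      simp only [ContinuousLinearMap.comp_apply, proj_apply, stabDiag_apply]
      split_ifs <;> simp
  have hr : proj s ∘L relOp hq = (relOp hq ∘L proj s : RapidFun Ω R →L[R] RapidFun Ω R) :=
    ContinuousLinearMap.ext fun f => proj_relOp hq (fun ω => hs ω) f
  rw [stabOp, ContinuousLinearMap.comp_add, ContinuousLinearMap.add_comp, hd,
    ← ContinuousLinearMap.comp_assoc, hr, ContinuousLinearMap.comp_assoc, hd,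
    ContinuousLinearMap.comp_assoc]

theorem proj_comp_stabOpT {s : Ω → Prop} (hs : ∀ ω, s (q ω) ↔ s ω) (t : ℝ) :
    stabOpT hq t ∘L proj s = (proj s ∘L stabOpT hq t : RapidFun Ω R →L[R] RapidFun Ω R) := by
  classical
  refine ContinuousLinearMap.ext fun f => RapidFun.ext fun ω => ?_
  simp only [ContinuousLinearMap.comp_apply, stabOpT_apply, proj_apply, hs]
  split_ifs <;> simp

end

end Stab

section SmoothStab

variable {𝔄 : Type w} [NonUnitalCommRing 𝔄] [Module ℝ 𝔄] [IsScalarTower ℝ 𝔄 𝔄]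
  [SMulCommClass ℝ 𝔄 𝔄] [TopologicalSpace 𝔄] [IsTopologicalRing 𝔄] [ContinuousSMul ℝ 𝔄]
  [PolynormableSpace ℝ 𝔄] [T2Space 𝔄] [AbsSummableSpace 𝔄]
  {X : Type x} {E : Type u} [AddCommGroup E] [Module ℝ E] [TopologicalSpace E]
  [IsTopologicalAddGroup E] [ContinuousSMul ℝ E] {i : X → E}
  {Ω Ξ : Type} [IndexSize Ω] [TemperedIndex Ω]

theorem SmoothMult.stabOp {q : Ω → Ω} (hq : IsTempered q) {c : X → ℝ} (hc : SmoothVia i id c) :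
    SmoothMult i fun x => (_root_.stabOp hq (c x) : Opr 𝔄 Ω Ω) :=
  (SmoothMult.diagOp (isDiagJet_rotProfile Real.contDiff_cos q) hc).add
    ((SmoothMult.relOp hq).comp (SmoothMult.diagOp (isDiagJet_rotProfile Real.contDiff_sin q) hc))

theorem SmoothMult.stabOpT {q : Ω → Ω} (hq : IsTempered q) {c : X → ℝ} (hc : SmoothVia i id c) :
    SmoothMult i fun x => (_root_.stabOpT hq (c x) : Opr 𝔄 Ω Ω) :=
  (SmoothMult.diagOp (isDiagJet_rotProfile Real.contDiff_cos q) hc).add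
    ((SmoothMult.diagOp (isDiagJet_rotProfile Real.contDiff_sin q) hc).comp (SmoothMult.pullOp hq))

end SmoothStab

/-! ### Frames -/

section Frames

variable {𝔄 : Type w} [NonUnitalCommRing 𝔄] [Module ℝ 𝔄] [IsScalarTower ℝ 𝔄 𝔄]
  [SMulCommClass ℝ 𝔄 𝔄] [TopologicalSpace 𝔄] [IsTopologicalRing 𝔄] [ContinuousSMul ℝ 𝔄]
  [PolynormableSpace ℝ 𝔄] [T2Space 𝔄] [AbsSummableSpace 𝔄]

/-- The index set of the matrices in the Grassmannian. -/
abbrev BlockIdx : Type := Fin 2 × ℕ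

variable {Ω : Type} [IndexSize Ω] [TemperedIndex Ω] {ι : Type} [Fintype ι] [DecidableEq ι]

/-- The operator which a matrix of operators induces through a family of embeddings. -/
noncomputable def placed (J : ι → Opr 𝔄 Ω BlockIdx) (J' : ι → Opr 𝔄 BlockIdx Ω)
    (M : Matrix ι ι (Opr 𝔄 Ω Ω)) : Opr 𝔄 BlockIdx BlockIdx :=
  ∑ a, ∑ b, J a ∘L M a b ∘L J' b

theorem placed_apply (J : ι → Opr 𝔄 Ω BlockIdx) (J' : ι → Opr 𝔄 BlockIdx Ω)
    (M : Matrix ι ι (Opr 𝔄 Ω Ω)) (f : RapidFun BlockIdx (Unitization ℝ 𝔄)) :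
    placed J J' M f = ∑ a, J a (∑ b, M a b (J' b f)) := by
  simp [placed, map_sum]

/-- Embeddings with orthonormal ranges which intertwine given operators with `diag (0, 1)`,
and their transposed operators. -/
structure OrthFrame (α : ι → Opr 𝔄 Ω Ω) (J : ι → Opr 𝔄 Ω BlockIdx) (J' : ι → Opr 𝔄 BlockIdx Ω) :
    Prop where
  orth : ∀ a b, J' a ∘L J b = if a = b then 1 else 0
  base : ∀ a, baseOp 𝔄 ∘L J a = J a ∘L α a
  base' : ∀ a, J' a ∘L baseOp 𝔄 = α a ∘L J' a

namespace OrthFrame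

variable {α : ι → Opr 𝔄 Ω Ω} {J : ι → Opr 𝔄 Ω BlockIdx} {J' : ι → Opr 𝔄 BlockIdx Ω}

section

variable (h : OrthFrame α J J')
include h

theorem orth_apply (a b : ι) (f : RapidFun Ω (Unitization ℝ 𝔄)) :
    J' a (J b f) = if a = b then f else 0 := by
  have := congrArg (fun Y : Opr 𝔄 Ω Ω => Y f) (h.orth a b)
  refine this.trans ?_
  split_ifs <;> rfl

theorem base_apply (a : ι) (f : RapidFun Ω (Unitization ℝ 𝔄)) :
    baseOp 𝔄 (J a f) = J a (α a f) := congrArg (fun Y : Opr 𝔄 Ω BlockIdx => Y f) (h.base a)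

theorem base_apply' (a : ι) (f : RapidFun BlockIdx (Unitization ℝ 𝔄)) :
    J' a (baseOp 𝔄 f) = α a (J' a f) := congrArg (fun Y : Opr 𝔄 BlockIdx Ω => Y f) (h.base' a)

theorem apply_placed (M : Matrix ι ι (Opr 𝔄 Ω Ω)) (a : ι)
    (f : RapidFun BlockIdx (Unitization ℝ 𝔄)) :
    J' a (placed J J' M f) = ∑ b, M a b (J' b f) := by
  rw [placed_apply, map_sum, Finset.sum_eq_single a]
  · rw [h.orth_apply, if_pos rfl]
  · intro b _ hb
    rw [h.orth_apply, if_neg hb.symm]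
  · simp

theorem placed_mul (M N : Matrix ι ι (Opr 𝔄 Ω Ω)) :
    placed J J' M * placed J J' N = placed J J' (M * N) :=
  ContinuousLinearMap.ext fun f => by
    rw [mul_apply_eq_comp, placed_apply _ _ M, placed_apply _ _ (M * N)]
    refine Finset.sum_congr rfl fun a _ => congrArg (J a) ?_
    simp only [h.apply_placed, Matrix.mul_apply, _root_.sum_apply, map_sum, mul_apply_eq_comp]
    rw [Finset.sum_comm]

theorem base_mul_placed (M : Matrix ι ι (Opr 𝔄 Ω Ω)) :
    baseOp 𝔄 * placed J J' M = placed J J' (Matrix.diagonal α * M) :=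
  ContinuousLinearMap.ext fun f => by
    rw [mul_apply_eq_comp, placed_apply, placed_apply, map_sum]
    refine Finset.sum_congr rfl fun a _ => ?_
    rw [h.base_apply, map_sum]
    simp only [Matrix.diagonal_mul, mul_apply_eq_comp]

theorem placed_mul_base (M : Matrix ι ι (Opr 𝔄 Ω Ω)) :
    placed J J' M * baseOp 𝔄 = placed J J' (M * Matrix.diagonal α) :=
  ContinuousLinearMap.ext fun f => by
    rw [mul_apply_eq_comp, placed_apply, placed_apply]
    refine Finset.sum_congr rfl fun a _ => congrArg (J a) ?_
    simp only [h.base_apply', Matrix.mul_diagonal, mul_apply_eq_comp]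

theorem placed_injective : Function.Injective (placed J J') := fun M N hMN => by
  ext1 a b
  refine ContinuousLinearMap.ext fun f => ?_
  have h1 : ∀ M : Matrix ι ι (Opr 𝔄 Ω Ω), J' a (placed J J' M (J b f)) = M a b f := fun M => by
    rw [h.apply_placed, Finset.sum_eq_single b]
    · rw [h.orth_apply, if_pos rfl]
    · intro c _ hc
      rw [h.orth_apply, if_neg hc, map_zero]
    · simp
  rw [← h1 M, ← h1 N, hMN]

/-- The operator `α a` is the compression J' R₀ J, and R₀ J = J α moves the two factors R₀ next to
each other. -/
theorem base_sq (a : ι) : α a * α a = α a :=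
  ContinuousLinearMap.ext fun f => by
    have h1 : ∀ g, α a g = J' a (baseOp 𝔄 (J a g)) := fun g => by
      rw [h.base_apply, h.orth_apply, if_pos rfl]
    have h2 : ∀ g, baseOp 𝔄 (baseOp 𝔄 g) = baseOp 𝔄 g := fun g =>
      congrArg (fun Y : Opr 𝔄 BlockIdx BlockIdx => Y g) baseOp_mul_baseOp
    rw [mul_apply_eq_comp, ← h.orth_apply a a (α a (α a f)) |>.trans (if_pos rfl),
      ← h.base_apply, ← h.base_apply, h2, ← h1]

end

end OrthFrame

theorem placed_add (J : ι → Opr 𝔄 Ω BlockIdx) (J' : ι → Opr 𝔄 BlockIdx Ω)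
    (M N : Matrix ι ι (Opr 𝔄 Ω Ω)) : placed J J' (M + N) = placed J J' M + placed J J' N :=
  ContinuousLinearMap.ext fun f => by
    simp [placed_apply, Finset.sum_add_distrib]

/-- The operator `diag (0, 1) + placed J J' (P - diag α)`. -/
noncomputable def lift (α : ι → Opr 𝔄 Ω Ω) (J : ι → Opr 𝔄 Ω BlockIdx) (J' : ι → Opr 𝔄 BlockIdx Ω)
    (P : Matrix ι ι (Opr 𝔄 Ω Ω)) : Opr 𝔄 BlockIdx BlockIdx :=
  baseOp 𝔄 + placed J J' (P - Matrix.diagonal α)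

/-- The intertwining relations turn multiplication by R₀ into multiplication by diag α, and α(Q - α)
+ (P - α)α + (P - α)(Q - α) = PQ - α since α is idempotent. In effect, the operator acts as P on the
range of the frame and as R₀ on the complement. -/
theorem OrthFrame.lift_mul {α : ι → Opr 𝔄 Ω Ω} {J : ι → Opr 𝔄 Ω BlockIdx}
    {J' : ι → Opr 𝔄 BlockIdx Ω} (h : OrthFrame α J J') (P Q : Matrix ι ι (Opr 𝔄 Ω Ω)) :
    lift α J J' P * lift α J J' Q = lift α J J' (P * Q) := by
  have h1 : Matrix.diagonal α * Matrix.diagonal α = Matrix.diagonal α := by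
    rw [Matrix.diagonal_mul_diagonal]
    exact congrArg _ (funext h.base_sq)
  rw [lift, lift, lift, add_mul, mul_add, mul_add, baseOp_mul_baseOp, h.base_mul_placed,
    h.placed_mul_base, h.placed_mul, add_assoc, ← placed_add, ← placed_add]
  congr 2
  simp only [sub_mul, mul_sub, h1]
  abel

theorem OrthFrame.lift_injective {α : ι → Opr 𝔄 Ω Ω} {J : ι → Opr 𝔄 Ω BlockIdx}
    {J' : ι → Opr 𝔄 BlockIdx Ω} (h : OrthFrame α J J') : Function.Injective (lift α J J') :=
  fun _ _ e => sub_left_injective (h.placed_injective (add_left_cancel e))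

/-! ### Smooth families of frames -/

section Smooth

variable {X : Type x} {E : Type u} [AddCommGroup E] [Module ℝ E] [TopologicalSpace E]
  [IsTopologicalAddGroup E] [ContinuousSMul ℝ E]

/-- Smooth families of frames. -/
structure SmoothFrame (i : X → E) (α : ι → X → Opr 𝔄 Ω Ω) (J : ι → X → Opr 𝔄 Ω BlockIdx)
    (J' : ι → X → Opr 𝔄 BlockIdx Ω) : Prop where
  orthFrame : ∀ x, OrthFrame (fun a => α a x) (fun a => J a x) fun a => J' a x
  smooth : ∀ a, SmoothMult i (J a)
  smooth' : ∀ a, SmoothMult i (J' a)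

variable {i : X → E} {α : ι → X → Opr 𝔄 Ω Ω} {J : ι → X → Opr 𝔄 Ω BlockIdx}
    {J' : ι → X → Opr 𝔄 BlockIdx Ω}

theorem SmoothFrame.placed (h : SmoothFrame i α J J') {D : X → Matrix ι ι (Opr 𝔄 Ω Ω)}
    (hD : ∀ a b, SmoothKernel i fun x => D x a b) :
    SmoothKernel i fun x => _root_.placed (fun a => J a x) (fun a => J' a x) (D x) :=
  SmoothKernel.sum _ fun a => SmoothKernel.sum _ fun b =>
    SmoothKernel.sandwich (h.smooth a) (hD a b) (h.smooth' b)

/-- Idempotent matrices of operators give rise to elements of the Grassmannian. -/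
theorem SmoothFrame.exists_gr (h : SmoothFrame i α J J') {P : X → Matrix ι ι (Opr 𝔄 Ω Ω)}
    (hP : ∀ a b, SmoothKernel i fun x => (P x - Matrix.diagonal fun a => α a x) a b)
    (hid : ∀ x, P x * P x = P x) :
    ∃ f : X → Gr 𝔄, SmoothVia i (fun b : Gr 𝔄 => b.1) f ∧
      ∀ x, (f x).top = lift (fun a => α a x) (fun a => J a x) (fun a => J' a x) (P x) := by
  obtain ⟨f, hf, hf'⟩ := Gr.exists_of_smoothKernel (h.placed hP) fun x => by
    have := (h.orthFrame x).lift_mul (P x) (P x)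
    rw [hid] at this
    exact this
  exact ⟨f, hf, fun x => by rw [Gr.top, hf', lift]⟩

theorem SmoothKernel.base {Ω Ω' : Type}
    [IndexSize Ω] [IndexSize Ω'] [TemperedIndex Ω] [TemperedIndex Ω'] {D : X → Opr 𝔄 Ω Ω'}
    (h : SmoothKernel i D) : SmoothKernel (timeEmb i) fun z : X × Set.Icc (0 : ℝ) 1 => D z.1 := by
  obtain ⟨δ, hδ, h⟩ := h
  exact ⟨_, hδ.base, fun z => h z.1⟩

theorem Gr.top_injective : Function.Injective (Gr.top : Gr 𝔄 → _) := fun _ _ h =>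
  Gr.dop_injective (add_left_cancel h)

/-- The idempotent matrix stays fixed while the frame moves. That P is idempotent is read off at
time 0, where its lift is a point of the Grassmannian and lifting is injective. -/
theorem SmoothFrame.homot {K : ι → X × Set.Icc (0 : ℝ) 1 → Opr 𝔄 Ω BlockIdx}
    {K' : ι → X × Set.Icc (0 : ℝ) 1 → Opr 𝔄 BlockIdx Ω}
    (h : SmoothFrame (timeEmb i) (fun a z => α a z.1) K K') {P : X → Matrix ι ι (Opr 𝔄 Ω Ω)}
    (hP : ∀ a b, SmoothKernel i fun x => (P x - Matrix.diagonal fun a => α a x) a b)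
    {f g : X → Gr 𝔄}
    (hf : ∀ x, (f x).top = lift (fun a => α a x) (fun a => K a (x, 0)) (fun a => K' a (x, 0)) (P x))
    (hg : ∀ x, (g x).top = lift (fun a => α a x) (fun a => K a (x, 1)) (fun a => K' a (x, 1)) (P x)) :
    Homot i f g := by
  obtain ⟨k, hk, hk'⟩ := h.exists_gr (P := fun z => P z.1) (fun a b => (hP a b).base) fun z => by
    have h1 := h.orthFrame (z.1, 0)
    refine h1.lift_injective ?_
    rw [← h1.lift_mul, ← hf, Gr.top_mul_top]
  exact ⟨k, hk, fun x => Gr.top_injective (by rw [hk', hf]),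
    fun x => Gr.top_injective (by rw [hk', hg])⟩

theorem SmoothMult.base {Ω Ω' : Type} [IndexSize Ω] [IndexSize Ω'] [TemperedIndex Ω]
    [TemperedIndex Ω'] [PolynormableSpace ℝ E] {J : X → Opr 𝔄 Ω Ω'} (h : SmoothMult i J) :
    SmoothMult (timeEmb i) fun z : X × Set.Icc (0 : ℝ) 1 => J z.1 :=
  h.map (SmoothVia.self i).base

/-! ### Uniqueness up to homotopy -/

variable [PolynormableSpace ℝ E]

/-- Composition of a frame with the stabilizing path of isometries. -/
theorem SmoothFrame.stab (h : SmoothFrame i α J J') {q : BlockIdx → BlockIdx} (hq : IsTempered q)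
    (hq1 : ∀ z, (q z).1 = z.1) (hinc : ∀ z, q z = z ∨ z.2 < (q z).2) :
    SmoothFrame (timeEmb i) (fun a (z : X × Set.Icc (0 : ℝ) 1) => α a z.1)
      (fun a z => stabOp hq z.2 ∘L J a z.1) fun a z => J' a z.1 ∘L stabOpT hq z.2 := by
  have hinc' : ∀ z, q z = z ∨ IndexSize.size z < IndexSize.size (q z) := fun z =>
    (hinc z).imp_right fun h => by
      change 0 + z.2 < 0 + (q z).2
      omega
  have hs : ∀ z, (q z).1 = 1 ↔ z.1 = 1 := fun z => by rw [hq1]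
  refine ⟨fun z => ⟨fun a b => ?_, fun a => ?_, fun a => ?_⟩, fun a => ?_, fun a => ?_⟩
  · rw [ContinuousLinearMap.comp_assoc, ← ContinuousLinearMap.comp_assoc _ _ (J b z.1),
      stabOpT_comp_stabOp hq hinc']
    exact (h.orthFrame z.1).orth a b
  · rw [← ContinuousLinearMap.comp_assoc, baseOp, proj_comp_stabOp hq hs,
      ContinuousLinearMap.comp_assoc, ContinuousLinearMap.comp_assoc, ← (h.orthFrame z.1).base a]
    rfl
  · rw [ContinuousLinearMap.comp_assoc, baseOp, proj_comp_stabOpT hq hs,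
      ← ContinuousLinearMap.comp_assoc, ← ContinuousLinearMap.comp_assoc,
      ← (h.orthFrame z.1).base' a]
    rfl
  · exact (SmoothMult.stabOp hq (SmoothVia.time contDiff_id)).comp (h.smooth a).base
  · exact (h.smooth' a).base.comp (SmoothMult.stabOpT hq (SmoothVia.time contDiff_id))

/-- Two copies of a frame can be rotated into each other if they are orthogonal. -/
theorem SmoothFrame.rotate {K : ι → X → Opr 𝔄 Ω BlockIdx} {K' : ι → X → Opr 𝔄 BlockIdx Ω}
    (h : SmoothFrame i α J J') (k : SmoothFrame i α K K')
    (hJK : ∀ a b x, J' a x ∘L K b x = 0) (hKJ : ∀ a b x, K' a x ∘L J b x = 0) :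
    SmoothFrame (timeEmb i) (fun a (z : X × Set.Icc (0 : ℝ) 1) => α a z.1)
      (fun a z => Real.cos (Real.pi / 2 * z.2) • J a z.1 + Real.sin (Real.pi / 2 * z.2) • K a z.1)
      fun a z =>
        Real.cos (Real.pi / 2 * z.2) • J' a z.1 + Real.sin (Real.pi / 2 * z.2) • K' a z.1 := by
  have hc : SmoothVia (timeEmb i) id fun z : X × Set.Icc (0 : ℝ) 1 =>
      Real.cos (Real.pi / 2 * z.2) :=
    SmoothVia.time (φ := fun t => Real.cos (Real.pi / 2 * t))
      (Real.contDiff_cos.comp (contDiff_const.mul contDiff_id))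
  have hs : SmoothVia (timeEmb i) id fun z : X × Set.Icc (0 : ℝ) 1 =>
      Real.sin (Real.pi / 2 * z.2) :=
    SmoothVia.time (φ := fun t => Real.sin (Real.pi / 2 * t))
      (Real.contDiff_sin.comp (contDiff_const.mul contDiff_id))
  refine ⟨fun z => ⟨fun a b => ?_, fun a => ?_, fun a => ?_⟩, fun a => ?_, fun a => ?_⟩
  · simp only [ContinuousLinearMap.add_comp, ContinuousLinearMap.comp_add,
      ContinuousLinearMap.smul_comp, ContinuousLinearMap.comp_smul, hJK, hKJ, smul_zero, add_zero,
      zero_add, (h.orthFrame z.1).orth, (k.orthFrame z.1).orth, smul_smul]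
    rw [← add_smul, ← sq, ← sq, Real.cos_sq_add_sin_sq, one_smul]
  · simp only [ContinuousLinearMap.add_comp, ContinuousLinearMap.comp_add,
      ContinuousLinearMap.smul_comp, ContinuousLinearMap.comp_smul, (h.orthFrame z.1).base,
      (k.orthFrame z.1).base]
  · simp only [ContinuousLinearMap.add_comp, ContinuousLinearMap.comp_add,
      ContinuousLinearMap.smul_comp, ContinuousLinearMap.comp_smul, (h.orthFrame z.1).base',
      (k.orthFrame z.1).base']
  · exact ((h.smooth a).base.smul hc).add ((k.smooth a).base.smul hs)
  · exact ((h.smooth' a).base.smul hc).add ((k.smooth' a).base.smul hs)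

/-- Composition of a frame with the relabeling by a map which respects the blocks. -/
theorem SmoothFrame.relOp (h : SmoothFrame i α J J') {q : BlockIdx → BlockIdx} (hq : IsTempered q)
    (hq1 : ∀ z, (q z).1 = z.1) :
    SmoothFrame i α (fun a x => RapidFun.relOp hq ∘L J a x)
      fun a x => J' a x ∘L RapidFun.pullOp hq := by
  have hs : ∀ z, (q z).1 = 1 ↔ z.1 = 1 := fun z => by rw [hq1]
  refine ⟨fun x => ⟨fun a b => ?_, fun a => ?_, fun a => ?_⟩, fun a => ?_, fun a => ?_⟩
  · rw [← (h.orthFrame x).orth a b]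
    exact ContinuousLinearMap.ext fun f => congrArg (J' a x) (pullOp_relOp hq _)
  · refine ContinuousLinearMap.ext fun f => (proj_relOp hq hs _).trans ?_
    exact congrArg (RapidFun.relOp hq) ((h.orthFrame x).base_apply a f)
  · refine ContinuousLinearMap.ext fun f => (congrArg (J' a x) (pullOp_proj hq hs _)).trans ?_
    exact (h.orthFrame x).base_apply' a _
  · exact (SmoothMult.relOp hq).comp (h.smooth a)
  · exact (h.smooth' a).comp (SmoothMult.pullOp hq)

/-- The map `(i, n) ↦ (i, 2 n + 1)`. -/
def oddMap (z : BlockIdx) : BlockIdx := (z.1, 2 * z.2 + 1)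

/-- The map `(i, n) ↦ (i, 2 n + 2)`. -/
def evenMap (z : BlockIdx) : BlockIdx := (z.1, 2 * z.2 + 2)

theorem wt_blockIdx (z : BlockIdx) : wt z = 1 + (z.2 : ℝ) := by
  simp [wt, IndexSize.size]

theorem isTempered_oddMap : IsTempered oddMap :=
  .of_le (fun a b h => by
    simp only [oddMap, Prod.mk.injEq] at h
    exact Prod.ext h.1 (by omega)) 3
    (fun z => by
      rw [wt_blockIdx, wt_blockIdx]
      simp only [oddMap]
      push_cast
      have : (0 : ℝ) ≤ z.2 := Nat.cast_nonneg _
      linarith) fun z => by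
      rw [wt_blockIdx, wt_blockIdx]
      simp only [oddMap]
      push_cast
      have : (0 : ℝ) ≤ z.2 := Nat.cast_nonneg _
      linarith

theorem isTempered_evenMap : IsTempered evenMap :=
  .of_le (fun a b h => by
    simp only [evenMap, Prod.mk.injEq] at h
    exact Prod.ext h.1 (by omega)) 3
    (fun z => by
      rw [wt_blockIdx, wt_blockIdx]
      simp only [evenMap]
      push_cast
      have : (0 : ℝ) ≤ z.2 := Nat.cast_nonneg _
      linarith) fun z => by
      rw [wt_blockIdx, wt_blockIdx]
      simp only [evenMap]
      push_cast
      have : (0 : ℝ) ≤ z.2 := Nat.cast_nonneg _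
      linarith

/-- The frame is carried along the path `stabOp`, which joins the identity to the relabeling and
commutes with R₀ because `q` preserves the blocks. -/
theorem SmoothFrame.homot_relOp (h : SmoothFrame i α J J') {q : BlockIdx → BlockIdx}
    (hq : IsTempered q) (hq1 : ∀ z, (q z).1 = z.1) (hinc : ∀ z, q z = z ∨ z.2 < (q z).2)
    {P : X → Matrix ι ι (Opr 𝔄 Ω Ω)}
    (hP : ∀ a b, SmoothKernel i fun x => (P x - Matrix.diagonal fun a => α a x) a b)
    {f g : X → Gr 𝔄}
    (hf : ∀ x, (f x).top = lift (fun a => α a x) (fun a => J a x) (fun a => J' a x) (P x))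
    (hg : ∀ x, (g x).top = lift (fun a => α a x) (fun a => RapidFun.relOp hq ∘L J a x)
      (fun a => J' a x ∘L RapidFun.pullOp hq) (P x)) :
    Homot i f g := by
  refine (h.stab hq hq1 hinc).homot hP (fun x => ?_) fun x => ?_
  · rw [hf]
    simp only [Set.Icc.coe_zero, stabOp_zero, stabOpT_zero]
    rfl
  · rw [hg]
    simp only [Set.Icc.coe_one, stabOp_one, stabOpT_one]

/-- The homotopy class of the element of the Grassmannian which is constructed from a frame does
not depend on the frame. -/
theorem SmoothFrame.homot_of_frames {K : ι → X → Opr 𝔄 Ω BlockIdx} {K' : ι → X → Opr 𝔄 BlockIdx Ω}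
    (h : SmoothFrame i α J J') (k : SmoothFrame i α K K') {P : X → Matrix ι ι (Opr 𝔄 Ω Ω)}
    (hP : ∀ a b, SmoothKernel i fun x => (P x - Matrix.diagonal fun a => α a x) a b)
    {f g : X → Gr 𝔄}
    (hf : ∀ x, (f x).top = lift (fun a => α a x) (fun a => J a x) (fun a => J' a x) (P x))
    (hg : ∀ x, (g x).top = lift (fun a => α a x) (fun a => K a x) (fun a => K' a x) (P x)) :
    Homot i f g := by
  have hid : ∀ x, P x * P x = P x := fun x => by
    refine (h.orthFrame x).lift_injective ?_
    rw [← (h.orthFrame x).lift_mul, ← hf, Gr.top_mul_top]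
  -- The frames may overlap in an uncontrolled way, so each of them is first pushed to positions of
  -- one parity. Both maps strictly increase the position, as the stabilizing path requires.
  have h0 := h.relOp isTempered_oddMap fun _ => rfl
  have h1 := k.relOp isTempered_evenMap fun _ => rfl
  obtain ⟨f', -, hf'⟩ := h0.exists_gr hP hid
  obtain ⟨g', -, hg'⟩ := h1.exists_gr hP hid
  have e1 : Homot i f f' := h.homot_relOp isTempered_oddMap (fun _ => rfl)
    (fun z => Or.inr (by simp only [oddMap]; omega)) hP hf hf'
  have e2 : Homot i g g' := k.homot_relOp isTempered_evenMap (fun _ => rfl)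
    (fun z => Or.inr (by simp only [evenMap]; omega)) hP hg hg'
  have e3 : Homot i f' g' := by
    refine (h0.rotate h1 (fun a b x => ?_) fun a b x => ?_).homot hP (fun x => ?_) fun x => ?_
    · refine ContinuousLinearMap.ext fun f => (congrArg (J' a x)
        (pullOp_relOp_eq_zero isTempered_oddMap isTempered_evenMap (fun a b e => ?_) _)).trans
        (map_zero _)
      have := congrArg Prod.snd e
      simp only [oddMap, evenMap] at this
      omega
    · refine ContinuousLinearMap.ext fun f => (congrArg (K' a x)
        (pullOp_relOp_eq_zero isTempered_evenMap isTempered_oddMap (fun a b e => ?_) _)).trans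
        (map_zero _)
      have := congrArg Prod.snd e
      simp only [oddMap, evenMap] at this
      omega
    · rw [hf']
      simp
    · rw [hg']
      simp
  exact e1.trans (e3.trans e2.symm)

end Smooth

end Frames

/-! ### Equivalent idempotents -/

section RotationAlgebra

variable {A : Type*} [Ring A] [Module ℝ A] [IsScalarTower ℝ A A] [SMulCommClass ℝ A A]

/-- The matrices of the homotopy between the idempotents `q p` and `p q`, for `p q p = p` and
`q p q = q`. -/
def mvnMatrix (u κ : ℝ) (b p q : A) : Matrix (Fin 2) (Fin 2) A :=
  !![(u • b + (1 - u) • p) * (u • b + (1 - u) • q), (u • b + (1 - u) • p) * (κ • (q - b));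
    (κ • (p - b)) * (u • b + (1 - u) • q), (κ • (p - b)) * (κ • (q - b))]

/-- The matrix is a column times a row, and the row times the column is `b`, which acts as identity
from the right on the column. The corner is `b = q p` for u = 1 and `p q` for u = 0, and the other
entries vanish in both cases since κ = 0. -/
theorem mvnMatrix_mul_self {u κ : ℝ} (hκ : κ * κ = u * (1 - u)) {b p q : A} (hb : q * p = b)
    (hp : p * b = p) (hbb : b * b = b) :
    mvnMatrix u κ b p q * mvnMatrix u κ b p q = mvnMatrix u κ b p q := by
  have h : (u • b + (1 - u) • q) * (u • b + (1 - u) • p) + (κ • (q - b)) * (κ • (p - b)) = b := by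
    simp only [add_mul, mul_add, sub_mul, mul_sub, smul_mul_assoc, mul_smul_comm, smul_smul, hb,
      hbb, smul_sub, hκ]
    module
  have h1 : (u • b + (1 - u) • p) * b = u • b + (1 - u) • p := by
    simp only [add_mul, smul_mul_assoc, hbb, hp]
  have h2 : (κ • (p - b)) * b = κ • (p - b) := by
    simp only [sub_mul, smul_mul_assoc, hbb, hp]
  have key : ∀ x y : A, x * b = x → x * (u • b + (1 - u) • q) * ((u • b + (1 - u) • p) * y) +
      x * (κ • (q - b)) * ((κ • (p - b)) * y) = x * y := fun x y hx => by
    calc _ = x * ((u • b + (1 - u) • q) * (u • b + (1 - u) • p) +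
        (κ • (q - b)) * (κ • (p - b))) * y := by simp only [mul_add, add_mul, mul_assoc]
      _ = x * y := by rw [h, hx]
  rw [mvnMatrix, Matrix.mul_fin_two, key _ _ h1, key _ _ h1, key _ _ h2, key _ _ h2]

end RotationAlgebra

section Mvn

variable {𝔄 : Type w} [NonUnitalCommRing 𝔄] [Module ℝ 𝔄] [IsScalarTower ℝ 𝔄 𝔄]
  [SMulCommClass ℝ 𝔄 𝔄] [TopologicalSpace 𝔄] [IsTopologicalRing 𝔄] [ContinuousSMul ℝ 𝔄]
  [PolynormableSpace ℝ 𝔄] [T2Space 𝔄] [AbsSummableSpace 𝔄]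

variable {Ω : Type} [IndexSize Ω] [TemperedIndex Ω] {ι : Type} [Fintype ι] [DecidableEq ι]
  {X : Type x} {E : Type u} [AddCommGroup E] [Module ℝ E] [TopologicalSpace E]
  [IsTopologicalAddGroup E] [ContinuousSMul ℝ E] {i : X → E}

theorem lift_unit (α : Opr 𝔄 Ω Ω) (J : Opr 𝔄 Ω BlockIdx) (J' : Opr 𝔄 BlockIdx Ω)
    (P : Matrix Unit Unit (Opr 𝔄 Ω Ω)) :
    lift (fun _ => α) (fun _ => J) (fun _ => J') P = baseOp 𝔄 + J ∘L (P () () - α) ∘L J' := by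
  simp [lift, placed]

theorem lift_fin_two (α : Fin 2 → Opr 𝔄 Ω Ω) (J : Fin 2 → Opr 𝔄 Ω BlockIdx)
    (J' : Fin 2 → Opr 𝔄 BlockIdx Ω) (P : Matrix (Fin 2) (Fin 2) (Opr 𝔄 Ω Ω)) :
    lift α J J' P = baseOp 𝔄 + (J 0 ∘L (P 0 0 - α 0) ∘L J' 0 + J 0 ∘L P 0 1 ∘L J' 1 +
      (J 1 ∘L P 1 0 ∘L J' 0 + J 1 ∘L (P 1 1 - α 1) ∘L J' 1)) := by
  simp [lift, placed, Fin.sum_univ_two, Matrix.diagonal]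
  abel

/-- The map `(i, n) ↦ (0, 4 n + 2 i)`. -/
def spareMap (z : BlockIdx) : BlockIdx := (0, 4 * z.2 + 2 * z.1)

theorem isTempered_spareMap : IsTempered spareMap :=
  .of_le (fun a b h => by
    simp only [spareMap, Prod.mk.injEq, true_and] at h
    exact Prod.ext (by omega) (by omega)) 4
    (fun z => by
      rw [wt_blockIdx, wt_blockIdx]
      simp only [spareMap]
      have h1 : (z.1 : ℕ) ≤ 1 := by omega
      have h2 : ((z.1 : ℕ) : ℝ) ≤ 1 := by exact_mod_cast h1
      push_cast
      have : (0 : ℝ) ≤ z.2 := Nat.cast_nonneg _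
      linarith) fun z => by
      rw [wt_blockIdx, wt_blockIdx]
      simp only [spareMap]
      push_cast
      have : (0 : ℝ) ≤ z.2 := Nat.cast_nonneg _
      have : (0 : ℝ) ≤ ((z.1 : ℕ) : ℝ) := Nat.cast_nonneg _
      linarith

theorem SmoothFrame.identity : SmoothFrame i (fun (_ : Unit) _ => baseOp 𝔄)
    (fun _ _ => (1 : Opr 𝔄 BlockIdx BlockIdx)) fun _ _ => 1 :=
  ⟨fun _ => ⟨fun _ _ => rfl, fun _ => rfl, fun _ => rfl⟩, fun _ => .one, fun _ => .one⟩

/-- The frame which consists of the embedding by `oddMap`, and an embedding into the remaining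
part of the zeroth block. -/
theorem SmoothFrame.spare : SmoothFrame i (fun (a : Fin 2) _ => ![baseOp 𝔄, 0] a)
    (fun a _ => ![RapidFun.relOp isTempered_oddMap, RapidFun.relOp isTempered_spareMap] a)
    fun a _ => ![RapidFun.pullOp isTempered_oddMap, RapidFun.pullOp isTempered_spareMap] a := by
  have h1 : ∀ a b, spareMap b ≠ oddMap a := fun a b h => by
    have := congrArg Prod.snd h
    simp only [spareMap, oddMap] at this
    omega
  have hp : ∀ f : RapidFun BlockIdx (Unitization ℝ 𝔄), RapidFun.proj (fun _ => False) f = 0 :=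
    fun f => RapidFun.ext fun ω => by rw [proj_apply, if_neg id]; rfl
  refine ⟨fun x => ⟨?_, ?_, ?_⟩, ?_, ?_⟩
  · rw [Fin.forall_fin_two, Fin.forall_fin_two, Fin.forall_fin_two]
    refine ⟨⟨?_, ?_⟩, ?_, ?_⟩ <;> refine ContinuousLinearMap.ext fun f => ?_
    · exact pullOp_relOp isTempered_oddMap f
    · exact pullOp_relOp_eq_zero isTempered_oddMap isTempered_spareMap (fun a b => h1 a b) f
    · exact pullOp_relOp_eq_zero isTempered_spareMap isTempered_oddMap (fun a b => (h1 b a).symm) f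
    · exact pullOp_relOp isTempered_spareMap f
  · rw [Fin.forall_fin_two]
    refine ⟨ContinuousLinearMap.ext fun f => ?_, ContinuousLinearMap.ext fun f => ?_⟩
    · exact proj_relOp isTempered_oddMap (fun _ => Iff.rfl) f
    · refine (proj_relOp (s := fun _ => False) isTempered_spareMap (fun _ => by simp [spareMap]) f).trans ?_
      rw [hp, map_zero]
      exact (map_zero (RapidFun.relOp isTempered_spareMap)).symm
  · rw [Fin.forall_fin_two]
    refine ⟨ContinuousLinearMap.ext fun f => ?_, ContinuousLinearMap.ext fun f => ?_⟩
    · exact pullOp_proj isTempered_oddMap (fun _ => Iff.rfl) f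
    · refine (pullOp_proj (s := fun _ => False) isTempered_spareMap (fun _ => by simp [spareMap]) f).trans ?_
      rw [hp]
      rfl
  · rw [Fin.forall_fin_two]
    exact ⟨.relOp _, .relOp _⟩
  · rw [Fin.forall_fin_two]
    exact ⟨.pullOp _, .pullOp _⟩

variable [PolynormableSpace ℝ E]

/-- Equivalent families of idempotents are homotopic. -/
theorem homot_of_mvn {P Q : X → Opr 𝔄 BlockIdx BlockIdx}
    (hP : SmoothKernel i fun x => P x - baseOp 𝔄) (hQ : SmoothKernel i fun x => Q x - baseOp 𝔄)
    (hPQP : ∀ x, P x * Q x * P x = P x) (hQPQ : ∀ x, Q x * P x * Q x = Q x) {f g : X → Gr 𝔄}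
    (hf : ∀ x, (f x).top = Q x * P x) (hg : ∀ x, (g x).top = P x * Q x) : Homot i f g := by
  -- Products of perturbations of R₀ are perturbations of R₀, because R₀ is idempotent.
  have mulK : ∀ {P Q : X → Opr 𝔄 BlockIdx BlockIdx}, SmoothKernel i (fun x => P x - baseOp 𝔄) →
      SmoothKernel i (fun x => Q x - baseOp 𝔄) →
      SmoothKernel i fun x => P x * Q x - baseOp 𝔄 := fun {P Q} hP hQ => by
    have h := (hP.comp hQ).add ((SmoothMult.baseOp.left (.self i) hQ).add
      (SmoothMult.baseOp.right (.self i) hP))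
    refine h.congr fun x => ?_
    change (P x - baseOp 𝔄) * (Q x - baseOp 𝔄) + (baseOp 𝔄 * (Q x - baseOp 𝔄) +
      (P x - baseOp 𝔄) * baseOp 𝔄) = _
    simp only [sub_mul, mul_sub, baseOp_mul_baseOp]
    abel
  have hb := mulK hQ hP
  -- The product of cosine and sine is a smooth square root of u (1 - u).
  let u : X × Set.Icc (0 : ℝ) 1 → ℝ := fun z => Real.cos (Real.pi / 2 * z.2) ^ 2
  let κ : X × Set.Icc (0 : ℝ) 1 → ℝ := fun z =>
    Real.cos (Real.pi / 2 * z.2) * Real.sin (Real.pi / 2 * z.2)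
  have hu : SmoothVia (timeEmb i) id u :=
    SmoothVia.time (φ := fun t => Real.cos (Real.pi / 2 * t) ^ 2)
      ((Real.contDiff_cos.comp (contDiff_const.mul contDiff_id)).pow 2)
  have hu' : SmoothVia (timeEmb i) id fun z => 1 - u z :=
    SmoothVia.time (φ := fun t => 1 - Real.cos (Real.pi / 2 * t) ^ 2)
      (contDiff_const.sub ((Real.contDiff_cos.comp (contDiff_const.mul contDiff_id)).pow 2))
  have hκ : SmoothVia (timeEmb i) id κ :=
    SmoothVia.time (φ := fun t => Real.cos (Real.pi / 2 * t) * Real.sin (Real.pi / 2 * t))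
      ((Real.contDiff_cos.comp (contDiff_const.mul contDiff_id)).mul
        (Real.contDiff_sin.comp (contDiff_const.mul contDiff_id)))
  have hκu : ∀ z, κ z * κ z = u z * (1 - u z) := fun z => by
    have := Real.cos_sq_add_sin_sq (Real.pi / 2 * z.2)
    simp only [u, κ]
    rw [show 1 - Real.cos (Real.pi / 2 * z.2) ^ 2 = Real.sin (Real.pi / 2 * z.2) ^ 2 by linarith]
    ring
  have hmix : ∀ {P Q : X → Opr 𝔄 BlockIdx BlockIdx}, SmoothKernel i (fun x => P x - baseOp 𝔄) →
      SmoothKernel i (fun x => Q x - baseOp 𝔄) → SmoothKernel (timeEmb i)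
      fun z : X × Set.Icc (0 : ℝ) 1 => (u z • P z.1 + (1 - u z) • Q z.1) - baseOp 𝔄 :=
    fun hP hQ => ((hP.base.smul hu).add (hQ.base.smul hu')).congr fun z => by module
  have hdiff : ∀ {P Q : X → Opr 𝔄 BlockIdx BlockIdx}, SmoothKernel i (fun x => P x - baseOp 𝔄) →
      SmoothKernel i (fun x => Q x - baseOp 𝔄) → SmoothKernel (timeEmb i)
      fun z : X × Set.Icc (0 : ℝ) 1 => κ z • (P z.1 - Q z.1) :=
    fun hP hQ => ((hP.base.sub hQ.base).smul hκ).congr fun z => by module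
  have hmult : ∀ {P : X × Set.Icc (0 : ℝ) 1 → Opr 𝔄 BlockIdx BlockIdx},
      SmoothKernel (timeEmb i) (fun z => P z - baseOp 𝔄) → SmoothMult (timeEmb i) P := fun {P} hP => by
    have := (SmoothMult.of_kernel hP).add SmoothMult.baseOp
    simpa using this
  have hv := hmix hb hP
  have hw := hmix hb hQ
  have hv' := hdiff hP hb
  have hw' := hdiff hQ hb
  -- The second row and column are placed in free positions of the zeroth block, where the base term
  -- is 0; there the entries themselves have to be rapidly decreasing. This holds because they
  -- contain differences of perturbations of R₀.
  obtain ⟨k, hk, hk'⟩ := (SmoothFrame.spare (i := timeEmb i)).exists_gr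
    (P := fun z : X × Set.Icc (0 : ℝ) 1 => mvnMatrix (u z) (κ z) (Q z.1 * P z.1) (P z.1) (Q z.1))
    (by
      have h00 : SmoothKernel (timeEmb i) fun z : X × Set.Icc (0 : ℝ) 1 =>
          (u z • (Q z.1 * P z.1) + (1 - u z) • P z.1) * (u z • (Q z.1 * P z.1) + (1 - u z) • Q z.1) -
            baseOp 𝔄 := by
        have h := (hv.comp hw).add ((SmoothMult.baseOp.left (.self _) hw).add
          (SmoothMult.baseOp.right (.self _) hv))
        refine h.congr fun z => ?_
        change (_ - baseOp 𝔄) * (_ - baseOp 𝔄) + (baseOp 𝔄 * (_ - baseOp 𝔄) +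
          (_ - baseOp 𝔄) * baseOp 𝔄) = _
        generalize (u z • (Q z.1 * P z.1) + (1 - u z) • P z.1) = a
        generalize (u z • (Q z.1 * P z.1) + (1 - u z) • Q z.1) = b
        simp only [sub_mul, mul_sub, baseOp_mul_baseOp]
        abel
      rw [Fin.forall_fin_two, Fin.forall_fin_two, Fin.forall_fin_two]
      refine ⟨⟨h00.congr fun z => rfl, ?_⟩, ?_, ?_⟩
      · exact ((hmult hv).left (.self _) hw').congr fun z => (sub_zero _).symm
      · exact ((hmult hw).right (.self _) hv').congr fun z => (sub_zero _).symm
      · exact (hv'.comp hw').congr fun z => (sub_zero _).symm)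
    fun z => mvnMatrix_mul_self (hκu z) rfl (by rw [← mul_assoc, hPQP])
      (by rw [← mul_assoc, hQPQ])
  -- At the ends only the corner is left, which is the given idempotent relabeled by `oddMap`.
  have e0 : Homot i f fun x => k (x, 0) := by
    refine SmoothFrame.identity.homot_relOp (P := fun x _ _ => Q x * P x) isTempered_oddMap (fun _ => rfl)
      (fun z => Or.inr (by simp only [oddMap]; omega)) (fun _ _ => hb) (fun x => ?_) fun x => ?_
    · refine (hf x).trans (Eq.trans ?_ (lift_unit _ _ _ _).symm)
      exact (add_sub_cancel _ _).symm
    · refine (hk' _).trans (Eq.trans ?_ (lift_unit _ _ _ _).symm)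
      refine (lift_fin_two _ _ _ _).trans (congrArg _ ?_)
      simp [u, κ, mvnMatrix]
      rw [show Q x * P x * (Q x * P x) = Q x * P x by rw [← mul_assoc, hQPQ]]
      rfl
  have e1 : Homot i g fun x => k (x, 1) := by
    refine SmoothFrame.identity.homot_relOp (P := fun x _ _ => P x * Q x) isTempered_oddMap (fun _ => rfl)
      (fun z => Or.inr (by simp only [oddMap]; omega)) (fun _ _ => mulK hP hQ) (fun x => ?_) fun x => ?_
    · refine (hg x).trans (Eq.trans ?_ (lift_unit _ _ _ _).symm)
      exact (add_sub_cancel _ _).symm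
    · refine (hk' _).trans (Eq.trans ?_ (lift_unit _ _ _ _).symm)
      refine (lift_fin_two _ _ _ _).trans (congrArg _ ?_)
      simp [u, κ, mvnMatrix]
      rfl
  exact e0.trans (Homot.trans ⟨k, hk, fun _ => rfl, fun _ => rfl⟩ e1.symm)

/-- Equivalent families of idempotent matrices of operators give rise to homotopic families. -/
theorem SmoothFrame.homot_of_mvn {α : ι → X → Opr 𝔄 Ω Ω} {J : ι → X → Opr 𝔄 Ω BlockIdx}
    {J' : ι → X → Opr 𝔄 BlockIdx Ω} (h : SmoothFrame i α J J') {P Q : X → Matrix ι ι (Opr 𝔄 Ω Ω)}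
    (hP : ∀ a b, SmoothKernel i fun x => (P x - Matrix.diagonal fun a => α a x) a b)
    (hQ : ∀ a b, SmoothKernel i fun x => (Q x - Matrix.diagonal fun a => α a x) a b)
    (hPQP : ∀ x, P x * Q x * P x = P x) (hQPQ : ∀ x, Q x * P x * Q x = Q x) {f g : X → Gr 𝔄}
    (hf : ∀ x, (f x).top = lift (fun a => α a x) (fun a => J a x) (fun a => J' a x) (Q x * P x))
    (hg : ∀ x, (g x).top = lift (fun a => α a x) (fun a => J a x) (fun a => J' a x) (P x * Q x)) :
    Homot i f g := by
  refine _root_.homot_of_mvn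
    (P := fun x => lift (fun a => α a x) (fun a => J a x) (fun a => J' a x) (P x))
    (Q := fun x => lift (fun a => α a x) (fun a => J a x) (fun a => J' a x) (Q x))
    ((h.placed hP).congr fun x => ?_) ((h.placed hQ).congr fun x => ?_) (fun x => ?_) (fun x => ?_)
    (fun x => ?_) fun x => ?_
  · exact (add_sub_cancel_left _ _).symm
  · exact (add_sub_cancel_left _ _).symm
  · rw [(h.orthFrame x).lift_mul, (h.orthFrame x).lift_mul, hPQP]
  · rw [(h.orthFrame x).lift_mul, (h.orthFrame x).lift_mul, hQPQ]
  · rw [(h.orthFrame x).lift_mul, hf]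
  · rw [(h.orthFrame x).lift_mul, hg]

end Mvn

/-! ### Regularization -/

section Reg

variable {𝔄 : Type w} [NonUnitalCommRing 𝔄] [Module ℝ 𝔄] [IsScalarTower ℝ 𝔄 𝔄]
  [SMulCommClass ℝ 𝔄 𝔄] [TopologicalSpace 𝔄] [IsTopologicalRing 𝔄] [ContinuousSMul ℝ 𝔄]
  [PolynormableSpace ℝ 𝔄] [T2Space 𝔄] [AbsSummableSpace 𝔄]

variable {Ω : Type} [IndexSize Ω] [TemperedIndex Ω] {ι : Type} [Fintype ι] [DecidableEq ι]
  {X : Type x} {E : Type u} [AddCommGroup E] [Module ℝ E] [TopologicalSpace E]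
  [IsTopologicalAddGroup E] [ContinuousSMul ℝ E] {i : X → E}

theorem isTempered_block (k : Fin 2) {r : Ω → ℕ} (hr : IsTempered r) :
    IsTempered (fun ω => (k, r ω) : Ω → BlockIdx) := (IsTempered.pair k).comp hr

theorem baseOp_relOp_zero {r : Ω → ℕ} (hr : IsTempered r) (f : RapidFun Ω (Unitization ℝ 𝔄)) :
    baseOp 𝔄 (relOp (isTempered_block 0 hr) f) = 0 := by
  refine (proj_relOp (s := fun _ => False) (isTempered_block 0 hr) (fun _ => by simp) f).trans ?_
  rw [show proj (fun _ => False) f = 0 from RapidFun.ext fun ω => by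
    rw [proj_apply, if_neg id]; rfl, map_zero]

theorem baseOp_relOp_one {r : Ω → ℕ} (hr : IsTempered r) (f : RapidFun Ω (Unitization ℝ 𝔄)) :
    baseOp 𝔄 (relOp (isTempered_block 1 hr) f) = relOp (isTempered_block 1 hr) f := by
  refine (proj_relOp (s := fun _ => True) (isTempered_block 1 hr) (fun _ => by simp) f).trans ?_
  rw [show proj (fun _ => True) f = f from RapidFun.ext fun ω => by
    rw [proj_apply, if_pos trivial]]

theorem pullOp_baseOp_zero {r : Ω → ℕ} (hr : IsTempered r)
    (f : RapidFun BlockIdx (Unitization ℝ 𝔄)) :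
    pullOp (isTempered_block 0 hr) (baseOp 𝔄 f) = 0 :=
  RapidFun.ext fun ω => by simp [baseOp, proj_apply]

theorem pullOp_baseOp_one {r : Ω → ℕ} (hr : IsTempered r)
    (f : RapidFun BlockIdx (Unitization ℝ 𝔄)) :
    pullOp (isTempered_block 1 hr) (baseOp 𝔄 f) = pullOp (isTempered_block 1 hr) f :=
  RapidFun.ext fun ω => by simp [baseOp, proj_apply]

theorem pullOp_relOp_block {Ω' : Type} [IndexSize Ω'] [TemperedIndex Ω'] {k l : Fin 2} {r : Ω → ℕ}
    {s : Ω' → ℕ} (hr : IsTempered r) (hs : IsTempered s) (hkl : k ≠ l)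
    (f : RapidFun Ω' (Unitization ℝ 𝔄)) :
    pullOp (isTempered_block k hr) (relOp (isTempered_block l hs) f) = 0 :=
  pullOp_relOp_eq_zero _ _ (fun _ _ h => hkl (congrArg Prod.fst h).symm) f

/-- The embedding which intertwines an idempotent `α` with `diag (0, 1)`: the range of `1 - α` is
placed in the zeroth block and the range of `α` is placed in the first block. -/
noncomputable def regEmb {r : Ω → ℕ} (hr : IsTempered r) (α : Opr 𝔄 Ω Ω) : Opr 𝔄 Ω BlockIdx :=
  relOp (isTempered_block 0 hr) ∘L (1 - α) + relOp (isTempered_block 1 hr) ∘L α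

/-- The left inverse of `regEmb`. -/
noncomputable def regEmbT {r : Ω → ℕ} (hr : IsTempered r) (α : Opr 𝔄 Ω Ω) : Opr 𝔄 BlockIdx Ω :=
  (1 - α) ∘L pullOp (isTempered_block 0 hr) + α ∘L pullOp (isTempered_block 1 hr)

theorem regEmb_apply {r : Ω → ℕ} (hr : IsTempered r) (α : Opr 𝔄 Ω Ω)
    (f : RapidFun Ω (Unitization ℝ 𝔄)) : regEmb hr α f =
      relOp (isTempered_block 0 hr) (f - α f) + relOp (isTempered_block 1 hr) (α f) := rfl

theorem regEmbT_apply {r : Ω → ℕ} (hr : IsTempered r) (α : Opr 𝔄 Ω Ω)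
    (f : RapidFun BlockIdx (Unitization ℝ 𝔄)) : regEmbT hr α f =
      pullOp (isTempered_block 0 hr) f - α (pullOp (isTempered_block 0 hr) f) +
        α (pullOp (isTempered_block 1 hr) f) := rfl

theorem SmoothMult.regEmb {r : Ω → ℕ} (hr : IsTempered r) {α : X → Opr 𝔄 Ω Ω}
    (hα : SmoothMult i α) : SmoothMult i fun x => _root_.regEmb hr (α x) :=
  ((SmoothMult.relOp _).comp (SmoothMult.one.sub hα)).add ((SmoothMult.relOp _).comp hα)

theorem SmoothMult.regEmbT {r : Ω → ℕ} (hr : IsTempered r) {α : X → Opr 𝔄 Ω Ω}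
    (hα : SmoothMult i α) : SmoothMult i fun x => _root_.regEmbT hr (α x) :=
  ((SmoothMult.one.sub hα).comp (SmoothMult.pullOp _)).add (hα.comp (SmoothMult.pullOp _))

/-- R₀ annihilates the zeroth block and fixes the first one, so it keeps exactly the α-part of the
embedding; J' J = (1 - α)² + α² = 1. Different members are orthogonal because the images of the
relabelings are disjoint. -/
theorem SmoothFrame.reg {r : ι → Ω → ℕ} (hr : ∀ a, IsTempered (r a))
    (hdisj : ∀ a b, a ≠ b → ∀ z w, r a z ≠ r b w) {α : ι → X → Opr 𝔄 Ω Ω}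
    (hα : ∀ a, SmoothMult i (α a)) (hid : ∀ a x, α a x * α a x = α a x) :
    SmoothFrame i α (fun a x => regEmb (hr a) (α a x)) fun a x => regEmbT (hr a) (α a x) := by
  have hid' : ∀ a x f, α a x (α a x f) = α a x f := fun a x f =>
    congrArg (fun Y : Opr 𝔄 Ω Ω => Y f) (hid a x)
  refine ⟨fun x => ⟨fun a b => ContinuousLinearMap.ext fun f => ?_,
    fun a => ContinuousLinearMap.ext fun f => ?_, fun a => ContinuousLinearMap.ext fun f => ?_⟩,
    fun a => (hα a).regEmb (hr a), fun a => (hα a).regEmbT (hr a)⟩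
  · rw [ContinuousLinearMap.comp_apply, regEmb_apply, regEmbT_apply]
    simp only [map_add, pullOp_relOp_block (hr a) (hr b) (zero_ne_one (α := Fin 2)),
      pullOp_relOp_block (hr a) (hr b) (one_ne_zero (α := Fin 2)), add_zero, zero_add]
    split_ifs with hab
    · subst hab
      simp only [pullOp_relOp, map_sub, hid']
      change _ = f
      abel
    · rw [pullOp_relOp_eq_zero _ _ (fun z w h => hdisj a b hab z w (congrArg Prod.snd h).symm),
        pullOp_relOp_eq_zero _ _ (fun z w h => hdisj a b hab z w (congrArg Prod.snd h).symm)]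
      simp
  · change baseOp 𝔄 (regEmb (hr a) (α a x) f) = regEmb (hr a) (α a x) (α a x f)
    rw [regEmb_apply, regEmb_apply, map_add, baseOp_relOp_zero (hr a), baseOp_relOp_one (hr a), hid', sub_self,
      map_zero]
  · change regEmbT (hr a) (α a x) (baseOp 𝔄 f) = α a x (regEmbT (hr a) (α a x) f)
    rw [regEmbT_apply, regEmbT_apply, pullOp_baseOp_zero (hr a), pullOp_baseOp_one (hr a)]
    simp only [map_add, map_sub, hid', map_zero]
    simp

theorem SmoothFrame.reg_single {r : Ω → ℕ} (hr : IsTempered r) {α : X → Opr 𝔄 Ω Ω}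
    (hα : SmoothMult i α) (hid : ∀ x, α x * α x = α x) :
    SmoothFrame i (fun (_ : Unit) => α) (fun _ x => regEmb hr (α x)) fun _ x => regEmbT hr (α x) :=
  SmoothFrame.reg (r := fun _ => r) (fun _ => hr) (fun _ _ h => absurd rfl h) (fun _ => hα)
    fun _ => hid

/-! ### Matrices of operators -/

theorem relabel_mat {Ω' : Type} [IndexSize Ω'] [TemperedIndex Ω'] {r : Ω → Ω'} (hr : IsTempered r)
    (Y : Opr 𝔄 Ω Ω) : relabel r (mat Y) = mat (relOp hr ∘L Y ∘L pullOp hr) := by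
  ext1 i j
  rw [mat_apply, relabel, Matrix.of_apply]
  change _ = relOp hr (Y (pullOp hr (single j))) i
  by_cases hi : ∃ a, r a = i
  · obtain ⟨a, rfl⟩ := hi
    rw [relOp_apply]
    by_cases hj : ∃ b, r b = j
    · obtain ⟨b, rfl⟩ := hj
      rw [pullOp_single]
      exact (hr.injective.prodMap hr.injective).extend_apply _ _ (a, b)
    · push Not at hj
      rw [pullOp_single_eq_zero hr hj, map_zero, Function.extend_apply']
      · rfl
      · rintro ⟨z, hz⟩
        exact hj z.2 (congrArg Prod.snd hz)
  · push Not at hi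
    rw [relOp_apply_eq_zero hr _ hi, Function.extend_apply']
    · rfl
    · rintro ⟨z, hz⟩
      exact hi z.1 (congrArg Prod.fst hz)

theorem mat_sub (Y Z : Opr 𝔄 Ω Ω) : mat (Y - Z) = mat Y - mat Z := by
  ext1 i j
  rfl

theorem mat_add (Y Z : Opr 𝔄 Ω Ω) : mat (Y + Z) = mat Y + mat Z := by
  ext1 i j
  rfl

theorem mat_one [DecidableEq Ω] : mat (1 : Opr 𝔄 Ω Ω) = 1 := by
  ext1 i j
  rw [mat_apply, one_apply_eq_self, Matrix.one_apply]
  split_ifs with h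
  · rw [h, single_self]
  · exact single_ne h

theorem mat_tens {Ξ : Type} [IndexSize Ξ] [TemperedIndex Ξ] (Y : Opr 𝔄 Ω Ω) (Z : Opr 𝔄 Ξ Ξ) :
    mat (tens Y Z) = kron (mat Y) (mat Z) := by
  ext1 i j
  exact tens_single Y Z j.1 j.2 i

/-- The direct sum of operators. -/
noncomputable def osum {Ξ : Type} [IndexSize Ξ] (Y : Opr 𝔄 Ω Ω) (Z : Opr 𝔄 Ξ Ξ) :
    Opr 𝔄 (Ω ⊕ Ξ) (Ω ⊕ Ξ) :=
  relOp .inl ∘L Y ∘L pullOp .inl + relOp .inr ∘L Z ∘L pullOp .inr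

theorem mat_osum {Ξ : Type} [IndexSize Ξ] (Y : Opr 𝔄 Ω Ω) (Z : Opr 𝔄 Ξ Ξ) :
    mat (osum Y Z) = Matrix.fromBlocks (mat Y) 0 0 (mat Z) := by
  have h1 : ∀ (f : RapidFun Ω (Unitization ℝ 𝔄)) (ξ : Ξ), relOp IsTempered.inl f (Sum.inr ξ) = 0 :=
    fun f ξ => relOp_apply_eq_zero _ _ fun _ => by simp
  have h2 : ∀ (f : RapidFun Ξ (Unitization ℝ 𝔄)) (ω : Ω), relOp IsTempered.inr f (Sum.inl ω) = 0 :=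
    fun f ξ => relOp_apply_eq_zero _ _ fun _ => by simp
  have h3 : ∀ ξ : Ξ, pullOp IsTempered.inl (single (Sum.inr ξ) : RapidFun (Ω ⊕ Ξ) (Unitization ℝ 𝔄)) = 0 :=
    fun ξ => pullOp_single_eq_zero _ fun _ => by simp
  have h4 : ∀ ω : Ω, pullOp IsTempered.inr (single (Sum.inl ω) : RapidFun (Ω ⊕ Ξ) (Unitization ℝ 𝔄)) = 0 :=
    fun ξ => pullOp_single_eq_zero _ fun _ => by simp
  have h5 : ∀ ω : Ω, pullOp IsTempered.inl (single (Sum.inl ω) : RapidFun (Ω ⊕ Ξ) (Unitization ℝ 𝔄)) =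
    single ω := fun ω => pullOp_single _ ω
  have h6 : ∀ ω : Ξ, pullOp IsTempered.inr (single (Sum.inr ω) : RapidFun (Ω ⊕ Ξ) (Unitization ℝ 𝔄)) =
    single ω := fun ω => pullOp_single _ ω
  ext1 i j
  rw [mat_apply, osum, _root_.add_apply, RapidFun.add_apply]
  simp only [ContinuousLinearMap.comp_apply]
  rcases i with i | i <;> rcases j with j | j <;>
    simp only [h1, h2, h3, h4, h5, h6, map_zero, RapidFun.zero_apply, Matrix.fromBlocks_apply₁₁,
      Matrix.fromBlocks_apply₁₂, Matrix.fromBlocks_apply₂₁, Matrix.fromBlocks_apply₂₂, add_zero,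
      zero_add, mat_apply, Matrix.zero_apply]
  · exact relOp_apply IsTempered.inl _ i
  · exact relOp_apply IsTempered.inr _ i

/-- The operator of a block matrix. -/
noncomputable def blockOp (M : Matrix (Fin 2) (Fin 2) (Opr 𝔄 ℕ ℕ)) : Opr 𝔄 BlockIdx BlockIdx :=
  placed (fun k => relOp (.pair k)) (fun k => pullOp (.pair k)) M

theorem mat_blockOp_apply (M : Matrix (Fin 2) (Fin 2) (Opr 𝔄 ℕ ℕ)) (k l : Fin 2) (m n : ℕ) :
    mat (blockOp M) (k, m) (l, n) = mat (M k l) m n := by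
  have h1 : ∀ b : Fin 2, pullOp (IsTempered.pair b) (single (l, n) : RapidFun BlockIdx (Unitization ℝ 𝔄)) =
      if b = l then single n else 0 := fun b => by
    split_ifs with h
    · subst h
      exact pullOp_single (IsTempered.pair b) n
    · exact pullOp_single_eq_zero _ fun a ha => h (congrArg Prod.fst ha)
  rw [mat_apply, blockOp, placed_apply, ← eval_apply, map_sum, Finset.sum_eq_single k]
  · rw [eval_apply, Finset.sum_eq_single l]
    · rw [h1, if_pos rfl]
      exact relOp_apply (IsTempered.pair k) _ m
    · intro b _ hb
      rw [h1, if_neg hb, map_zero]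
    · simp
  · intro b _ hb
    exact relOp_apply_eq_zero (IsTempered.pair b) _ fun a ha => hb (congrArg Prod.fst ha)
  · simp

theorem blockOp_mul (M N : Matrix (Fin 2) (Fin 2) (Opr 𝔄 ℕ ℕ)) :
    blockOp M * blockOp N = blockOp (M * N) := by
  -- The inclusions of the two blocks form a frame whose base terms are 0 and 1.
  refine OrthFrame.placed_mul (α := fun a => if a = 1 then 1 else 0) ⟨fun a b => ?_, ?_, ?_⟩ M N
  · split_ifs with h
    · subst h
      exact ContinuousLinearMap.ext fun f => pullOp_relOp _ f
    · exact ContinuousLinearMap.ext fun f => pullOp_relOp_block .id .id h f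
  · rw [Fin.forall_fin_two]
    exact ⟨ContinuousLinearMap.ext fun f => (baseOp_relOp_zero .id f).trans
      (map_zero (relOp (IsTempered.pair (0 : Fin 2)))).symm,
      ContinuousLinearMap.ext fun f => baseOp_relOp_one .id f⟩
  · rw [Fin.forall_fin_two]
    exact ⟨ContinuousLinearMap.ext fun f => pullOp_baseOp_zero .id f,
      ContinuousLinearMap.ext fun f => pullOp_baseOp_one .id f⟩

theorem regMat_mat (a b : Opr 𝔄 ℕ ℕ) :
    regMat (mat b, mat a) = mat (blockOp (!![1 - a, a; a, 1 - a] * !![b, 0; 0, 1 - a] *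
      !![1 - a, a; a, 1 - a])) := by
  have h1 : swMat (mat a) = mat (blockOp !![1 - a, a; a, 1 - a]) := by
    ext1 ⟨k, m⟩ ⟨l, n⟩
    rw [mat_blockOp_apply, swMat, Matrix.of_apply, ← mat_one, ← mat_sub]
    fin_cases k <;> fin_cases l <;> rfl
  have h2 : diagMat (mat b) (1 - mat a) = mat (blockOp !![b, 0; 0, 1 - a]) := by
    ext1 ⟨k, m⟩ ⟨l, n⟩
    rw [mat_blockOp_apply, diagMat, Matrix.of_apply, ← mat_one, ← mat_sub]
    fin_cases k <;> fin_cases l <;> rfl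
  rw [regMat, h1, h2, mmul_mat, mmul_mat, ← blockOp_mul, ← blockOp_mul]
  rfl

theorem baseOp_eq_blockOp : baseOp 𝔄 = blockOp !![0, 0; 0, 1] := by
  refine mat_injective ?_
  rw [mat_baseOp]
  ext1 ⟨k, m⟩ ⟨l, n⟩
  rw [mat_blockOp_apply, baseMat, Matrix.diagonal_apply]
  fin_cases k <;> fin_cases l
  · simp
  · simp
  · simp
  · have := congrFun (congrFun (mat_one (𝔄 := 𝔄) (Ω := ℕ)) m) n
    refine Eq.trans ?_ this.symm
    rw [Matrix.one_apply]
    simp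

/-- Regularization of a relabeled pair in terms of `regEmb`. -/
theorem regRelabel_mat {r : Ω → ℕ} (hr : IsTempered r) {α β : Opr 𝔄 Ω Ω} (hα : α * α = α) :
    regRelabel r (mat β, mat α) = mat (baseOp 𝔄 + regEmb hr α ∘L (β - α) ∘L regEmbT hr α) := by
  have hα' : ∀ f, α (α f) = α f := fun f => congrArg (fun Y : Opr 𝔄 Ω Ω => Y f) hα
  rw [regRelabel, relabel_mat hr, relabel_mat hr, regMat_mat, baseOp_eq_blockOp]
  refine congrArg _ (ContinuousLinearMap.ext fun f => ?_)
  have e : ∀ k (g : RapidFun Ω (Unitization ℝ 𝔄)), relOp (IsTempered.pair k) (relOp hr g) =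
      relOp (isTempered_block k hr) g := fun k g => relOp_relOp _ _ _
  have e' : ∀ (k : Fin 2) (g : RapidFun BlockIdx (Unitization ℝ 𝔄)), pullOp hr (pullOp (IsTempered.pair k) g) =
      pullOp (isTempered_block k hr) g := fun k g => rfl
  -- The product of the three block matrices is multiplied out; `pullOp_relOp` and idempotency of
  -- `α` are the only relations needed.
  simp only [blockOp, _root_.add_apply, placed_apply, Fin.sum_univ_two, Matrix.mul_apply,
    ContinuousLinearMap.comp_apply, regEmb_apply, regEmbT_apply, mul_apply_eq_comp,
    Matrix.of_apply, Matrix.cons_val', Matrix.cons_val_zero, Matrix.cons_val_one,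
    Matrix.cons_val_fin_one, _root_.sub_apply, one_apply_eq_self, _root_.zero_apply, map_add,
    map_sub, map_zero, add_zero, zero_add, pullOp_relOp, hα', e, e']
  abel

end Reg

/-! ### Smooth families of embeddings -/

section Emb

variable {𝔄 : Type w} [NonUnitalCommRing 𝔄] [Module ℝ 𝔄] [IsScalarTower ℝ 𝔄 𝔄]
  [SMulCommClass ℝ 𝔄 𝔄] [TopologicalSpace 𝔄] [IsTopologicalRing 𝔄] [ContinuousSMul ℝ 𝔄]
  [PolynormableSpace ℝ 𝔄] [T2Space 𝔄] [AbsSummableSpace 𝔄]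

variable {Ω Ω' Ω'' Ξ Ξ' : Type} [IndexSize Ω] [IndexSize Ω'] [IndexSize Ω''] [IndexSize Ξ]
  [IndexSize Ξ'] [TemperedIndex Ω] [TemperedIndex Ω'] [TemperedIndex Ω''] [TemperedIndex Ξ]
  [TemperedIndex Ξ'] {ι : Type} [Fintype ι] [DecidableEq ι]
  {X : Type x} {E : Type u} [AddCommGroup E] [Module ℝ E] [TopologicalSpace E]
  [IsTopologicalAddGroup E] [ContinuousSMul ℝ E] {i : X → E}

/-- Smooth families of embeddings `J` with left inverses `J'`, which intertwine `α` with `β`. -/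
structure SmoothEmb (i : X → E) (β : X → Opr 𝔄 Ω' Ω') (α : X → Opr 𝔄 Ω Ω) (J : X → Opr 𝔄 Ω Ω')
    (J' : X → Opr 𝔄 Ω' Ω) : Prop where
  retract : ∀ x f, J' x (J x f) = f
  base : ∀ x f, β x (J x f) = J x (α x f)
  base' : ∀ x f, J' x (β x f) = α x (J' x f)
  smooth : SmoothMult i J
  smooth' : SmoothMult i J'

namespace SmoothEmb

variable {β β₂ : X → Opr 𝔄 Ω' Ω'} {α α₂ : X → Opr 𝔄 Ω Ω} {J : X → Opr 𝔄 Ω Ω'} {J' : X → Opr 𝔄 Ω' Ω}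

theorem one (α : X → Opr 𝔄 Ω Ω) : SmoothEmb i α α (fun _ => 1) fun _ => 1 :=
  ⟨fun _ _ => rfl, fun _ _ => rfl, fun _ _ => rfl, .one, .one⟩

theorem comp (h : SmoothEmb i β α J J') {γ : X → Opr 𝔄 Ω'' Ω''} {K : X → Opr 𝔄 Ω' Ω''}
    {K' : X → Opr 𝔄 Ω'' Ω'} (k : SmoothEmb i γ β K K') :
    SmoothEmb i γ α (fun x => K x ∘L J x) fun x => J' x ∘L K' x :=
  ⟨fun x f => by simp [k.retract, h.retract], fun x f => by simp [k.base, h.base],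
    fun x f => by simp [k.base', h.base'], k.smooth.comp h.smooth, h.smooth'.comp k.smooth'⟩

theorem add (h : SmoothEmb i β α J J') (k : SmoothEmb i β₂ α₂ J J') :
    SmoothEmb i (fun x => β x + β₂ x) (fun x => α x + α₂ x) J J' :=
  ⟨h.retract, fun x f => by simp [k.base, h.base],
    fun x f => by simp [k.base', h.base'], h.smooth, h.smooth'⟩

theorem one_sub (h : SmoothEmb i β α J J') :
    SmoothEmb i (fun x => 1 - β x) (fun x => 1 - α x) J J' :=
  ⟨h.retract, fun x f => by simp [h.base],
    fun x f => by simp [h.base'], h.smooth, h.smooth'⟩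

theorem congr (h : SmoothEmb i β α J J') (e : ∀ x, β x = β₂ x) (e' : ∀ x, α x = α₂ x) :
    SmoothEmb i β₂ α₂ J J' := funext e ▸ funext e' ▸ h

theorem tens (h : SmoothEmb i β α J J') {δ : X → Opr 𝔄 Ξ' Ξ'} {γ : X → Opr 𝔄 Ξ Ξ}
    {K : X → Opr 𝔄 Ξ Ξ'} {K' : X → Opr 𝔄 Ξ' Ξ} (k : SmoothEmb i δ γ K K') :
    SmoothEmb i (fun x => RapidFun.tens (β x) (δ x)) (fun x => RapidFun.tens (α x) (γ x))
      (fun x => RapidFun.tens (J x) (K x)) fun x => RapidFun.tens (J' x) (K' x) := by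
  refine ⟨fun x f => ?_, fun x f => ?_, fun x f => ?_, h.smooth.tens k.smooth,
    h.smooth'.tens k.smooth'⟩
  · rw [tens_tens, show J' x ∘L J x = 1 from ContinuousLinearMap.ext (h.retract x),
      show K' x ∘L K x = 1 from ContinuousLinearMap.ext (k.retract x), tens_one]
    rfl
  · rw [tens_tens, tens_tens, show β x ∘L J x = J x ∘L α x from ContinuousLinearMap.ext (h.base x),
      show δ x ∘L K x = K x ∘L γ x from ContinuousLinearMap.ext (k.base x)]
  · rw [tens_tens, tens_tens,
      show J' x ∘L β x = α x ∘L J' x from ContinuousLinearMap.ext (h.base' x),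
      show K' x ∘L δ x = γ x ∘L K' x from ContinuousLinearMap.ext (k.base' x)]

theorem relOp {r : Ω → Ω'} (hr : IsTempered r) (hβ : ∀ x f, β x (RapidFun.relOp hr f) =
    RapidFun.relOp hr (α x f)) (hβ' : ∀ x f, RapidFun.pullOp hr (β x f) =
    α x (RapidFun.pullOp hr f)) :
    SmoothEmb i β α (fun _ => RapidFun.relOp hr) fun _ => RapidFun.pullOp hr :=
  ⟨fun _ _ => pullOp_relOp _ _, hβ, hβ', .relOp hr, .pullOp hr⟩

end SmoothEmb

variable {α : ι → X → Opr 𝔄 Ω Ω} {J : ι → X → Opr 𝔄 Ω BlockIdx}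
    {J' : ι → X → Opr 𝔄 BlockIdx Ω}

theorem SmoothFrame.of_emb (h : ∀ a, SmoothEmb i (fun _ => baseOp 𝔄) (α a) (J a) (J' a))
    (horth : ∀ a b, a ≠ b → ∀ x f, J' a x (J b x f) = 0) : SmoothFrame i α J J' :=
  ⟨fun x => ⟨fun a b => ContinuousLinearMap.ext fun f => by
      by_cases hab : a = b
      · subst hab
        rw [if_pos rfl]
        exact (h a).retract x f
      · rw [if_neg hab]
        exact horth a b hab x f,
    fun a => ContinuousLinearMap.ext ((h a).base x),
    fun a => ContinuousLinearMap.ext ((h a).base' x)⟩, fun a => (h a).smooth, fun a => (h a).smooth'⟩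

theorem SmoothFrame.emb (h : SmoothFrame i α J J') (a : ι) :
    SmoothEmb i (fun _ => baseOp 𝔄) (α a) (J a) (J' a) :=
  ⟨fun x f => ((h.orthFrame x).orth_apply a a f).trans (if_pos rfl),
    fun x f => (h.orthFrame x).base_apply a f, fun x f => (h.orthFrame x).base_apply' a f,
    h.smooth a, h.smooth' a⟩

theorem SmoothFrame.orth_apply (h : SmoothFrame i α J J') {a b : ι} (hab : a ≠ b) (x : X)
    (f : RapidFun Ω (Unitization ℝ 𝔄)) : J' a x (J b x f) = 0 :=
  ((h.orthFrame x).orth_apply a b f).trans (if_neg hab)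

/-- The embeddings of a frame intertwine the summands with the sum. -/
theorem SmoothFrame.emb_top (h : SmoothFrame i α J J') {D : ι → X → Opr 𝔄 Ω Ω}
    {y : X → Opr 𝔄 BlockIdx BlockIdx}
    (hy : ∀ x, y x = baseOp 𝔄 + ∑ a, J a x ∘L D a x ∘L J' a x) (a : ι) :
    SmoothEmb i y (fun x => α a x + D a x) (J a) (J' a) := by
  refine ⟨(h.emb a).retract, fun x f => ?_, fun x f => ?_, h.smooth a, h.smooth' a⟩
  · have e : (∑ b, J b x ∘L D b x ∘L J' b x) (J a x f) = J a x (D a x f) := by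
      rw [_root_.sum_apply, Finset.sum_eq_single a]
      · simp [(h.emb a).retract]
      · intro b _ hb
        simp [h.orth_apply hb]
      · simp
    rw [hy, _root_.add_apply, e, (h.emb a).base, _root_.add_apply, map_add]
  · have e : J' a x ((∑ b, J b x ∘L D b x ∘L J' b x) f) = D a x (J' a x f) := by
      rw [_root_.sum_apply, map_sum, Finset.sum_eq_single a]
      · simp [(h.emb a).retract]
      · intro b _ hb
        simp [h.orth_apply hb.symm]
      · simp
    rw [hy, _root_.add_apply, map_add, e, (h.emb a).base', _root_.add_apply]

theorem lift_diagonal (α : ι → Opr 𝔄 Ω Ω) (J : ι → Opr 𝔄 Ω BlockIdx) (J' : ι → Opr 𝔄 BlockIdx Ω)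
    (D : ι → Opr 𝔄 Ω Ω) : lift α J J' (Matrix.diagonal fun a => α a + D a) =
      baseOp 𝔄 + ∑ a, J a ∘L D a ∘L J' a := by
  rw [lift, placed, Matrix.diagonal_sub]
  congr 1
  refine Finset.sum_congr rfl fun a _ => ?_
  rw [Finset.sum_eq_single a]
  · rw [Matrix.diagonal_apply_eq, add_sub_cancel_left]
  · intro b _ hb
    rw [Matrix.diagonal_apply_ne' _ hb]
    exact ContinuousLinearMap.ext fun f => map_zero (J a)
  · simp

theorem SmoothKernel.diagonal {D : ι → X → Opr 𝔄 Ω Ω} (hD : ∀ a, SmoothKernel i (D a)) (a b : ι) :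
    SmoothKernel i fun x => (Matrix.diagonal (fun a => α a x + D a x) -
      Matrix.diagonal fun a => α a x) a b := by
  by_cases hab : a = b
  · subst hab
    exact (hD a).congr fun x => by simp
  · exact SmoothKernel.zero.congr fun x => by simp [hab]

/-- Sums over frames with the same bases and the same summands are homotopic. -/
theorem SmoothFrame.homot_of_dop [PolynormableSpace ℝ E] (h : SmoothFrame i α J J')
    {K : ι → X → Opr 𝔄 Ω BlockIdx} {K' : ι → X → Opr 𝔄 BlockIdx Ω} (k : SmoothFrame i α K K')
    {D : ι → X → Opr 𝔄 Ω Ω} (hD : ∀ a, SmoothKernel i (D a)) {f g : X → Gr 𝔄}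
    (hf : ∀ x, (f x).dop = ∑ a, J a x ∘L D a x ∘L J' a x)
    (hg : ∀ x, (g x).dop = ∑ a, K a x ∘L D a x ∘L K' a x) : Homot i f g :=
  h.homot_of_frames k (P := fun x => Matrix.diagonal fun a => α a x + D a x)
    (SmoothKernel.diagonal hD)
    (fun x => by rw [lift_diagonal, Gr.top, hf]) fun x => by rw [lift_diagonal, Gr.top, hg]

/-- A point is determined by its operator, so the smooth family constructed from the kernel has to
be `f`. -/
theorem SmoothVia.of_dop {f : X → Gr 𝔄} (h : SmoothKernel i fun x => (f x).dop) :
    SmoothVia i (fun b : Gr 𝔄 => b.1) f := by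
  obtain ⟨g, hg, hg'⟩ := Gr.exists_of_smoothKernel h fun x => (f x).top_mul_top
  rwa [show f = g from funext fun x => Gr.dop_injective (hg' x).symm]

/-- Construction of elements of the Grassmannian from pairs of idempotents. -/
theorem Gr.exists_of_reg {r : Ω → ℕ} (hr : IsTempered r) {α β : Opr 𝔄 Ω Ω} (hα : α * α = α)
    (hβ : β * β = β) (hs : SmoothMult (fun _ : Unit => (0 : ℝ)) fun _ => α)
    (hd : SmoothKernel (fun _ : Unit => (0 : ℝ)) fun _ => β - α) : ∃ c : Gr 𝔄,
      c.mat = regRelabel r (RapidFun.mat β, RapidFun.mat α) ∧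
      c.dop = regEmb hr α ∘L (β - α) ∘L regEmbT hr α := by
  -- A single pair is treated as a family over a one-point parameter space.
  obtain ⟨c, -, hc⟩ := (SmoothFrame.reg_single hr hs fun _ => hα).exists_gr
    (P := fun _ => Matrix.of fun _ _ => β) (fun _ _ => hd) fun _ => by
      ext1 a b
      simpa [Matrix.mul_apply] using hβ
  have hc' : (c ()).dop = regEmb hr α ∘L (β - α) ∘L regEmbT hr α :=
    add_left_cancel ((hc ()).trans (lift_unit _ _ _ _))
  exact ⟨c (), by rw [Gr.mat_eq, regRelabel_mat hr hα, hc'], hc'⟩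

end Emb

/-! ### Addition -/

section Add

variable {𝔄 : Type w} [NonUnitalCommRing 𝔄] [Module ℝ 𝔄] [IsScalarTower ℝ 𝔄 𝔄]
  [SMulCommClass ℝ 𝔄 𝔄] [TopologicalSpace 𝔄] [IsTopologicalRing 𝔄] [ContinuousSMul ℝ 𝔄]
  [PolynormableSpace ℝ 𝔄] [T2Space 𝔄] [AbsSummableSpace 𝔄]

theorem Gr.mat_eq_top (b : Gr 𝔄) : b.mat = RapidFun.mat b.top := b.mat_eq

theorem osum_mul {Ω Ξ : Type} [IndexSize Ω] [IndexSize Ξ] (Y Y' : Opr 𝔄 Ω Ω)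
    (Z Z' : Opr 𝔄 Ξ Ξ) : osum Y Z * osum Y' Z' = osum (Y * Y') (Z * Z') := by
  have h1 : ∀ f : RapidFun Ξ (Unitization ℝ 𝔄), pullOp IsTempered.inl (relOp IsTempered.inr f :
    RapidFun (Ω ⊕ Ξ) (Unitization ℝ 𝔄)) = 0 := pullOp_relOp_eq_zero _ _ (by simp)
  have h2 : ∀ f : RapidFun Ω (Unitization ℝ 𝔄), pullOp IsTempered.inr (relOp IsTempered.inl f :
    RapidFun (Ω ⊕ Ξ) (Unitization ℝ 𝔄)) = 0 := pullOp_relOp_eq_zero _ _ (by simp)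
  refine ContinuousLinearMap.ext fun f => ?_
  simp [osum, h1, h2, mul_apply_eq_comp]

theorem osum_sub {Ω Ξ : Type} [IndexSize Ω] [IndexSize Ξ] (Y Y' : Opr 𝔄 Ω Ω)
    (Z Z' : Opr 𝔄 Ξ Ξ) : osum Y Z - osum Y' Z' = osum (Y - Y') (Z - Z') := by
  refine ContinuousLinearMap.ext fun f => ?_
  simp [osum]
  abel

/-- The embeddings which are used in order to add elements of the Grassmannian. -/
noncomputable def addEmb {θ : BlockIdx ⊕ BlockIdx → ℕ} (hθ : IsTempered θ) :
    Fin 2 → Opr 𝔄 BlockIdx BlockIdx :=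
  ![regEmb (hθ.comp .inl) (baseOp 𝔄), regEmb (hθ.comp .inr) (baseOp 𝔄)]

/-- The left inverses of the embeddings `addEmb`. -/
noncomputable def addEmbT {θ : BlockIdx ⊕ BlockIdx → ℕ} (hθ : IsTempered θ) :
    Fin 2 → Opr 𝔄 BlockIdx BlockIdx :=
  ![regEmbT (hθ.comp .inl) (baseOp 𝔄), regEmbT (hθ.comp .inr) (baseOp 𝔄)]

/-- The base term of the sum is R₀ ⊕ R₀ whatever the arguments are, and its regularizing embedding
along θ splits into those along the restrictions of θ to the two summands. So addition moves the two
differences by a constant frame. -/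
theorem Gr.exists_add {θ : BlockIdx ⊕ BlockIdx → ℕ} (hθ : IsTempered θ) (a b : Gr 𝔄) :
    ∃ c : Gr 𝔄, c.mat = regRelabel θ (pairSum a.pair b.pair) ∧
      c.dop = addEmb hθ 0 ∘L a.dop ∘L addEmbT hθ 0 + addEmb hθ 1 ∘L b.dop ∘L addEmbT hθ 1 := by
  have e : ∀ a : Gr 𝔄, a.top - baseOp 𝔄 = a.dop := fun a => add_sub_cancel_left _ _
  have hk : ∀ a : Gr 𝔄, SmoothKernel (fun _ : Unit => (0 : ℝ)) fun _ => a.dop := fun a =>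
    (SmoothVia.const a).dop
  obtain ⟨c, hc, hc'⟩ := Gr.exists_of_reg hθ (α := osum (baseOp 𝔄) (baseOp 𝔄))
    (β := osum a.top b.top) (by rw [osum_mul, baseOp_mul_baseOp])
    (by rw [osum_mul, top_mul_top, top_mul_top])
    (((SmoothMult.relOp _).comp (SmoothMult.baseOp.comp (.pullOp _))).add
      ((SmoothMult.relOp _).comp (SmoothMult.baseOp.comp (.pullOp _))))
    (((SmoothKernel.sandwich (.relOp .inl) (hk a) (.pullOp .inl)).add
      (.sandwich (.relOp .inr) (hk b) (.pullOp .inr))).congr fun _ => by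
        rw [osum_sub, e, e]; rfl)
  refine ⟨c, ?_, ?_⟩
  · rw [hc, mat_osum, mat_osum, mat_baseOp, ← mat_eq_top, ← mat_eq_top]
    rfl
  · have h1 : ∀ f : RapidFun BlockIdx (Unitization ℝ 𝔄), pullOp IsTempered.inl (relOp IsTempered.inr f :
      RapidFun (BlockIdx ⊕ BlockIdx) (Unitization ℝ 𝔄)) = 0 := pullOp_relOp_eq_zero _ _ (by simp)
    have h2 : ∀ f : RapidFun BlockIdx (Unitization ℝ 𝔄), pullOp IsTempered.inr (relOp IsTempered.inl f :
      RapidFun (BlockIdx ⊕ BlockIdx) (Unitization ℝ 𝔄)) = 0 := pullOp_relOp_eq_zero _ _ (by simp)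
    have h3 : ∀ (k : Fin 2) (f : RapidFun BlockIdx (Unitization ℝ 𝔄)),
        relOp (isTempered_block k hθ) (relOp IsTempered.inl f) =
        relOp (isTempered_block k (hθ.comp .inl)) f := fun k f => relOp_relOp _ _ _
    have h4 : ∀ (k : Fin 2) (f : RapidFun BlockIdx (Unitization ℝ 𝔄)),
        relOp (isTempered_block k hθ) (relOp IsTempered.inr f) =
        relOp (isTempered_block k (hθ.comp .inr)) f := fun k f => relOp_relOp _ _ _
    have h5 : ∀ (k : Fin 2) (f : RapidFun BlockIdx (Unitization ℝ 𝔄)),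
        pullOp IsTempered.inl (pullOp (isTempered_block k hθ) f) =
        pullOp (isTempered_block k (hθ.comp .inl)) f := fun k f => rfl
    have h6 : ∀ (k : Fin 2) (f : RapidFun BlockIdx (Unitization ℝ 𝔄)),
        pullOp IsTempered.inr (pullOp (isTempered_block k hθ) f) =
        pullOp (isTempered_block k (hθ.comp .inr)) f := fun k f => rfl
    rw [hc', osum_sub, e, e]
    refine ContinuousLinearMap.ext fun f => ?_
    simp only [osum, addEmb, addEmbT, _root_.add_apply, ContinuousLinearMap.comp_apply, regEmb_apply,
      regEmbT_apply, map_add, map_sub, h1, h2, pullOp_relOp, map_zero, add_zero, zero_add,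
      Matrix.cons_val_zero, Matrix.cons_val_one, Matrix.cons_val_fin_one, h3, h4, h5, h6]
    abel

variable {X : Type x} {E : Type u} [AddCommGroup E] [Module ℝ E] [TopologicalSpace E]
  [IsTopologicalAddGroup E] [ContinuousSMul ℝ E] {i : X → E}

theorem SmoothFrame.addEmb {θ : BlockIdx ⊕ BlockIdx → ℕ} (hθ : IsTempered θ) :
    SmoothFrame i (fun _ _ => baseOp 𝔄) (fun a _ => addEmb hθ a) fun a _ => addEmbT hθ a := by
  have hr : ∀ a : Fin 2, IsTempered (![θ ∘ Sum.inl, θ ∘ Sum.inr] a) := by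
    rw [Fin.forall_fin_two]
    exact ⟨hθ.comp .inl, hθ.comp .inr⟩
  have := SmoothFrame.reg (i := i) hr (by
    rw [Fin.forall_fin_two, Fin.forall_fin_two, Fin.forall_fin_two]
    refine ⟨⟨fun h => absurd rfl h, fun _ z w h => ?_⟩, fun _ z w h => ?_, fun h => absurd rfl h⟩
    · simpa using hθ.injective h
    · simpa using hθ.injective h) (α := fun _ _ => baseOp 𝔄) (fun _ => .baseOp)
    fun _ _ => baseOp_mul_baseOp
  have e : ∀ a, (_root_.addEmb hθ a : Opr 𝔄 BlockIdx BlockIdx) = regEmb (hr a) (baseOp 𝔄) := by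
    rw [Fin.forall_fin_two]
    exact ⟨rfl, rfl⟩
  have e' : ∀ a, (addEmbT hθ a : Opr 𝔄 BlockIdx BlockIdx) = regEmbT (hr a) (baseOp 𝔄) := by
    rw [Fin.forall_fin_two]
    exact ⟨rfl, rfl⟩
  simpa only [e, e'] using this

end Add

/-- The matrix which relates the idempotents `diag (e, 1 - e)` and `diag (a, 1 - a)`. -/
def mixMatrix {A : Type*} [Ring A] (e a : A) : Matrix (Fin 2) (Fin 2) A :=
  !![e * a, e * (1 - a); (1 - e) * a, (1 - e) * (1 - a)]

/-- The matrix is the column (e, 1 - e) times the row (a, 1 - a). In the product the inner factor a²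
+ (1 - a)² = 1 disappears, and the column of e times the row of e is diagonal. -/
theorem mixMatrix_mul {A : Type*} [Ring A] {e a : A} (he : e * e = e) (ha : a * a = a) :
    mixMatrix e a * mixMatrix a e = !![e, 0; 0, 1 - e] := by
  have h1 : a * a + (1 - a) * (1 - a) = 1 := by
    simp only [mul_sub, sub_mul, ha, mul_one, one_mul]
    abel
  have key : ∀ x y : A, x * a * (a * y) + x * (1 - a) * ((1 - a) * y) = x * y := fun x y => by
    calc _ = x * (a * a + (1 - a) * (1 - a)) * y := by simp only [mul_add, add_mul, mul_assoc]
      _ = x * y := by rw [h1, mul_one]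
  rw [mixMatrix, mixMatrix, Matrix.mul_fin_two, key, key, key, key]
  simp [mul_sub, sub_mul, he]

/-! ### The laws of addition -/

section AddLaws

variable {𝔄 : Type w} [NonUnitalCommRing 𝔄] [Module ℝ 𝔄] [IsScalarTower ℝ 𝔄 𝔄]
  [SMulCommClass ℝ 𝔄 𝔄] [TopologicalSpace 𝔄] [IsTopologicalRing 𝔄] [ContinuousSMul ℝ 𝔄]
  [PolynormableSpace ℝ 𝔄] [T2Space 𝔄] [AbsSummableSpace 𝔄]
  {X : Type x} {E : Type u} [AddCommGroup E] [Module ℝ E] [TopologicalSpace E]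
  [IsTopologicalAddGroup E] [ContinuousSMul ℝ E] {i : X → E}

section Frames

variable {Ω : Type} [IndexSize Ω] [TemperedIndex Ω]

theorem SmoothFrame.of_emb_two {α : Fin 2 → X → Opr 𝔄 Ω Ω} {J : Fin 2 → X → Opr 𝔄 Ω BlockIdx}
    {J' : Fin 2 → X → Opr 𝔄 BlockIdx Ω}
    (h0 : SmoothEmb i (fun _ => baseOp 𝔄) (α 0) (J 0) (J' 0))
    (h1 : SmoothEmb i (fun _ => baseOp 𝔄) (α 1) (J 1) (J' 1))
    (h01 : ∀ x f, J' 0 x (J 1 x f) = 0) (h10 : ∀ x f, J' 1 x (J 0 x f) = 0) :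
    SmoothFrame i α J J' := by
  refine SmoothFrame.of_emb (Fin.forall_fin_two.2 ⟨h0, h1⟩) ?_
  rw [Fin.forall_fin_two, Fin.forall_fin_two, Fin.forall_fin_two]
  exact ⟨⟨fun h => absurd rfl h, fun _ => h01⟩, fun _ => h10, fun h => absurd rfl h⟩

theorem SmoothFrame.of_emb_single {α : X → Opr 𝔄 Ω Ω} {J : X → Opr 𝔄 Ω BlockIdx}
    {J' : X → Opr 𝔄 BlockIdx Ω} (h : SmoothEmb i (fun _ => baseOp 𝔄) α J J') :
    SmoothFrame i (fun (_ : Unit) => α) (fun _ => J) (fun _ => J') :=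
  SmoothFrame.of_emb (fun _ => h) fun _ _ h => absurd rfl h

theorem SmoothEmb.homot_of_dop [PolynormableSpace ℝ E] {α : X → Opr 𝔄 Ω Ω}
    {J K : X → Opr 𝔄 Ω BlockIdx} {J' K' : X → Opr 𝔄 BlockIdx Ω}
    (h : SmoothEmb i (fun _ => baseOp 𝔄) α J J') (k : SmoothEmb i (fun _ => baseOp 𝔄) α K K')
    {D : X → Opr 𝔄 Ω Ω} (hD : SmoothKernel i D) {f g : X → Gr 𝔄}
    (hf : ∀ x, (f x).dop = J x ∘L D x ∘L J' x)
    (hg : ∀ x, (g x).dop = K x ∘L D x ∘L K' x) : Homot i f g :=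
  (SmoothFrame.of_emb_single h).homot_of_dop (SmoothFrame.of_emb_single k) (D := fun _ => D)
    (fun _ => hD) (fun x => by rw [hf]; simp) fun x => by rw [hg]; simp

end Frames

theorem Gr.exists_zero : ∃ z : Gr 𝔄, z.mat = baseMat (Unitization ℝ 𝔄) ℕ ∧ z.dop = 0 := by
  obtain ⟨f, -, hf⟩ := Gr.exists_of_smoothKernel (𝔄 := 𝔄) (i := fun _ : Unit => (0 : ℝ)) .zero
    fun _ => by rw [add_zero, baseOp_mul_baseOp]
  exact ⟨f (), by rw [mat_eq, hf, add_zero, mat_baseOp], hf ()⟩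

variable {K K' : Fin 2 → Opr 𝔄 BlockIdx BlockIdx} {add : Gr 𝔄 → Gr 𝔄 → Gr 𝔄}
  (hadd : ∀ a b, (add a b).dop = K 0 ∘L a.dop ∘L K' 0 + K 1 ∘L b.dop ∘L K' 1)
  (hK : SmoothFrame i (fun _ _ => baseOp 𝔄) (fun a _ => K a) fun a _ => K' a)

include hadd hK

theorem SmoothVia.add_gr {f g : X → Gr 𝔄} (hf : SmoothVia i (fun b : Gr 𝔄 => b.1) f)
    (hg : SmoothVia i (fun b : Gr 𝔄 => b.1) g) :
    SmoothVia i (fun b : Gr 𝔄 => b.1) fun x => add (f x) (g x) :=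
  .of_dop (((SmoothKernel.sandwich (hK.smooth 0) hf.dop (hK.smooth' 0)).add
    (.sandwich (hK.smooth 1) hg.dop (hK.smooth' 1))).congr fun _ => (hadd _ _).symm)

variable [PolynormableSpace ℝ E] {f g h : X → Gr 𝔄} (hf : SmoothVia i (fun b : Gr 𝔄 => b.1) f)
  (hg : SmoothVia i (fun b : Gr 𝔄 => b.1) g) (hh : SmoothVia i (fun b : Gr 𝔄 => b.1) h)
  {z : Gr 𝔄} (hz : z.dop = 0)

include hf

include hg in
-- The two sides use the same summands with the two embeddings of the frame interchanged.
theorem Homot.add_comm : Homot i (fun x => add (f x) (g x)) fun x => add (g x) (f x) := by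
  refine hK.homot_of_dop (K := fun a _ => K a.rev) (K' := fun a _ => K' a.rev)
    (.of_emb (fun a => hK.emb a.rev) fun a b hab => hK.orth_apply (Fin.rev_injective.ne hab))
    (D := fun a x => ![(f x).dop, (g x).dop] a)
    (Fin.forall_fin_two.2 ⟨hf.dop, hg.dop⟩) (fun x => ?_) fun x => ?_
  · rw [hadd, Fin.sum_univ_two]
    rfl
  · rw [hadd, Fin.sum_univ_two, _root_.add_comm]
    rfl

include hz in
-- The zero element contributes nothing, so the embedding `K 0` is compared with the identity.
theorem Homot.add_zero : Homot i (fun x => add (f x) z) f :=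
  (hK.emb 0).homot_of_dop (SmoothEmb.one _) hf.dop
    (fun x => by rw [hadd, hz]; ext1; simp) fun x => rfl

include hz in
theorem Homot.zero_add : Homot i (fun x => add z (f x)) f :=
  (hK.emb 1).homot_of_dop (SmoothEmb.one _) hf.dop
    (fun x => by rw [hadd, hz]; ext1; simp) fun x => rfl

include hg hh in
-- Each bracketing places the same three differences by a frame of three composed embeddings.
theorem Homot.add_assoc :
    Homot i (fun x => add (add (f x) (g x)) (h x)) fun x => add (f x) (add (g x) (h x)) := by
  have h0 := hK.emb 0
  have h1 := hK.emb 1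
  have r0 : ∀ x f, K' 0 (K 0 f) = f := h0.retract
  have r1 : ∀ x f, K' 1 (K 1 f) = f := h1.retract
  have o0 : ∀ x f, K' 0 (K 1 f) = 0 := hK.orth_apply zero_ne_one
  have o1 : ∀ x f, K' 1 (K 0 f) = 0 := hK.orth_apply one_ne_zero
  refine SmoothFrame.homot_of_dop (i := i) (α := fun (_ : Fin 3) _ => baseOp 𝔄)
    (J := fun a _ => ![K 0 ∘L K 0, K 0 ∘L K 1, K 1] a)
    (J' := fun a _ => ![K' 0 ∘L K' 0, K' 1 ∘L K' 0, K' 1] a)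
    (K := fun a _ => ![K 0, K 1 ∘L K 0, K 1 ∘L K 1] a)
    (K' := fun a _ => ![K' 0, K' 0 ∘L K' 1, K' 1 ∘L K' 1] a)
    (D := fun a x => ![(f x).dop, (g x).dop, (h x).dop] a) (.of_emb ?_ ?_) (.of_emb ?_ ?_) ?_
    (fun x => ?_) fun x => ?_
  · intro a
    fin_cases a
    exacts [h0.comp h0, h1.comp h0, h1]
  · intro a b hab x f
    fin_cases a <;> fin_cases b <;> first | exact absurd rfl hab | simp [r0 x, o0 x, o1 x]
  · intro a
    fin_cases a
    exacts [h0, h0.comp h1, h1.comp h1]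
  · intro a b hab x f
    fin_cases a <;> fin_cases b <;> first | exact absurd rfl hab | simp [r1 x, o0 x, o1 x]
  · intro a
    fin_cases a
    exacts [hf.dop, hg.dop, hh.dop]
  · rw [hadd, hadd, Fin.sum_univ_three]
    ext1
    simp
  · rw [hadd, hadd, Fin.sum_univ_three]
    ext1
    simp
    abel

omit hf

variable {N N' : Opr 𝔄 BlockIdx BlockIdx} {neg : Gr 𝔄 → Gr 𝔄}
  (hneg : ∀ a, (neg a).dop = -(N ∘L a.dop ∘L N'))
  (hN : SmoothEmb i (fun _ => baseOp 𝔄) (fun _ => 1 - baseOp 𝔄) (fun _ => N) fun _ => N')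

include hf hz hneg hN in
-- With respect to base terms R₀ and 1 - R₀, the sum is the lift of diag (f, 1 - f) and the zero
-- element is the lift of diag (R₀, 1 - R₀). The matrices P = `mixMatrix` of R₀ and f, and Q with
-- the roles exchanged, satisfy QP = diag (f, 1 - f) and PQ = diag (R₀, 1 - R₀).
theorem Homot.add_neg : Homot i (fun x => add (f x) (neg (f x))) fun _ => z := by
  have h0 := hK.emb 0
  have h1 := hK.emb 1
  have hA := hf.dop
  have hB : SmoothKernel i fun x => baseOp 𝔄 * (f x).dop := SmoothMult.baseOp.left (.self i) hA
  have hB' : SmoothKernel i fun x => (f x).dop * baseOp 𝔄 := SmoothMult.baseOp.right (.self i) hA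
  have e : baseOp 𝔄 * baseOp 𝔄 = baseOp 𝔄 := baseOp_mul_baseOp
  have hA' : SmoothKernel i fun x => (f x).dop - baseOp 𝔄 * (f x).dop := hA.sub hB
  have hA'' : SmoothKernel i fun x => (f x).dop - (f x).dop * baseOp 𝔄 := hA.sub hB'
  have hd : ∀ y : Opr 𝔄 BlockIdx BlockIdx, !![y, 0; 0, 1 - y] =
      Matrix.diagonal fun a => ![baseOp 𝔄, 1 - baseOp 𝔄] a + ![y - baseOp 𝔄, baseOp 𝔄 - y] a :=
    fun y => by
      ext1 a b
      fin_cases a <;> fin_cases b <;> simp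
  refine SmoothFrame.homot_of_mvn (i := i) (α := fun a _ => ![baseOp 𝔄, 1 - baseOp 𝔄] a)
    (J := fun a _ => ![K 0, K 1 ∘L N] a) (J' := fun a _ => ![K' 0, N' ∘L K' 1] a)
    (P := fun x => mixMatrix (baseOp 𝔄) (f x).top) (Q := fun x => mixMatrix (f x).top (baseOp 𝔄))
    (.of_emb_two h0 (hN.comp h1) (fun x f => hK.orth_apply zero_ne_one x _)
      fun x f => (congrArg N' (hK.orth_apply one_ne_zero x _)).trans (map_zero N'))
    ?_ ?_ (fun x => ?_) (fun x => ?_) (fun x => ?_) fun x => ?_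
  -- For f = R₀ the mixing matrix is exactly the base diagonal, so each entry of the difference
  -- contains a factor f - R₀.
  · rw [Fin.forall_fin_two, Fin.forall_fin_two, Fin.forall_fin_two]
    refine ⟨⟨hB.congr fun x => ?_, hB.neg.congr fun x => ?_⟩, hA'.congr fun x => ?_,
      hA'.neg.congr fun x => ?_⟩ <;>
    · simp [mixMatrix, Gr.top, mul_add, mul_sub, sub_mul, e]
      try abel
  · rw [Fin.forall_fin_two, Fin.forall_fin_two, Fin.forall_fin_two]
    refine ⟨⟨hB'.congr fun x => ?_, hA''.congr fun x => ?_⟩, hB'.neg.congr fun x => ?_,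
      hA''.neg.congr fun x => ?_⟩ <;>
    · simp [mixMatrix, Gr.top, add_mul, mul_sub, sub_mul, e]
      try abel
  · rw [mixMatrix_mul e (f x).top_mul_top, mixMatrix, Matrix.mul_fin_two]
    simp [mul_sub, sub_mul, ← mul_assoc, e]
  · rw [mixMatrix_mul (f x).top_mul_top e, mixMatrix, Matrix.mul_fin_two]
    simp [mul_sub, sub_mul, ← mul_assoc, (f x).top_mul_top]
  · rw [mixMatrix_mul (f x).top_mul_top e, hd]
    refine Eq.trans ?_ (lift_diagonal _ _ _ _).symm
    rw [Gr.top, hadd, hneg, Fin.sum_univ_two]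
    ext1
    simp [Gr.top]
  · rw [mixMatrix_mul e (f x).top_mul_top, hd]
    refine Eq.trans ?_ (lift_diagonal _ _ _ _).symm
    rw [Gr.top, hz, Fin.sum_univ_two]
    ext1
    simp

end AddLaws

/-! ### Operators of the inverse, the product and the unit -/

section Mul

variable {𝔄 : Type w} [NonUnitalCommRing 𝔄] [Module ℝ 𝔄] [IsScalarTower ℝ 𝔄 𝔄]
  [SMulCommClass ℝ 𝔄 𝔄] [TopologicalSpace 𝔄] [IsTopologicalRing 𝔄] [ContinuousSMul ℝ 𝔄]
  [PolynormableSpace ℝ 𝔄] [T2Space 𝔄] [AbsSummableSpace 𝔄]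

theorem one_sub_mul_self {A : Type*} [Ring A] {a : A} (h : a * a = a) :
    (1 - a) * (1 - a) = 1 - a := by
  simp [mul_sub, sub_mul, h]

theorem Gr.exists_neg {θ : BlockIdx → ℕ} (hθ : IsTempered θ) (a : Gr 𝔄) :
    ∃ c : Gr 𝔄, c.mat = regRelabel θ (pairInv a.pair) ∧
      c.dop = -(regEmb (𝔄 := 𝔄) hθ (1 - baseOp 𝔄) ∘L a.dop ∘L
        regEmbT (𝔄 := 𝔄) hθ (1 - baseOp 𝔄)) := by
  have e : (1 - a.top) - ((1 : Opr 𝔄 BlockIdx BlockIdx) - baseOp 𝔄) = -a.dop := by rw [Gr.top]; abel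
  obtain ⟨c, hc, hc'⟩ := Gr.exists_of_reg hθ (α := 1 - baseOp 𝔄) (β := (1 - a.top : Opr 𝔄 BlockIdx BlockIdx))
    (one_sub_mul_self (baseOp_mul_baseOp (𝔄 := 𝔄))) (one_sub_mul_self a.top_mul_top)
    (SmoothMult.one.sub (SmoothMult.baseOp (𝔄 := 𝔄))) ((SmoothVia.const a).dop.neg.congr fun _ => e.symm)
  refine ⟨c, ?_, ?_⟩
  · rw [hc, mat_sub, mat_sub, mat_one, mat_baseOp, ← mat_eq_top]
    rfl
  · rw [hc', e]
    ext1
    simp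

/-! ### Multiplication -/

/-- The base term of the product. -/
noncomputable def prodBase (x y : Opr 𝔄 BlockIdx BlockIdx) :
    Opr 𝔄 (BlockIdx × BlockIdx) (BlockIdx × BlockIdx) := tens x y + tens (1 - x) (baseOp 𝔄)

theorem tens_mul {Ω Ξ : Type} [IndexSize Ω] [IndexSize Ξ] [TemperedIndex Ω] [TemperedIndex Ξ]
    (Y Y' : Opr 𝔄 Ω Ω) (Z Z' : Opr 𝔄 Ξ Ξ) : tens Y Z * tens Y' Z' = tens (Y * Y') (Z * Z') :=
  tens_comp Y Y' Z Z'

/-- The two summands are idempotents which annihilate each other, because x (1 - x) = 0 in the first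
factor. -/
theorem prodBase_mul_self {x y : Opr 𝔄 BlockIdx BlockIdx} (hx : x * x = x) (hy : y * y = y) :
    prodBase x y * prodBase x y = prodBase x y := by
  have h1 : x * (1 - x) = 0 := by rw [mul_sub, mul_one, hx, sub_self]
  have h2 : (1 - x) * x = 0 := by rw [sub_mul, one_mul, hx, sub_self]
  simp only [prodBase, add_mul, mul_add, tens_mul, hx, hy, baseOp_mul_baseOp, h1, h2,
    one_sub_mul_self hx, tens_zero_left]
  simp

/-- The key formula of multiplication: the difference between leading and base term of a product is
the tensor product of the differences. It is rapidly decreasing although the single terms are not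
perturbations of R₀ ⊗ R₀. -/
theorem prodBase_sub (x y z : Opr 𝔄 BlockIdx BlockIdx) :
    prodBase x y - prodBase z y = tens (x - z) (y - baseOp 𝔄) := by
  simp only [prodBase, tens_sub_left, tens_sub_right]
  abel

/-- The embeddings which are used in order to multiply elements of the Grassmannian. -/
noncomputable def mulEmb {θ : BlockIdx × BlockIdx → ℕ} (hθ : IsTempered θ) (y : Gr 𝔄) :
    Opr 𝔄 (BlockIdx × BlockIdx) BlockIdx := regEmb hθ (prodBase (baseOp 𝔄) y.top)

/-- The left inverse of `mulEmb`. -/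
noncomputable def mulEmbT {θ : BlockIdx × BlockIdx → ℕ} (hθ : IsTempered θ) (y : Gr 𝔄) :
    Opr 𝔄 BlockIdx (BlockIdx × BlockIdx) := regEmbT hθ (prodBase (baseOp 𝔄) y.top)

section

variable {X : Type x} {E : Type u} [AddCommGroup E] [Module ℝ E] [TopologicalSpace E]
  [IsTopologicalAddGroup E] [ContinuousSMul ℝ E] {i : X → E}

theorem SmoothMult.prodBase {x y : X → Opr 𝔄 BlockIdx BlockIdx} (hx : SmoothMult i x)
    (hy : SmoothMult i y) : SmoothMult i fun z => _root_.prodBase (x z) (y z) :=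
  (hx.tens hy).add ((SmoothMult.one.sub hx).tens .baseOp)

theorem SmoothEmb.mulEmb {θ : BlockIdx × BlockIdx → ℕ} (hθ : IsTempered θ) {y : X → Gr 𝔄}
    (hy : SmoothVia i (fun b : Gr 𝔄 => b.1) y) :
    SmoothEmb i (fun _ => baseOp 𝔄) (fun x => _root_.prodBase (baseOp 𝔄) (y x).top)
      (fun x => _root_.mulEmb hθ (y x)) fun x => mulEmbT hθ (y x) :=
  (SmoothFrame.reg_single hθ (SmoothMult.prodBase .baseOp hy.top) fun x =>
    prodBase_mul_self baseOp_mul_baseOp (y x).top_mul_top).emb ()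

end

theorem Gr.top_sub (a : Gr 𝔄) : a.top - baseOp 𝔄 = a.dop := add_sub_cancel_left _ _

theorem Gr.exists_mul {θ : BlockIdx × BlockIdx → ℕ} (hθ : IsTempered θ) (a b : Gr 𝔄) :
    ∃ c : Gr 𝔄, c.mat = regRelabel θ (pairProd .left a.pair b.pair) ∧
      c.dop = mulEmb hθ b ∘L tens a.dop b.dop ∘L mulEmbT hθ b := by
  have e : prodBase a.top b.top - prodBase (baseOp 𝔄) b.top = tens a.dop b.dop := by
    rw [prodBase_sub, top_sub, top_sub]
  obtain ⟨c, hc, hc'⟩ := Gr.exists_of_reg hθ (α := prodBase (baseOp 𝔄) b.top)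
    (β := prodBase a.top b.top) (prodBase_mul_self baseOp_mul_baseOp b.top_mul_top)
    (prodBase_mul_self a.top_mul_top b.top_mul_top)
    (SmoothMult.prodBase .baseOp (SmoothVia.const b).top)
    (((SmoothVia.const a).dop.tens (SmoothVia.const b).dop).congr fun _ => e.symm)
  refine ⟨c, ?_, by rw [hc', e]; rfl⟩
  rw [hc]
  simp only [prodBase, mat_add, mat_tens, mat_sub, mat_one, mat_baseOp, ← mat_eq_top]
  rfl

theorem relabel_comp_swap {R : Type*} [Zero R] {Ω Ω' : Type*} {r : Ω × Ω → Ω'}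
    (hr : Function.Injective r) (M : Matrix (Ω × Ω) (Ω × Ω) R) :
    relabel (r ∘ Prod.swap) M = relabel r (M.submatrix Prod.swap Prod.swap) := by
  have hr' : Function.Injective (r ∘ Prod.swap) := hr.comp Prod.swap_injective
  ext1 i j
  by_cases h : ∃ z w, r z = i ∧ r w = j
  · obtain ⟨z, w, rfl, rfl⟩ := h
    have h1 := (hr'.prodMap hr').extend_apply (fun p => M p.1 p.2) 0 (z.swap, w.swap)
    have h2 := (hr.prodMap hr).extend_apply
      (fun p => M.submatrix Prod.swap Prod.swap p.1 p.2) 0 (z, w)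
    simp only [Prod.map_apply, Function.comp_apply, Prod.swap_swap] at h1 h2
    exact h1.trans h2.symm
  · rw [relabel, relabel, Matrix.of_apply, Matrix.of_apply, Function.extend_apply',
      Function.extend_apply']
    · rintro ⟨z, hz⟩
      exact h ⟨z.1, z.2, congrArg Prod.fst hz, congrArg Prod.snd hz⟩
    · rintro ⟨z, hz⟩
      exact h ⟨z.1.swap, z.2.swap, congrArg Prod.fst hz, congrArg Prod.snd hz⟩

/-- Up to interchanging the tensor factors, the right product is the left product in the opposite
order; the interchange is absorbed in the relabeling map. -/
theorem regRelabel_prod_right {R : Type*} [CommRing R] [TopologicalSpace R] {Ω : Type*}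
    [DecidableEq Ω] {r : Ω × Ω → ℕ} (hr : Function.Injective r) (x y : MatPair Ω R) :
    regRelabel (r ∘ Prod.swap) (pairProd .left y x) = regRelabel r (pairProd .right x y) := by
  rw [regRelabel, regRelabel, relabel_comp_swap hr, relabel_comp_swap hr]
  congr 3 <;>
  · ext1 i j
    simp [pairProd, kron, mul_comm]

/-! ### The multiplicative unit -/

/-- The constant `1 × 1` matrix. -/
noncomputable def unitOp (e : 𝔄) : Opr 𝔄 (Fin 1) (Fin 1) :=
  op (RapidFun.mk (fun _ => e) fun p k => ⟨p.1 e, fun z => by simp [wt, IndexSize.size]⟩)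

theorem unitOp_single (e : 𝔄) (j : Fin 1) (k : Fin 1) :
    unitOp e (single j) k = (e : Unitization ℝ 𝔄) := op_single _ _ _

theorem unitOp_apply (e : 𝔄) (f : RapidFun (Fin 1) (Unitization ℝ 𝔄)) (k : Fin 1) :
    unitOp e f k = f k * (e : Unitization ℝ 𝔄) := by
  have h := op_hasSum (unitOp e) f k
  refine h.unique ?_
  have h2 := hasSum_unique fun j : Fin 1 => f j * unitOp e (single j) k
  rw [unitOp_single] at h2
  rwa [show (default : Fin 1) = k from Subsingleton.elim _ _] at h2

/-- The base term is 0, hence the whole 1 × 1 matrix is placed in the zeroth block; it is idempotent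
since e e = e. -/
theorem Gr.exists_one {θ : Fin 1 → ℕ} (hθ : IsTempered θ) {e : 𝔄} (he : ∀ x, e * x = x) :
    ∃ c : Gr 𝔄, c.mat = regRelabel θ (pairOne (e : Unitization ℝ 𝔄)) ∧
      c.dop = regEmb hθ 0 ∘L unitOp e ∘L regEmbT hθ 0 := by
  obtain ⟨c, hc, hc'⟩ := Gr.exists_of_reg hθ (α := 0) (β := unitOp (𝔄 := 𝔄) e) (by simp)
    (op_ext fun i j => by
      rw [mul_apply_eq_comp, unitOp_apply, unitOp_single, ← Unitization.inr_mul, he])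
    (.of_kernel .zero) (SmoothKernel.congr ⟨fun _ => _, .const _, fun _ => rfl⟩ fun _ =>
      (sub_zero _).symm)
  refine ⟨c, ?_, by rw [hc', sub_zero]⟩
  rw [hc, pairOne]
  congr 2
  ext1 j k
  exact unitOp_single e k j

end Mul

/-! ### Distributivity, associativity and the unit rule -/

section MulLaws

variable {𝔄 : Type w} [NonUnitalCommRing 𝔄] [Module ℝ 𝔄] [IsScalarTower ℝ 𝔄 𝔄]
  [SMulCommClass ℝ 𝔄 𝔄] [TopologicalSpace 𝔄] [IsTopologicalRing 𝔄] [ContinuousSMul ℝ 𝔄]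
  [PolynormableSpace ℝ 𝔄] [T2Space 𝔄] [AbsSummableSpace 𝔄]

theorem tens_sandwich {Ω Ω' Ω₁ Ω₁' Ξ Ξ' Ξ₁ Ξ₁' : Type} [IndexSize Ω] [IndexSize Ω'] [IndexSize Ω₁]
    [IndexSize Ω₁'] [IndexSize Ξ] [IndexSize Ξ'] [IndexSize Ξ₁] [IndexSize Ξ₁'] [TemperedIndex Ω]
    [TemperedIndex Ω'] [TemperedIndex Ω₁] [TemperedIndex Ω₁'] [TemperedIndex Ξ] [TemperedIndex Ξ']
    [TemperedIndex Ξ₁] [TemperedIndex Ξ₁'] (J : Opr 𝔄 Ω Ω₁) (F : Opr 𝔄 Ω' Ω) (J' : Opr 𝔄 Ω₁' Ω')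
    (K : Opr 𝔄 Ξ Ξ₁) (G : Opr 𝔄 Ξ' Ξ) (K' : Opr 𝔄 Ξ₁' Ξ') :
    tens (J ∘L F ∘L J') (K ∘L G ∘L K') = tens J K ∘L tens F G ∘L tens J' K' := by
  rw [tens_comp, tens_comp]

section Assoc

variable {Ω Ξ Υ : Type} [IndexSize Ω] [IndexSize Ξ] [IndexSize Υ] [TemperedIndex Ω]
    [TemperedIndex Ξ] [TemperedIndex Υ] (Y : Opr 𝔄 Ω Ω) (Z : Opr 𝔄 Ξ Ξ) (W : Opr 𝔄 Υ Υ)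

theorem tens_comp_relOp_assoc : tens Y (tens Z W) ∘L relOp .assoc =
    relOp .assoc ∘L tens (tens Y Z) W := by
  refine op_ext fun ⟨a, b, c⟩ ⟨⟨a', b'⟩, c'⟩ => ?_
  have h := relOp_apply IsTempered.assoc (tens (tens Y Z) W (single ((a', b'), c'))) ((a, b), c)
  rw [tens_single, tens_single, mul_assoc] at h
  refine Eq.trans ?_ h.symm
  rw [ContinuousLinearMap.comp_apply, relOp_single, tens_single, tens_single]

theorem pullOp_assoc_comp_tens : pullOp .assoc ∘L tens Y (tens Z W) =
    tens (tens Y Z) W ∘L pullOp .assoc := by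
  refine op_ext fun ⟨⟨a, b⟩, c⟩ ⟨a', b', c'⟩ => ?_
  have h := pullOp_single (R := Unitization ℝ 𝔄) (IsTempered.assoc (Ω := Ω) (Ξ := Ξ) (Ξ' := Υ))
    ((a', b'), c')
  simp only [ContinuousLinearMap.comp_apply] at h ⊢
  rw [h, pullOp_apply, tens_single, tens_single, tens_single, tens_single, mul_assoc]

end Assoc

theorem prodBase_assoc_left (y z : Opr 𝔄 BlockIdx BlockIdx) :
    tens (prodBase (baseOp 𝔄) y) z + tens (1 - prodBase (baseOp 𝔄) y) (baseOp 𝔄) =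
      tens (tens (baseOp 𝔄) y) z + tens (tens (baseOp 𝔄) (1 - y)) (baseOp 𝔄) +
        (tens (tens (1 - baseOp 𝔄) (baseOp 𝔄)) z +
          tens (tens (1 - baseOp 𝔄) (1 - baseOp 𝔄)) (baseOp 𝔄)) := by
  have e : 1 - prodBase (baseOp 𝔄) y = tens (baseOp 𝔄) (1 - y) +
      tens (1 - baseOp 𝔄) (1 - baseOp 𝔄) := by
    rw [prodBase, ← tens_one]
    simp only [tens_sub_left, tens_sub_right]
    abel
  rw [e, prodBase, tens_add_left, tens_add_left]
  abel

theorem prodBase_assoc_right (y z : Opr 𝔄 BlockIdx BlockIdx) :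
    tens (baseOp 𝔄) (prodBase y z) + tens (1 - baseOp 𝔄) (prodBase (baseOp 𝔄) z) =
      tens (baseOp 𝔄) (tens y z) + tens (baseOp 𝔄) (tens (1 - y) (baseOp 𝔄)) +
        (tens (1 - baseOp 𝔄) (tens (baseOp 𝔄) z) +
          tens (1 - baseOp 𝔄) (tens (1 - baseOp 𝔄) (baseOp 𝔄))) := by
  rw [prodBase, prodBase, tens_add_right, tens_add_right]

variable {X : Type x} {E : Type u} [AddCommGroup E] [Module ℝ E] [TopologicalSpace E]
  [IsTopologicalAddGroup E] [ContinuousSMul ℝ E] {i : X → E}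

/-- Both base terms expand to the same four triple tensors, R₀⊗y⊗z, R₀⊗(1-y)⊗R₀, (1-R₀)⊗R₀⊗z and
(1-R₀)⊗(1-R₀)⊗R₀, bracketed differently. -/
theorem smoothEmb_relOp_assoc (y z : X → Opr 𝔄 BlockIdx BlockIdx) :
    SmoothEmb i (fun x => tens (baseOp 𝔄) (prodBase (y x) (z x)) +
        tens (1 - baseOp 𝔄) (prodBase (baseOp 𝔄) (z x)))
      (fun x => tens (prodBase (baseOp 𝔄) (y x)) (z x) +
        tens (1 - prodBase (baseOp 𝔄) (y x)) (baseOp 𝔄)) (fun _ => RapidFun.relOp .assoc)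
      fun _ => pullOp .assoc := by
  refine SmoothEmb.relOp _ (fun x φ => ?_) fun x φ => ?_
  · have e := fun Y Z W : Opr 𝔄 BlockIdx BlockIdx =>
      congrArg (fun T => T φ) (tens_comp_relOp_assoc Y Z W)
    simp only [ContinuousLinearMap.comp_apply] at e
    simp only [prodBase_assoc_left, prodBase_assoc_right, _root_.add_apply, map_add, e]
  · have e := fun Y Z W : Opr 𝔄 BlockIdx BlockIdx =>
      congrArg (fun T => T φ) (pullOp_assoc_comp_tens Y Z W)
    simp only [ContinuousLinearMap.comp_apply] at e
    simp only [prodBase_assoc_left, prodBase_assoc_right, _root_.add_apply, map_add, e]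

variable {θ : BlockIdx × BlockIdx → ℕ} {hθ : IsTempered θ} {mul : Gr 𝔄 → Gr 𝔄 → Gr 𝔄}
  (hmul : ∀ a b, (mul a b).dop = mulEmb hθ b ∘L tens a.dop b.dop ∘L mulEmbT hθ b)

include hmul

theorem SmoothVia.mul_gr {f g : X → Gr 𝔄} (hf : SmoothVia i (fun b : Gr 𝔄 => b.1) f)
    (hg : SmoothVia i (fun b : Gr 𝔄 => b.1) g) :
    SmoothVia i (fun b : Gr 𝔄 => b.1) fun x => mul (f x) (g x) :=
  .of_dop ((SmoothKernel.sandwich (SmoothEmb.mulEmb hθ hg).smooth (hf.dop.tens hg.dop)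
    (SmoothEmb.mulEmb hθ hg).smooth').congr fun _ => (hmul _ _).symm)

variable [PolynormableSpace ℝ E] {f g h : X → Gr 𝔄} (hf : SmoothVia i (fun b : Gr 𝔄 => b.1) f)
  (hg : SmoothVia i (fun b : Gr 𝔄 => b.1) g) (hh : SmoothVia i (fun b : Gr 𝔄 => b.1) h)

include hf

section Distributivity

variable {K K' : Fin 2 → Opr 𝔄 BlockIdx BlockIdx} {add : Gr 𝔄 → Gr 𝔄 → Gr 𝔄}
  (hadd : ∀ a b, (add a b).dop = K 0 ∘L a.dop ∘L K' 0 + K 1 ∘L b.dop ∘L K' 1)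
  (hK : SmoothFrame i (fun _ _ => baseOp 𝔄) (fun a _ => K a) fun a _ => K' a)

include hg hh hadd hK

/-- Both sides place `(f x).dop ⊗ (g x).dop` and `(f x).dop ⊗ (h x).dop`. On the left, `1 ⊗ K a`
followed by the embedding of the product serves as frame: `K a` intertwines the idempotent of the
sum with that of the a-th summand, and R₀ with itself, hence also the base terms of the products. -/
theorem Homot.mul_add :
    Homot i (fun x => mul (f x) (add (g x) (h x)))
      fun x => add (mul (f x) (g x)) (mul (f x) (h x)) := by
  have hy := SmoothVia.add_gr hadd hK hg hh
  have hM := SmoothEmb.mulEmb hθ hy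
  have hx : ∀ a : Fin 2, SmoothVia i (fun b : Gr 𝔄 => b.1) fun x => ![g x, h x] a :=
    Fin.forall_fin_two.2 ⟨hg, hh⟩
  have hL : ∀ a : Fin 2, SmoothEmb i (fun x => prodBase (baseOp 𝔄) (add (g x) (h x)).top)
      (fun x => prodBase (baseOp 𝔄) (![g x, h x] a).top) (fun _ => tens 1 (K a))
      fun _ => tens 1 (K' a) := fun a =>
    ((SmoothEmb.one _).tens (hK.emb_top (D := fun a x => (![g x, h x] a).dop) (fun x => by
      rw [Gr.top, hadd, Fin.sum_univ_two]; rfl) a)).add ((SmoothEmb.one _).one_sub.tens (hK.emb a))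
  refine SmoothFrame.homot_of_dop (i := i)
    (α := fun (a : Fin 2) x => prodBase (baseOp 𝔄) (![g x, h x] a).top)
    (J := fun a x => mulEmb hθ (add (g x) (h x)) ∘L tens 1 (K a))
    (J' := fun a x => tens 1 (K' a) ∘L mulEmbT hθ (add (g x) (h x)))
    (K := fun a x => K a ∘L mulEmb hθ (![g x, h x] a))
    (K' := fun a x => mulEmbT hθ (![g x, h x] a) ∘L K' a)
    (D := fun a x => tens (f x).dop (![g x, h x] a).dop)
    (.of_emb (fun a => (hL a).comp hM) fun a b hab x φ => ?_)
    (.of_emb (fun a => (SmoothEmb.mulEmb hθ (hx a)).comp (hK.emb a)) fun a b hab x φ => ?_)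
    (fun a => hf.dop.tens (hx a).dop) (fun x => ?_) fun x => ?_
  · simp only [ContinuousLinearMap.comp_apply, hM.retract, tens_tens]
    rw [show K' a ∘L K b = 0 from ContinuousLinearMap.ext (hK.orth_apply hab x), tens_zero_right]
    rfl
  · simp only [ContinuousLinearMap.comp_apply]
    rw [show K' a (K b _) = 0 from hK.orth_apply hab x _, map_zero]
  · have e : ∀ a (G : Opr 𝔄 BlockIdx BlockIdx), tens (f x).dop (K a ∘L G ∘L K' a) =
        tens 1 (K a) ∘L tens (f x).dop G ∘L tens 1 (K' a) := fun a G => by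
      rw [← tens_sandwich]; rfl
    rw [hmul, hadd, Fin.sum_univ_two, tens_add_right, e, e]
    ext1
    simp
  · rw [hadd, hmul, hmul, Fin.sum_univ_two]
    simp only [Matrix.cons_val_zero, Matrix.cons_val_one, Matrix.cons_val_fin_one,
      ContinuousLinearMap.comp_assoc]

/-- The base term of the product involves only the second factor, so `K a ⊗ 1` intertwines it with
itself and the two frames have equal base terms. -/
theorem Homot.add_mul :
    Homot i (fun x => mul (add (f x) (g x)) (h x))
      fun x => add (mul (f x) (h x)) (mul (g x) (h x)) := by
  have hM := SmoothEmb.mulEmb hθ hh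
  have hx : ∀ a : Fin 2, SmoothVia i (fun b : Gr 𝔄 => b.1) fun x => ![f x, g x] a :=
    Fin.forall_fin_two.2 ⟨hf, hg⟩
  have hL : ∀ a : Fin 2, SmoothEmb i (fun x => prodBase (baseOp 𝔄) (h x).top)
      (fun x => prodBase (baseOp 𝔄) (h x).top) (fun _ => tens (K a) 1)
      fun _ => tens (K' a) 1 := fun a =>
    ((hK.emb a).tens (SmoothEmb.one _)).add ((hK.emb a).one_sub.tens (SmoothEmb.one _))
  refine SmoothFrame.homot_of_dop (i := i)
    (α := fun (_ : Fin 2) x => prodBase (baseOp 𝔄) (h x).top)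
    (J := fun a x => mulEmb hθ (h x) ∘L tens (K a) 1)
    (J' := fun a x => tens (K' a) 1 ∘L mulEmbT hθ (h x))
    (K := fun a x => K a ∘L mulEmb hθ (h x))
    (K' := fun a x => mulEmbT hθ (h x) ∘L K' a)
    (D := fun a x => tens (![f x, g x] a).dop (h x).dop)
    (.of_emb (fun a => (hL a).comp hM) fun a b hab x φ => ?_)
    (.of_emb (fun a => hM.comp (hK.emb a)) fun a b hab x φ => ?_)
    (fun a => (hx a).dop.tens hh.dop) (fun x => ?_) fun x => ?_
  · simp only [ContinuousLinearMap.comp_apply, hM.retract, tens_tens]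
    rw [show K' a ∘L K b = 0 from ContinuousLinearMap.ext (hK.orth_apply hab x), tens_zero_left]
    rfl
  · simp only [ContinuousLinearMap.comp_apply]
    rw [show K' a (K b _) = 0 from hK.orth_apply hab x _, map_zero]
  · have e : ∀ a (G : Opr 𝔄 BlockIdx BlockIdx), tens (K a ∘L G ∘L K' a) (h x).dop =
        tens (K a) 1 ∘L tens G (h x).dop ∘L tens (K' a) 1 := fun a G => by
      rw [← tens_sandwich]; rfl
    rw [hmul, hadd, Fin.sum_univ_two, tens_add_left, e, e]
    ext1
    simp
  · rw [hadd, hmul, hmul, Fin.sum_univ_two]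
    simp only [Matrix.cons_val_zero, Matrix.cons_val_one, Matrix.cons_val_fin_one,
      ContinuousLinearMap.comp_assoc]

end Distributivity

include hg hh in
-- Both bracketings place the triple tensor of the differences. The second one also passes through
-- reassociation and the embedding for `h`, which intertwines the idempotent of the product `mul (g
-- x) (h x)` with `prodBase (g x).top (h x).top`.
theorem Homot.mul_assoc :
    Homot i (fun x => mul (mul (f x) (g x)) (h x)) fun x => mul (f x) (mul (g x) (h x)) := by
  have hMg := SmoothEmb.mulEmb hθ hg
  have hMh := SmoothEmb.mulEmb hθ hh
  have hM := SmoothEmb.mulEmb hθ (SmoothVia.mul_gr hmul hg hh)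
  have hJ := ((hMg.tens (SmoothEmb.one fun x => (h x).top)).add
    (hMg.one_sub.tens (SmoothEmb.one fun _ => baseOp 𝔄))).comp hMh
  have htop := ((SmoothFrame.of_emb_single hMh).emb_top (D := fun _ x => tens (g x).dop (h x).dop)
    (y := fun x => (mul (g x) (h x)).top) (fun x => by rw [Gr.top, hmul]; simp) ()).congr
    (fun _ => rfl) (fun x => show _ = prodBase (g x).top (h x).top by
      rw [← Gr.top_sub, ← Gr.top_sub, ← prodBase_sub, add_sub_cancel])
  have hK := (((SmoothEmb.one fun _ : X => baseOp 𝔄).tens htop).add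
    ((SmoothEmb.one fun _ : X => baseOp 𝔄).one_sub.tens hMh)).comp hM
  have hrel := smoothEmb_relOp_assoc (i := i) (fun x => (g x).top) fun x => (h x).top
  refine hJ.homot_of_dop (hrel.comp hK) (D := fun x => tens (tens (f x).dop (g x).dop) (h x).dop)
    ((hf.dop.tens hg.dop).tens hh.dop) (fun x => ?_) fun x => ?_
  · have e : ∀ G : Opr 𝔄 (BlockIdx × BlockIdx) (BlockIdx × BlockIdx),
        tens (mulEmb hθ (g x) ∘L G ∘L mulEmbT hθ (g x)) (h x).dop =
        tens (mulEmb hθ (g x)) 1 ∘L tens G (h x).dop ∘L tens (mulEmbT hθ (g x)) 1 := fun G => by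
      rw [← tens_sandwich]; rfl
    rw [hmul, hmul, e]
    simp only [ContinuousLinearMap.comp_assoc]
  · have e' : tens (f x).dop (tens (g x).dop (h x).dop) = relOp .assoc ∘L
        tens (tens (f x).dop (g x).dop) (h x).dop ∘L pullOp .assoc := by
      rw [← pullOp_assoc_comp_tens]
      refine ContinuousLinearMap.ext fun φ => RapidFun.ext fun ⟨a, b, c⟩ => ?_
      exact (relOp_apply IsTempered.assoc (pullOp IsTempered.assoc
        (tens (f x).dop (tens (g x).dop (h x).dop) φ)) ((a, b), c)).symm
    have e'' : ∀ G : Opr 𝔄 (BlockIdx × BlockIdx) (BlockIdx × BlockIdx),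
        tens (f x).dop (mulEmb hθ (h x) ∘L G ∘L mulEmbT hθ (h x)) =
        tens 1 (mulEmb hθ (h x)) ∘L tens (f x).dop G ∘L tens 1 (mulEmbT hθ (h x)) := fun G => by
      rw [← tens_sandwich]; rfl
    rw [hmul, hmul, e'', e']
    simp only [ContinuousLinearMap.comp_assoc]

/-- As the base term of the unit is 0, the base term on the 1 × 1 factor tensored with the blocks
reduces to R₀; and the tensor product with `e` does not change the difference, since its entries lie
in the algebra. The remaining embedding is compared with the identity. -/
theorem Homot.one_mul {θ' : Fin 1 → ℕ} (hθ' : IsTempered θ') {e : 𝔄} (he : ∀ x, e * x = x)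
    {c : Gr 𝔄} (hc : c.dop = regEmb hθ' 0 ∘L unitOp e ∘L regEmbT hθ' 0) :
    Homot i (fun x => mul c (f x)) f := by
  have hM := SmoothEmb.mulEmb hθ hf
  have hO := (SmoothFrame.reg_single (i := i) (α := fun _ => (0 : Opr 𝔄 (Fin 1) (Fin 1))) hθ'
    (.of_kernel .zero) fun _ => mul_zero _).emb ()
  have hL := ((hO.tens (SmoothEmb.one fun x => (f x).top)).add
    (hO.one_sub.tens (SmoothEmb.one fun _ => baseOp 𝔄))).comp hM
  have e1 : ∀ Y : Opr 𝔄 BlockIdx BlockIdx, tens 1 Y ∘L relOp (.pair (0 : Fin 1)) =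
      relOp (.pair (0 : Fin 1)) ∘L Y := fun Y => op_ext fun ⟨a, b⟩ c => by
    obtain rfl : a = 0 := Subsingleton.elim _ _
    have := relOp_apply (IsTempered.pair (0 : Fin 1)) (Y (single c)) b
    refine Eq.trans ?_ this.symm
    rw [ContinuousLinearMap.comp_apply, relOp_single, tens_single]
    simp
  have e2 : ∀ Y : Opr 𝔄 BlockIdx BlockIdx, pullOp (.pair (0 : Fin 1)) ∘L tens 1 Y =
      Y ∘L pullOp (.pair (0 : Fin 1)) := fun Y => op_ext fun b ⟨a, c⟩ => by
    obtain rfl : a = 0 := Subsingleton.elim _ _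
    have := pullOp_single (R := Unitization ℝ 𝔄) (IsTempered.pair (Ω := BlockIdx) (0 : Fin 1)) c
    rw [ContinuousLinearMap.comp_apply, ContinuousLinearMap.comp_apply, this, pullOp_apply,
      tens_single]
    simp
  have hrel := SmoothEmb.relOp (i := i) (α := fun _ => baseOp 𝔄)
    (β := fun x => tens (0 : Opr 𝔄 (Fin 1) (Fin 1)) (f x).top + tens (1 - 0) (baseOp 𝔄))
    (IsTempered.pair (0 : Fin 1)) (fun x φ => by
      rw [tens_zero_left, _root_.zero_add, sub_zero]
      exact congrArg (fun T => T φ) (e1 (baseOp 𝔄))) fun x φ => by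
      rw [tens_zero_left, _root_.zero_add, sub_zero]
      exact congrArg (fun T => T φ) (e2 (baseOp 𝔄))
  refine (hrel.comp hL).homot_of_dop (SmoothEmb.one _) hf.dop (fun x => ?_) fun x => rfl
  have e3 : tens (unitOp e) (f x).dop =
      relOp (.pair (0 : Fin 1)) ∘L (f x).dop ∘L pullOp (.pair (0 : Fin 1)) := by
    refine op_ext fun ⟨a, b⟩ ⟨a', c⟩ => ?_
    obtain rfl : a = 0 := Subsingleton.elim _ _
    obtain rfl : a' = 0 := Subsingleton.elim _ _
    have h1 := pullOp_single (R := Unitization ℝ 𝔄) (IsTempered.pair (Ω := BlockIdx) (0 : Fin 1)) c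
    have h2 := relOp_apply (IsTempered.pair (0 : Fin 1)) ((f x).dop (single c)) b
    rw [tens_single, unitOp_single, ContinuousLinearMap.comp_apply, ContinuousLinearMap.comp_apply,
      h1]
    refine Eq.trans ?_ h2.symm
    rw [Gr.dop, op_single]
    exact (Unitization.inr_mul ℝ _ _).symm.trans (congrArg _ (he _))
  rw [hmul, hc, show (f x).dop = 1 ∘L (f x).dop ∘L 1 from rfl, tens_sandwich, e3]
  rfl

end MulLaws

/-! ### Commutativity of the multiplication -/

section CommAlgebra

variable {A : Type*} [Ring A]

/-- The partial switch matrix. -/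
def switchMatrix (x : A) : Matrix (Fin 2) (Fin 2) A := !![1 - x, x; x, 1 - x]

/-- The matrix which relates the idempotents `c + y` and `c + x`. -/
def exchangeMatrix (c x y : A) : Matrix (Fin 2) (Fin 2) A :=
  switchMatrix y * !![c, x; y, 0] * switchMatrix x

variable {c x y : A}

theorem switchMatrix_mul_self (hx : x * x = x) : switchMatrix x * switchMatrix x = 1 := by
  rw [switchMatrix, Matrix.mul_fin_two, Matrix.one_fin_two]
  simp [mul_sub, sub_mul, hx]

variable (hc : c * c = c) (hx : x * x = x) (hy : y * y = y) (hcx : c * x = 0) (hxc : x * c = 0)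
  (hcy : c * y = 0) (hyc : y * c = 0)

include hc hx hy hcx hxc in
-- The inner switches cancel. The matrices [c, y; x, 0] and [c, x; y, 0] multiply to diag (c + y,
-- x), since c annihilates x and the three are idempotent.
theorem exchangeMatrix_mul : exchangeMatrix c y x * exchangeMatrix c x y =
    switchMatrix x * !![c + y, 0; 0, x] * switchMatrix x := by
  have h : !![c, y; x, 0] * !![c, x; y, 0] = !![c + y, 0; 0, x] := by
    rw [Matrix.mul_fin_two]
    simp [*]
  calc _ = switchMatrix x * !![c, y; x, 0] * (switchMatrix y * switchMatrix y) *
        !![c, x; y, 0] * switchMatrix x := by simp only [exchangeMatrix, mul_assoc]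
    _ = _ := by rw [switchMatrix_mul_self hy, mul_one, mul_assoc (switchMatrix x), h]

include hc hx hy hcx hxc hcy hyc in
theorem exchangeMatrix_mul_mul :
    exchangeMatrix c x y * exchangeMatrix c y x * exchangeMatrix c x y = exchangeMatrix c x y := by
  have h : !![c, x; y, 0] * !![c + y, 0; 0, x] = !![c, x; y, 0] := by
    rw [Matrix.mul_fin_two]
    simp [mul_add, *]
  rw [mul_assoc, exchangeMatrix_mul hc hx hy hcx hxc, exchangeMatrix]
  calc _ = switchMatrix y * !![c, x; y, 0] * (switchMatrix x * switchMatrix x) *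
        !![c + y, 0; 0, x] * switchMatrix x := by simp only [mul_assoc]
    _ = _ := by rw [switchMatrix_mul_self hx, mul_one, mul_assoc (switchMatrix y), h]

include hx hy hcx hyc in
-- This form shows why the switches are inserted: apart from c + x + y in the corner, only the
-- products y x occur, and these are rapidly decreasing in the application.
theorem exchangeMatrix_eq : exchangeMatrix c x y =
    !![c + x + y - (y * x + y * x), y * x; y * x, 0] := by
  rw [exchangeMatrix, switchMatrix, switchMatrix, Matrix.mul_fin_two, Matrix.mul_fin_two]
  ext1 a b
  fin_cases a <;> fin_cases b <;>
  · simp [mul_sub, sub_mul, add_mul, mul_assoc, hx, hy, hcx, hyc]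
    try abel

variable {β d : A} (hxβ : x * β = 0) (hβx : β * x = 0)

include hx hxβ hβx in
-- For d = 0 the switch turns diag (β, x) into diag (β + x, 0), because x and β are orthogonal.
-- Hence d appears multiplied by the column (1 - x, x) and the row (1 - x, x).
theorem switchMatrix_conj : switchMatrix x * !![β + d, 0; 0, x] * switchMatrix x =
    !![β + x + (1 - x) * d * (1 - x), (1 - x) * d * x; x * d * (1 - x), x * d * x] := by
  rw [switchMatrix, Matrix.mul_fin_two, Matrix.mul_fin_two]
  ext1 a b
  fin_cases a <;> fin_cases b <;>
  · simp [mul_sub, sub_mul, mul_add, add_mul, mul_assoc, hx, hxβ, hβx]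
    try abel

end CommAlgebra

section MulComm

variable {𝔄 : Type w} [NonUnitalCommRing 𝔄] [Module ℝ 𝔄] [IsScalarTower ℝ 𝔄 𝔄]
  [SMulCommClass ℝ 𝔄 𝔄] [TopologicalSpace 𝔄] [IsTopologicalRing 𝔄] [ContinuousSMul ℝ 𝔄]
  [PolynormableSpace ℝ 𝔄] [T2Space 𝔄] [AbsSummableSpace 𝔄]
  {X : Type x} {E : Type u} [AddCommGroup E] [Module ℝ E] [TopologicalSpace E]
  [IsTopologicalAddGroup E] [ContinuousSMul ℝ E] {i : X → E}

section Frame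

variable {Ω : Type} [IndexSize Ω] [TemperedIndex Ω]

theorem SmoothEmb.exists_gr {α : X → Opr 𝔄 Ω Ω} {J : X → Opr 𝔄 Ω BlockIdx}
    {J' : X → Opr 𝔄 BlockIdx Ω} (h : SmoothEmb i (fun _ => baseOp 𝔄) α J J') {D : X → Opr 𝔄 Ω Ω}
    (hD : SmoothKernel i D) (hid : ∀ x, (α x + D x) * (α x + D x) = α x + D x) :
    ∃ f : X → Gr 𝔄, SmoothVia i (fun b : Gr 𝔄 => b.1) f ∧ ∀ x, (f x).dop = J x ∘L D x ∘L J' x := by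
  obtain ⟨f, hf, hf'⟩ := (SmoothFrame.of_emb_single h).exists_gr
    (P := fun x => Matrix.of fun _ _ => α x + D x)
    (fun _ _ => hD.congr fun x => (add_sub_cancel_left _ _).symm) fun x => by
      ext1 a b
      simpa [Matrix.mul_apply] using hid x
  refine ⟨f, hf, fun x => add_left_cancel ((hf' x).trans ((lift_unit _ _ _ _).trans ?_))⟩
  rw [Matrix.of_apply, add_sub_cancel_left]

variable {γ x β : X → Opr 𝔄 Ω Ω} {L : Fin 2 → X → Opr 𝔄 Ω BlockIdx}
  {L' : Fin 2 → X → Opr 𝔄 BlockIdx Ω}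

/-- Distribution of an embedding to the two embeddings of a frame. -/
theorem SmoothFrame.mix (h : SmoothFrame i (fun a z => ![γ z, 0] a) L L') (hx : SmoothMult i x)
    (hxx : ∀ z, x z * x z = x z) (hxβ : ∀ z, x z * β z = 0) (hβx : ∀ z, β z * x z = 0)
    (hγ : ∀ z, β z + x z = γ z) :
    SmoothEmb i (fun _ => baseOp 𝔄) β (fun z => L 0 z ∘L (1 - x z) + L 1 z ∘L x z)
      fun z => (1 - x z) ∘L L' 0 z + x z ∘L L' 1 z := by
  have h0 := h.emb 0
  have h1 := h.emb 1
  have o0 : ∀ z φ, L' 0 z (L 1 z φ) = 0 := h.orth_apply zero_ne_one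
  have o1 : ∀ z φ, L' 1 z (L 0 z φ) = 0 := h.orth_apply one_ne_zero
  have e : ∀ z φ, x z (x z φ) = x z φ := fun z φ => congrArg (fun T : Opr 𝔄 Ω Ω => T φ) (hxx z)
  have e1 : ∀ z φ, x z (β z φ) = 0 := fun z φ => congrArg (fun T : Opr 𝔄 Ω Ω => T φ) (hxβ z)
  have e2 : ∀ z φ, β z (x z φ) = 0 := fun z φ => congrArg (fun T : Opr 𝔄 Ω Ω => T φ) (hβx z)
  refine ⟨fun z φ => ?_, fun z φ => ?_, fun z φ => ?_,
    ((h.smooth 0).comp (SmoothMult.one.sub hx)).add ((h.smooth 1).comp hx),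
    ((SmoothMult.one.sub hx).comp (h.smooth' 0)).add (hx.comp (h.smooth' 1))⟩
  · simp [h0.retract, h1.retract, o0, o1, e]
  · simp [h0.base, h1.base, ← hγ, e, e1, e2]
  · simp [h0.base', h1.base', ← hγ, e, e1, e2]

/-- It identifies the lift through the two-member frame with base terms γ and 0 as the placement of
d by the mixed embedding of `SmoothFrame.mix`, whose base term is β. -/
theorem lift_switchMatrix {γ x β d : Opr 𝔄 Ω Ω} {L : Fin 2 → Opr 𝔄 Ω BlockIdx}
    {L' : Fin 2 → Opr 𝔄 BlockIdx Ω} (hxx : x * x = x) (hxβ : x * β = 0) (hβx : β * x = 0)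
    (hγ : β + x = γ) :
    lift (fun a => ![γ, 0] a) L L' (switchMatrix x * !![β + d, 0; 0, x] * switchMatrix x) =
      baseOp 𝔄 + (L 0 ∘L (1 - x) + L 1 ∘L x) ∘L d ∘L ((1 - x) ∘L L' 0 + x ∘L L' 1) := by
  rw [switchMatrix_conj hxx hxβ hβx, lift_fin_two, hγ]
  refine congrArg _ (ContinuousLinearMap.ext fun φ => ?_)
  simp [mul_apply_eq_comp]
  abel

theorem Gr.top_eq_add {a : Gr 𝔄} {D : Opr 𝔄 BlockIdx BlockIdx} (h : a.dop = D) :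
    a.top = baseOp 𝔄 + D :=
  h ▸ rfl

/-- The idempotents `β + d = c + q` and `β' + d = c + p` with `β + p = β' + q` lead to homotopic
points of the Grassmannian. -/
theorem SmoothFrame.homot_of_exchange [PolynormableSpace ℝ E] {γ c p q β β' d : X → Opr 𝔄 Ω Ω}
    {L : Fin 2 → X → Opr 𝔄 Ω BlockIdx} {L' : Fin 2 → X → Opr 𝔄 BlockIdx Ω}
    (hL : SmoothFrame i (fun a z => ![γ z, 0] a) L L')
    (hcc : ∀ z, c z * c z = c z) (hpp : ∀ z, p z * p z = p z) (hqq : ∀ z, q z * q z = q z)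
    (hcp : ∀ z, c z * p z = 0) (hpc : ∀ z, p z * c z = 0)
    (hcq : ∀ z, c z * q z = 0) (hqc : ∀ z, q z * c z = 0)
    (hpβ : ∀ z, p z * β z = 0) (hβp : ∀ z, β z * p z = 0)
    (hqβ : ∀ z, q z * β' z = 0) (hβq : ∀ z, β' z * q z = 0)
    (hγ1 : ∀ z, β z + p z = γ z) (hγ2 : ∀ z, β' z + q z = γ z)
    (hd1 : ∀ z, c z + q z = β z + d z) (hd2 : ∀ z, c z + p z = β' z + d z)
    (hp : SmoothMult i p) (hq : SmoothMult i q) (hd : SmoothKernel i d)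
    (hqp : SmoothKernel i fun z => q z * p z) (hpq : SmoothKernel i fun z => p z * q z)
    {J K : X → Opr 𝔄 Ω BlockIdx} {J' K' : X → Opr 𝔄 BlockIdx Ω}
    (hJ : SmoothEmb i (fun _ => baseOp 𝔄) β J J') (hK : SmoothEmb i (fun _ => baseOp 𝔄) β' K K')
    {f g : X → Gr 𝔄} (hf : ∀ z, (f z).dop = J z ∘L d z ∘L J' z)
    (hg : ∀ z, (g z).dop = K z ∘L d z ∘L K' z) : Homot i f g := by
  -- Both given embeddings may be replaced by mixtures of one common frame, since the homotopy class
  -- depends only on the base terms and on d.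
  have hM := hL.mix hp hpp hpβ hβp hγ1
  have hM' := hL.mix hq hqq hqβ hβq hγ2
  obtain ⟨F, -, hF⟩ := hM.exists_gr hd fun z => by
    rw [← hd1, add_mul, mul_add, mul_add, hcc, hcq, hqc, hqq, add_zero, zero_add]
  obtain ⟨G, -, hG⟩ := hM'.exists_gr hd fun z => by
    rw [← hd2, add_mul, mul_add, mul_add, hcc, hcp, hpc, hpp, add_zero, zero_add]
  refine (hJ.homot_of_dop hM hd hf hF).trans (Homot.trans ?_ (hK.homot_of_dop hM' hd hg hG).symm)
  -- In the common frame the two points are the lifts of QP and PQ for the exchange matrices P and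
  -- Q.
  refine hL.homot_of_mvn (P := fun z => exchangeMatrix (c z) (p z) (q z))
    (Q := fun z => exchangeMatrix (c z) (q z) (p z)) ?_ ?_ (fun z => ?_) (fun z => ?_)
    (fun z => ?_) fun z => ?_
  · rw [Fin.forall_fin_two, Fin.forall_fin_two, Fin.forall_fin_two]
    refine ⟨⟨(hd.sub (hqp.add hqp)).congr fun z => ?_, hqp.congr fun z => ?_⟩,
      hqp.congr fun z => ?_, SmoothKernel.zero.congr fun z => ?_⟩ <;>
      rw [exchangeMatrix_eq (hpp z) (hqq z) (hcp z) (hqc z)] <;> simp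
    rw [← hγ1, add_right_comm, hd1]
    abel
  · rw [Fin.forall_fin_two, Fin.forall_fin_two, Fin.forall_fin_two]
    refine ⟨⟨(hd.sub (hpq.add hpq)).congr fun z => ?_, hpq.congr fun z => ?_⟩,
      hpq.congr fun z => ?_, SmoothKernel.zero.congr fun z => ?_⟩ <;>
      rw [exchangeMatrix_eq (hqq z) (hpp z) (hcq z) (hpc z)] <;> simp
    rw [← hγ1, hd1]
    abel
  · exact exchangeMatrix_mul_mul (hcc z) (hpp z) (hqq z) (hcp z) (hpc z) (hcq z) (hqc z)
  · exact exchangeMatrix_mul_mul (hcc z) (hqq z) (hpp z) (hcq z) (hqc z) (hcp z) (hpc z)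
  · rw [exchangeMatrix_mul (hcc z) (hpp z) (hqq z) (hcp z) (hpc z), hd1]
    exact (Gr.top_eq_add (hF z)).trans
      (lift_switchMatrix (L := fun a => L a z) (L' := fun a => L' a z) (hpp z) (hpβ z) (hβp z) (hγ1 z)).symm
  · rw [exchangeMatrix_mul (hcc z) (hqq z) (hpp z) (hcq z) (hqc z), hd2]
    exact (Gr.top_eq_add (hG z)).trans
      (lift_switchMatrix (L := fun a => L a z) (L' := fun a => L' a z) (hqq z) (hqβ z) (hβq z) (hγ2 z)).symm

end Frame

theorem isTempered_two_mul_add (k : ℕ) : IsTempered fun n : ℕ => 2 * n + k :=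
  .of_le (fun a b h => by simpa using h) (2 + k)
    (fun n => by
      simp only [wt, IndexSize.size]
      push_cast
      nlinarith [(Nat.cast_nonneg n : (0 : ℝ) ≤ n), (Nat.cast_nonneg k : (0 : ℝ) ≤ k),
        mul_nonneg (Nat.cast_nonneg n : (0 : ℝ) ≤ n) (Nat.cast_nonneg k : (0 : ℝ) ≤ k)])
    fun n => by
      refine le_trans ?_ (le_mul_of_one_le_left (wt_pos _).le (by
        linarith [(Nat.cast_nonneg k : (0 : ℝ) ≤ k)]))
      simp only [wt, IndexSize.size]
      push_cast
      linarith [(Nat.cast_nonneg n : (0 : ℝ) ≤ n), (Nat.cast_nonneg k : (0 : ℝ) ≤ k)]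

section Swap

variable {Ω Ξ : Type} [IndexSize Ω] [IndexSize Ξ] [TemperedIndex Ω]
    [TemperedIndex Ξ] (Y : Opr 𝔄 Ω Ω) (Z : Opr 𝔄 Ξ Ξ)

theorem tens_comp_relOp_swap : tens Z Y ∘L relOp .swap = relOp .swap ∘L tens Y Z := by
  refine op_ext fun ⟨b, a⟩ ⟨a', b'⟩ => ?_
  have h := relOp_apply IsTempered.swap (tens Y Z (single (a', b'))) (a, b)
  rw [tens_single, mul_comm] at h
  refine Eq.trans ?_ h.symm
  rw [ContinuousLinearMap.comp_apply, relOp_single]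
  exact tens_single Z Y b' a' (b, a)

theorem pullOp_swap_comp_tens : pullOp .swap ∘L tens Z Y = tens Y Z ∘L pullOp .swap := by
  refine op_ext fun ⟨a, b⟩ ⟨b', a'⟩ => ?_
  have h := pullOp_single (R := Unitization ℝ 𝔄) (IsTempered.swap (Ω := Ω) (Ξ := Ξ)) (a', b')
  simp only [ContinuousLinearMap.comp_apply, Prod.swap_prod_mk] at h ⊢
  rw [h, pullOp_apply, tens_single, tens_single, mul_comm]
  rfl

theorem tens_eq_swap : tens Z Y = relOp .swap ∘L tens Y Z ∘L pullOp .swap := by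
  rw [← pullOp_swap_comp_tens]
  refine ContinuousLinearMap.ext fun φ => RapidFun.ext fun ⟨a, b⟩ => ?_
  exact (relOp_apply IsTempered.swap (pullOp IsTempered.swap (tens Z Y φ)) (b, a)).symm

theorem tens_neg_neg : tens (-Y) (-Z) = tens Y Z := by
  refine op_ext fun k l => ?_
  rw [tens_single, tens_single]
  exact neg_mul_neg _ _

end Swap

variable {θ : BlockIdx × BlockIdx → ℕ} {hθ : IsTempered θ} {mul : Gr 𝔄 → Gr 𝔄 → Gr 𝔄}
  (hmul : ∀ a b, (mul a b).dop = mulEmb hθ b ∘L tens a.dop b.dop ∘L mulEmbT hθ b)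

include hmul

/-- After interchanging the factors of the second product, both products place the same d = (f -
R₀)⊗(g - R₀), but with base terms β = R₀⊗g + (1-R₀)⊗R₀ and β' = f⊗R₀ + R₀⊗(1-R₀). With c = f⊗g, p =
R₀⊗(1-g), q = (1-f)⊗R₀ one has β + d = c + q, β' + d = c + p, and β + p = β' + q = R₀⊗1 + (1-R₀)⊗R₀,
so the exchange argument applies. -/
theorem homot_mul_comm [PolynormableSpace ℝ E] {f g : X → Gr 𝔄}
    (hf : SmoothVia i (fun b : Gr 𝔄 => b.1) f) (hg : SmoothVia i (fun b : Gr 𝔄 => b.1) g) :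
    Homot i (fun x => mul (f x) (g x)) fun x => mul (g x) (f x) := by
  have hr : ∀ a : Fin 2, IsTempered fun z => 2 * θ z + a := fun a =>
    (isTempered_two_mul_add a).comp hθ
  have hγ : SmoothMult i fun _ : X => prodBase (baseOp 𝔄) 1 := .prodBase .baseOp .one
  have hL := SmoothFrame.reg (i := i) (α := fun a _ => ![prodBase (baseOp 𝔄) 1, 0] a) hr
    (fun a b hab z w h => hab (Fin.ext (by omega)))
    (Fin.forall_fin_two.2 ⟨hγ, .of_kernel .zero⟩)
    (Fin.forall_fin_two.2 ⟨fun _ => prodBase_mul_self baseOp_mul_baseOp (mul_one 1),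
      fun _ => mul_zero _⟩)
  have eR : baseOp 𝔄 * baseOp 𝔄 = baseOp 𝔄 := baseOp_mul_baseOp
  have eR1 : baseOp 𝔄 * (1 - baseOp 𝔄) = 0 := by rw [mul_sub, mul_one, eR, sub_self]
  have eR2 : (1 - baseOp 𝔄) * baseOp 𝔄 = 0 := by rw [sub_mul, one_mul, eR, sub_self]
  have et : ∀ a : Gr 𝔄, a.top * a.top = a.top := Gr.top_mul_top
  have et1 : ∀ a : Gr 𝔄, a.top * (1 - a.top) = 0 := fun a => by rw [mul_sub, mul_one, et, sub_self]
  have et2 : ∀ a : Gr 𝔄, (1 - a.top) * a.top = 0 := fun a => by rw [sub_mul, one_mul, et, sub_self]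
  have et3 : ∀ a : Gr 𝔄, (1 - a.top) * (1 - a.top) = 1 - a.top := fun a => one_sub_mul_self (et a)
  have hone : ∀ {f : X → Gr 𝔄}, SmoothVia i (fun b : Gr 𝔄 => b.1) f →
      SmoothMult i fun z => 1 - (f z).top := fun hf => SmoothMult.one.sub hf.top
  have hs : SmoothEmb i (fun z => prodBase (baseOp 𝔄) (f z).top)
      (fun z => RapidFun.tens (f z).top (baseOp 𝔄) + RapidFun.tens (baseOp 𝔄) (1 - baseOp 𝔄))
      (fun _ => relOp .swap) fun _ => pullOp .swap := by
    refine SmoothEmb.relOp _ (fun z φ => ?_) fun z φ => ?_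
    · have e := fun Y Z : Opr 𝔄 BlockIdx BlockIdx =>
        congrArg (fun T => T φ) (tens_comp_relOp_swap Y Z)
      simp only [ContinuousLinearMap.comp_apply] at e
      simp only [prodBase, _root_.add_apply, map_add, e]
    · have e := fun Y Z : Opr 𝔄 BlockIdx BlockIdx =>
        congrArg (fun T => T φ) (pullOp_swap_comp_tens Y Z)
      simp only [ContinuousLinearMap.comp_apply] at e
      simp only [prodBase, _root_.add_apply, map_add, e]
  refine hL.homot_of_exchange (c := fun z => RapidFun.tens (f z).top (g z).top)
    (p := fun z => RapidFun.tens (baseOp 𝔄) (1 - (g z).top))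
    (q := fun z => RapidFun.tens (1 - (f z).top) (baseOp 𝔄))
    (d := fun z => RapidFun.tens (f z).dop (g z).dop)
    ?_ ?_ ?_ ?_ ?_ ?_ ?_ ?_ ?_ ?_ ?_ ?_ ?_ ?_ ?_ (SmoothMult.tens .baseOp (hone hg))
    (SmoothMult.tens (hone hf) .baseOp) (hf.dop.tens hg.dop) ?_ ?_
    (SmoothEmb.mulEmb hθ hg) (hs.comp (SmoothEmb.mulEmb hθ hf)) (fun z => hmul _ _) fun z => ?_
  · intro z; simp only [tens_mul, et]
  · intro z; simp only [tens_mul, et3, eR]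
  · intro z; simp only [tens_mul, et3, eR]
  · intro z; simp only [tens_mul, et1, tens_zero_right]
  · intro z; simp only [tens_mul, et2, tens_zero_right]
  · intro z; simp only [tens_mul, et1, tens_zero_left]
  · intro z; simp only [tens_mul, et2, tens_zero_left]
  · intro z; simp only [prodBase, mul_add, tens_mul, et2, eR1, tens_zero_left, tens_zero_right,
      add_zero]
  · intro z; simp only [prodBase, add_mul, tens_mul, et1, eR2, tens_zero_left, tens_zero_right,
      add_zero]
  · intro z; simp only [mul_add, tens_mul, et2, eR1, tens_zero_left, tens_zero_right, add_zero]
  · intro z; simp only [add_mul, tens_mul, et1, eR2, tens_zero_left, tens_zero_right, add_zero]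
  · intro z
    simp only [prodBase, tens_sub_left, tens_sub_right]
    abel
  · intro z
    simp only [prodBase, tens_sub_left, tens_sub_right]
    abel
  · intro z
    simp only [prodBase, ← Gr.top_sub, tens_sub_left, tens_sub_right]
    abel
  · intro z
    simp only [← Gr.top_sub, tens_sub_left, tens_sub_right]
    abel
  -- The product of `q` and `p` is rapidly decreasing in both factors: (1 - f) R₀ = -(1 - f)(f -
  -- R₀), because (1 - f) f = 0, and similarly for g; the signs cancel.
  · refine (((hone hf).left (.self i) hf.dop).tens ((hone hg).right (.self i) hg.dop)).congr
      fun z => ?_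
    have h1 : (1 - (f z).top) * baseOp 𝔄 = -((1 - (f z).top) * (f z).dop) := by
      rw [← Gr.top_sub, mul_sub, et2, zero_sub, neg_neg]
    have h2 : baseOp 𝔄 * (1 - (g z).top) = -((g z).dop * (1 - (g z).top)) := by
      rw [← Gr.top_sub, sub_mul, et1, zero_sub, neg_neg]
    rw [tens_mul, h1, h2, tens_neg_neg]
    rfl
  · refine (((hone hf).right (.self i) hf.dop).tens ((hone hg).left (.self i) hg.dop)).congr
      fun z => ?_
    have h1 : baseOp 𝔄 * (1 - (f z).top) = -((f z).dop * (1 - (f z).top)) := by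
      rw [← Gr.top_sub, sub_mul, et1, zero_sub, neg_neg]
    have h2 : (1 - (g z).top) * baseOp 𝔄 = -((1 - (g z).top) * (g z).dop) := by
      rw [← Gr.top_sub, mul_sub, et2, zero_sub, neg_neg]
    rw [tens_mul, h1, h2, tens_neg_neg]
    rfl
  · rw [hmul, tens_eq_swap]
    simp only [ContinuousLinearMap.comp_assoc]

end MulComm

/-! ### The H-ring structure -/

section HRing

variable {𝔄 : Type w} [NonUnitalCommRing 𝔄] [Module ℝ 𝔄] [IsScalarTower ℝ 𝔄 𝔄]
  [SMulCommClass ℝ 𝔄 𝔄] [TopologicalSpace 𝔄] [IsTopologicalRing 𝔄] [ContinuousSMul ℝ 𝔄]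
  [PolynormableSpace ℝ 𝔄] [T2Space 𝔄] [AbsSummableSpace 𝔄]

theorem smoothVia_coord {k : ℕ} (m : Fin k) :
    SmoothVia (tupleEmb 𝔄 k) (fun b : Gr 𝔄 => b.1) fun x => x m :=
  SmoothVia.of_global (Φ := fun x => x m)
    (.of_clm (ContinuousLinearMap.proj (R := ℝ) (φ := fun _ : Fin k => RapidMat (Fin 2 × ℕ) 𝔄) m))
    fun _ => rfl

theorem exists_add_group {θ₁ : BlockIdx ⊕ BlockIdx → ℕ} {θ₂ : BlockIdx → ℕ} (hθ₁ : IsTempered θ₁)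
    (hθ₂ : IsTempered θ₂) : ∃ (add : Gr 𝔄 → Gr 𝔄 → Gr 𝔄) (neg : Gr 𝔄 → Gr 𝔄) (zero : Gr 𝔄),
      (∀ a b, (add a b).mat = regRelabel θ₁ (pairSum a.pair b.pair)) ∧
      (∀ a, (neg a).mat = regRelabel θ₂ (pairInv a.pair)) ∧
      zero.mat = baseMat (Unitization ℝ 𝔄) ℕ ∧
      (∀ a b, (add a b).dop = addEmb (𝔄 := 𝔄) hθ₁ 0 ∘L a.dop ∘L addEmbT (𝔄 := 𝔄) hθ₁ 0 +
        addEmb (𝔄 := 𝔄) hθ₁ 1 ∘L b.dop ∘L addEmbT (𝔄 := 𝔄) hθ₁ 1) ∧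
      (∀ a, (neg a).dop = -(regEmb (𝔄 := 𝔄) hθ₂ (1 - baseOp 𝔄) ∘L a.dop ∘L regEmbT (𝔄 := 𝔄) hθ₂ (1 - baseOp 𝔄))) ∧
      zero.dop = 0 := by
  choose add hadd hadd' using Gr.exists_add (𝔄 := 𝔄) hθ₁
  choose neg hneg hneg' using Gr.exists_neg (𝔄 := 𝔄) hθ₂
  obtain ⟨zero, hzero, hzero'⟩ := Gr.exists_zero (𝔄 := 𝔄)
  exact ⟨add, neg, zero, hadd, hneg, hzero, hadd', hneg', hzero'⟩

/-- The opposite multiplication is treated at the same time, as it is needed for the right product.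
Its laws are those of the given multiplication with variables permuted. -/
theorem isCommSmoothHRing_of_dop {θ₁ : BlockIdx ⊕ BlockIdx → ℕ} {θ₂ : BlockIdx → ℕ}
    {θ₃ : BlockIdx × BlockIdx → ℕ} (hθ₁ : IsTempered θ₁) (hθ₂ : IsTempered θ₂)
    (hθ₃ : IsTempered θ₃) {add mul : Gr 𝔄 → Gr 𝔄 → Gr 𝔄} {neg : Gr 𝔄 → Gr 𝔄} {zero : Gr 𝔄}
    (hadd : ∀ a b, (add a b).dop = addEmb (𝔄 := 𝔄) hθ₁ 0 ∘L a.dop ∘L addEmbT (𝔄 := 𝔄) hθ₁ 0 +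
        addEmb (𝔄 := 𝔄) hθ₁ 1 ∘L b.dop ∘L addEmbT (𝔄 := 𝔄) hθ₁ 1)
    (hneg : ∀ a, (neg a).dop =
      -(regEmb (𝔄 := 𝔄) hθ₂ (1 - baseOp 𝔄) ∘L a.dop ∘L regEmbT (𝔄 := 𝔄) hθ₂ (1 - baseOp 𝔄)))
    (hzero : zero.dop = 0)
    (hmul : ∀ a b, (mul a b).dop = mulEmb hθ₃ b ∘L RapidFun.tens a.dop b.dop ∘L mulEmbT hθ₃ b) :
    IsCommSmoothHRing add mul neg zero ∧ IsCommSmoothHRing add (fun a b => mul b a) neg zero := by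
  have hK : ∀ k, SmoothFrame (tupleEmb 𝔄 k) (fun _ _ => baseOp 𝔄) (fun a _ => addEmb hθ₁ a)
      fun a _ => addEmbT hθ₁ a := fun k => SmoothFrame.addEmb hθ₁
  have hN : ∀ k, SmoothEmb (tupleEmb 𝔄 k) (fun _ => baseOp 𝔄) (fun _ => 1 - baseOp 𝔄)
      (fun _ => regEmb hθ₂ (1 - baseOp 𝔄)) fun _ => regEmbT hθ₂ (1 - baseOp 𝔄) := fun k =>
    (SmoothFrame.reg_single hθ₂ (SmoothMult.one.sub .baseOp)
      fun _ => one_sub_mul_self baseOp_mul_baseOp).emb ()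
  have c : ∀ {k} (m : Fin k), SmoothVia (tupleEmb 𝔄 k) (fun b : Gr 𝔄 => b.1) fun x => x m :=
    smoothVia_coord
  have sneg : SmoothVia (tupleEmb 𝔄 1) (fun b : Gr 𝔄 => b.1) fun x => neg (x 0) := by
    refine SmoothVia.of_dop ((((hN 1).smooth.left (.self _) ((hN 1).smooth'.right (.self _)
      (c 0).dop)).neg).congr fun x => (hneg _).symm)
  have hcomm : ∀ {k} (m n : Fin k), Homot (tupleEmb 𝔄 k) (fun x => mul (x m) (x n))
      fun x => mul (x n) (x m) := fun m n => homot_mul_comm hmul (c m) (c n)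
  have hleft := fun m n l : Fin 3 => Homot.mul_add hmul (c m) (c n) (c l) hadd (hK 3)
  have hright := fun m n l : Fin 3 => Homot.add_mul hmul (c m) (c n) (c l) hadd (hK 3)
  have hassoc := fun m n l : Fin 3 => Homot.mul_assoc hmul (c m) (c n) (c l)
  have s_add := IsSmoothOp.of_smoothVia (SmoothVia.add_gr hadd (hK 2) (c 0) (c 1))
  have a_assoc := (Homot.add_assoc hadd (hK 3) (c 0) (c 1) (c 2)).smoothlyHomotopic
  have a_comm := (Homot.add_comm hadd (hK 2) (c 0) (c 1)).smoothlyHomotopic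
  have a_zero := (Homot.add_zero hadd (hK 1) (c 0) hzero).smoothlyHomotopic
  have zero_a := (Homot.zero_add hadd (hK 1) (c 0) hzero).smoothlyHomotopic
  have a_neg := Homot.add_neg hadd (hK 1) (c 0) hzero hneg (hN 1)
  have neg_a := ((Homot.add_comm hadd (hK 1) sneg (c 0)).trans a_neg).smoothlyHomotopic
  exact ⟨{ smooth_add := s_add
           smooth_mul := .of_smoothVia (SmoothVia.mul_gr hmul (c 0) (c 1))
           smooth_neg := .of_smoothVia sneg
           add_assoc := a_assoc
           add_comm := a_comm
           add_zero := a_zero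
           zero_add := zero_a
           add_neg := a_neg.smoothlyHomotopic
           neg_add := neg_a
           mul_assoc := (hassoc 0 1 2).smoothlyHomotopic
           mul_comm := (hcomm 0 1).smoothlyHomotopic
           mul_add := (hleft 0 1 2).smoothlyHomotopic
           add_mul := (hright 0 1 2).smoothlyHomotopic },
    { smooth_add := s_add
      smooth_mul := .of_smoothVia (SmoothVia.mul_gr hmul (c 1) (c 0))
      smooth_neg := .of_smoothVia sneg
      add_assoc := a_assoc
      add_comm := a_comm
      add_zero := a_zero
      zero_add := zero_a
      add_neg := a_neg.smoothlyHomotopic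
      neg_add := neg_a
      mul_assoc := (hassoc 2 1 0).symm.smoothlyHomotopic
      mul_comm := (hcomm 1 0).smoothlyHomotopic
      mul_add := (hright 1 2 0).smoothlyHomotopic
      add_mul := (hleft 2 0 1).smoothlyHomotopic }⟩

theorem isSmoothHUnit_of_dop {θ₃ : BlockIdx × BlockIdx → ℕ} {θ₄ : Fin 1 → ℕ}
    (hθ₃ : IsTempered θ₃) (hθ₄ : IsTempered θ₄) {mul : Gr 𝔄 → Gr 𝔄 → Gr 𝔄} {one : Gr 𝔄} {e : 𝔄}
    (he : ∀ x, e * x = x)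
    (hmul : ∀ a b, (mul a b).dop = mulEmb hθ₃ b ∘L RapidFun.tens a.dop b.dop ∘L mulEmbT hθ₃ b)
    (hone : one.dop = regEmb hθ₄ 0 ∘L unitOp e ∘L regEmbT hθ₄ 0) :
    IsSmoothHUnit mul one ∧ IsSmoothHUnit (fun a b => mul b a) one := by
  have h1 := Homot.one_mul hmul (smoothVia_coord (k := 1) 0) hθ₄ he hone
  have h2 := (homot_mul_comm hmul (smoothVia_coord (k := 1) 0) (SmoothVia.const one)).trans h1
  exact ⟨⟨h1.smoothlyHomotopic, h2.smoothlyHomotopic⟩, ⟨h2.smoothlyHomotopic, h1.smoothlyHomotopic⟩⟩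

theorem exists_isCommSmoothHRing {θ₁ : BlockIdx ⊕ BlockIdx → ℕ} {θ₂ : BlockIdx → ℕ}
    {θ₃ : BlockIdx × BlockIdx → ℕ} {θ₄ : Fin 1 → ℕ} (side : ProductSide) (hθ₁ : IsTempered θ₁)
    (hθ₂ : IsTempered θ₂) (hθ₃ : IsTempered θ₃) (hθ₄ : IsTempered θ₄) :
    ∃ (add mul : Gr 𝔄 → Gr 𝔄 → Gr 𝔄) (neg : Gr 𝔄 → Gr 𝔄) (zero : Gr 𝔄),
      (∀ a b, (add a b).mat = regRelabel θ₁ (pairSum a.pair b.pair)) ∧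
      (∀ a, (neg a).mat = regRelabel θ₂ (pairInv a.pair)) ∧
      zero.mat = baseMat (Unitization ℝ 𝔄) ℕ ∧
      (∀ a b, (mul a b).mat = regRelabel θ₃ (pairProd side a.pair b.pair)) ∧
      IsCommSmoothHRing add mul neg zero ∧
      ∀ e : 𝔄, (∀ x, e * x = x) → ∃ one : Gr 𝔄,
        one.mat = regRelabel θ₄ (pairOne (e : Unitization ℝ 𝔄)) ∧ IsSmoothHUnit mul one := by
  obtain ⟨add, neg, zero, hadd, hneg, hzero, hadd', hneg', hzero'⟩ :=
    exists_add_group (𝔄 := 𝔄) hθ₁ hθ₂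
  cases side with
  | left =>
    choose mul hmul hmul' using Gr.exists_mul (𝔄 := 𝔄) hθ₃
    refine ⟨add, mul, neg, zero, hadd, hneg, hzero, hmul,
      (isCommSmoothHRing_of_dop hθ₁ hθ₂ hθ₃ hadd' hneg' hzero' hmul').1, fun e he => ?_⟩
    obtain ⟨one, hone, hone'⟩ := Gr.exists_one hθ₄ he
    exact ⟨one, hone, (isSmoothHUnit_of_dop hθ₃ hθ₄ he hmul' hone').1⟩
  | right =>
    -- The right product along θ₃ is the opposite of the left product along the swapped relabeling.
    have hθ₃' : IsTempered (θ₃ ∘ Prod.swap) := hθ₃.comp .swap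
    choose mul hmul hmul' using Gr.exists_mul (𝔄 := 𝔄) hθ₃'
    refine ⟨add, fun a b => mul b a, neg, zero, hadd, hneg, hzero, fun a b => ?_,
      (isCommSmoothHRing_of_dop hθ₁ hθ₂ hθ₃' hadd' hneg' hzero' hmul').2, fun e he => ?_⟩
    · exact (hmul b a).trans (regRelabel_prod_right hθ₃.injective _ _)
    · obtain ⟨one, hone, hone'⟩ := Gr.exists_one hθ₄ he
      exact ⟨one, hone, (isSmoothHUnit_of_dop hθ₃' hθ₄ he hmul' hone').2⟩

end HRing

/-! ### Conjugation by real matrices -/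

section Conj

variable {Ω Ω' : Type*} [IndexSize Ω] [IndexSize Ω'] [TemperedIndex Ω] [TemperedIndex Ω']

section Module

variable {V : Type*} [AddCommGroup V] [Module ℝ V] [TopologicalSpace V] [IsTopologicalAddGroup V]
  [PolynormableSpace ℝ V] [AbsSummableSpace V] [T2Space V]

/-- The map `A ↦ g A gᵀ`. -/
noncomputable def scalConj (g : temperedKernel Ω' Ω) :
    RapidFun (Ω × Ω) V →L[ℝ] RapidFun (Ω' × Ω') V :=
  scal g ∘L pull .swap ∘L scal g ∘L pull .swap

theorem scalConj_apply (g : temperedKernel Ω' Ω) (A : RapidFun (Ω × Ω) V) (i j : Ω') :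
    scalConj g A (i, j) = ∑' k, g.1 i k • ∑' l, g.1 j l • A (k, l) := rfl

/-- The definition is an iterated sum. Products of the rows i and j of g have polynomial growth on
pairs, so they form a kernel with a single row; this yields unconditional summability over pairs,
and fiberwise summation identifies the two values. -/
theorem hasSum_scalConj (g : temperedKernel Ω' Ω) (A : RapidFun (Ω × Ω) V) (i j : Ω') :
    HasSum (fun z : Ω × Ω => (g.1 i z.1 * g.1 j z.2) • A z) (scalConj g A (i, j)) := by
  have := (PolynormableSpace.withSeminorms ℝ V).continuousSMul
  obtain ⟨C, k, hC⟩ := g.2 0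
  let h : temperedKernel (Fin 1) (Ω × Ω) := ⟨fun _ z => g.1 i z.1 * g.1 j z.2, fun n =>
    ⟨C * C, k + k, fun a z => by
      have h1 := hC i z.1
      have h2 := hC j z.2
      rw [pow_zero, one_mul] at h1 h2
      have h0 : 0 ≤ C := nonneg_of_mul_nonneg_left ((abs_nonneg _).trans h1) (pow_pos (wt_pos z.1) k)
      have ha : wt a = 1 := by simp [wt, IndexSize.size]
      rw [ha, one_pow, one_mul, abs_mul, pow_add]
      calc _ ≤ (C * wt z.1 ^ k) * (C * wt z.2 ^ k) :=
            mul_le_mul h1 h2 (abs_nonneg _) ((abs_nonneg _).trans h1)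
        _ = C * C * (wt z.1 ^ k * wt z.2 ^ k) := by ring
        _ ≤ _ := mul_le_mul_of_nonneg_left (mul_le_mul
            (pow_le_pow_left₀ (wt_pos _).le (wt_le_wt_prod_left z.1 z.2) k)
            (pow_le_pow_left₀ (wt_pos _).le (wt_le_wt_prod_right z.1 z.2) k)
            (pow_nonneg (wt_pos _).le _) (pow_nonneg (wt_pos _).le _)) (mul_nonneg h0 h0)⟩⟩
  have hs : Summable fun z : Ω × Ω => (g.1 i z.1 * g.1 j z.2) • A z :=
    summable_smul h (pull isTempered_fst_fin_one A) 0 (0 : Fin 1)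
  have h1 := hs.hasSum.prod_fiberwise (g := fun x => g.1 i x • ∑' l, g.1 j l • A (x, l)) fun x => by
    simp only [mul_smul]
    exact (summable_smul g (pull .swap A) j x).hasSum.const_smul _
  rw [scalConj_apply, h1.tsum_eq]
  exact hs.hasSum

end Module

variable {𝔄 : Type w} [NonUnitalCommRing 𝔄] [Module ℝ 𝔄] [IsScalarTower ℝ 𝔄 𝔄]
  [SMulCommClass ℝ 𝔄 𝔄] [TopologicalSpace 𝔄] [IsTopologicalRing 𝔄] [ContinuousSMul ℝ 𝔄]
  [PolynormableSpace ℝ 𝔄] [T2Space 𝔄] [AbsSummableSpace 𝔄]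

variable (𝔄) in
/-- The operator of a real matrix. -/
noncomputable def kerOp (g : temperedKernel Ω' Ω) : Opr 𝔄 Ω Ω' :=
  mkOp (pull isTempered_mk_fin_one ∘L scal g ∘L pull isTempered_fst_fin_one) fun c f ω => by
    refine Eq.trans (tsum_congr fun j => ?_)
      ((summable_smul g (pull isTempered_fst_fin_one f) ω (0 : Fin 1)).tsum_mul_left c)
    exact (mul_smul_comm _ _ _).symm

theorem kerOp_apply (g : temperedKernel Ω' Ω) (f : RapidFun Ω (Unitization ℝ 𝔄)) (i : Ω') :
    kerOp 𝔄 g f i = ∑' j, g.1 i j • f j := rfl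

theorem kerOp_single (g : temperedKernel Ω' Ω) (i : Ω') (j : Ω) :
    kerOp 𝔄 g (single j) i = algebraMap ℝ _ (g.1 i j) := by
  rw [kerOp_apply, tsum_eq_single j fun k hk => by rw [single_ne hk, smul_zero], single_self,
    Algebra.algebraMap_eq_smul_one]

theorem kerOp_comp_op {Ξ : Type*} [IndexSize Ξ] [TemperedIndex Ξ] (g : temperedKernel Ω' Ω)
    (A : RapidFun (Ω × Ξ) 𝔄) : kerOp 𝔄 g ∘L op A = op (scal g A) :=
  op_ext fun i j => by
    have h := (inrCLM 𝔄).map_tsum (summable_smul g A i j)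
    rw [op_single, scal_apply, ContinuousLinearMap.comp_apply, kerOp_apply]
    refine Eq.trans (tsum_congr fun k => ?_) h.symm
    rw [op_single, map_smul]
    rfl

theorem kmul_pull_swap {Ξ : Type*} [IndexSize Ξ] (A : RapidFun (Ω' × Ω) 𝔄)
    (B : RapidFun (Ω × Ξ) 𝔄) :
    kmul (pull .swap B) (pull .swap A) = pull .swap (kmul A B) :=
  RapidFun.ext fun z => by
    rw [kmul_apply, pull_apply, kmul_apply]
    exact tsum_congr fun k => mul_comm _ _

/-- The columns of a real matrix are finite and orthonormal. -/
def HasOrthonormalColumns (g : temperedKernel Ω' Ω) : Prop := open Classical in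
  ∀ n, ∃ s : Finset Ω', (∀ k ∉ s, g.1 k n = 0) ∧
    ∀ l, ∑ k ∈ s, g.1 k n * g.1 k l = if l = n then 1 else 0

/-- This is (A gᵀ) g = A. As column n of g is finite, the sum over its rows may be taken inside the
infinite sum of A gᵀ, where orthonormality leaves only the term l = n. -/
theorem HasOrthonormalColumns.op_comp_kerOp {Ξ : Type*} [IndexSize Ξ] [TemperedIndex Ξ]
    {g : temperedKernel Ω' Ω} (hg : HasOrthonormalColumns g) (A : RapidFun (Ξ × Ω) 𝔄) :
    (op (pull .swap (scal g (pull .swap A))) : Opr 𝔄 Ω' Ξ) ∘L kerOp 𝔄 g = op A := by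
  classical
  refine op_ext fun i n => ?_
  obtain ⟨s, hs, hs'⟩ := hg n
  have e : ∑ k ∈ s, g.1 k n • (∑' l, g.1 k l • A (i, l)) = A (i, n) := by
    have h1 : ∀ k ∈ s, HasSum (fun l => g.1 k n • g.1 k l • A (i, l))
        (g.1 k n • ∑' l, g.1 k l • A (i, l)) := fun k _ =>
      (summable_smul g (pull .swap A) k i).hasSum.const_smul _
    rw [← (hasSum_sum h1).tsum_eq, tsum_eq_single n]
    · simp only [smul_smul, ← Finset.sum_smul]
      rw [hs', if_pos rfl, one_smul]
    · intro l hl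
      simp only [smul_smul, ← Finset.sum_smul]
      rw [hs', if_neg hl, zero_smul]
  rw [ContinuousLinearMap.comp_apply, op_single, ← e]
  refine (kop_apply _ _ _).trans ?_
  rw [tsum_eq_sum (s := s) fun k hk => by
    rw [kerOp_single, hs k hk, map_zero, mul_zero]]
  refine Eq.trans (Finset.sum_congr rfl fun k _ => ?_) (map_sum (inrCLM 𝔄) _ s).symm
  rw [kerOp_single, mul_comm, ← Algebra.smul_def, map_smul]
  rfl

/-- In (g A gᵀ)(g B gᵀ) the inner factors cancel against A by `op_comp_kerOp`. The remaining A (B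
gᵀ) = (A B) gᵀ is obtained by transposition, which reverses products since the algebra is
commutative. -/
theorem HasOrthonormalColumns.kmul_scalConj {g : temperedKernel Ω' Ω}
    (hg : HasOrthonormalColumns g) (A B : RapidFun (Ω × Ω) 𝔄) :
    kmul (scalConj g A) (scalConj g B) = scalConj g (kmul A B) := by
  have e : kmul A (pull .swap (scal g (pull .swap B))) =
      pull .swap (scal g (pull .swap (kmul A B))) := by
    rw [← kmul_pull_swap A B]
    have h : scal g (kmul (pull .swap B) (pull .swap A)) =
        kmul (scal g (pull .swap B)) (pull .swap A) := by
      refine op_injective ?_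
      rw [← kerOp_comp_op, op_comp, op_comp, ← kerOp_comp_op, ContinuousLinearMap.comp_assoc]
    rw [h, ← kmul_pull_swap]
    rfl
  refine op_injective ?_
  have h : ∀ A : RapidFun (Ω × Ω) 𝔄, op (scalConj g A) =
      kerOp 𝔄 g ∘L op (pull .swap (scal g (pull .swap A))) := fun A => (kerOp_comp_op _ _).symm
  rw [op_comp, h, h, h, ← e, op_comp]
  conv_rhs => rw [← hg.op_comp_kerOp A]
  simp only [ContinuousLinearMap.comp_assoc]

end Conj

/-! ### The matrices `C(θ)` -/

section Rot

theorem deriv_sin_pow_mul_cos_pow (a b : ℕ) :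
    (deriv fun θ : ℝ => Real.sin θ ^ a * Real.cos θ ^ b) = fun θ =>
      (a : ℝ) * (Real.sin θ ^ (a - 1) * Real.cos θ ^ (b + 1)) -
        (b : ℝ) * (Real.sin θ ^ (a + 1) * Real.cos θ ^ (b - 1)) := by
  funext θ
  refine (((Real.hasDerivAt_sin θ).pow a).mul ((Real.hasDerivAt_cos θ).pow b)).deriv.trans ?_
  simp only [Pi.pow_apply]
  ring

theorem contDiff_sin_pow_mul_cos_pow (a b : ℕ) {n : WithTop ℕ∞} :
    ContDiff ℝ n fun θ : ℝ => Real.sin θ ^ a * Real.cos θ ^ b :=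
  (Real.contDiff_sin.pow a).mul (Real.contDiff_cos.pow b)

/-- The derivative of a monomial of degree d is a combination of monomials of the same degree with
coefficients a and -b, whose absolute values add up to d. -/
theorem abs_iteratedDeriv_sin_pow_mul_cos_pow_le (d j : ℕ) : ∀ a b : ℕ, a + b = d → ∀ θ : ℝ,
    |iteratedDeriv j (fun θ : ℝ => Real.sin θ ^ a * Real.cos θ ^ b) θ| ≤ (d : ℝ) ^ j := by
  induction j with
  | zero =>
    intro a b _ θ
    rw [iteratedDeriv_zero, pow_zero, abs_mul, abs_pow, abs_pow]
    exact mul_le_one₀ (pow_le_one₀ (abs_nonneg _) (Real.abs_sin_le_one θ)) (by positivity)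
      (pow_le_one₀ (abs_nonneg _) (Real.abs_cos_le_one θ))
  | succ j ih =>
    intro a b hab θ
    have h1 : |(a : ℝ) * iteratedDeriv j
        (fun θ : ℝ => Real.sin θ ^ (a - 1) * Real.cos θ ^ (b + 1)) θ| ≤ a * (d : ℝ) ^ j := by
      -- For a = 0 the truncated exponent a - 1 spoils the degree, but the coefficient vanishes.
      rcases Nat.eq_zero_or_pos a with rfl | ha
      · simp
      · rw [abs_mul, Nat.abs_cast]
        exact mul_le_mul_of_nonneg_left (ih _ _ (by omega) θ) (Nat.cast_nonneg _)
    have h2 : |(b : ℝ) * iteratedDeriv j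
        (fun θ : ℝ => Real.sin θ ^ (a + 1) * Real.cos θ ^ (b - 1)) θ| ≤ b * (d : ℝ) ^ j := by
      rcases Nat.eq_zero_or_pos b with rfl | hb
      · simp
      · rw [abs_mul, Nat.abs_cast]
        exact mul_le_mul_of_nonneg_left (ih _ _ (by omega) θ) (Nat.cast_nonneg _)
    rw [iteratedDeriv_succ', deriv_sin_pow_mul_cos_pow, iteratedDeriv_fun_sub
      ((contDiff_const.mul (contDiff_sin_pow_mul_cos_pow _ _)).contDiffAt)
      ((contDiff_const.mul (contDiff_sin_pow_mul_cos_pow _ _)).contDiffAt),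
      iteratedDeriv_const_mul_field, iteratedDeriv_const_mul_field]
    refine (abs_sub _ _).trans ((add_le_add h1 h2).trans (le_of_eq ?_))
    rw [← add_mul, ← Nat.cast_add, hab, pow_succ, mul_comm]

/-- A uniform description of the three cases in the definition of C(θ), sufficient for all
estimates. -/
theorem exists_rotMat_eq (m n : ℕ) : ∃ (c : ℝ) (a b : ℕ), |c| ≤ 1 ∧ a + b ≤ n + 1 ∧
    (n + 1 < m → c = 0) ∧
    ∀ θ, rotMat θ m n = c * (Real.sin θ ^ a * Real.cos θ ^ b) := by
  rcases m with - | m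
  · exact ⟨1, n, 1, by simp, le_rfl, fun h => by omega, fun θ => by simp [rotMat]⟩
  · rcases lt_trichotomy n m with h | rfl | h
    · exact ⟨0, 0, 0, by simp, by omega, fun _ => rfl, fun θ => by simp [rotMat, h]⟩
    · exact ⟨-1, 1, 0, by simp, by omega, fun h => by omega, fun θ => by simp [rotMat]⟩
    · exact ⟨1, n - (m + 1), 2, by simp, by omega, fun h => by omega, fun θ => by
        simp [rotMat, h.not_gt, h.ne']⟩

theorem contDiff_rotMat (m n : ℕ) {k : WithTop ℕ∞} : ContDiff ℝ k fun θ => rotMat θ m n := by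
  obtain ⟨c, a, b, -, -, -, h⟩ := exists_rotMat_eq m n
  simp only [h]
  exact contDiff_const.mul (contDiff_sin_pow_mul_cos_pow a b)

/-- A nonzero entry has m ≤ n + 1, so its row weight is at most twice its column weight; and its
degree is at most the column weight, so each derivative costs one power. -/
theorem rotMat_bound (j k : ℕ) (θ : ℝ) (m n : ℕ) :
    wt m ^ k * |iteratedDeriv j (fun θ => rotMat θ m n) θ| ≤ 2 ^ k * wt n ^ (k + j) := by
  obtain ⟨c, a, b, hc, hab, hc0, h⟩ := exists_rotMat_eq m n
  have hn : (0 : ℝ) ≤ n := Nat.cast_nonneg n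
  simp only [h]
  rw [iteratedDeriv_const_mul_field, abs_mul]
  by_cases hm : n + 1 < m
  · rw [hc0 hm, abs_zero, zero_mul, mul_zero]
    exact mul_nonneg (by positivity) (pow_nonneg (wt_pos n).le _)
  have hm' : (m : ℝ) ≤ n + 1 := by exact_mod_cast not_lt.1 hm
  have hw : wt m ≤ 2 * wt n := by
    simp only [wt, IndexSize.size]
    linarith
  have h1 := abs_iteratedDeriv_sin_pow_mul_cos_pow_le (a + b) j a b rfl θ
  have h2 : ((a + b : ℕ) : ℝ) ≤ wt n := by
    have : ((a + b : ℕ) : ℝ) ≤ ((n + 1 : ℕ) : ℝ) := Nat.cast_le.2 hab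
    refine this.trans (le_of_eq ?_)
    simp only [wt, IndexSize.size]
    push_cast
    ring
  calc _ ≤ (2 * wt n) ^ k * (1 * wt n ^ j) :=
        mul_le_mul (pow_le_pow_left₀ (wt_pos m).le hw k)
          (mul_le_mul hc (h1.trans (pow_le_pow_left₀ (Nat.cast_nonneg _) h2 j)) (abs_nonneg _)
            zero_le_one) (by positivity) (pow_nonneg (mul_nonneg zero_le_two (wt_pos n).le) _)
    _ = _ := by rw [one_mul, mul_pow, pow_add, mul_assoc]

/-- The derivatives of the matrices `C(θ)`. -/
noncomputable def rotKernel (j : ℕ) (θ : ℝ) : temperedKernel ℕ ℕ :=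
  ⟨fun m n => iteratedDeriv j (fun θ => rotMat θ m n) θ, fun k =>
    ⟨2 ^ k, k + j, rotMat_bound j k θ⟩⟩

theorem rotKernel_zero (θ : ℝ) (m n : ℕ) : (rotKernel 0 θ).1 m n = rotMat θ m n :=
  congrFun iteratedDeriv_zero θ

theorem isKernelJet_rotKernel : IsKernelJet rotKernel where
  deriv j θ m n := by
    have h : Differentiable ℝ (iteratedDeriv j fun θ => rotMat θ m n) :=
      (contDiff_rotMat m n).differentiable_iteratedDeriv' j
    have h' := (h θ).hasDerivAt
    rw [← iteratedDeriv_succ] at h'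
    exact h'
  bound j k := ⟨2 ^ k, k + j, by positivity, rotMat_bound j k⟩

/-- With t = sin θ and s = cos θ, the rows 1, …, m contribute s⁴ t^(n-m) times a geometric sum in
t², that is, s² t^(n-m) (1 - t^(2m)). Row 0 contributes s² t^(m+n) and row m + 1 contributes -s²
t^(n-m), so the total is 0. -/
theorem sum_rotMat_mul_of_lt {θ : ℝ} {m n : ℕ} (h : m < n) :
    ∑ k ∈ Finset.range (m + 2), rotMat θ k m * rotMat θ k n = 0 := by
  obtain ⟨d, rfl⟩ := Nat.exists_eq_add_of_lt h
  rw [Finset.sum_range_succ', Finset.sum_range_succ]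
  have h1 : ∀ k ∈ Finset.range m, rotMat θ (k + 1) m * rotMat θ (k + 1) (m + d + 1) =
      Real.cos θ ^ 4 * Real.sin θ ^ (d + 1) * (Real.sin θ ^ 2) ^ (m - 1 - k) := fun k hk => by
    have hk := Finset.mem_range.1 hk
    obtain ⟨e, rfl⟩ := Nat.exists_eq_add_of_lt hk
    have e1 : k + e + 1 - (k + 1) = e := by omega
    have e2 : k + e + 1 + d + 1 - (k + 1) = e + (d + 1) := by omega
    have e3 : k + e + 1 - 1 - k = e := by omega
    simp only [rotMat, Matrix.of_apply]
    rw [if_neg (by omega), if_neg (by omega), if_neg (by omega), if_neg (by omega), e1, e2, e3]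
    ring
  rw [Finset.sum_congr rfl h1, ← Finset.mul_sum,
    Finset.sum_range_reflect (fun k => (Real.sin θ ^ 2) ^ k) m]
  have h2 := geom_sum_mul_neg (Real.sin θ ^ 2) m
  have h3 : 1 - Real.sin θ ^ 2 = Real.cos θ ^ 2 := by rw [← Real.cos_sq_add_sin_sq θ]; ring
  rw [h3] at h2
  have e1 : m + d + 1 - (m + 1) = d := by omega
  simp only [rotMat, Matrix.of_apply, lt_irrefl, if_true, if_false]
  rw [if_neg (by omega), if_neg (by omega), e1]
  have h4 : Real.cos θ ^ 4 * Real.sin θ ^ (d + 1) * ∑ k ∈ Finset.range m, (Real.sin θ ^ 2) ^ k =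
      Real.cos θ ^ 2 * Real.sin θ ^ (d + 1) * (1 - (Real.sin θ ^ 2) ^ m) := by
    rw [← h2]; ring
  rw [h4]
  ring

theorem sum_rotMat_mul_self (θ : ℝ) (m : ℕ) :
    ∑ k ∈ Finset.range (m + 2), rotMat θ k m * rotMat θ k m = 1 := by
  rw [Finset.sum_range_succ', Finset.sum_range_succ]
  have h1 : ∀ k ∈ Finset.range m, rotMat θ (k + 1) m * rotMat θ (k + 1) m =
      Real.cos θ ^ 4 * (Real.sin θ ^ 2) ^ (m - 1 - k) := fun k hk => by
    have hk := Finset.mem_range.1 hk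
    obtain ⟨e, rfl⟩ := Nat.exists_eq_add_of_lt hk
    have e1 : k + e + 1 - (k + 1) = e := by omega
    have e3 : k + e + 1 - 1 - k = e := by omega
    simp only [rotMat, Matrix.of_apply]
    rw [if_neg (by omega), if_neg (by omega), e1, e3]
    ring
  rw [Finset.sum_congr rfl h1, ← Finset.mul_sum,
    Finset.sum_range_reflect (fun k => (Real.sin θ ^ 2) ^ k) m]
  have h2 := geom_sum_mul_neg (Real.sin θ ^ 2) m
  have h3 : 1 - Real.sin θ ^ 2 = Real.cos θ ^ 2 := by rw [← Real.cos_sq_add_sin_sq θ]; ring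
  rw [h3] at h2
  simp only [rotMat, Matrix.of_apply, lt_irrefl, if_true, if_false]
  have h4 : Real.cos θ ^ 4 * ∑ k ∈ Finset.range m, (Real.sin θ ^ 2) ^ k =
      Real.cos θ ^ 2 * (1 - (Real.sin θ ^ 2) ^ m) := by
    rw [← h2]; ring
  rw [h4]
  linear_combination Real.cos_sq_add_sin_sq θ

theorem rotMat_eq_zero {θ : ℝ} {m n : ℕ} (h : n + 1 < m) : rotMat θ m n = 0 := by
  obtain ⟨c, a, b, -, -, hc0, h'⟩ := exists_rotMat_eq m n
  rw [h', hc0 h, zero_mul]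

theorem hasOrthonormalColumns_rotKernel (θ : ℝ) : HasOrthonormalColumns (rotKernel 0 θ) := by
  intro n
  -- The last possibly nonzero entry of column n lies in row n + 1.
  refine ⟨Finset.range (n + 2), fun k hk => ?_, fun l => ?_⟩
  · rw [rotKernel_zero]
    exact rotMat_eq_zero (by rw [Finset.mem_range] at hk; omega)
  · simp only [rotKernel_zero]
    rcases lt_trichotomy l n with h | rfl | h
    · rw [if_neg h.ne, ← sum_rotMat_mul_of_lt (θ := θ) h]
      refine Eq.symm (Finset.sum_subset_zero_on_sdiff (Finset.range_subset_range.2 (by omega))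
        (fun k hk => ?_) fun k _ => mul_comm _ _)
      rw [Finset.mem_sdiff, Finset.mem_range, Finset.mem_range] at hk
      rw [rotMat_eq_zero (m := k) (n := l) (by omega), mul_zero]
    · rw [if_pos rfl, sum_rotMat_mul_self]
    · rw [if_neg h.ne', sum_rotMat_mul_of_lt h]

theorem rotMat_zero (m n : ℕ) : rotMat 0 m n = if m = n then 1 else 0 := by
  rcases m with - | m
  · rcases n with - | n <;> simp [rotMat]
  · rcases lt_trichotomy n m with h | rfl | h
    · simp [rotMat, h]
      omega
    · simp [rotMat]
    · obtain ⟨e, rfl⟩ := Nat.exists_eq_add_of_lt h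
      rcases e with - | e
      · simp [rotMat]
      · have e1 : m + (e + 1) + 1 - (m + 1) = e + 1 := by omega
        simp [rotMat, e1]

theorem rotMat_pi_div_two_zero (n : ℕ) : rotMat (Real.pi / 2) 0 n = 0 := by simp [rotMat]

theorem rotMat_pi_div_two_succ (m n : ℕ) :
    rotMat (Real.pi / 2) (m + 1) n = if n = m then -1 else 0 := by
  simp only [rotMat, Matrix.of_apply]
  split_ifs with h h' h'
  · omega
  · rfl
  · simp
  · simp

end Rot

/-! ### The stabilizing homotopy through C(θ) -/

section RotHomotopy

variable {𝔄 : Type w} [NonUnitalCommRing 𝔄] [Module ℝ 𝔄] [IsScalarTower ℝ 𝔄 𝔄]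
  [SMulCommClass ℝ 𝔄 𝔄] [TopologicalSpace 𝔄] [IsTopologicalRing 𝔄] [ContinuousSMul ℝ 𝔄]
  [PolynormableSpace ℝ 𝔄] [T2Space 𝔄] [AbsSummableSpace 𝔄]

theorem mmul_toMatrix_iff {Ω : Type*} [IndexSize Ω] [TemperedIndex Ω] {A B D : RapidMat Ω 𝔄} :
    mmul A.toMatrix B.toMatrix = D.toMatrix ↔
      kmul (RapidMat.toFunL A) (RapidMat.toFunL B) = RapidMat.toFunL D := by
  constructor
  · intro h
    exact RapidFun.ext fun z => (kmul_apply _ _ z).trans (congrFun (congrFun h z.1) z.2)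
  · intro h
    ext1 i j
    exact (kmul_apply _ _ (i, j)).symm.trans (congrArg (fun f : RapidFun (Ω × Ω) 𝔄 => f (i, j)) h)

theorem exists_rot_homotopy (hpi : 0 ≤ Real.pi / 2) :
    ∃ T : RapidMat ℕ 𝔄 × Set.Icc (0 : ℝ) (Real.pi / 2) → RapidMat ℕ 𝔄,
      (∀ (A : RapidMat ℕ 𝔄) (θ : Set.Icc (0 : ℝ) (Real.pi / 2)) (m n : ℕ),
        HasSum (fun x : ℕ × ℕ => (rotMat θ m x.1 * rotMat θ n x.2) • A.toMatrix x.1 x.2)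
          ((T (A, θ)).toMatrix m n)) ∧
      IsStabilizingHomotopy hpi (fun n => n + 1) T := by
  let S : RapidMat ℕ 𝔄 → ℝ → RapidMat ℕ 𝔄 := fun A θ =>
    RapidMat.toFunL.symm (scalConj (rotKernel 0 θ) (RapidMat.toFunL A))
  have hS : ∀ A θ, RapidMat.toFunL (S A θ) = scalConj (rotKernel 0 θ) (RapidMat.toFunL A) :=
    fun A θ => RapidMat.toFunL.apply_symm_apply _
  have hsum : ∀ A θ m n, HasSum (fun x : ℕ × ℕ =>
      (rotMat θ m x.1 * rotMat θ n x.2) • A.toMatrix x.1 x.2) ((S A θ).toMatrix m n) :=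
    fun A θ m n => by
      have h := hasSum_scalConj (rotKernel 0 θ) (RapidMat.toFunL A) m n
      simp only [rotKernel_zero] at h
      exact h
  have hsm : SmoothVia (fun x => (x.1, (x.2 : ℝ)) :
      RapidMat ℕ 𝔄 × Set.Icc (0 : ℝ) (Real.pi / 2) → RapidMat ℕ 𝔄 × ℝ)
      (fun A : RapidMat ℕ 𝔄 => A) fun z => S z.1 z.2 := by
    let i : RapidMat ℕ 𝔄 × Set.Icc (0 : ℝ) (Real.pi / 2) → RapidMat ℕ 𝔄 × ℝ :=
      fun x => (x.1, (x.2 : ℝ))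
    have ht : SmoothVia i id fun z => (z.2 : ℝ) :=
      SmoothVia.of_global (j := (id : ℝ → ℝ))
        (BastianiSmooth.of_clm (ContinuousLinearMap.snd ℝ (RapidMat ℕ 𝔄) ℝ)) fun _ => rfl
    have hA : SmoothVia i id fun z => (pull .swap (RapidMat.toFunL z.1) : RapidFun (ℕ × ℕ) 𝔄) :=
      SmoothVia.of_global (j := (id : RapidFun (ℕ × ℕ) 𝔄 → RapidFun (ℕ × ℕ) 𝔄))
        (BastianiSmooth.of_clm ((pull .swap ∘L
          (RapidMat.toFunL : RapidMat ℕ 𝔄 ≃L[ℝ] RapidFun (ℕ × ℕ) 𝔄).toContinuousLinearMap) ∘L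
          ContinuousLinearMap.fst ℝ (RapidMat ℕ 𝔄) ℝ)) fun _ => rfl
    -- Conjugation consists of two scalar actions on the first index, separated by transpositions;
    -- each action is jointly smooth in matrix and angle.
    have h1 := ((hA.prodMk ht).map isKernelJet_rotKernel.smooth_scal).clm
      (pull (V := 𝔄) (IsTempered.swap (Ω := ℕ) (Ξ := ℕ)))
    have h2 := ((h1.prodMk ht).map isKernelJet_rotKernel.smooth_scal).clm
      (RapidMat.toFunL (Ω := ℕ) (𝔄 := 𝔄)).symm.toContinuousLinearMap
    exact h2
  refine ⟨fun z => S z.1 z.2, fun A θ m n => hsum A θ m n, ?_, hsm, fun A B t => ?_, fun a A t => ?_,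
    fun A B D h t => ?_, fun A => ?_, fun A => ?_⟩
  · exact hsm.continuous (continuous_fst.prodMk (continuous_subtype_val.comp continuous_snd))
      Topology.IsInducing.id
  · simp only [S, map_add]
  · simp only [S, map_smul]
  · rw [mmul_toMatrix_iff] at h ⊢
    rw [hS, hS, hS, (hasOrthonormalColumns_rotKernel t).kmul_scalConj, h]
  · refine RapidMat.toFunL.injective (RapidFun.ext fun z => ?_)
    refine (hsum A 0 z.1 z.2).unique ?_
    have e : (fun x : ℕ × ℕ => (rotMat 0 z.1 x.1 * rotMat 0 z.2 x.2) • A.toMatrix x.1 x.2) =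
        fun x => if x = z then A.toMatrix z.1 z.2 else 0 := by
      funext x
      rw [rotMat_zero, rotMat_zero]
      by_cases hx : x = z
      · simp [hx]
      · rw [if_neg hx]
        by_cases h1 : z.1 = x.1
        · have h2 : z.2 ≠ x.2 := fun h2 => hx (Prod.ext h1.symm h2.symm)
          rw [if_neg h2, mul_zero, zero_smul]
        · rw [if_neg h1, zero_mul, zero_smul]
    rw [e]
    exact hasSum_ite_eq z _
  -- C(π/2) is the negative of the shift; the sign occurs twice in the conjugation and cancels.
  · ext1 m n
    refine (hsum A (Real.pi / 2) m n).unique ?_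
    rcases m with - | m
    · have h0 : relabel (fun n => n + 1) A.toMatrix 0 n = 0 := by
        rw [relabel, Matrix.of_apply, Function.extend_apply']
        · rfl
        · rintro ⟨z, hz⟩
          exact Nat.succ_ne_zero _ (congrArg Prod.fst hz)
      rw [h0]
      simp only [rotMat_pi_div_two_zero, zero_mul, zero_smul]
      exact hasSum_zero
    rcases n with - | n
    · have h0 : relabel (fun n => n + 1) A.toMatrix (m + 1) 0 = 0 := by
        rw [relabel, Matrix.of_apply, Function.extend_apply']
        · rfl
        · rintro ⟨z, hz⟩
          exact Nat.succ_ne_zero _ (congrArg Prod.snd hz)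
      rw [h0]
      simp only [rotMat_pi_div_two_zero, mul_zero, zero_smul]
      exact hasSum_zero
    have h0 : relabel (fun n => n + 1) A.toMatrix (m + 1) (n + 1) = A.toMatrix m n :=
      ((add_left_injective 1).prodMap (add_left_injective 1)).extend_apply
        (fun p => A.toMatrix p.1 p.2) 0 (m, n)
    rw [h0]
    have e : (fun x : ℕ × ℕ => (rotMat (Real.pi / 2) (m + 1) x.1 *
        rotMat (Real.pi / 2) (n + 1) x.2) • A.toMatrix x.1 x.2) =
        fun x => if x = (m, n) then A.toMatrix m n else 0 := by
      funext x
      rw [rotMat_pi_div_two_succ, rotMat_pi_div_two_succ]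
      by_cases hx : x = (m, n)
      · simp [hx]
      · rw [if_neg hx]
        by_cases h1 : x.1 = m
        · have h2 : x.2 ≠ n := fun h2 => hx (Prod.ext h1 h2)
          rw [if_neg h2, mul_zero, zero_smul]
        · rw [if_neg h1, zero_mul, zero_smul]
    rw [e]
    exact hasSum_ite_eq (m, n) _

end RotHomotopy

/-! ### Infinite stabilization -/

section InfiniteStabilization

/-- The map `(i, n) ↦ (i, 2 n)`. -/
def doubleMap (z : BlockIdx) : BlockIdx := (z.1, 2 * z.2)

theorem isTempered_double : IsTempered fun n : ℕ => 2 * n := isTempered_two_mul_add 0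

theorem isTempered_doubleMap : IsTempered doubleMap :=
  .of_le (fun a b h => by
    simp only [doubleMap, Prod.mk.injEq] at h
    exact Prod.ext h.1 (by omega)) 2
    (fun z => by
      rw [wt_blockIdx, wt_blockIdx]
      simp only [doubleMap]
      push_cast
      have : (0 : ℝ) ≤ z.2 := Nat.cast_nonneg _
      linarith) fun z => by
      rw [wt_blockIdx, wt_blockIdx]
      simp only [doubleMap]
      push_cast
      have : (0 : ℝ) ≤ z.2 := Nat.cast_nonneg _
      linarith

theorem isTempered_evenOdd : IsTempered evenOdd :=
  .of_le (fun a b h => by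
    rcases a with a | a <;> rcases b with b | b <;>
      simp only [evenOdd, Sum.elim_inl, Sum.elim_inr, Prod.mk.injEq] at h
    · exact congrArg _ (Prod.ext h.1 (by omega))
    · omega
    · omega
    · exact congrArg _ (Prod.ext h.1 (by omega))) 3
    (fun z => by
      rcases z with z | z <;>
      · have : (0 : ℝ) ≤ z.2 := Nat.cast_nonneg _
        simp only [wt, IndexSize.size, evenOdd, Sum.elim_inl, Sum.elim_inr]
        push_cast
        linarith) fun z => by
      rcases z with z | z <;>
      · have : (0 : ℝ) ≤ z.2 := Nat.cast_nonneg _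
        simp only [wt, IndexSize.size, evenOdd, Sum.elim_inl, Sum.elim_inr]
        push_cast
        linarith

/-- The size of (i, n) is that of n, so the stabilizing path on both blocks runs in each block like
the path on ℕ. -/
theorem stabAngle_doubleMap (t : ℝ) (i : Fin 2) (n : ℕ) :
    stabAngle doubleMap t (i, n) = stabAngle (fun n => 2 * n) t n := by
  have h : doubleMap (i, n) = (i, n) ↔ 2 * n = n := by simp [doubleMap]
  have h2 : (IndexSize.size (i, n) : ℝ) = IndexSize.size n := by simp [IndexSize.size]
  have h3 : stabRate doubleMap (i, n) = stabRate (fun n => 2 * n) n := by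
    simp only [stabRate, h, h2]
    congr
  have h4 : stabShift doubleMap (i, n) = stabShift (fun n => 2 * n) n := by
    simp only [stabShift, h, h2]
    congr
  rw [stabAngle, stabAngle, h3, h4]

variable {𝔄 : Type w} [NonUnitalCommRing 𝔄] [Module ℝ 𝔄] [IsScalarTower ℝ 𝔄 𝔄]
  [SMulCommClass ℝ 𝔄 𝔄] [TopologicalSpace 𝔄] [IsTopologicalRing 𝔄] [ContinuousSMul ℝ 𝔄]
  [PolynormableSpace ℝ 𝔄] [T2Space 𝔄] [AbsSummableSpace 𝔄]

theorem pullOp_pair_comp_stabOp (t : ℝ) (k : Fin 2) :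
    (pullOp (.pair k) ∘L stabOp isTempered_doubleMap t : Opr 𝔄 BlockIdx ℕ) =
      stabOp isTempered_double t ∘L pullOp (.pair k) :=
  ContinuousLinearMap.ext fun f => RapidFun.ext fun n => by
    rw [ContinuousLinearMap.comp_apply, ContinuousLinearMap.comp_apply, pullOp_apply, stabOp_apply,
      stabOp_apply, pullOp_apply, stabAngle_doubleMap]
    congr 1
    rcases Nat.even_or_odd' n with ⟨a, rfl | rfl⟩
    · have h1 := relOp_apply isTempered_doubleMap (stabDiag _ Real.contDiff_sin doubleMap t f) (k, a)
      have h2 := relOp_apply isTempered_double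
        (stabDiag _ Real.contDiff_sin (fun n => 2 * n) t (pullOp (.pair k) f)) a
      refine h1.trans (Eq.trans ?_ h2.symm)
      rw [stabDiag_apply, stabDiag_apply, stabAngle_doubleMap, pullOp_apply]
    · rw [relOp_apply_eq_zero _ _ fun z hz => ?_, relOp_apply_eq_zero _ _ fun z hz => ?_]
      · omega
      · have := congrArg Prod.snd hz
        simp only [doubleMap] at this
        omega

theorem stabOpT_comp_relOp_pair (t : ℝ) (k : Fin 2) :
    (stabOpT isTempered_doubleMap t ∘L relOp (.pair k) : Opr 𝔄 ℕ BlockIdx) =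
      relOp (.pair k) ∘L stabOpT isTempered_double t :=
  ContinuousLinearMap.ext fun f => RapidFun.ext fun ⟨l, n⟩ => by
    rw [ContinuousLinearMap.comp_apply, ContinuousLinearMap.comp_apply, stabOpT_apply,
      stabAngle_doubleMap]
    by_cases h : k = l
    · subst h
      have h1 := relOp_apply (IsTempered.pair k) f n
      have h2 := relOp_apply (IsTempered.pair k) f (2 * n)
      have h3 := relOp_apply (IsTempered.pair k) (stabOpT isTempered_double t f) n
      refine Eq.trans ?_ h3.symm
      rw [stabOpT_apply, ← h1, ← h2]
      rfl
    · have h0 : ∀ (f : RapidFun ℕ (Unitization ℝ 𝔄)) (n : ℕ), relOp (.pair k) f (l, n) = 0 :=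
        fun f n => relOp_apply_eq_zero _ _ fun z hz => h (congrArg Prod.fst hz)
      rw [show doubleMap (l, n) = (l, 2 * n) from rfl, h0, h0, h0, smul_zero, smul_zero, add_zero]

theorem relabel_of_op {r : ℕ → ℕ} (hr : IsTempered r) {A B : RapidMat ℕ 𝔄}
    (h : op (RapidMat.toFunL B) = relOp hr ∘L op (RapidMat.toFunL A) ∘L pullOp hr) :
    B.toMatrix = relabel r A.toMatrix := by
  ext1 m n
  refine Unitization.inr_injective (R := ℝ) ?_
  have h1 := congrFun (congrFun (relabel_mat hr (op (RapidMat.toFunL A))) m) n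
  rw [← h, mat_apply, op_single] at h1
  refine h1.symm.trans ?_
  refine Eq.trans ?_ (Function.apply_extend (g := fun p : ℕ × ℕ => A.toMatrix p.1 p.2)
    (Unitization.inr : 𝔄 → Unitization ℝ 𝔄) (Prod.map r r) 0 (m, n)).symm
  rw [relabel, Matrix.of_apply]
  congr 1
  funext z
  exact op_single _ _ _

/-- Conjugation of A by the path `stabOp`. It is multiplicative at all times because the transposed
path is a left inverse. -/
theorem exists_stab_homotopy : ∃ Hv : RapidMat ℕ 𝔄 × Set.Icc (0 : ℝ) 1 → RapidMat ℕ 𝔄,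
    IsStabilizingHomotopy zero_le_one (fun n => 2 * n) Hv ∧
    ∀ z, op (RapidMat.toFunL (Hv z)) = stabOp isTempered_double z.2 ∘L
      op (RapidMat.toFunL z.1) ∘L stabOpT isTempered_double z.2 := by
  let i : RapidMat ℕ 𝔄 × Set.Icc (0 : ℝ) 1 → RapidMat ℕ 𝔄 × ℝ := timeEmb id
  have hop : SmoothKernel i fun z => op (RapidMat.toFunL z.1) :=
    ⟨fun z => RapidMat.toFunL z.1, SmoothVia.of_global
      (BastianiSmooth.of_clm ((RapidMat.toFunL : RapidMat ℕ 𝔄 ≃L[ℝ] _).toContinuousLinearMap ∘L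
        ContinuousLinearMap.fst ℝ (RapidMat ℕ 𝔄) ℝ)) fun _ => rfl, fun _ => rfl⟩
  have ht : SmoothVia i id fun z => (z.2 : ℝ) := SmoothVia.time contDiff_id
  obtain ⟨δ, hδ, hδ'⟩ := SmoothKernel.sandwich (SmoothMult.stabOp isTempered_double ht) hop
    (SmoothMult.stabOpT isTempered_double ht)
  let T : RapidMat ℕ 𝔄 × Set.Icc (0 : ℝ) 1 → RapidMat ℕ 𝔄 := fun z => RapidMat.toFunL.symm (δ z)
  have hT : ∀ z, op (RapidMat.toFunL (T z)) = stabOp isTempered_double z.2 ∘L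
      op (RapidMat.toFunL z.1) ∘L stabOpT isTempered_double z.2 := fun z => by
    rw [ContinuousLinearEquiv.apply_symm_apply, hδ']
  have hsm : SmoothVia i (fun A : RapidMat ℕ 𝔄 => A) T :=
    hδ.clm (RapidMat.toFunL (Ω := ℕ) (𝔄 := 𝔄)).symm.toContinuousLinearMap
  have hinc : ∀ n : ℕ, 2 * n = n ∨ IndexSize.size n < IndexSize.size (2 * n) := fun n => by
    change _ ∨ n < 2 * n
    omega
  have hinj : ∀ {A B : RapidMat ℕ 𝔄}, op (RapidMat.toFunL A) = op (RapidMat.toFunL B) → A = B :=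
    fun h => RapidMat.toFunL.injective (op_injective h)
  refine ⟨T, ⟨?_, hsm, fun A B t => ?_, fun a A t => ?_, fun A B D h t => ?_, fun A => ?_,
    fun A => ?_⟩, hT⟩
  · exact hsm.continuous (continuous_fst.prodMk (continuous_subtype_val.comp continuous_snd))
      Topology.IsInducing.id
  · refine hinj ?_
    rw [map_add, op_add, hT, hT, hT, map_add, op_add, ContinuousLinearMap.add_comp,
      ContinuousLinearMap.comp_add]
  · refine hinj ?_
    rw [map_smul, op_smul, hT, hT, map_smul, op_smul, ContinuousLinearMap.smul_comp,
      ContinuousLinearMap.comp_smul]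
  · rw [mmul_toMatrix_iff] at h ⊢
    refine op_injective ?_
    have e := stabOpT_comp_stabOp (R := Unitization ℝ 𝔄) isTempered_double hinc t
    rw [op_comp, hT, hT, hT, ← h, op_comp]
    refine ContinuousLinearMap.ext fun f => ?_
    have e' := fun f => congrArg (fun T => T f) e
    simp only [ContinuousLinearMap.comp_apply] at e' ⊢
    rw [e']
    rfl
  · refine hinj ?_
    rw [hT]
    change stabOp isTempered_double 0 ∘L _ ∘L stabOpT isTempered_double 0 = _
    rw [stabOp_zero, stabOpT_zero]
    rfl
  · have h1 := hT (A, ⟨1, zero_le_one, le_rfl⟩)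
    change _ = stabOp isTempered_double 1 ∘L _ ∘L stabOpT isTempered_double 1 at h1
    rw [stabOp_one, stabOpT_one] at h1
    exact relabel_of_op _ h1

/-! ### Infinite stabilization in the Grassmannian -/

section Grassmannian

/-- R₀ is the sum of its copies at the even and at the odd positions. Placing the difference at even
positions therefore changes the even copy into b and leaves the odd copy as it is. -/
theorem Gr.mat_eq_stabMat {a b : Gr 𝔄} (h : a.dop = relOp isTempered_doubleMap ∘L b.dop ∘L
    pullOp isTempered_doubleMap) : a.mat = b.stabMat := by
  rw [Gr.mat_eq, Gr.stabMat, Gr.mat_eq b, ← mat_baseOp, ← mat_osum, relabel_mat isTempered_evenOdd, h]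
  have h1 : relOp isTempered_evenOdd ∘L osum (baseOp 𝔄 + b.dop) (baseOp 𝔄) ∘L
      pullOp isTempered_evenOdd =
        relOp isTempered_doubleMap ∘L (baseOp 𝔄 + b.dop) ∘L pullOp isTempered_doubleMap +
          relOp isTempered_oddMap ∘L baseOp 𝔄 ∘L pullOp isTempered_oddMap := by
    have e1 : ∀ f : RapidFun BlockIdx (Unitization ℝ 𝔄), relOp isTempered_evenOdd (relOp .inl f) =
        relOp isTempered_doubleMap f := relOp_relOp _ _
    have e2 : ∀ f : RapidFun BlockIdx (Unitization ℝ 𝔄), relOp isTempered_evenOdd (relOp .inr f) =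
        relOp isTempered_oddMap f := relOp_relOp _ _
    refine ContinuousLinearMap.ext fun f => ?_
    simp only [osum, ContinuousLinearMap.comp_apply, _root_.add_apply, map_add, e1, e2]
    rfl
  have h2 : (baseOp 𝔄 : Opr 𝔄 BlockIdx BlockIdx) =
      relOp isTempered_doubleMap ∘L baseOp 𝔄 ∘L pullOp isTempered_doubleMap +
        relOp isTempered_oddMap ∘L baseOp 𝔄 ∘L pullOp isTempered_oddMap := by
    refine ContinuousLinearMap.ext fun f => RapidFun.ext fun ⟨k, n⟩ => ?_
    simp only [ContinuousLinearMap.comp_apply, _root_.add_apply, RapidFun.add_apply]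
    rcases Nat.even_or_odd' n with ⟨a, rfl | rfl⟩
    · have h1 := relOp_apply isTempered_doubleMap (baseOp 𝔄 (pullOp isTempered_doubleMap f)) (k, a)
      rw [relOp_apply_eq_zero isTempered_oddMap _ fun z hz => ?_, add_zero]
      · refine Eq.trans ?_ h1.symm
        simp only [baseOp, proj_apply]
        rfl
      · have := congrArg Prod.snd hz
        simp only [oddMap] at this
        omega
    · have h1 := relOp_apply isTempered_oddMap (baseOp 𝔄 (pullOp isTempered_oddMap f)) (k, a)
      rw [relOp_apply_eq_zero isTempered_doubleMap _ fun z hz => ?_, zero_add]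
      · refine Eq.trans ?_ h1.symm
        simp only [baseOp, proj_apply]
        rfl
      · have := congrArg Prod.snd hz
        simp only [doubleMap] at this
        omega
  rw [h1]
  conv_lhs => rw [h2]
  simp only [ContinuousLinearMap.add_comp, ContinuousLinearMap.comp_add]
  rw [add_right_comm]

theorem exists_gr_stab_homotopy :
    ∃ F : (Fin 1 → Gr 𝔄) × Set.Icc (0 : ℝ) 1 → Gr 𝔄, IsSmoothHomotopy F ∧
      ∀ z, (F z).dop = stabOp isTempered_doubleMap z.2 ∘L (z.1 0).dop ∘L
        stabOpT isTempered_doubleMap z.2 := by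
  have hinc : ∀ z, doubleMap z = z ∨ z.2 < (doubleMap z).2 := fun z => by
    rcases Nat.eq_zero_or_pos z.2 with h | h
    · exact Or.inl (Prod.ext rfl (by simp [doubleMap, h]))
    · exact Or.inr (by simp only [doubleMap]; omega)
  have hJ := ((SmoothFrame.of_emb_single (SmoothEmb.one (i := tupleEmb 𝔄 1)
    fun _ => baseOp 𝔄)).stab isTempered_doubleMap (fun _ => rfl) hinc).emb ()
  have hD : SmoothKernel (timeEmb (tupleEmb 𝔄 1)) fun z : (Fin 1 → Gr 𝔄) × Set.Icc (0 : ℝ) 1 =>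
      (z.1 0).dop := (smoothVia_coord 0).base.dop
  obtain ⟨F, hF, hF'⟩ := hJ.exists_gr hD fun z => (z.1 0).top_mul_top
  exact ⟨F, hF.isSmoothHomotopy, fun z => hF' z⟩

theorem exists_infinite_stab : ∃ Hv : RapidMat ℕ 𝔄 × Set.Icc (0 : ℝ) 1 → RapidMat ℕ 𝔄,
      IsStabilizingHomotopy zero_le_one (fun n => 2 * n) Hv ∧
      ∃ F : (Fin 1 → Gr 𝔄) × Set.Icc (0 : ℝ) 1 → Gr 𝔄, IsSmoothHomotopy F ∧
        (∀ b t (i j : Fin 2) (B : RapidMat ℕ 𝔄),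
          (∀ m n, B.toMatrix m n = (b 0).1.toMatrix (i, m) (j, n)) →
          ∀ m n, (F (b, t)).1.toMatrix (i, m) (j, n) = (Hv (B, t)).toMatrix m n) ∧
        (∀ b, F (b, ⟨0, by simp⟩) = b 0) ∧
        ∀ b, (F (b, ⟨1, by simp⟩)).mat = (b 0).stabMat := by
  obtain ⟨Hv, hHv, hHv'⟩ := exists_stab_homotopy (𝔄 := 𝔄)
  obtain ⟨F, hF, hF'⟩ := exists_gr_stab_homotopy (𝔄 := 𝔄)
  refine ⟨Hv, hHv, F, hF, fun b t i j B hB m n => ?_, fun b => Gr.dop_injective ?_,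
    fun b => Gr.mat_eq_stabMat ?_⟩
  -- The compressions to blocks commute with the rotations, which transfers the formula for `Hv` to
  -- each block of the difference.
  · have h1 : op (RapidMat.toFunL B) =
        pullOp (.pair i) ∘L (b 0).dop ∘L relOp (.pair j) := op_ext fun m n => by
      rw [op_single, RapidMat.toFunL_apply, hB, ContinuousLinearMap.comp_apply,
        ContinuousLinearMap.comp_apply, relOp_single, pullOp_apply, Gr.dop, op_single]
      rfl
    have h2 : op (RapidMat.toFunL (Hv (B, t))) =
        pullOp (.pair i) ∘L (F (b, t)).dop ∘L relOp (.pair j) := by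
      rw [hHv', h1, hF']
      have e1 := fun f => congrArg (fun T : Opr 𝔄 BlockIdx ℕ => T f) (pullOp_pair_comp_stabOp t i)
      have e2 := fun f => congrArg (fun T : Opr 𝔄 ℕ BlockIdx => T f) (stabOpT_comp_relOp_pair t j)
      refine ContinuousLinearMap.ext fun f => ?_
      simp only [ContinuousLinearMap.comp_apply] at e1 e2 ⊢
      rw [e1, e2]
    have h3 := congrArg (fun T : Opr 𝔄 ℕ ℕ => T (single n) m) h2
    simp only [ContinuousLinearMap.comp_apply, relOp_single, pullOp_apply, Gr.dop, op_single] at h3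
    exact (Unitization.inr_injective h3).symm
  · rw [hF']
    change stabOp isTempered_doubleMap 0 ∘L _ ∘L stabOpT isTempered_doubleMap 0 = _
    rw [stabOp_zero, stabOpT_zero]
    rfl
  · rw [hF']
    change stabOp isTempered_doubleMap 1 ∘L _ ∘L stabOpT isTempered_doubleMap 1 = _
    rw [stabOp_one, stabOpT_one]

end Grassmannian

end InfiniteStabilization

theorem mainTheorem2 {𝔄 : Type*} [NonUnitalCommRing 𝔄] [Module ℝ 𝔄] [IsScalarTower ℝ 𝔄 𝔄]
    [SMulCommClass ℝ 𝔄 𝔄] [UniformSpace 𝔄] [IsUniformAddGroup 𝔄] [IsTopologicalRing 𝔄]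
    [ContinuousSMul ℝ 𝔄] [LocallyConvexSpace ℝ 𝔄] [T2Space 𝔄]
    (hcomplete : ∀ a : ℕ → 𝔄, CauchySeq a → ∃ l, Tendsto a atTop (𝓝 l)) :
    -- the H-ring structure, for all choices of the relabeling maps and of the product operation
    (∀ (θ₁ : (Fin 2 × ℕ) ⊕ (Fin 2 × ℕ) → ℕ) (θ₂ : Fin 2 × ℕ → ℕ)
      (θ₃ : (Fin 2 × ℕ) × (Fin 2 × ℕ) → ℕ) (θ₄ : Fin 1 → ℕ) (side : ProductSide),
      IsRelabeling θ₁ → IsRelabeling θ₂ → IsRelabeling θ₃ → IsRelabeling θ₄ →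
      ∃ (add mul : Gr 𝔄 → Gr 𝔄 → Gr 𝔄) (neg : Gr 𝔄 → Gr 𝔄) (zero : Gr 𝔄),
        (∀ a b, (add a b).mat = regRelabel θ₁ (pairSum a.pair b.pair)) ∧
        (∀ a, (neg a).mat = regRelabel θ₂ (pairInv a.pair)) ∧
        zero.mat = baseMat (Unitization ℝ 𝔄) ℕ ∧
        (∀ a b, (mul a b).mat = regRelabel θ₃ (pairProd side a.pair b.pair)) ∧
        IsCommSmoothHRing add mul neg zero ∧
        -- the multiplicative unit, if `𝔄` has a unit element `e`
        ∀ e : 𝔄, (∀ x, e * x = x) → ∃ one : Gr 𝔄,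
          one.mat = regRelabel θ₄ (pairOne (e : Unitization ℝ 𝔄)) ∧ IsSmoothHUnit mul one) ∧
    -- stabilization by one position through the matrices `C(θ)`
    (∃ T : RapidMat ℕ 𝔄 × Set.Icc (0 : ℝ) (Real.pi / 2) → RapidMat ℕ 𝔄,
      (∀ (A : RapidMat ℕ 𝔄) (θ : Set.Icc (0 : ℝ) (Real.pi / 2)) (m n : ℕ), HasSum (fun x : ℕ × ℕ =>
          (rotMat θ m x.1 * rotMat θ n x.2) • A.toMatrix x.1 x.2) ((T (A, θ)).toMatrix m n)) ∧
      IsStabilizingHomotopy (by positivity) (fun n => n + 1) T) ∧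
    -- infinite stabilization inside the matrix algebra, and inside the Grassmannian
    (∃ Hv : RapidMat ℕ 𝔄 × Set.Icc (0 : ℝ) 1 → RapidMat ℕ 𝔄,
      IsStabilizingHomotopy zero_le_one (fun n => 2 * n) Hv ∧
      ∃ F : (Fin 1 → Gr 𝔄) × Set.Icc (0 : ℝ) 1 → Gr 𝔄, IsSmoothHomotopy F ∧
        (∀ b t (i j : Fin 2) (B : RapidMat ℕ 𝔄),
          (∀ m n, B.toMatrix m n = (b 0).1.toMatrix (i, m) (j, n)) →
          ∀ m n, (F (b, t)).1.toMatrix (i, m) (j, n) = (Hv (B, t)).toMatrix m n) ∧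
        (∀ b, F (b, ⟨0, by simp⟩) = b 0) ∧
        ∀ b, (F (b, ⟨1, by simp⟩)).mat = (b 0).stabMat) := by
  -- Local convexity supplies the seminorms, and sequential completeness the summation of absolutely
  -- convergent series.
  have : PolynormableSpace ℝ 𝔄 := inferInstance
  have : AbsSummableSpace 𝔄 := .of_seqComplete hcomplete
  exact ⟨fun θ₁ θ₂ θ₃ θ₄ side h₁ h₂ h₃ h₄ => exists_isCommSmoothHRing side h₁.isTempered
    h₂.isTempered h₃.isTempered h₄.isTempered, exists_rot_homotopy _, exists_infinite_stab⟩
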